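/- Let $m\geqslant 2$ and $N\geqslant 0$ be integers, let $\kappa\in\mathbb C$ and $\ell=\kappa-m$. **Lie algebras.** $\widehat{\mathfrak{gl}}_m=\mathfrak{gl}_m[t,t^{-1}]\oplus\mathbb C\,C$ has $C$ central and $[E_{ab}t^i,E_{cd}t^j]=(\delta_{bc}E_{ad}-\delta_{da}E_{cb})t^{i+j}+i\,\delta_{i,-j}\delta_{bc}\delta_{da}C$. Put $\widehat{\mathfrak{sl}}_m=\mathfrak{sl}_m[t,t^{-1}]\oplus\mathbb C\,C$ and $\widehat{\mathfrak h}=\mathfrak h\oplus\mathbb C\,C$, where $\mathfrak h$ is the space of traceless diagonal matrices. Put $\widehat{\mathfrak n}=\mathfrak n\oplus t^{-1}\mathfrak{sl}_m[t^{-1}]$ and $\widehat{\mathfrak n}'=\mathfrak n'\oplus t\,\mathfrak{sl}_m[t]$, where $\mathfrak n$ (resp. $\mathfrak n'$) is spanned by the $E_{ab}$ with $a>b$ (resp. $a<b$). Let $E_0=E_{m1}t$, $F_0=E_{1m}t^{-1}$, $H_0=C-E_{11}+E_{mm}$, $\varepsilon_0=E_{mm}^*-E_{11}^*$, and for $1\leqslant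 c<m$ let $E_c=E_{c,c+1}$, $F_c=E_{c+1,c}$, $H_c=E_{cc}-E_{c+1,c+1}$, $\varepsilon_c=E_{cc}^*-E_{c+1,c+1}^*$. The functionals $\varepsilon_c$ on $\widehat{\mathfrak h}$ vanish at $C$. **Rings of fractions.** Let $\bar{\mathrm U}(\widehat{\mathfrak h})$ and $\bar{\mathrm U}=\bar{\mathrm U}(\widehat{\mathfrak{sl}}_m)$ be the rings of fractions of $\mathrm U(\widehat{\mathfrak h})$ and $\mathrm U(\widehat{\mathfrak{sl}}_m)$ with the set of denominators generated by the elements $E_{aa}-E_{bb}+iC+j$ with $1\leqslant a<b\leqslant m$ and $i,j\in\mathbb Z$. **The bimodule.** Let $\mathfrak P_N=\mathbb C[x_1^{\pm1},\dots,x_N^{\pm1}]$. Identify $\mathfrak P_N\otimes(\mathbb C^m)^{\otimes N}$ with $(\mathbb C^m[t,t^{-1}])^{\otimes N}$, an $\widehat{\mathfrak{sl}}_m$-module of level zero: $E_{cd}t^j$ acts by $\sum_q x_q^j\otimes E_{cd}^{(q)}$. Put $\mathrm B=\mathfrak P_N\otimes(\mathbb C^m)^{\otimes N}\otimes\mathrm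 U(\widehat{\mathfrak{sl}}_m)$ and $\bar{\mathrm B}=\mathfrak P_N\otimes(\mathbb C^m)^{\otimes N}\otimes\bar{\mathrm U}$. On both, $\widehat{\mathfrak{sl}}_m$ acts from the left diagonally, and from the right by right multiplication in the last factor; on $\bar{\mathrm B}$ these actions extend to $\bar{\mathrm U}$. Put $\mathrm{ad}_X(Y)=XY-YX$ and $\bar{\mathrm J}=\widehat{\mathfrak n}\,\bar{\mathrm B}$, $\bar{\mathrm J}'=\bar{\mathrm B}\,\widehat{\mathfrak n}'$, $\bar{\mathrm I}=\bar{\mathrm B}\,(C-\ell)$. **The operators.** Let $c\in\{0,1,\dots,m-1\}$. For $c>0$ let $\tau_c$ be the transposition of $c,c+1$, acting on $\widehat{\mathfrak{gl}}_m$ by $E_{ab}t^i\mapsto E_{\tau_c(a)\tau_c(b)}t^i$ and on $\mathbb C^m[t,t^{-1}]$ by $e_at^i\mapsto e_{\tau_c(a)}t^i$. For $c=0$ let $\tau_0$ be the transposition of $1,m$, acting by $E_{ab}t^i\mapsto E_{\tau_0(a)\tau_0(b)}\,t^{\,i+\delta_{a1}-\delta_{am}-\delta_{b1}+\delta_{bm}}+\delta_{i0}\delta_{ab}(\delta_{a1}-\delta_{am})C$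 and by $e_at^i\mapsto e_{\tau_0(a)}t^{\,i+\delta_{a1}-\delta_{am}}$. In all cases $\tau_c(C)=C$. These actions induce an action of $\tau_c$ on $\bar{\mathrm B}$. Define $\xi_c:\mathrm B\to\bar{\mathrm B}$ by $$\xi_c(Y)=Y+\sum_{n\geqslant1}\bigl(n!\,H_c(H_c-1)\cdots(H_c-n+1)\bigr)^{-1}E_c^{\,n}\,\mathrm{ad}_{F_c}^{\,n}(Y),$$ where only finitely many terms are non-zero for each $Y$. Define $\bar\xi_c:\bar{\mathrm B}\to\bar{\mathrm B}/\bar{\mathrm J}$ by $\bar\xi_c(YA)=\xi_c(Y)Z+\bar{\mathrm J}$ for $Y\in\mathrm B$ and $A\in\bar{\mathrm U}(\widehat{\mathfrak h})$, where $Z$ is obtained from $A$, regarded as a rational function on $\widehat{\mathfrak h}^*$, by adding $\varepsilon_c$ to the argument. The Zhelobenko operator is the linear map $\eta_c:\bar{\mathrm B}/\bar{\mathrm J}\to\bar{\mathrm B}/\bar{\mathrm J}$ with $\eta_c(y+\bar{\mathrm J})=\bar\xi_c(\tau_c(y))$. **The Cherednik algebra.** Let $\mathfrak C_N$ be the complex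 associative algebra generated by the group algebra $\mathbb C\,\mathfrak S_N$, by pairwise commuting $u_1,\dots,u_N$ and by $\mathfrak P_N$, subject to the following relations, where $\sigma_{pq}$ is the transposition of $p,q$, $\sigma_p=\sigma_{p,p+1}$ and $z_p=u_p-\sum_{q<p}\sigma_{qp}$: $\sigma_pu_q=u_q\sigma_p$ for $q\neq p,p+1$; $\sigma_pu_p=u_{p+1}\sigma_p-1$; $\sigma x_p\sigma^{-1}=x_{\sigma(p)}$ for $\sigma\in\mathfrak S_N$; $[z_p,x_q]=-x_p\sigma_{pq}$ for $q\neq p$; $[z_p,x_p]=\kappa x_p+\sum_{r\neq p}x_p\sigma_{pr}$. **The action.** Let $V$ be the universal Verma module of level $\ell$ over $\bar{\mathrm U}$, that is the quotient of $\bar{\mathrm U}$ by the left ideal generated by $\widehat{\mathfrak n}'$ and $C-\ell$, and let $W=\mathfrak P_N\otimes(\mathbb C^m)^{\otimes N}\otimes V$ with the diagonal action of $\widehat{\mathfrak{sl}}_m$. Let $\mathfrak C_N$ act on $W$ so that $x_p^{\pm1}$ acts by multiplication, $\mathfrak S_N$ by simultaneous permutations of the variables and of the $N$ factors $\mathbb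 C^m$, and $z_p$ as $$\kappa\,x_p\partial_p\otimes\mathrm{id}\otimes\mathrm{id}+\sum_{r\neq p}\frac{x_p}{x_p-x_r}(1-\sigma_{pr})\otimes\sigma_{pr}\otimes\mathrm{id}+\sum_{i\geqslant0}x_p^{-i}\otimes\Bigl(\sum_{a,b=1}^mE_{ab}^{(p)}\otimes E_{ba}t^i-\tfrac1m\,\mathrm{id}\otimes I\,t^i\Bigr),\qquad I=\sum_aE_{aa}$$ (the operator in the brackets being understood as $\sum_{a,b}E_{ab}^{(p)}\otimes(E_{ba}-\tfrac{\delta_{ab}}m I)t^i$, so that only the action of $\widehat{\mathfrak{sl}}_m$ on $V$ is used). **Theorem.** Let $c\in\{0,1,\dots,m-1\}$. 1. The Zhelobenko operator $\eta_c$ is well defined (and uniquely determined) by the above, and it determines a linear map $T:\bar{\mathrm B}/(\bar{\mathrm J}+\bar{\mathrm J}'+\bar{\mathrm I})\to\bar{\mathrm B}/(\bar{\mathrm J}+\bar{\mathrm J}'+\bar{\mathrm I})$. 2. The action of $\mathfrak C_N$ on $W$ is well defined and unique. The projection $\bar{\mathrm U}\to V$ induces a linear isomorphism of $\bar{\mathrm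 B}/(\bar{\mathrm J}+\bar{\mathrm J}'+\bar{\mathrm I})$ onto the space $W/\widehat{\mathfrak n}W$ of $\widehat{\mathfrak n}$-coinvariants. The action of $\mathfrak C_N$ descends from $W$ to $W/\widehat{\mathfrak n}W$, and hence gives an action of $\mathfrak C_N$ on $\bar{\mathrm B}/(\bar{\mathrm J}+\bar{\mathrm J}'+\bar{\mathrm I})$. 3. The linear map $T$ commutes with this action of $\mathfrak C_N$. -/

import Mathlib

open scoped TensorProduct LaurentPolynomial
open Filter

noncomputable section

namespace Zhel

attribute [local instance 100] LieRing.ofAssociativeRing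

/-! ### The affine Lie algebras -/

/-- The operator `t d/dt` on Laurent polynomials. -/
def euler : ℂ[T;T⁻¹] →ₗ[ℂ] ℂ[T;T⁻¹] where
  toFun f := .ofCoeff (Finsupp.onFinset f.coeff.support (fun n => (n : ℂ) * f.coeff n)
    (fun n hn => by
      rw [Finsupp.mem_support_iff]
      exact fun h => hn (by rw [h, mul_zero])))
  map_add' f g := by
    ext n
    simp [mul_add]
  map_smul' z f := by
    ext n
    simp [mul_left_comm]

theorem coeff_euler (f : ℂ[T;T⁻¹]) (n : ℤ) : (euler f).coeff n = (n : ℂ) * f.coeff n := by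
  simp [euler]

theorem euler_single (n : ℤ) (z : ℂ) :
    euler (AddMonoidAlgebra.single n z) = AddMonoidAlgebra.single n ((n : ℂ) * z) := by
  ext k
  rw [coeff_euler]
  by_cases h : n = k
  · subst h; simp [-LaurentPolynomial.single_eq_C_mul_T]
  · simp [-LaurentPolynomial.single_eq_C_mul_T, h]

theorem euler_mul (f g : ℂ[T;T⁻¹]) : euler (f * g) = euler f * g + f * euler g := by
  induction f using LaurentPolynomial.induction_on' with
  | add p q hp hq => simp only [add_mul, map_add, hp, hq]; ring
  | C_mul_T k a =>
    induction g using LaurentPolynomial.induction_on' with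
    | add p q hp hq => simp only [mul_add, map_add, hp, hq]; ring
    | C_mul_T l b =>
      simp only [← LaurentPolynomial.single_eq_C_mul_T, AddMonoidAlgebra.single_mul_single,
        euler_single]
      rw [← AddMonoidAlgebra.single_add]
      congr 1
      push_cast
      ring

/-- The constant term of the trace of a matrix of Laurent polynomials. -/
def trace0 (m : ℕ) : Matrix (Fin m) (Fin m) ℂ[T;T⁻¹] →ₗ[ℂ] ℂ where
  toFun A := A.trace.coeff 0
  map_add' A B := by simp [Matrix.trace_add]
  map_smul' z A := by simp [Matrix.trace_smul]

theorem trace0_mul_comm {m : ℕ} (A B : Matrix (Fin m) (Fin m) ℂ[T;T⁻¹]) :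
    trace0 m (A * B) = trace0 m (B * A) := by
  change (A * B).trace.coeff 0 = (B * A).trace.coeff 0
  rw [Matrix.trace_mul_comm]

/-- `t d/dt` applied to every entry of a matrix. -/
def eulerMat (m : ℕ) : Matrix (Fin m) (Fin m) ℂ[T;T⁻¹] →ₗ[ℂ] Matrix (Fin m) (Fin m) ℂ[T;T⁻¹] :=
  euler.mapMatrix

theorem eulerMat_mul {m : ℕ} (A B : Matrix (Fin m) (Fin m) ℂ[T;T⁻¹]) :
    eulerMat m (A * B) = eulerMat m A * B + A * eulerMat m B := by
  ext1 i j
  simp only [eulerMat, LinearMap.mapMatrix_apply, Matrix.map_apply, Matrix.mul_apply,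
    Matrix.add_apply, map_sum, euler_mul, Finset.sum_add_distrib]

theorem trace0_eulerMat {m : ℕ} (A : Matrix (Fin m) (Fin m) ℂ[T;T⁻¹]) :
    trace0 m (eulerMat m A) = 0 := by
  simp [trace0, eulerMat, Matrix.trace, AddMonoidAlgebra.coeff_sum, coeff_euler]

/-- The underlying space of the affine Lie algebra `𝔤𝔩ₘ[t, t⁻¹] ⊕ ℂ C`: a pair `(A, z)` stands
for `A + z C`. -/
def AffineGL (m : ℕ) : Type := Matrix (Fin m) (Fin m) ℂ[T;T⁻¹] × ℂ

namespace AffineGL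

instance (m : ℕ) : AddCommGroup (AffineGL m) :=
  inferInstanceAs (AddCommGroup (Matrix (Fin m) (Fin m) ℂ[T;T⁻¹] × ℂ))

instance (m : ℕ) : Module ℂ (AffineGL m) :=
  inferInstanceAs (Module ℂ (Matrix (Fin m) (Fin m) ℂ[T;T⁻¹] × ℂ))

/-- The current part of an element. -/
def mat {m : ℕ} : AffineGL m →ₗ[ℂ] Matrix (Fin m) (Fin m) ℂ[T;T⁻¹] := LinearMap.fst ℂ _ _

/-- The coefficient at the central element `C`. -/
def cen {m : ℕ} : AffineGL m →ₗ[ℂ] ℂ := LinearMap.snd ℂ _ _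

/-- The element with given current and central parts. -/
def mk {m : ℕ} (A : Matrix (Fin m) (Fin m) ℂ[T;T⁻¹]) (z : ℂ) : AffineGL m := (A, z)

@[simp] theorem mat_mk {m : ℕ} (A : Matrix (Fin m) (Fin m) ℂ[T;T⁻¹]) (z : ℂ) :
    (mk A z).mat = A := rfl

@[simp] theorem cen_mk {m : ℕ} (A : Matrix (Fin m) (Fin m) ℂ[T;T⁻¹]) (z : ℂ) :
    (mk A z).cen = z := rfl

@[ext] theorem ext {m : ℕ} {X Y : AffineGL m} (h₁ : X.mat = Y.mat) (h₂ : X.cen = Y.cen) :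
    X = Y := Prod.ext h₁ h₂

/-- The bracket: the pointwise commutator of currents, together with the cocycle
`(A, B) ↦ Res tr (dA · B)`, so that
`[E_ab tⁱ, E_cd tʲ] = (δ_bc E_ad - δ_da E_cb) tⁱ⁺ʲ + i δ_{i,-j} δ_bc δ_da C`. -/
instance (m : ℕ) : Bracket (AffineGL m) (AffineGL m) where
  bracket X Y := mk (X.mat * Y.mat - Y.mat * X.mat) (trace0 m (eulerMat m X.mat * Y.mat))

@[simp] theorem mat_lie {m : ℕ} (X Y : AffineGL m) :
    mat ⁅X, Y⁆ = X.mat * Y.mat - Y.mat * X.mat := rfl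

@[simp] theorem cen_lie {m : ℕ} (X Y : AffineGL m) :
    cen ⁅X, Y⁆ = trace0 m (eulerMat m X.mat * Y.mat) := rfl

instance (m : ℕ) : LieRing (AffineGL m) where
  add_lie X Y Z := by
    ext1
    · simp only [mat_lie, map_add, add_mul, mul_add]; abel
    · simp only [cen_lie, map_add, add_mul]
  lie_add X Y Z := by
    ext1
    · simp only [mat_lie, map_add, add_mul, mul_add]; abel
    · simp only [cen_lie, map_add, mul_add]
  lie_self X := by
    ext1
    · simp
    · have h := trace0_eulerMat (X.mat * X.mat)
      rw [eulerMat_mul, map_add, trace0_mul_comm X.mat] at h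
      simpa using h
  leibniz_lie X Y Z := by
    ext1
    · simp only [mat_lie, map_add]; noncomm_ring
    · simp only [mat_lie, cen_lie, map_add, map_sub, eulerMat_mul, mul_sub, add_mul, sub_mul]
      have cyc : ∀ A B C : Matrix (Fin m) (Fin m) ℂ[T;T⁻¹],
          trace0 m (A * B * C) = trace0 m (B * C * A) := fun A B C => by
        rw [mul_assoc, trace0_mul_comm]
      have h1 := cyc X.mat (eulerMat m Y.mat) Z.mat
      have h2 := cyc Y.mat (eulerMat m X.mat) Z.mat
      simp only [← mul_assoc]
      linear_combination h2 - h1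

instance (m : ℕ) : LieAlgebra ℂ (AffineGL m) where
  lie_smul z X Y := by
    ext1
    · simp [smul_sub]
    · simp

/-- The element `E_ab tⁱ`. -/
def E {m : ℕ} (a b : Fin m) (i : ℤ) : AffineGL m :=
  mk (Matrix.single a b (LaurentPolynomial.T i)) 0

/-- The central element `C`. -/
def C (m : ℕ) : AffineGL m := mk 0 1

end AffineGL

/-- The affine Lie algebra `𝔰𝔩ₘ[t, t⁻¹] ⊕ ℂ C`. -/
def affineSL (m : ℕ) : LieSubalgebra ℂ (AffineGL m) where
  carrier := {X | X.mat.trace = 0}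
  add_mem' {X Y} hX hY := by
    change X.mat.trace = 0 at hX
    change Y.mat.trace = 0 at hY
    change (X + Y).mat.trace = 0
    rw [map_add, Matrix.trace_add, hX, hY, add_zero]
  zero_mem' := by simp
  smul_mem' z X hX := by
    change X.mat.trace = 0 at hX
    change (z • X).mat.trace = 0
    rw [map_smul, Matrix.trace_smul, hX, smul_zero]
  lie_mem' {X Y} _ _ := by
    change (X.mat * Y.mat - Y.mat * X.mat).trace = 0
    rw [Matrix.trace_sub, Matrix.trace_mul_comm, sub_self]

theorem mem_affineSL {m : ℕ} {X : AffineGL m} : X ∈ affineSL m ↔ X.mat.trace = 0 := Iff.rfl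

/-- The central element `C` of `𝔰𝔩̂ₘ`. -/
def slC (m : ℕ) : affineSL m := ⟨AffineGL.C m, by simp [mem_affineSL, AffineGL.C]⟩

/-- The element `(E_ab - δ_ab I / m) tⁱ` of `𝔰𝔩ₘ[t, t⁻¹]`, where `I = E_11 + ⋯ + E_mm`.
For `a ≠ b` this is `E_ab tⁱ`. -/
def slE {m : ℕ} [NeZero m] (a b : Fin m) (i : ℤ) : affineSL m :=
  ⟨AffineGL.E a b i -
      (if a = b then (m : ℂ)⁻¹ else 0) • ∑ d : Fin m, AffineGL.E d d i, by
    have hm : (m : ℂ) ≠ 0 := NeZero.ne _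
    rw [mem_affineSL]
    by_cases h : a = b
    · subst h
      simp [AffineGL.E, Matrix.trace_sub, Matrix.trace_smul, Matrix.trace_sum]
      rw [← nsmul_eq_mul, ← Nat.cast_smul_eq_nsmul ℂ, smul_smul, inv_mul_cancel₀ hm, one_smul,
        sub_self]
    · simp [AffineGL.E, h]⟩

/-- The element `E_aa - E_bb` of `𝔰𝔩ₘ`. -/
def slH {m : ℕ} (a b : Fin m) : affineSL m :=
  ⟨AffineGL.E a a 0 - AffineGL.E b b 0, by simp [mem_affineSL, AffineGL.E, Matrix.trace_sub]⟩

/-- The Cartan subalgebra `𝔥̂ = 𝔥 ⊕ ℂ C`: constant diagonal matrices of trace zero, plus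
multiples of `C`. -/
def hhat (m : ℕ) : LieSubalgebra ℂ (affineSL m) where
  carrier := {X | ∃ f : Fin m → ℂ, X.1.mat = Matrix.diagonal fun a => LaurentPolynomial.C (f a)}
  add_mem' := by
    rintro X Y ⟨f, hf⟩ ⟨g, hg⟩
    refine ⟨f + g, ?_⟩
    change X.1.mat + Y.1.mat = _
    rw [hf, hg, Matrix.diagonal_add]
    simp
  zero_mem' := ⟨0, by simp⟩
  smul_mem' := by
    rintro z X ⟨f, hf⟩
    refine ⟨z • f, ?_⟩
    change z • X.1.mat = _
    rw [hf, ← Matrix.diagonal_smul]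
    congr 1
    funext a
    simp [LaurentPolynomial.smul_eq_C_mul]
  lie_mem' := by
    rintro X Y ⟨f, hf⟩ ⟨g, hg⟩
    refine ⟨0, ?_⟩
    change X.1.mat * Y.1.mat - Y.1.mat * X.1.mat = _
    rw [hf, hg, Matrix.diagonal_mul_diagonal, Matrix.diagonal_mul_diagonal]
    simp [mul_comm]

theorem lie_hhat {m : ℕ} (X Y : hhat m) : ⁅X, Y⁆ = 0 := by
  obtain ⟨X, f, hf⟩ := X
  obtain ⟨Y, g, hg⟩ := Y
  apply Subtype.ext
  apply Subtype.ext
  change ⁅X.1, Y.1⁆ = 0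
  ext1
  · change X.1.mat * Y.1.mat - Y.1.mat * X.1.mat = 0
    rw [hf, hg, Matrix.diagonal_mul_diagonal, Matrix.diagonal_mul_diagonal]
    simp [mul_comm]
  · change trace0 m (eulerMat m X.1.mat * Y.1.mat) = 0
    have : eulerMat m X.1.mat = 0 := by
      rw [hf]
      ext a b n
      simp only [eulerMat, LinearMap.mapMatrix_apply, Matrix.map_apply, Matrix.diagonal_apply,
        coeff_euler]
      split_ifs
      · simp only [LaurentPolynomial.C_apply]
        split_ifs with h <;> simp [h]
      · simp
    rw [this, zero_mul, map_zero]

/-- The diagonal coordinate functional `E_aa^*` on `𝔥̂`. -/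
def diagCoord {m : ℕ} (a : Fin m) : hhat m →ₗ[ℂ] ℂ where
  toFun X := (X.1.1.mat a a).coeff 0
  map_add' X Y := by
    change ((X.1.1.mat + Y.1.1.mat) a a).coeff 0 = _
    simp
  map_smul' z X := by
    change ((z • X.1.1.mat) a a).coeff 0 = _
    simp

theorem hElem_aux {m : ℕ} (a b : Fin m) (i : ℤ) :
    (slH a b + (i : ℂ) • slC m).1.mat = Matrix.diagonal fun d =>
      LaurentPolynomial.C ((if d = a then 1 else 0) - (if d = b then 1 else 0)) := by
  change (Matrix.single a a (LaurentPolynomial.T 0) - Matrix.single b b (LaurentPolynomial.T 0))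
    + (i : ℂ) • (0 : Matrix (Fin m) (Fin m) ℂ[T;T⁻¹]) = _
  ext1 x y
  simp only [LaurentPolynomial.T_zero, smul_zero, add_zero, Matrix.sub_apply, Matrix.single_apply,
    Matrix.diagonal_apply, map_sub]
  by_cases h : x = y
  · subst h
    simp only [eq_comm (a := x), and_self]
    split_ifs <;> simp
  · rw [if_neg, if_neg, if_neg h, sub_zero] <;> grind

/-- The element `E_aa - E_bb + i C` of `𝔥̂`. -/
def hElem {m : ℕ} (a b : Fin m) (i : ℤ) : hhat m :=
  ⟨slH a b + (i : ℂ) • slC m, _, hElem_aux a b i⟩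

/-- The subalgebra `𝔫̂ = 𝔫 ⊕ t⁻¹ 𝔰𝔩ₘ[t⁻¹]`, where `𝔫` is spanned by the `E_ab` with `a > b`. -/
def nhat (m : ℕ) : Set (affineSL m) :=
  {X | X.1.cen = 0 ∧ ∀ a b, ∀ j ∈ (X.1.mat a b).coeff.support, j < 0 ∨ (j = 0 ∧ b < a)}

/-- The subalgebra `𝔫̂' = 𝔫' ⊕ t 𝔰𝔩ₘ[t]`, where `𝔫'` is spanned by the `E_ab` with `a < b`. -/
def nhat' (m : ℕ) : Set (affineSL m) :=
  {X | X.1.cen = 0 ∧ ∀ a b, ∀ j ∈ (X.1.mat a b).coeff.support, 0 < j ∨ (j = 0 ∧ a < b)}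

/-! ### The enveloping algebra and its ring of fractions -/

/-- The universal enveloping algebra `U(𝔰𝔩̂ₘ)`. -/
abbrev U (m : ℕ) : Type := UniversalEnvelopingAlgebra ℂ (affineSL m)

/-- The universal enveloping algebra `U(𝔥̂)`. -/
abbrev Uh (m : ℕ) : Type := UniversalEnvelopingAlgebra ℂ (hhat m)

theorem adjoin_range_uea {L : Type} [LieRing L] [LieAlgebra ℂ L] :
    Algebra.adjoin ℂ (Set.range (UniversalEnvelopingAlgebra.ι ℂ (L := L))) = ⊤ := by
  set B := Algebra.adjoin ℂ (Set.range (UniversalEnvelopingAlgebra.ι ℂ (L := L)))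
  let f : L →ₗ⁅ℂ⁆ B :=
    { toFun := fun x => ⟨UniversalEnvelopingAlgebra.ι ℂ x, Algebra.subset_adjoin ⟨x, rfl⟩⟩
      map_add' := fun x y => by ext; simp only [map_add]; rfl
      map_smul' := fun z x => by ext; simp only [map_smul]; rfl
      map_lie' := fun {x y} => by ext; simp only [LieHom.map_lie]; rfl }
  have h : B.val.comp (UniversalEnvelopingAlgebra.lift ℂ f) = AlgHom.id ℂ _ := by
    apply UniversalEnvelopingAlgebra.hom_ext
    ext x
    change B.val (UniversalEnvelopingAlgebra.lift ℂ f (UniversalEnvelopingAlgebra.ι ℂ x)) = _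
    rw [UniversalEnvelopingAlgebra.lift_ι_apply]
    rfl
  rw [eq_top_iff]
  intro x _
  have := congrArg (fun g => g x) h
  change B.val (UniversalEnvelopingAlgebra.lift ℂ f x) = x at this
  rw [← this]
  exact Subtype.property _

instance (m : ℕ) : CommRing (Uh m) :=
  { (inferInstance : Ring (Uh m)) with
    mul_comm := fun x y => by
      have hc : ∀ a ∈ Set.range (UniversalEnvelopingAlgebra.ι ℂ (L := hhat m)),
          ∀ b ∈ Set.range (UniversalEnvelopingAlgebra.ι ℂ (L := hhat m)), a * b = b * a := by
        rintro _ ⟨a, rfl⟩ _ ⟨b, rfl⟩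
        have h := LieHom.map_lie (UniversalEnvelopingAlgebra.ι ℂ (L := hhat m)) a b
        rw [lie_hhat, map_zero, LieRing.of_associative_ring_bracket] at h
        exact (sub_eq_zero.mp h.symm)
      have hmem : ∀ z : Uh m, z ∈ Algebra.adjoin ℂ
          (Set.range (UniversalEnvelopingAlgebra.ι ℂ (L := hhat m))) := fun z => by
        rw [adjoin_range_uea]
        exact Algebra.mem_top
      exact Algebra.commute_of_mem_adjoin_of_forall_mem_commute (hmem y) fun b hb =>
        (Algebra.commute_of_mem_adjoin_of_forall_mem_commute (hmem x)
          fun a ha => hc b hb a ha).symm }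

/-- The homomorphism `U(𝔥̂) → U(𝔰𝔩̂ₘ)` given by the inclusion `𝔥̂ ⊂ 𝔰𝔩̂ₘ`. -/
def UhToU (m : ℕ) : Uh m →ₐ[ℂ] U m :=
  UniversalEnvelopingAlgebra.lift ℂ ((UniversalEnvelopingAlgebra.ι ℂ).comp (hhat m).incl)

/-- The elements `E_aa - E_bb + i C + j` of `U(𝔥̂)`, where `a ≠ b` and `i, j ∈ ℤ`. (Including both
orders of `a` and `b` changes them by signs only.) -/
def denomGen (m : ℕ) : Set (Uh m) :=
  {d | ∃ (a b : Fin m) (i j : ℤ), a ≠ b ∧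
    d = UniversalEnvelopingAlgebra.ι ℂ (hElem a b i) + algebraMap ℂ (Uh m) j}

/-- The multiplicative set of denominators in `U(𝔥̂)`. -/
def Sh (m : ℕ) : Submonoid (Uh m) := Submonoid.closure (denomGen m)

/-- The multiplicative set of denominators in `U(𝔰𝔩̂ₘ)`: the image of the one in `U(𝔥̂)`. -/
def S (m : ℕ) : Submonoid (U m) := (Sh m).map (UhToU m)

/-- An elementary criterion for a multiplicative set to be a left Ore set. -/
theorem oreSet_of_weights {A : Type} [Ring A] [Algebra ℂ A] (D G : Set A)
    (hG : Algebra.adjoin ℂ G = ⊤)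
    (hcomm : ∀ d ∈ D, ∀ e ∈ D, d * e = e * d)
    (hshift : ∀ d ∈ D, ∀ k : ℤ, d + algebraMap ℂ A k ∈ D)
    (hw : ∀ g ∈ G, ∀ d ∈ D, ∃ k : ℤ, (d + algebraMap ℂ A k) * g = g * d) :
    Nonempty (OreLocalization.OreSet (Submonoid.closure D)) := by
  set S := Submonoid.closure D
  -- the left Ore condition
  have hScomm : ∀ s ∈ S, ∀ t ∈ S, s * t = t * s := by
    intro s hs t ht
    have h1 : ∀ d ∈ D, Commute d t := fun d hd => by
      induction ht using Submonoid.closure_induction with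
      | mem e he => exact hcomm d hd e he
      | one => exact Commute.one_right d
      | mul x y _ _ hx hy => exact hx.mul_right hy
    induction hs using Submonoid.closure_induction with
    | mem e he => exact h1 e he
    | one => exact Commute.one_left t
    | mul x y _ _ hx hy => exact Commute.mul_left hx hy
  have hore : ∀ r : A, ∀ s ∈ S, ∃ r' : A, ∃ s' ∈ S, s' * r = r' * s := by
    intro r
    have hr : r ∈ Algebra.adjoin ℂ G := hG ▸ Algebra.mem_top
    induction hr using Algebra.adjoin_induction with
    | mem g hg =>
      intro s hs
      refine ⟨g, ?_⟩
      induction hs using Submonoid.closure_induction with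
      | mem d hd =>
        obtain ⟨k, hk⟩ := hw g hg d hd
        exact ⟨_, Submonoid.subset_closure (hshift d hd k), hk⟩
      | one => exact ⟨1, S.one_mem, by simp⟩
      | mul x y _ _ hx hy =>
        obtain ⟨x', hx', h1⟩ := hx
        obtain ⟨y', hy', h2⟩ := hy
        exact ⟨x' * y', S.mul_mem hx' hy', by
          rw [mul_assoc, h2, ← mul_assoc, h1, mul_assoc]⟩
    | algebraMap z => exact fun s hs => ⟨algebraMap ℂ A z, s, hs, (Algebra.commutes z s).symm⟩
    | add x y _ _ hx hy =>
      intro s hs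
      obtain ⟨x', s1, hs1, h1⟩ := hx s hs
      obtain ⟨y', s2, hs2, h2⟩ := hy s hs
      refine ⟨s2 * x' + s1 * y', s1 * s2, S.mul_mem hs1 hs2, ?_⟩
      rw [mul_add, add_mul, mul_assoc s1 s2 y, h2, hScomm s1 hs1 s2 hs2, mul_assoc s2 s1 x, h1]
      simp only [mul_assoc]
    | mul x y _ _ hx hy =>
      intro s hs
      obtain ⟨y', s1, hs1, h1⟩ := hy s hs
      obtain ⟨x', s2, hs2, h2⟩ := hx s1 hs1
      exact ⟨x' * y', s2, hs2, by rw [← mul_assoc, h2, mul_assoc, h1, mul_assoc]⟩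
  -- weak cancellation
  have hann : ∀ d ∈ D, ∀ r : A, ∃ K : List ℤ,
      (K.map fun k : ℤ => (LinearMap.mulLeft ℂ (d + algebraMap ℂ A k) - LinearMap.mulRight ℂ d :
        Module.End ℂ A)).prod r = 0 := by
    intro d hd r
    let M : Submonoid A :=
      { carrier := {e | ∃ k : ℤ, (d + algebraMap ℂ A k) * e = e * d}
        one_mem' := ⟨0, by simp⟩
        mul_mem' := by
          rintro x y ⟨k, hk⟩ ⟨l, hl⟩
          refine ⟨k + l, ?_⟩
          have h1 : d * x = x * d - algebraMap ℂ A k * x := by rw [← hk, add_mul]; abel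
          have h2 : d * y = y * d - algebraMap ℂ A l * y := by rw [← hl, add_mul]; abel
          rw [add_mul, ← mul_assoc, h1, sub_mul, mul_assoc x d y, h2, mul_sub, ← mul_assoc x _ y,
            ← Algebra.commutes (l : ℂ) x]
          rw [Int.cast_add, map_add, add_mul]
          simp only [mul_assoc]
          abel }
    have hGM : G ⊆ M := fun g hg => hw g hg d hd
    have hr : r ∈ Submodule.span ℂ (M : Set A) := by
      have h1 : r ∈ Algebra.adjoin ℂ G := hG ▸ Algebra.mem_top
      rw [← Subalgebra.mem_toSubmodule, Algebra.adjoin_eq_span] at h1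
      exact Submodule.span_mono (Submonoid.closure_le.mpr hGM) h1
    have hTcomm : ∀ k l : ℤ, Commute
        (LinearMap.mulLeft ℂ (d + algebraMap ℂ A k) - LinearMap.mulRight ℂ d : Module.End ℂ A)
        (LinearMap.mulLeft ℂ (d + algebraMap ℂ A l) - LinearMap.mulRight ℂ d) := by
      intro k l
      have e : ∀ k : ℤ, (LinearMap.mulLeft ℂ (d + algebraMap ℂ A k) - LinearMap.mulRight ℂ d :
          Module.End ℂ A) = (LinearMap.mulLeft ℂ d - LinearMap.mulRight ℂ d) +
            algebraMap ℂ (Module.End ℂ A) k := by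
        intro k
        ext x
        simp [add_mul, Algebra.smul_def]
        abel
      rw [e k, e l]
      exact ((Commute.refl _).add_left (Algebra.commute_algebraMap_left _ _)).add_right
        ((Algebra.commute_algebraMap_right _ _).add_left (Algebra.commute_algebraMap_right _ _))
    induction hr using Submodule.span_induction with
    | mem e he =>
      obtain ⟨k, hk⟩ := he
      exact ⟨[k], by simpa [sub_eq_zero] using hk⟩
    | zero => exact ⟨[], by simp⟩
    | add x y _ _ hx hy =>
      obtain ⟨K, hK⟩ := hx
      obtain ⟨K', hK'⟩ := hy
      refine ⟨K ++ K', ?_⟩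
      rw [List.map_append, List.prod_append, map_add, Module.End.mul_apply, Module.End.mul_apply,
        hK', map_zero, add_zero, ← Module.End.mul_apply, (Commute.list_prod_right _ _ ?_).eq,
        Module.End.mul_apply, hK, map_zero]
      intro T' hT'
      refine (Commute.list_prod_right _ _ ?_).symm
      intro T hT
      obtain ⟨k, _, rfl⟩ := List.mem_map.mp hT
      obtain ⟨l, _, rfl⟩ := List.mem_map.mp hT'
      exact hTcomm l k
    | smul z x _ hx =>
      obtain ⟨K, hK⟩ := hx
      exact ⟨K, by rw [map_smul, hK, smul_zero]⟩
  have hcancel : ∀ s ∈ S, ∀ r : A, r * s = 0 → ∃ s' ∈ S, s' * r = 0 := by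
    intro s hs
    induction hs using Submonoid.closure_induction with
    | mem d hd =>
      intro r hr
      obtain ⟨K, hK⟩ := hann d hd r
      refine ⟨(K.map fun k : ℤ => d + algebraMap ℂ A k).prod,
        S.list_prod_mem (by
          intro x hx
          obtain ⟨k, _, rfl⟩ := List.mem_map.mp hx
          exact Submonoid.subset_closure (hshift d hd k)), ?_⟩
      have key : ∀ K : List ℤ,
          (K.map fun k : ℤ => (LinearMap.mulLeft ℂ (d + algebraMap ℂ A k) -
            LinearMap.mulRight ℂ d : Module.End ℂ A)).prod r =
          (K.map fun k : ℤ => d + algebraMap ℂ A k).prod * r := by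
        intro K
        induction K with
        | nil => simp
        | cons k K ih =>
          simp only [List.map_cons, List.prod_cons, Module.End.mul_apply, ih, LinearMap.sub_apply,
            LinearMap.mulLeft_apply, LinearMap.mulRight_apply]
          rw [mul_assoc _ r d, hr, mul_zero, sub_zero, mul_assoc]
      rw [← key, hK]
    | one => exact fun r hr => ⟨1, S.one_mem, by simpa using hr⟩
    | mul x y _ _ hx hy =>
      intro r hr
      rw [← mul_assoc] at hr
      obtain ⟨s1, hs1, h1⟩ := hy _ hr
      rw [← mul_assoc] at h1
      obtain ⟨s2, hs2, h2⟩ := hx _ h1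
      exact ⟨s2 * s1, S.mul_mem hs2 hs1, by rw [mul_assoc, h2]⟩
  choose num den hden heq using fun (r : A) (s : S) => hore r s s.2
  exact ⟨
    { ore_right_cancel := fun r₁ r₂ s h => by
        obtain ⟨s', hs', h'⟩ := hcancel s s.2 (r₁ - r₂) (by rw [sub_mul, h, sub_self])
        exact ⟨⟨s', hs'⟩, by rw [← sub_eq_zero, ← mul_sub, h']⟩
      oreNum := num
      oreDenom := fun r s => ⟨den r s, hden r s⟩
      ore_eq := heq }⟩

theorem UhToU_ι {m : ℕ} (h : hhat m) :
    UhToU m (UniversalEnvelopingAlgebra.ι ℂ h) = UniversalEnvelopingAlgebra.ι ℂ h.1 := by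
  rw [UhToU, UniversalEnvelopingAlgebra.lift_ι_apply]
  rfl

theorem S_eq_closure (m : ℕ) : S m = Submonoid.closure (UhToU m '' denomGen m) :=
  MonoidHom.map_mclosure (UhToU m : Uh m →* U m) (denomGen m)

theorem eulerMat_hhat {m : ℕ} (h : hhat m) : eulerMat m h.1.1.mat = 0 := by
  obtain ⟨h, f, hf⟩ := h
  ext a b n
  rw [hf]
  simp only [eulerMat, LinearMap.mapMatrix_apply, Matrix.map_apply, Matrix.diagonal_apply,
    coeff_euler]
  split_ifs
  · simp only [LaurentPolynomial.C_apply]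
    split_ifs with h <;> simp [h]
  · simp

theorem mat_hElem {m : ℕ} (a b : Fin m) (i : ℤ) :
    (hElem a b i).1.1.mat = Matrix.diagonal fun d =>
      LaurentPolynomial.C ((if d = a then 1 else 0) - (if d = b then 1 else 0)) :=
  (hElem_aux a b i)

theorem adjoin_weights (m : ℕ) :
    Algebra.adjoin ℂ ((UniversalEnvelopingAlgebra.ι ℂ : affineSL m →ₗ⁅ℂ⁆ U m) ''
      {X : affineSL m | ∀ (a b : Fin m) (i : ℤ), ∃ k : ℤ, ⁅(hElem a b i).1, X⁆ = (k : ℂ) • X}) =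
      ⊤ := by
  set G : Set (affineSL m) :=
    {X : affineSL m | ∀ (a b : Fin m) (i : ℤ), ∃ k : ℤ, ⁅(hElem a b i).1, X⁆ = (k : ℂ) • X}
  have hoff : ∀ (p q : Fin m) (f : ℂ[T;T⁻¹]) (hpq : p ≠ q),
      (⟨AffineGL.mk (Matrix.single p q f) 0, by simp [mem_affineSL, hpq]⟩ : affineSL m) ∈ G := by
    intro p q f hpq a b i
    refine ⟨((if p = a then 1 else 0) - (if p = b then 1 else 0)) -
      ((if q = a then 1 else 0) - (if q = b then 1 else 0)), ?_⟩
    apply Subtype.ext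
    ext1
    · rw [LieSubalgebra.coe_bracket, SetLike.val_smul, map_smul, AffineGL.mat_lie,
        mat_hElem, AffineGL.mat_mk]
      ext1 x y
      simp only [Matrix.sub_apply, Matrix.diagonal_mul, Matrix.mul_diagonal, Matrix.single_apply,
        Matrix.smul_apply, LaurentPolynomial.smul_eq_C_mul]
      by_cases h : p = x ∧ q = y
      · obtain ⟨rfl, rfl⟩ := h
        simp only [and_self, if_true]
        push_cast
        simp only [map_sub]
        ring
      · simp [h]
    · rw [LieSubalgebra.coe_bracket, SetLike.val_smul, map_smul, AffineGL.cen_lie,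
        eulerMat_hhat, zero_mul, map_zero, AffineGL.cen_mk, smul_zero]
  have hdiag : ∀ X : affineSL m, (∀ p q, p ≠ q → X.1.mat p q = 0) → X ∈ G := by
    intro X hX a b i
    refine ⟨0, ?_⟩
    apply Subtype.ext
    ext1
    · rw [LieSubalgebra.coe_bracket, SetLike.val_smul, map_smul, AffineGL.mat_lie,
        mat_hElem]
      ext1 x y
      simp only [Matrix.sub_apply, Matrix.diagonal_mul, Matrix.mul_diagonal]
      by_cases h : x = y
      · subst h
        simp [mul_comm]
      · simp [hX x y h]
    · rw [LieSubalgebra.coe_bracket, SetLike.val_smul, map_smul, AffineGL.cen_lie,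
        eulerMat_hhat, zero_mul, map_zero, Int.cast_zero, zero_smul]
  have hspan : ∀ X : affineSL m, X ∈ Submodule.span ℂ G := by
    intro X
    let Z : Fin m → Fin m → affineSL m := fun p q =>
      if hpq : p = q then 0 else
        ⟨AffineGL.mk (Matrix.single p q (X.1.mat p q)) 0, by simp [mem_affineSL, hpq]⟩
    have hZ : ∀ p q x y, (Z p q).1.mat x y =
        if p ≠ q ∧ p = x ∧ q = y then X.1.mat x y else 0 := by
      intro p q x y
      by_cases hpq : p = q
      · simp [Z, hpq]
      · simp only [Z, hpq, dif_neg, not_false_eq_true, AffineGL.mat_mk, Matrix.single_apply]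
        by_cases h : p = x ∧ q = y
        · obtain ⟨rfl, rfl⟩ := h
          simp [hpq]
        · simp [h]
    have hsum : X = (X - ∑ p, ∑ q, Z p q) + ∑ p, ∑ q, Z p q := by abel
    rw [hsum]
    refine Submodule.add_mem _ (Submodule.subset_span (hdiag _ ?_))
      (Submodule.sum_mem _ fun p _ => Submodule.sum_mem _ fun q _ => ?_)
    · intro x y hxy
      have : ((X - ∑ p, ∑ q, Z p q : affineSL m) : AffineGL m).mat x y =
          X.1.mat x y - ∑ p, ∑ q, (Z p q).1.mat x y := by
        simp [Matrix.sum_apply]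
      rw [this]
      simp only [hZ]
      rw [Finset.sum_eq_single x, Finset.sum_eq_single y]
      · simp [hxy]
      · intro q _ hq
        simp [hq]
      · simp
      · intro p _ hp
        exact Finset.sum_eq_zero fun q _ => by simp [hp]
      · simp
    · by_cases hpq : p = q
      · simp [Z, hpq]
      · simp only [Z, hpq, dif_neg, not_false_eq_true]
        exact Submodule.subset_span (hoff p q _ hpq)
  rw [eq_top_iff, ← adjoin_range_uea]
  refine Algebra.adjoin_le ?_
  rintro _ ⟨X, rfl⟩
  have h1 := hspan X
  rw [SetLike.mem_coe]
  induction h1 using Submodule.span_induction with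
  | mem x hx => exact Algebra.subset_adjoin ⟨x, hx, rfl⟩
  | zero => rw [map_zero]; exact Subalgebra.zero_mem _
  | add x y _ _ hx hy => rw [map_add]; exact Subalgebra.add_mem _ hx hy
  | smul z x _ hx => rw [map_smul]; exact Subalgebra.smul_mem _ hx z

theorem nonempty_oreSet (m : ℕ) : Nonempty (OreLocalization.OreSet (S m)) := by
  rw [S_eq_closure]
  refine oreSet_of_weights _ _ (adjoin_weights m) ?_ ?_ ?_
  · rintro _ ⟨d, _, rfl⟩ _ ⟨e, _, rfl⟩
    rw [← map_mul, mul_comm, map_mul]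
  · rintro _ ⟨_, ⟨a, b, i, j, hab, rfl⟩, rfl⟩ k
    refine ⟨_, ⟨a, b, i, j + k, hab, rfl⟩, ?_⟩
    push_cast
    simp only [map_add, AlgHom.commutes, add_assoc]
  · rintro _ ⟨X, hX, rfl⟩ _ ⟨_, ⟨a, b, i, j, hab, rfl⟩, rfl⟩
    obtain ⟨k, hk⟩ := hX a b i
    refine ⟨-k, ?_⟩
    have h := congrArg (UniversalEnvelopingAlgebra.ι ℂ) hk
    rw [LieHom.map_lie, LieRing.of_associative_ring_bracket, map_smul, sub_eq_iff_eq_add] at h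
    simp only [map_add, AlgHom.commutes, add_mul, mul_add, UhToU_ι, h, Algebra.smul_def,
      Algebra.commutes (j : ℂ)]
    push_cast
    simp only [neg_mul]
    abel

noncomputable instance (m : ℕ) : OreLocalization.OreSet (S m) := (nonempty_oreSet m).some

/-- The ring of fractions `Ū(𝔰𝔩̂ₘ)`. -/
abbrev Ubar (m : ℕ) : Type := OreLocalization (S m) (U m)

/-- The ring of fractions `Ū(𝔥̂)`. -/
abbrev Uhbar (m : ℕ) : Type := OreLocalization (Sh m) (Uh m)

/-! ### The space `𝔓_N ⊗ (ℂᵐ)^{⊗N}` -/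

/-- The index set of the monomial basis `x_1^{i_1} ⋯ x_N^{i_N} ⊗ e_{a_1} ⊗ ⋯ ⊗ e_{a_N}`:
the pairs `(i, a)`. -/
abbrev Mon (m N : ℕ) : Type := (Fin N → ℤ) × (Fin N → Fin m)

/-- The space `𝔓_N ⊗ (ℂᵐ)^{⊗N}`, where `𝔓_N` is the ring of Laurent polynomials in
`x_1, …, x_N`, in its monomial basis. -/
def P (m N : ℕ) : Type := Mon m N →₀ ℂ

instance (m N : ℕ) : AddCommGroup (P m N) := inferInstanceAs (AddCommGroup (Mon m N →₀ ℂ))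

instance (m N : ℕ) : Module ℂ (P m N) := inferInstanceAs (Module ℂ (Mon m N →₀ ℂ))

/-- The monomials form a basis. -/
def basisMon (m N : ℕ) : Module.Basis (Mon m N) ℂ (P m N) := .ofRepr (LinearEquiv.refl ℂ (P m N))

/-- The basis vector `x^i ⊗ e_a`. -/
def basisP {m N : ℕ} (k : Mon m N) : P m N := basisMon m N k

/-- The linear operator with given values on the monomial basis. -/
def opOfBasis {m N : ℕ} (f : Mon m N → P m N) : Module.End ℂ (P m N) :=
  (basisMon m N).constr ℂ f

@[simp] theorem opOfBasis_basisP {m N : ℕ} (f : Mon m N → P m N) (k : Mon m N) :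
    opOfBasis f (basisP k) = f k := by
  simp [opOfBasis, basisP]

theorem opP_ext {m N : ℕ} {f g : Module.End ℂ (P m N)} (h : ∀ k, f (basisP k) = g (basisP k)) :
    f = g := by
  exact (basisMon m N).ext h

/-- Multiplication by `x_p^j`. -/
def xOp {m N : ℕ} (p : Fin N) (j : ℤ) : Module.End ℂ (P m N) :=
  opOfBasis fun k => basisP (Function.update k.1 p (k.1 p + j), k.2)

/-- The operator `E_ab^{(p)}`: the matrix unit `E_ab` applied in the `p`-th factor `ℂᵐ`. -/
def EOp {m N : ℕ} (p : Fin N) (a b : Fin m) : Module.End ℂ (P m N) :=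
  opOfBasis fun k => if k.2 p = b then basisP (k.1, Function.update k.2 p a) else 0

/-- The permutation `σ` applied simultaneously to the variables `x_1, …, x_N` and to the `N`
tensor factors `ℂᵐ`. -/
def permOp {m N : ℕ} (σ : Equiv.Perm (Fin N)) : Module.End ℂ (P m N) :=
  opOfBasis fun k => basisP (k.1 ∘ σ.symm, k.2 ∘ σ.symm)

/-- The permutation `σ` applied to the `N` tensor factors `ℂᵐ` only. -/
def tensorPermOp {m N : ℕ} (σ : Equiv.Perm (Fin N)) : Module.End ℂ (P m N) :=
  opOfBasis fun k => basisP (k.1, k.2 ∘ σ.symm)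

/-- The operator `x_p ∂_p`. -/
def eulerOp {m N : ℕ} (p : Fin N) : Module.End ℂ (P m N) :=
  opOfBasis fun k => (k.1 p : ℂ) • basisP k

/-- The operator `x_p / (x_p - x_r) (1 - σ_pr) ⊗ σ_pr` for `r ≠ p`, where the first factor acts
on Laurent polynomials and the second one on `(ℂᵐ)^{⊗N}`. It is written out on monomials:
if `u ≥ v` then `x_p / (x_p - x_r) (x_p^u x_r^v - x_p^v x_r^u) = ∑_{s < u - v} x_p^{u-s} x_r^{v+s}`,
and the opposite case follows by antisymmetry; see `dunklOp_spec`. -/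
def dunklOp {m N : ℕ} (p r : Fin N) : Module.End ℂ (P m N) :=
  opOfBasis fun k =>
    (∑ s ∈ Finset.range (k.1 p - k.1 r).toNat,
      basisP (Function.update (Function.update k.1 p (k.1 p - s)) r (k.1 r + s),
        k.2 ∘ Equiv.swap p r)) -
    ∑ s ∈ Finset.range (k.1 r - k.1 p).toNat,
      basisP (Function.update (Function.update k.1 p (k.1 r - s)) r (k.1 p + s),
        k.2 ∘ Equiv.swap p r)

theorem dunklOp_spec {m N : ℕ} (p r : Fin N) (hpr : p ≠ r) :
    (xOp p 1 - xOp r 1) * dunklOp p r =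
      xOp p 1 * (tensorPermOp (m := m) (Equiv.swap p r) - permOp (Equiv.swap p r)) := by
  have tele : ∀ (i : Fin N → ℤ) (a : Fin N → Fin m) (u v : ℤ) (n : ℕ),
      (xOp p 1 - xOp r 1 : Module.End ℂ (P m N)) (∑ s ∈ Finset.range n,
        basisP (Function.update (Function.update i p (u - s)) r (v + s), a)) =
      basisP (Function.update (Function.update i p (u + 1)) r v, a) -
        basisP (Function.update (Function.update i p (u - n + 1)) r (v + n), a) := by
    intro i a u v n
    induction n with
    | zero => simp
    | succ n ih =>
      rw [Finset.sum_range_succ, map_add, ih]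
      simp only [LinearMap.sub_apply, xOp, opOfBasis_basisP]
      have e1 : Function.update (Function.update (Function.update i p (u - n)) r (v + n)) p
          (Function.update (Function.update i p (u - n)) r (v + n) p + 1) =
          Function.update (Function.update i p (u - n + 1)) r (v + n) := by
        ext q
        by_cases hq : q = p
        · subst hq; simp [hpr]
        · by_cases hq' : q = r
          · subst hq'; simp [hq]
          · simp [hq, hq']
      have e2 : Function.update (Function.update (Function.update i p (u - n)) r (v + n)) r
          (Function.update (Function.update i p (u - n)) r (v + n) r + 1) =
          Function.update (Function.update i p (u - (n + 1 : ℕ) + 1)) r (v + (n + 1 : ℕ)) := by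
        ext q
        by_cases hq : q = r
        · subst hq; simp [add_assoc]
        · by_cases hq' : q = p
          · subst hq'; simp [hq]; ring
          · simp [hq, hq']
      rw [e1, e2]
      abel
  have upd : ∀ (i : Fin N → ℤ) (u : ℤ),
      Function.update (Function.update i p (i p + 1)) r (i r) = Function.update i p (i p + 1) := by
    intro i u
    ext q
    by_cases hq : q = r
    · subst hq; simp [hpr.symm]
    · simp [hq]
  have swp : ∀ (i : Fin N → ℤ),
      Function.update (Function.update i p (i r + 1)) r (i p) =
        Function.update (i ∘ Equiv.swap p r) p ((i ∘ Equiv.swap p r) p + 1) := by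
    intro i
    ext q
    by_cases hq : q = p
    · subst hq; simp [hpr]
    · by_cases hq' : q = r
      · subst hq'; simp [hq]
      · simp [hq, hq', Equiv.swap_apply_of_ne_of_ne]
  apply opP_ext
  rintro ⟨i, a⟩
  have e1 : ∀ f : P m N, ((xOp p 1 - xOp r 1) * dunklOp p r : Module.End ℂ (P m N)) f =
      (xOp p 1 - xOp r 1 : Module.End ℂ (P m N)) (dunklOp p r f) := fun f => rfl
  rw [e1, dunklOp, opOfBasis_basisP, map_sub, tele, tele]
  simp only [Module.End.mul_apply, LinearMap.sub_apply, tensorPermOp, permOp, opOfBasis_basisP,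
    map_sub, xOp, Equiv.symm_swap, ← swp]
  rcases le_total (i r) (i p) with h | h
  · have h1 : ((i p - i r).toNat : ℤ) = i p - i r := Int.toNat_of_nonneg (by omega)
    have h2 : (i r - i p).toNat = 0 := by omega
    rw [h1, h2]
    simp [upd i 0]
  · have h1 : ((i r - i p).toNat : ℤ) = i r - i p := Int.toNat_of_nonneg (by omega)
    have h2 : (i p - i r).toNat = 0 := by omega
    rw [h1, h2]
    simp [upd i 0]

theorem EOp_mul_EOp {m N : ℕ} (p : Fin N) (a b c d : Fin m) :
    EOp (N := N) p a b * EOp p c d = if b = c then EOp p a d else 0 := by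
  apply opP_ext
  rintro ⟨i, k⟩
  by_cases hbc : b = c
  · subst hbc
    simp only [Module.End.mul_apply, EOp, opOfBasis_basisP, if_true]
    split_ifs with h
    · simp
    · simp
  · simp only [Module.End.mul_apply, EOp, opOfBasis_basisP, if_neg hbc, LinearMap.zero_apply]
    split_ifs with h
    · simp [Ne.symm hbc]
    · simp

theorem EOp_commute {m N : ℕ} {p q : Fin N} (hpq : p ≠ q) (a b c d : Fin m) :
    Commute (EOp (N := N) p a b) (EOp q c d) := by
  apply opP_ext
  rintro ⟨i, k⟩
  simp only [Module.End.mul_apply, EOp, opOfBasis_basisP]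
  split_ifs with h1 h2 h2
  · simp [h1, h2, hpq, hpq.symm, Function.update_comm hpq]
  · simp [h2, hpq]
  · simp [h1, hpq.symm]
  · simp

theorem xOp_EOp_commute {m N : ℕ} (p q : Fin N) (j : ℤ) (c d : Fin m) :
    Commute (xOp (N := N) p j) (EOp q c d) := by
  apply opP_ext
  rintro ⟨i, k⟩
  simp only [Module.End.mul_apply, EOp, xOp, opOfBasis_basisP]
  split_ifs <;> simp

theorem xOp_add {m N : ℕ} (p : Fin N) (i j : ℤ) :
    xOp (m := m) p (i + j) = xOp p i * xOp p j := by
  apply opP_ext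
  rintro ⟨u, k⟩
  simp [xOp, add_assoc, add_comm i]

theorem xOp_zero {m N : ℕ} (p : Fin N) : xOp (m := m) p 0 = 1 := by
  apply opP_ext
  rintro ⟨u, k⟩
  simp [xOp]

theorem xOp_commute {m N : ℕ} (p q : Fin N) (i j : ℤ) :
    Commute (xOp (m := m) p i) (xOp q j) := by
  by_cases hpq : p = q
  · subst hpq
    rw [Commute, SemiconjBy, ← xOp_add, ← xOp_add, add_comm]
  · apply opP_ext
    rintro ⟨u, k⟩
    simp [xOp, hpq, Ne.symm hpq, Function.update_comm (Ne.symm hpq)]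

/-- The action of Laurent polynomials in `t` through multiplication by `x_q`. -/
def xHom {m N : ℕ} (q : Fin N) : ℂ[T;T⁻¹] →ₐ[ℂ] Module.End ℂ (P m N) :=
  AddMonoidAlgebra.lift ℂ _ ℤ
    { toFun := fun j => xOp q j.toAdd
      map_one' := xOp_zero q
      map_mul' := fun i j => xOp_add q i.toAdd j.toAdd }

theorem xHom_C_mul_T {m N : ℕ} (q : Fin N) (n : ℤ) (z : ℂ) :
    xHom (m := m) q (LaurentPolynomial.C z * LaurentPolynomial.T n) = z • xOp q n := by
  rw [← LaurentPolynomial.single_eq_C_mul_T, xHom, AddMonoidAlgebra.lift_single]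
  rfl

/-- The action of a matrix of Laurent polynomials in `t` on the `q`-th tensor factor
`ℂᵐ[t, t⁻¹]`, where `t` acts as `x_q`: the matrix `E_cd tʲ` acts as `x_q^j ⊗ E_cd^{(q)}`. -/
def currentOp {m N : ℕ} (q : Fin N) :
    Matrix (Fin m) (Fin m) ℂ[T;T⁻¹] →ₗ[ℂ] Module.End ℂ (P m N) where
  toFun A := ∑ c, ∑ d, xHom q (A c d) * EOp q c d
  map_add' A B := by simp [add_mul, Finset.sum_add_distrib]
  map_smul' z A := by simp [Finset.smul_sum]

theorem xHom_EOp_commute {m N : ℕ} (p q : Fin N) (f : ℂ[T;T⁻¹]) (c d : Fin m) :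
    Commute (xHom (N := N) p f) (EOp q c d) := by
  induction f using LaurentPolynomial.induction_on' with
  | add f g hf hg => rw [map_add]; exact hf.add_left hg
  | C_mul_T n z => rw [xHom_C_mul_T]; exact (xOp_EOp_commute p q n c d).smul_left z

theorem xHom_commute {m N : ℕ} (p q : Fin N) (f g : ℂ[T;T⁻¹]) :
    Commute (xHom (m := m) (N := N) p f) (xHom q g) := by
  induction f using LaurentPolynomial.induction_on' with
  | add f f' hf hf' => rw [map_add]; exact hf.add_left hf'
  | C_mul_T n z =>
    rw [xHom_C_mul_T]
    refine Commute.smul_left ?_ z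
    induction g using LaurentPolynomial.induction_on' with
    | add f g hf hg => rw [map_add]; exact hf.add_right hg
    | C_mul_T l w => rw [xHom_C_mul_T]; exact (xOp_commute p q n l).smul_right w

theorem currentOp_mul {m N : ℕ} (q : Fin N) (A B : Matrix (Fin m) (Fin m) ℂ[T;T⁻¹]) :
    currentOp (N := N) q A * currentOp q B = currentOp q (A * B) := by
  have h : ∀ a b c d, (xHom q (A a b) * EOp q a b) * (xHom q (B c d) * EOp (N := N) q c d) =
      if b = c then xHom q (A a b * B c d) * EOp q a d else 0 := by
    intro a b c d
    rw [mul_assoc, ← mul_assoc (EOp q a b), ← (xHom_EOp_commute q q (B c d) a b).eq, mul_assoc,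
      EOp_mul_EOp, ← mul_assoc, ← map_mul]
    split_ifs <;> simp
  have h2 : ∀ a b, (∑ c, ∑ d, if b = c then xHom q (A a b * B c d) * EOp (N := N) q a d else 0) =
      ∑ d, xHom q (A a b * B b d) * EOp q a d := by
    intro a b
    rw [Finset.sum_comm]
    refine Finset.sum_congr rfl fun d _ => ?_
    rw [Finset.sum_ite_eq, if_pos (Finset.mem_univ b)]
  have h3 : ∀ a b, (xHom q (A a b) * EOp q a b) * (∑ c, ∑ d, xHom q (B c d) * EOp (N := N) q c d) =
      ∑ d, xHom q (A a b * B b d) * EOp q a d := by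
    intro a b
    rw [← h2, Finset.mul_sum]
    refine Finset.sum_congr rfl fun c _ => ?_
    rw [Finset.mul_sum]
    exact Finset.sum_congr rfl fun d _ => h a b c d
  change (∑ a, ∑ b, xHom q (A a b) * EOp q a b) * (∑ c, ∑ d, xHom q (B c d) * EOp (N := N) q c d) =
    ∑ a, ∑ d, xHom q ((A * B) a d) * EOp q a d
  rw [Finset.sum_mul]
  refine Finset.sum_congr rfl fun a _ => ?_
  rw [Finset.sum_mul, Finset.sum_congr rfl fun b _ => h3 a b, Finset.sum_comm]
  refine Finset.sum_congr rfl fun d _ => ?_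
  rw [Matrix.mul_apply, map_sum, Finset.sum_mul]

theorem currentOp_commute {m N : ℕ} {p q : Fin N} (hpq : p ≠ q)
    (A B : Matrix (Fin m) (Fin m) ℂ[T;T⁻¹]) :
    Commute (currentOp (N := N) p A) (currentOp q B) := by
  refine Commute.sum_left _ _ _ fun a _ => Commute.sum_left _ _ _ fun b _ =>
    Commute.sum_right _ _ _ fun c _ => Commute.sum_right _ _ _ fun d _ => ?_
  exact ((xHom_commute p q _ _).mul_right (xHom_EOp_commute p q _ c d)).mul_left
    (((xHom_EOp_commute q p _ a b).symm).mul_right (EOp_commute hpq a b c d))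

theorem sum_commutator {R ι : Type*} [Ring R] [Fintype ι] [DecidableEq ι] (f g : ι → R)
    (h : ∀ p q, p ≠ q → Commute (f p) (g q)) :
    (∑ p, f p) * (∑ q, g q) - (∑ q, g q) * (∑ p, f p) = ∑ p, (f p * g p - g p * f p) := by
  rw [Finset.sum_mul_sum, Finset.sum_mul_sum, Finset.sum_comm (f := fun q p => g q * f p),
    ← Finset.sum_sub_distrib]
  refine Finset.sum_congr rfl fun p _ => ?_
  rw [← Finset.sum_sub_distrib, Finset.sum_eq_single p]
  · intro q _ hq
    rw [(h p q (Ne.symm hq)).eq, sub_self]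
  · simp

/-- The level zero action of the affine Lie algebra on `𝔓_N ⊗ (ℂᵐ)^{⊗N}`, the tensor product of
`N` copies of `ℂᵐ[t, t⁻¹]`: the element `E_cd tʲ` acts as `∑_q x_q^j ⊗ E_cd^{(q)}`, and `C` acts
as zero. -/
def loopRep (m N : ℕ) : affineSL m →ₗ⁅ℂ⁆ Module.End ℂ (P m N) where
  toFun X := ∑ q, currentOp q X.1.mat
  map_add' X Y := by
    rw [← Finset.sum_add_distrib]
    exact Finset.sum_congr rfl fun q _ => map_add (currentOp q) X.1.mat Y.1.mat
  map_smul' z X := by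
    rw [RingHom.id_apply, Finset.smul_sum]
    exact Finset.sum_congr rfl fun q _ => map_smul (currentOp q) z X.1.mat
  map_lie' {X Y} := by
    rw [LieRing.of_associative_ring_bracket, LieSubalgebra.coe_bracket, AffineGL.mat_lie]
    refine Eq.trans (Finset.sum_congr rfl fun q _ => ?_) (sum_commutator
      (fun q => currentOp (N := N) q X.1.mat) (fun q => currentOp q Y.1.mat)
      fun p q hpq => currentOp_commute hpq _ _).symm
    rw [map_sub, ← currentOp_mul, ← currentOp_mul]

/-! ### The spaces `B` and `B̄` and the two actions on `B̄` -/

/-- The homomorphism `U(𝔰𝔩̂ₘ) → Ū(𝔰𝔩̂ₘ)`. -/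
def numer (m : ℕ) : U m →ₐ[ℂ] Ubar m :=
  { (OreLocalization.numeratorRingHom : U m →+* Ubar m) with
    commutes' := fun _ => rfl }

/-- The space `B = 𝔓_N ⊗ (ℂᵐ)^{⊗N} ⊗ U(𝔰𝔩̂ₘ)`. -/
abbrev B (m N : ℕ) : Type := P m N ⊗[ℂ] U m

/-- The space `B̄ = 𝔓_N ⊗ (ℂᵐ)^{⊗N} ⊗ Ū(𝔰𝔩̂ₘ)`. -/
abbrev Bbar (m N : ℕ) : Type := P m N ⊗[ℂ] Ubar m

/-- The tensor product of the level zero module `𝔓_N ⊗ (ℂᵐ)^{⊗N}` with a module `V`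
over `U(𝔰𝔩̂ₘ)`, as a module of the Lie algebra `𝔰𝔩̂ₘ`. -/
def diagAct {m : ℕ} (N : ℕ) {V : Type} [AddCommGroup V] [Module ℂ V]
    (F : U m →ₐ[ℂ] Module.End ℂ V) : affineSL m →ₗ⁅ℂ⁆ Module.End ℂ (P m N ⊗[ℂ] V) where
  toFun X := LinearMap.rTensor V (loopRep m N X) +
    LinearMap.lTensor (P m N) (F (UniversalEnvelopingAlgebra.ι ℂ X))
  map_add' X Y := by
    simp only [map_add, LinearMap.rTensor_add, LinearMap.lTensor_add]
    abel
  map_smul' z X := by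
    simp only [map_smul, LinearMap.rTensor_smul, LinearMap.lTensor_smul, smul_add,
      RingHom.id_apply]
  map_lie' {X Y} := by
    have hc : ∀ (f : Module.End ℂ (P m N)) (g : Module.End ℂ V),
        LinearMap.rTensor V f * LinearMap.lTensor (P m N) g =
          LinearMap.lTensor (P m N) g * LinearMap.rTensor V f := by
      intro f g
      rw [Module.End.mul_eq_comp, Module.End.mul_eq_comp, LinearMap.rTensor_comp_lTensor,
        LinearMap.lTensor_comp_rTensor]
    simp only [LieHom.map_lie, LieRing.of_associative_ring_bracket, map_sub, map_mul,
      LinearMap.rTensor_sub, LinearMap.lTensor_sub, LinearMap.rTensor_mul, LinearMap.lTensor_mul,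
      mul_add, add_mul, hc]
    abel

/-- The action of `U(𝔰𝔩̂ₘ)` extending `diagAct`. -/
def diagActU {m : ℕ} (N : ℕ) {V : Type} [AddCommGroup V] [Module ℂ V]
    (F : U m →ₐ[ℂ] Module.End ℂ V) : U m →ₐ[ℂ] Module.End ℂ (P m N ⊗[ℂ] V) :=
  UniversalEnvelopingAlgebra.lift ℂ (diagAct N F)

/-- `U(𝔰𝔩̂ₘ)` acting on itself by left multiplications. -/
def FU (m : ℕ) : U m →ₐ[ℂ] Module.End ℂ (U m) := Algebra.lmul ℂ (U m)

/-- `U(𝔰𝔩̂ₘ)` acting on `Ū(𝔰𝔩̂ₘ)` by left multiplications. -/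
def FUbar (m : ℕ) : U m →ₐ[ℂ] Module.End ℂ (Ubar m) := (Algebra.lmul ℂ (Ubar m)).comp (numer m)

/-- The right action of `U(𝔰𝔩̂ₘ)` on `B`. -/
def rightU {m : ℕ} (N : ℕ) (A : U m) : Module.End ℂ (B m N) :=
  LinearMap.lTensor (P m N) (LinearMap.mulRight ℂ A)

/-- The right action of `Ū(𝔰𝔩̂ₘ)` on `B̄`. -/
def rightUbar {m : ℕ} (N : ℕ) (A : Ubar m) : Module.End ℂ (Bbar m N) :=
  LinearMap.lTensor (P m N) (LinearMap.mulRight ℂ A)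

/-- The operator multiplying `Y ⊗ A` from the left by `g k` in the second factor, where
`Y` is the basis vector with the index `k`. -/
def leftMul {m N : ℕ} (g : Mon m N → Ubar m) : Module.End ℂ (Bbar m N) :=
  TensorProduct.lift ((basisMon m N).constr ℂ fun k =>
    (TensorProduct.mk ℂ (P m N) (Ubar m) (basisP k)).comp (LinearMap.mulLeft ℂ (g k)))

theorem leftMul_tmul {m N : ℕ} (g : Mon m N → Ubar m) (k : Mon m N) (A : Ubar m) :
    leftMul g (basisP k ⊗ₜ A) = basisP k ⊗ₜ (g k * A) := by
  simp [leftMul, basisP]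

theorem opBbar_ext {m N : ℕ} {V W : Type} [AddCommGroup V] [Module ℂ V] [AddCommGroup W]
    [Module ℂ W] {f g : P m N ⊗[ℂ] V →ₗ[ℂ] W}
    (h : ∀ k A, f (basisP k ⊗ₜ A) = g (basisP k ⊗ₜ A)) : f = g := by
  apply TensorProduct.ext
  refine (basisMon m N).ext fun k => ?_
  ext A
  exact h k A

theorem leftMul_mul {m N : ℕ} (g h : Mon m N → Ubar m) :
    leftMul g * leftMul h = leftMul (N := N) (g * h) := by
  apply opBbar_ext
  intro k A
  rw [Module.End.mul_apply, leftMul_tmul, leftMul_tmul, leftMul_tmul, Pi.mul_apply, mul_assoc]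

theorem leftMul_one {m N : ℕ} : leftMul (1 : Mon m N → Ubar m) = 1 := by
  apply opBbar_ext
  intro k A
  rw [leftMul_tmul, Pi.one_apply, one_mul, Module.End.one_apply]

/-- The eigenvalue of `E_aa - E_bb + i C` on the basis vector with the index `k`. -/
def wt {m N : ℕ} (a b : Fin m) (k : Mon m N) : ℤ :=
  ∑ q, ((if k.2 q = a then 1 else 0) - (if k.2 q = b then 1 else 0))

theorem loopRep_hElem {m N : ℕ} (a b : Fin m) (i : ℤ) (k : Mon m N) :
    loopRep m N (hElem a b i).1 (basisP k) = (wt a b k : ℂ) • basisP k := by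
  have h1 : ∀ (q : Fin N) (f : Fin m → ℂ),
      currentOp q (Matrix.diagonal fun d => LaurentPolynomial.C (f d)) (basisP k) =
        f (k.2 q) • basisP k := by
    intro q f
    have h2 : ∀ c d, xHom (m := m) q (Matrix.diagonal (fun d => LaurentPolynomial.C (f d)) c d) *
        EOp (N := N) q c d = if c = d then f d • EOp q c d else 0 := by
      intro c d
      by_cases hcd : c = d
      · subst hcd
        rw [Matrix.diagonal_apply_eq, if_pos rfl]
        have := xHom_C_mul_T (m := m) q 0 (f c)
        rw [LaurentPolynomial.T_zero, mul_one, xOp_zero] at this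
        rw [this, smul_mul_assoc, one_mul]
      · rw [Matrix.diagonal_apply_ne _ hcd, if_neg hcd, map_zero, zero_mul]
    change (∑ c, ∑ d, xHom (m := m) q (Matrix.diagonal (fun d => LaurentPolynomial.C (f d)) c d) *
      EOp (N := N) q c d : Module.End ℂ (P m N)) (basisP k) = _
    simp only [h2, Finset.sum_ite_eq, Finset.mem_univ, if_true]
    rw [LinearMap.sum_apply]
    simp only [LinearMap.smul_apply, EOp, opOfBasis_basisP]
    simp
  change (∑ q, currentOp q (hElem a b i).1.1.mat) (basisP k) = _
  rw [mat_hElem, LinearMap.sum_apply]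
  simp only [h1, wt, ← Finset.sum_smul]
  push_cast
  rfl

theorem diagActU_ι {m : ℕ} (N : ℕ) {V : Type} [AddCommGroup V] [Module ℂ V]
    (F : U m →ₐ[ℂ] Module.End ℂ V) (X : affineSL m) :
    diagActU N F (UniversalEnvelopingAlgebra.ι ℂ X) = LinearMap.rTensor V (loopRep m N X) +
      LinearMap.lTensor (P m N) (F (UniversalEnvelopingAlgebra.ι ℂ X)) :=
  UniversalEnvelopingAlgebra.lift_ι_apply _ _ _

theorem isUnit_numer {m : ℕ} {d : Uh m} (hd : d ∈ denomGen m) :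
    IsUnit (numer m (UhToU m d)) :=
  OreLocalization.numerator_isUnit (S := S m) ⟨UhToU m d, d, Submonoid.subset_closure hd, rfl⟩ 

theorem isUnit_diagActU (m N : ℕ) (s : S m) : IsUnit (diagActU N (FUbar m) (s : U m)) := by
  obtain ⟨_, s, hs, rfl⟩ := s
  change IsUnit (diagActU N (FUbar m) (UhToU m s))
  induction hs using Submonoid.closure_induction with
  | mem d hd =>
    obtain ⟨a, b, i, j, hab, rfl⟩ := hd
    have hu : ∀ k : Mon m N, IsUnit (numer m (UhToU m
        (UniversalEnvelopingAlgebra.ι ℂ (hElem a b i) +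
          algebraMap ℂ (Uh m) ((j + wt a b k : ℤ) : ℂ)))) := fun k =>
      isUnit_numer ⟨a, b, i, _, hab, rfl⟩
    choose u hu using hu
    have e : diagActU N (FUbar m) (UhToU m (UniversalEnvelopingAlgebra.ι ℂ (hElem a b i) +
        algebraMap ℂ (Uh m) j)) = leftMul fun k => (u k : Ubar m) := by
      apply opBbar_ext
      intro k A
      rw [leftMul_tmul, hu, map_add, map_add, AlgHom.commutes, AlgHom.commutes, UhToU_ι,
        diagActU_ι, map_add, map_add, AlgHom.commutes, AlgHom.commutes, UhToU_ι]
      simp only [LinearMap.add_apply, LinearMap.rTensor_tmul, LinearMap.lTensor_tmul,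
        loopRep_hElem, Module.algebraMap_end_apply, TensorProduct.smul_tmul]
      rw [← TensorProduct.tmul_smul, ← TensorProduct.tmul_add, ← TensorProduct.tmul_add]
      congr 1
      simp only [FUbar, AlgHom.comp_apply, Algebra.coe_lmul_eq_mul, LinearMap.mul_apply',
        add_mul, Algebra.smul_def]
      push_cast
      simp only [add_mul]
      abel
    rw [e]
    have e1 : leftMul (fun k => (u k : Ubar m)) * leftMul (fun k => ((u k)⁻¹ : (Ubar m)ˣ)) =
        (1 : Module.End ℂ (Bbar m N)) := by
      rw [leftMul_mul, ← leftMul_one]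
      congr 1
      funext k
      simp
    have e2 : leftMul (fun k => ((u k)⁻¹ : (Ubar m)ˣ)) * leftMul (fun k => (u k : Ubar m)) =
        (1 : Module.End ℂ (Bbar m N)) := by
      rw [leftMul_mul, ← leftMul_one]
      congr 1
      funext k
      simp
    exact ⟨⟨_, _, e1, e2⟩, rfl⟩
  | one => simp
  | mul x y _ _ hx hy => rw [map_mul, map_mul]; exact hx.mul hy

/-- The homomorphism from a ring of fractions extending a homomorphism that makes the denominators
invertible. -/
def oreLift {R T : Type} [Ring R] [Ring T] {D : Submonoid R} [OreLocalization.OreSet D]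
    (f : R →+* T) (hf : ∀ d : D, IsUnit (f d)) : OreLocalization D R →+* T :=
  OreLocalization.universalHom f (IsUnit.liftRight ((f : R →* T).comp D.subtype) hf) fun _ => rfl

theorem oreLift_numerator {R T : Type} [Ring R] [Ring T] {D : Submonoid R}
    [OreLocalization.OreSet D] (f : R →+* T) (hf : ∀ d : D, IsUnit (f d)) (r : R) :
    oreLift f hf (OreLocalization.numeratorRingHom r) = f r :=
  OreLocalization.universalHom_commutes _ _ _

/-- The left action of `Ū(𝔰𝔩̂ₘ)` on `B̄`. -/
def leftUbar (m N : ℕ) : Ubar m →+* Module.End ℂ (Bbar m N) :=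
  oreLift (diagActU N (FUbar m)).toRingHom (isUnit_diagActU m N)

/-! ### The automorphisms `τ_c` -/

section nodes

variable {m : ℕ} [NeZero m]

/-- The transposition by which `τ_c` permutes the row indices. Rows are numbered from `0`, so that
`τ_c` with `c > 0` exchanges the rows `c - 1` and `c`, and `τ_0` exchanges the last row and
the first one; here `c - 1` is taken modulo `m`. -/
def tauPerm (c : Fin m) : Equiv.Perm (Fin m) := Equiv.swap (c - 1) c

/-- The shift of the degree in `t` made by `τ_c` on the vectors `e_a tⁱ`. It is zero unless `c = 0`;
for `c = 0` it is `1` on the first row and `-1` on the last one. -/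
def tauShift (c a : Fin m) : ℤ :=
  if c = 0 then (if a = c then 1 else 0) - (if a = c - 1 then 1 else 0) else 0

end nodes

/-- For a permutation `w` of the rows and for `s ∈ ℤᵐ`, the action on `𝔤𝔩̂ₘ` with
`E_ab tⁱ ↦ E_{w(a) w(b)} t^{i + s_a - s_b} + δ_{i0} δ_ab s_a C` and `C ↦ C`. -/
def affineMap {m : ℕ} (w : Equiv.Perm (Fin m)) (s : Fin m → ℤ) : AffineGL m →ₗ⁅ℂ⁆ AffineGL m where
  toFun X := AffineGL.mk
    (Matrix.of fun x y => LaurentPolynomial.T (s (w.symm x) - s (w.symm y)) *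
      X.mat (w.symm x) (w.symm y))
    (X.cen + ∑ a, (s a : ℂ) * (X.mat a a).coeff 0)
  map_add' X Y := by
    ext1
    · simp only [map_add, AffineGL.mat_mk]
      ext1 x y
      simp [mul_add]
    · simp only [map_add, AffineGL.cen_mk, Matrix.add_apply]
      simp only [AddMonoidAlgebra.coeff_add, Finsupp.add_apply, mul_add, Finset.sum_add_distrib]
      ring
  map_smul' z X := by
    ext1
    · simp only [map_smul, AffineGL.mat_mk]
      ext1 x y
      simp
    · simp [mul_add, Finset.mul_sum, mul_left_comm]
  map_lie' {X Y} := by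
    set A := X.mat with hA
    set B := Y.mat with hB
    have hmul : ∀ A B : Matrix (Fin m) (Fin m) ℂ[T;T⁻¹], ∀ x y,
        ∑ z, (LaurentPolynomial.T (s x - s z) * A x z) * (LaurentPolynomial.T (s z - s y) * B z y) =
          LaurentPolynomial.T (s x - s y) * (A * B) x y := by
      intro A B x y
      rw [Matrix.mul_apply, Finset.mul_sum]
      refine Finset.sum_congr rfl fun z _ => ?_
      rw [show s x - s y = (s x - s z) + (s z - s y) by ring, LaurentPolynomial.T_add]
      ring
    ext1
    · simp only [AffineGL.mat_mk, AffineGL.mat_lie]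
      ext1 x y
      simp only [Matrix.of_apply, Matrix.sub_apply, Matrix.mul_apply (M := Matrix.of _)]
      rw [Equiv.sum_comp w.symm fun z => (LaurentPolynomial.T (s (w.symm x) - s z) *
          X.mat (w.symm x) z) * (LaurentPolynomial.T (s z - s (w.symm y)) * Y.mat z (w.symm y)),
        Equiv.sum_comp w.symm fun z => (LaurentPolynomial.T (s (w.symm x) - s z) *
          Y.mat (w.symm x) z) * (LaurentPolynomial.T (s z - s (w.symm y)) * X.mat z (w.symm y)),
        hmul, hmul, mul_sub]
    · have htr : ∀ M K : Matrix (Fin m) (Fin m) ℂ[T;T⁻¹], trace0 m (eulerMat m M * K) =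
          ∑ x, ∑ y, (euler (M x y) * K y x).coeff 0 := by
        intro M K
        simp [trace0, Matrix.trace, Matrix.mul_apply, eulerMat, AddMonoidAlgebra.coeff_sum]
      have hterm : ∀ x y, (euler (LaurentPolynomial.T (s x - s y) * A x y) *
          (LaurentPolynomial.T (s y - s x) * B y x)).coeff 0 =
          (euler (A x y) * B y x).coeff 0 + ((s x : ℂ) - s y) * (A x y * B y x).coeff 0 := by
        intro x y
        have h1 : euler (LaurentPolynomial.T (s x - s y)) =
            ((s x : ℂ) - s y) • LaurentPolynomial.T (s x - s y) := by
          rw [LaurentPolynomial.T, euler_single]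
          simp [LaurentPolynomial.smul_eq_C_mul, sub_mul]
        have h2 : (LaurentPolynomial.T (s x - s y) : ℂ[T;T⁻¹]) * LaurentPolynomial.T (s y - s x) =
            1 := by
          rw [← LaurentPolynomial.T_add]
          simp
        rw [euler_mul, h1, ← smul_eq_mul (b := (A x y * B y x).coeff 0),
          ← Finsupp.smul_apply, ← AddMonoidAlgebra.coeff_smul, ← Finsupp.add_apply,
          ← AddMonoidAlgebra.coeff_add]
        congr 2
        rw [smul_mul_assoc, add_mul, smul_mul_assoc]
        rw [show LaurentPolynomial.T (s x - s y) * A x y * (LaurentPolynomial.T (s y - s x) * B y x)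
            = (LaurentPolynomial.T (s x - s y) * LaurentPolynomial.T (s y - s x)) *
              (A x y * B y x) by ring,
          show LaurentPolynomial.T (s x - s y) * euler (A x y) *
            (LaurentPolynomial.T (s y - s x) * B y x)
            = (LaurentPolynomial.T (s x - s y) * LaurentPolynomial.T (s y - s x)) *
              (euler (A x y) * B y x) by ring, h2, one_mul, one_mul, add_comm]
      simp only [AffineGL.cen_mk, AffineGL.mat_mk, AffineGL.cen_lie, AffineGL.mat_lie]
      rw [htr, htr]
      simp only [Matrix.of_apply]
      refine Eq.trans ?_ (Equiv.sum_comp w.symm fun x => ∑ y,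
        (euler (LaurentPolynomial.T (s x - s (w.symm y)) * A x (w.symm y)) *
          (LaurentPolynomial.T (s (w.symm y) - s x) * B (w.symm y) x)).coeff 0).symm
      have h3 : ∀ x, ∑ y, (euler (LaurentPolynomial.T (s x - s (w.symm y)) *
          A x (w.symm y)) * (LaurentPolynomial.T (s (w.symm y) - s x) * B (w.symm y) x)).coeff 0 =
          ∑ y, ((euler (A x y) * B y x).coeff 0 +
            ((s x : ℂ) - s y) * (A x y * B y x).coeff 0) := by
        intro x
        refine (Equiv.sum_comp w.symm fun y => (euler (LaurentPolynomial.T (s x - s y) * A x y) *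
          (LaurentPolynomial.T (s y - s x) * B y x)).coeff 0).trans ?_
        exact Finset.sum_congr rfl fun y _ => hterm x y
      rw [Finset.sum_congr rfl fun x _ => h3 x]
      simp only [Finset.sum_add_distrib]
      congr 1
      simp only [Matrix.sub_apply, Matrix.mul_apply, AddMonoidAlgebra.coeff_sub, Finsupp.sub_apply,
        AddMonoidAlgebra.coeff_sum, Finsupp.finsetSum_apply, mul_sub, sub_mul, Finset.mul_sum,
        Finset.sum_sub_distrib]
      congr 1
      rw [Finset.sum_comm]
      refine Finset.sum_congr rfl fun x _ => Finset.sum_congr rfl fun y _ => ?_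
      exact congrArg (fun f : ℂ[T;T⁻¹] => (s y : ℂ) * f.coeff 0) (mul_comm _ _)

/-- The action on `𝔰𝔩̂ₘ`. -/
def affineMapSL {m : ℕ} (w : Equiv.Perm (Fin m)) (s : Fin m → ℤ) :
    affineSL m →ₗ⁅ℂ⁆ affineSL m where
  toFun X := ⟨affineMap w s X.1, by
    have h := X.2
    rw [mem_affineSL] at h ⊢
    rw [← h]
    change ∑ x, LaurentPolynomial.T (s (w.symm x) - s (w.symm x)) *
      X.1.mat (w.symm x) (w.symm x) = ∑ x, X.1.mat x x
    simp only [sub_self, LaurentPolynomial.T_zero, one_mul]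
    exact Equiv.sum_comp w.symm fun x => X.1.mat x x⟩
  map_add' X Y := Subtype.ext (map_add (affineMap w s) X.1 Y.1)
  map_smul' z X := Subtype.ext (map_smul (affineMap w s) z X.1)
  map_lie' {X Y} := Subtype.ext (LieHom.map_lie (affineMap w s) X.1 Y.1)

theorem affineMapSL_hElem {m : ℕ} (w : Equiv.Perm (Fin m)) (s : Fin m → ℤ) (a b : Fin m) (i : ℤ) :
    affineMapSL w s (hElem a b i).1 = (hElem (w a) (w b) (i + s a - s b)).1 := by
  apply Subtype.ext
  ext1
  · change (Matrix.of fun x y => LaurentPolynomial.T (s (w.symm x) - s (w.symm y)) *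
      (hElem a b i).1.1.mat (w.symm x) (w.symm y)) = _
    rw [mat_hElem, mat_hElem]
    ext1 x y
    by_cases h : x = y
    · subst h
      simp [Equiv.symm_apply_eq]
    · simp [h]
  · change (hElem a b i).1.1.cen + ∑ d, (s d : ℂ) * ((hElem a b i).1.1.mat d d).coeff 0 = _
    have hcen : ∀ (a b : Fin m) (i : ℤ), (hElem a b i).1.1.cen = i := by
      intro a b i
      change (0 : ℂ) - 0 + (i : ℂ) • (1 : ℂ) = i
      simp
    rw [hcen, hcen, mat_hElem]
    simp only [Matrix.diagonal_apply_eq, LaurentPolynomial.C_apply, if_true, mul_sub,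
      Finset.sum_sub_distrib, mul_ite, mul_one, mul_zero, Finset.sum_ite_eq', Finset.mem_univ]
    push_cast
    ring

/-- The action on `U(𝔰𝔩̂ₘ)`. -/
def affineMapU {m : ℕ} (w : Equiv.Perm (Fin m)) (s : Fin m → ℤ) : U m →ₐ[ℂ] U m :=
  UniversalEnvelopingAlgebra.lift ℂ ((UniversalEnvelopingAlgebra.ι ℂ).comp (affineMapSL w s))

theorem affineMapU_ι {m : ℕ} (w : Equiv.Perm (Fin m)) (s : Fin m → ℤ) (X : affineSL m) :
    affineMapU w s (UniversalEnvelopingAlgebra.ι ℂ X) =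
      UniversalEnvelopingAlgebra.ι ℂ (affineMapSL w s X) :=
  UniversalEnvelopingAlgebra.lift_ι_apply _ _ _

theorem affineMapU_mem {m : ℕ} (w : Equiv.Perm (Fin m)) (s : Fin m → ℤ) (d : S m) :
    affineMapU w s d ∈ S m := by
  have h : S m ≤ (S m).comap (affineMapU w s) := by
    rw [S_eq_closure, Submonoid.closure_le, ← S_eq_closure]
    rintro _ ⟨_, ⟨a, b, i, j, hab, rfl⟩, rfl⟩
    refine ⟨_, Submonoid.subset_closure
      ⟨w a, w b, i + s a - s b, j, fun h => hab (w.injective h), rfl⟩, ?_⟩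
    rw [map_add, map_add, map_add, AlgHom.commutes, AlgHom.commutes, UhToU_ι, UhToU_ι,
      affineMapU_ι, affineMapSL_hElem]
  exact h d.2

theorem isUnit_affineMapU {m : ℕ} (w : Equiv.Perm (Fin m)) (s : Fin m → ℤ) (d : S m) :
    IsUnit (((numer m).comp (affineMapU w s)) d) :=
  OreLocalization.numerator_isUnit (S := S m) ⟨_, affineMapU_mem w s d⟩

/-- The action on `Ū(𝔰𝔩̂ₘ)`. -/
def affineMapUbar {m : ℕ} (w : Equiv.Perm (Fin m)) (s : Fin m → ℤ) : Ubar m →ₐ[ℂ] Ubar m :=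
  { oreLift ((numer m).comp (affineMapU w s)).toRingHom (isUnit_affineMapU w s) with
    commutes' := fun z => (oreLift_numerator _ (isUnit_affineMapU w s) _).trans
      (AlgHom.commutes ((numer m).comp (affineMapU w s)) z) }

/-- The action on `𝔓_N ⊗ (ℂᵐ)^{⊗N}` induced by the map `e_a tⁱ ↦ e_{w(a)} t^{i + s_a}` on each
of the `N` tensor factors `ℂᵐ[t, t⁻¹]`. -/
def affineMapP {m : ℕ} (N : ℕ) (w : Equiv.Perm (Fin m)) (s : Fin m → ℤ) : Module.End ℂ (P m N) :=
  opOfBasis fun k => basisP (fun q => k.1 q + s (k.2 q), fun q => w (k.2 q))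

section nodes

variable {m : ℕ} [NeZero m] (N : ℕ) (c : Fin m)

/-- The action of `τ_c` on `B̄`. -/
def tauBbar : Module.End ℂ (Bbar m N) :=
  TensorProduct.map (affineMapP N (tauPerm c) (tauShift c))
    (affineMapUbar (tauPerm c) (tauShift c)).toLinearMap

/-! ### The Chevalley generators and the maps `ξ_c` -/

/-- The degree in `t` of `E_c`: this is `1` for `c = 0` and `0` otherwise. -/
def nodeDeg : ℤ := if c = 0 then 1 else 0

/-- The element `E_c` in `U(𝔰𝔩̂ₘ)`. -/
def chevE : U m := UniversalEnvelopingAlgebra.ι ℂ (slE (c - 1) c (nodeDeg c))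

/-- The element `F_c` in `U(𝔰𝔩̂ₘ)`. -/
def chevF : U m := UniversalEnvelopingAlgebra.ι ℂ (slE c (c - 1) (-nodeDeg c))

/-- The element `H_c` in `𝔥̂`. -/
def chevH : hhat m := hElem (c - 1) c (nodeDeg c)

/-- The functional `ε_c` on `𝔥̂`. -/
def epsilon : hhat m →ₗ[ℂ] ℂ := diagCoord (c - 1) - diagCoord c

/-- The adjoint action of `F_c` on `B`. -/
def adF : Module.End ℂ (B m N) := diagActU N (FU m) (chevF c) - rightU N (chevF c)

end nodes

theorem sub_one_ne {m : ℕ} [m.AtLeastTwo] (c : Fin m) : c - 1 ≠ c := by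
  intro h
  have h1 : (1 : Fin m) = 0 := by simpa using h
  have h2 := congrArg Fin.val h1
  have h3 : 2 ≤ m := Nat.AtLeastTwo.prop
  rw [Fin.val_zero, Fin.coe_ofNat_eq_mod, Nat.mod_eq_of_lt (by omega)] at h2
  omega

section nodes

variable {m : ℕ} [m.AtLeastTwo] (N : ℕ) (c : Fin m)

/-- The element `H_c (H_c - 1) ⋯ (H_c - n + 1)`, as an element of the set of denominators. -/
def fallingH (n : ℕ) : S m :=
  ⟨UhToU m (∏ j ∈ Finset.range n,
      (UniversalEnvelopingAlgebra.ι ℂ (chevH c) - algebraMap ℂ (Uh m) j)), by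
    refine Submonoid.mem_map_of_mem _ ((Sh m).prod_mem fun j _ => Submonoid.subset_closure
      ⟨c - 1, c, nodeDeg c, -(j : ℤ), sub_one_ne c, ?_⟩)
    rw [chevH, Int.cast_neg, map_neg, sub_eq_add_neg, Int.cast_natCast]⟩

/-- The map sending `Y ∈ B` to
`(n! H_c (H_c - 1) ⋯ (H_c - n + 1))⁻¹ E_c^n ad_{F_c}^n (Y) ∈ B̄`. -/
def xiTerm (n : ℕ) : B m N →ₗ[ℂ] Bbar m N :=
  ((n.factorial : ℂ)⁻¹ • leftUbar m N (chevE c ^ n /ₒ fallingH c n)) ∘ₗ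
    LinearMap.lTensor (P m N) (numer m).toLinearMap ∘ₗ adF N c ^ n

end nodes

/-- The linear map `f` is the sum of the locally finite series `∑_n t n`. -/
def IsLocallyFiniteSum {V W : Type} [AddCommGroup V] [Module ℂ V] [AddCommGroup W] [Module ℂ W]
    (t : ℕ → V →ₗ[ℂ] W) (f : V →ₗ[ℂ] W) : Prop :=
  ∀ y, ∀ᶠ K in atTop, f y = ∑ n ∈ Finset.range K, t n y

/-! ### The Zhelobenko operators -/

/-- The subspace `J̄ = 𝔫̂ B̄` of `B̄`. -/
def Jbar (m N : ℕ) : Submodule ℂ (Bbar m N) :=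
  Submodule.span ℂ {y | ∃ X ∈ nhat m, ∃ z,
    y = leftUbar m N (numer m (UniversalEnvelopingAlgebra.ι ℂ X)) z}

/-- The subspace `J̄' = B̄ 𝔫̂'` of `B̄`. -/
def Jbar' (m N : ℕ) : Submodule ℂ (Bbar m N) :=
  Submodule.span ℂ {y | ∃ X ∈ nhat' m, ∃ z,
    y = rightUbar N (numer m (UniversalEnvelopingAlgebra.ι ℂ X)) z}

/-- The subspace `Ī = B̄ (C - ℓ)` of `B̄`. -/
def Ibar (m N : ℕ) (l : ℂ) : Submodule ℂ (Bbar m N) :=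
  Submodule.span ℂ {y | ∃ z, y = rightUbar N
    (numer m (UniversalEnvelopingAlgebra.ι ℂ (slC m) - algebraMap ℂ (U m) l)) z}

/-- The homomorphism `Ū(𝔥̂) → Ū(𝔰𝔩̂ₘ)` given by the inclusion `𝔥̂ ⊂ 𝔰𝔩̂ₘ`. -/
def UhbarToUbar (m : ℕ) : Uhbar m →+* Ubar m :=
  oreLift ((numer m).comp (UhToU m)).toRingHom fun d =>
    OreLocalization.numerator_isUnit (S := S m) ⟨_, d, d.2, rfl⟩

theorem diagCoord_hElem {m : ℕ} (d a b : Fin m) (i : ℤ) : diagCoord d (hElem a b i) =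
    (((if d = a then 1 else 0) - (if d = b then 1 else 0) : ℤ) : ℂ) := by
  change ((hElem a b i).1.1.mat d d).coeff 0 = _
  rw [mat_hElem, Matrix.diagonal_apply_eq, LaurentPolynomial.C_apply, if_pos rfl]
  push_cast
  rfl

section nodes

variable {m : ℕ} [NeZero m] (c : Fin m)

/-- The automorphism `X ↦ X + ε_c(X)` of `U(𝔥̂)`: adding `ε_c` to the argument of polynomial
functions on the dual space of `𝔥̂`. -/
def shiftUh : Uh m →ₐ[ℂ] Uh m :=
  UniversalEnvelopingAlgebra.lift ℂ
    { toFun := fun X => UniversalEnvelopingAlgebra.ι ℂ X + algebraMap ℂ (Uh m) (epsilon c X)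
      map_add' := fun X Y => by simp only [map_add]; abel
      map_smul' := fun z X => by
        simp only [map_smul, smul_eq_mul, map_mul, Algebra.smul_def, RingHom.id_apply]
        exact (mul_add (R := Uh m) _ _ _).symm
      map_lie' := fun {X Y} => by
        change UniversalEnvelopingAlgebra.ι ℂ ⁅X, Y⁆ + algebraMap ℂ (Uh m) (epsilon c ⁅X, Y⁆) = _
        rw [lie_hhat, map_zero, map_zero, map_zero, add_zero]
        exact (sub_eq_zero.mpr (mul_comm (G := Uh m) _ _)).symm }

theorem shiftUh_ι (X : hhat m) : shiftUh c (UniversalEnvelopingAlgebra.ι ℂ X) =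
    UniversalEnvelopingAlgebra.ι ℂ X + algebraMap ℂ (Uh m) (epsilon c X) :=
  UniversalEnvelopingAlgebra.lift_ι_apply _ _ _

theorem shiftUh_mem (d : Sh m) : shiftUh c d ∈ Sh m := by
  have h : Sh m ≤ (Sh m).comap (shiftUh c) := by
    refine Submonoid.closure_le.mpr ?_
    rintro _ ⟨a, b, i, j, hab, rfl⟩
    refine Submonoid.subset_closure ⟨a, b, i, j +
      (((if c - 1 = a then 1 else 0) - (if c - 1 = b then 1 else 0)) -
        ((if c = a then 1 else 0) - (if c = b then 1 else 0))), hab, ?_⟩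
    rw [map_add, AlgHom.commutes, shiftUh_ι, epsilon, LinearMap.sub_apply, diagCoord_hElem,
      diagCoord_hElem, ← Int.cast_sub, add_assoc, ← map_add, ← Int.cast_add, add_comm j]
  exact h d.2

/-- The automorphism of `Ū(𝔥̂)` adding `ε_c` to the argument of rational functions on the dual
space of `𝔥̂`. -/
def shiftUhbar : Uhbar m →+* Uhbar m :=
  oreLift (OreLocalization.numeratorRingHom.comp (shiftUh c).toRingHom) fun d =>
    OreLocalization.numerator_isUnit (S := Sh m) ⟨_, shiftUh_mem c d⟩

end nodes

section nodes

variable {m N : ℕ} [m.AtLeastTwo] (c : Fin m)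

/-- The linear map `ξ` is the map `ξ_c : B → B̄`,
`ξ_c(Y) = Y + ∑_{n ≥ 1} (n! H_c (H_c - 1) ⋯ (H_c - n + 1))⁻¹ E_c^n ad_{F_c}^n (Y)`. -/
def IsXi (ξ : B m N →ₗ[ℂ] Bbar m N) : Prop :=
  IsLocallyFiniteSum (xiTerm N c) ξ

/-- The linear map `ξbar` is the map `B̄ → B̄ / J̄` determined by the map `ξ = ξ_c`, that is
`Y A ↦ ξ_c(Y) Z + J̄` for `Y ∈ B` and `A ∈ Ū(𝔥̂)`, where `Z` is obtained from `A` by adding `ε_c`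
to the argument of the rational function. -/
def IsXiBar (ξ : B m N →ₗ[ℂ] Bbar m N) (ξbar : Bbar m N →ₗ[ℂ] Bbar m N ⧸ Jbar m N) : Prop :=
  ∀ (Y : B m N) (A : Uhbar m),
    ξbar (rightUbar N (UhbarToUbar m A) (LinearMap.lTensor (P m N) (numer m).toLinearMap Y)) =
      (Jbar m N).mkQ (rightUbar N (UhbarToUbar m (shiftUhbar c A)) (ξ Y))

/-- The linear map `η` is the Zhelobenko operator `η_c` on `B̄ / J̄`, that is the composition of
the map `B̄ → B̄ / J̄` determined by `ξ_c` with the action of `τ_c` on `B̄`. -/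
def IsZhelobenko (η : Module.End ℂ (Bbar m N ⧸ Jbar m N)) : Prop :=
  ∃ (ξ : B m N →ₗ[ℂ] Bbar m N) (ξbar : Bbar m N →ₗ[ℂ] Bbar m N ⧸ Jbar m N),
    IsXi c ξ ∧ IsXiBar c ξ ξbar ∧ ∀ y, η ((Jbar m N).mkQ y) = ξbar (tauBbar N c y)

end nodes

/-- The quotient `B̄ / (J̄ + J̄' + Ī)`. -/
abbrev Q (m N : ℕ) (l : ℂ) : Type := Bbar m N ⧸ (Jbar m N ⊔ Jbar' m N ⊔ Ibar m N l)

/-- The projection `B̄ / J̄ → B̄ / (J̄ + J̄' + Ī)`. -/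
def projQ (m N : ℕ) (l : ℂ) : (Bbar m N ⧸ Jbar m N) →ₗ[ℂ] Q m N l :=
  Submodule.factor (le_sup_left.trans le_sup_left)

/-! ### The universal Verma module and the coinvariants -/

/-- The left ideal of `Ū(𝔰𝔩̂ₘ)` generated by `𝔫̂'` and by the element `C - ℓ`. -/
def vermaIdeal (m : ℕ) (l : ℂ) : Submodule (Ubar m) (Ubar m) :=
  Submodule.span (Ubar m)
    ({A | ∃ X ∈ nhat' m, A = numer m (UniversalEnvelopingAlgebra.ι ℂ X)} ∪
      {numer m (UniversalEnvelopingAlgebra.ι ℂ (slC m) - algebraMap ℂ (U m) l)})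

/-- The universal Verma module of level `ℓ` (over `Ū(𝔰𝔩̂ₘ)`). -/
abbrev Verma (m : ℕ) (l : ℂ) : Type := Ubar m ⧸ vermaIdeal m l

/-- The projection of `Ū(𝔰𝔩̂ₘ)` onto the universal Verma module. -/
def vermaMk (m : ℕ) (l : ℂ) : Ubar m →ₗ[ℂ] Verma m l := (vermaIdeal m l).mkQ.restrictScalars ℂ

/-- The action of `U(𝔰𝔩̂ₘ)` on the universal Verma module. -/
def FVerma (m : ℕ) (l : ℂ) : U m →ₐ[ℂ] Module.End ℂ (Verma m l) :=
  (Algebra.lsmul ℂ ℂ (Verma m l)).comp (numer m)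

/-- The space `W = 𝔓_N ⊗ (ℂᵐ)^{⊗N} ⊗ V` where `V` is the universal Verma module of level `ℓ`. -/
abbrev W (m N : ℕ) (l : ℂ) : Type := P m N ⊗[ℂ] Verma m l

/-- The subspace `𝔫̂ W` of `W`. -/
def nW (m N : ℕ) (l : ℂ) : Submodule ℂ (W m N l) :=
  Submodule.span ℂ {w | ∃ X ∈ nhat m, ∃ v, w = diagAct N (FVerma m l) X v}

/-- The space of `𝔫̂`-coinvariants of `W`. -/
abbrev Coinv (m N : ℕ) (l : ℂ) : Type := W m N l ⧸ nW m N l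

/-! ### The trigonometric Cherednik algebra -/

/-- The generators of the trigonometric Cherednik algebra. -/
inductive CherednikGen (N : ℕ) : Type
  | s (σ : Equiv.Perm (Fin N))
  | u (p : Fin N)
  | x (p : Fin N)
  | xinv (p : Fin N)

namespace CherednikGen

variable {N : ℕ}

/-- The generator `σ`, as an element of the free algebra. -/
def fs (σ : Equiv.Perm (Fin N)) : FreeAlgebra ℂ (CherednikGen N) := FreeAlgebra.ι ℂ (s σ)

/-- The generator `u_p`, as an element of the free algebra. -/
def fu (p : Fin N) : FreeAlgebra ℂ (CherednikGen N) := FreeAlgebra.ι ℂ (u p)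

/-- The generator `x_p`, as an element of the free algebra. -/
def fx (p : Fin N) : FreeAlgebra ℂ (CherednikGen N) := FreeAlgebra.ι ℂ (x p)

/-- The generator `x_p⁻¹`, as an element of the free algebra. -/
def fxinv (p : Fin N) : FreeAlgebra ℂ (CherednikGen N) := FreeAlgebra.ι ℂ (xinv p)

/-- The element `z_p = u_p - ∑_{q < p} σ_qp`. -/
def fz (p : Fin N) : FreeAlgebra ℂ (CherednikGen N) :=
  fu p - ∑ q ∈ Finset.univ.filter (· < p), fs (Equiv.swap q p)

/-- The defining relations of the trigonometric Cherednik algebra. -/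
inductive Rel (κ : ℂ) :
    FreeAlgebra ℂ (CherednikGen N) → FreeAlgebra ℂ (CherednikGen N) → Prop
  | s_one : Rel κ (fs 1) 1
  | s_mul (σ τ : Equiv.Perm (Fin N)) : Rel κ (fs (σ * τ)) (fs σ * fs τ)
  | u_comm (p q : Fin N) : Rel κ (fu p * fu q) (fu q * fu p)
  | s_u (p p' q : Fin N) (hp : p'.val = p.val + 1) (hq : q ≠ p) (hq' : q ≠ p') :
      Rel κ (fs (Equiv.swap p p') * fu q) (fu q * fs (Equiv.swap p p'))
  | s_u_same (p p' : Fin N) (hp : p'.val = p.val + 1) :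
      Rel κ (fs (Equiv.swap p p') * fu p) (fu p' * fs (Equiv.swap p p') - 1)
  | x_comm (p q : Fin N) : Rel κ (fx p * fx q) (fx q * fx p)
  | x_xinv (p : Fin N) : Rel κ (fx p * fxinv p) 1
  | xinv_x (p : Fin N) : Rel κ (fxinv p * fx p) 1
  | s_x (σ : Equiv.Perm (Fin N)) (p : Fin N) : Rel κ (fs σ * fx p) (fx (σ p) * fs σ)
  | z_x (p q : Fin N) (hpq : q ≠ p) :
      Rel κ (fz p * fx q - fx q * fz p) (-(fx p * fs (Equiv.swap p q)))
  | z_x_same (p : Fin N) :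
      Rel κ (fz p * fx p - fx p * fz p)
        (κ • fx p + ∑ r ∈ Finset.univ.filter (· ≠ p), fx p * fs (Equiv.swap p r))

end CherednikGen

/-- The trigonometric Cherednik algebra `ℭ_N` with the parameter `κ`. -/
abbrev Cherednik (N : ℕ) (κ : ℂ) : Type := RingQuot (CherednikGen.Rel (N := N) κ)

namespace Cherednik

/-- The projection from the free algebra. -/
def mk (N : ℕ) (κ : ℂ) : FreeAlgebra ℂ (CherednikGen N) →ₐ[ℂ] Cherednik N κ :=
  RingQuot.mkAlgHom ℂ _

/-- The permutation `σ` in `ℭ_N`. -/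
def s {N : ℕ} (κ : ℂ) (σ : Equiv.Perm (Fin N)) : Cherednik N κ := mk N κ (CherednikGen.fs σ)

/-- The generator `x_p` of `ℭ_N`. -/
def x {N : ℕ} (κ : ℂ) (p : Fin N) : Cherednik N κ := mk N κ (CherednikGen.fx p)

/-- The generator `x_p⁻¹` of `ℭ_N`. -/
def xinv {N : ℕ} (κ : ℂ) (p : Fin N) : Cherednik N κ := mk N κ (CherednikGen.fxinv p)

/-- The element `z_p` of `ℭ_N`. -/
def z {N : ℕ} (κ : ℂ) (p : Fin N) : Cherednik N κ := mk N κ (CherednikGen.fz p)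

end Cherednik

section action

variable {m : ℕ} [NeZero m] {N : ℕ} {V : Type} [AddCommGroup V] [Module ℂ V]

/-- The summand of the Cherednik operator with the index `i`,
`x_p^{-i} ⊗ (∑_{a,b} E_ab^{(p)} ⊗ E_ba tⁱ - (1/m) id ⊗ I tⁱ)`. It is written as
`x_p^{-i} ⊗ ∑_{a,b} E_ab^{(p)} ⊗ (E_ba - δ_ab I / m) tⁱ`, so that only the action of `𝔰𝔩̂ₘ` on `V`
is needed. -/
def cherednikTerm (F : U m →ₐ[ℂ] Module.End ℂ V) (p : Fin N) (i : ℕ) :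
    Module.End ℂ (P m N ⊗[ℂ] V) :=
  ∑ a, ∑ b, TensorProduct.map (xOp p (-(i : ℤ)) * EOp p a b)
    (F (UniversalEnvelopingAlgebra.ι ℂ (slE b a i)))

/-- The operator `κ x_p ∂_p ⊗ id + ∑_{r ≠ p} x_p / (x_p - x_r) (1 - σ_pr) ⊗ σ_pr` on
`𝔓_N ⊗ (ℂᵐ)^{⊗N}`. -/
def dunklPart (κ : ℂ) (p : Fin N) : Module.End ℂ (P m N) :=
  κ • eulerOp p + ∑ r ∈ Finset.univ.filter (· ≠ p), dunklOp p r

/-- The homomorphism `ρ` is the action of the trigonometric Cherednik algebra on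
`𝔓_N ⊗ (ℂᵐ)^{⊗N} ⊗ V` where `V` is a module over `𝔰𝔩̂ₘ` given by `F`: the elements `x_p` and
`x_p⁻¹` act by multiplication, permutations act simultaneously on the variables and on the
tensor factors `ℂᵐ`, and `z_p` acts as the Cherednik operator (where the sum over `i ≥ 0` has
only finitely many non-zero terms on every vector). -/
def IsCherednikAction (κ : ℂ) (F : U m →ₐ[ℂ] Module.End ℂ V)
    (ρ : Cherednik N κ →ₐ[ℂ] Module.End ℂ (P m N ⊗[ℂ] V)) : Prop :=
  (∀ p, ρ (Cherednik.x κ p) = LinearMap.rTensor V (xOp p 1)) ∧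
  (∀ p, ρ (Cherednik.xinv κ p) = LinearMap.rTensor V (xOp p (-1))) ∧
  (∀ σ, ρ (Cherednik.s κ σ) = LinearMap.rTensor V (permOp σ)) ∧
  ∀ p, IsLocallyFiniteSum (cherednikTerm F p)
    (ρ (Cherednik.z κ p) - LinearMap.rTensor V (dunklPart κ p))

end action

end Zhel

end

open Zhel

/-!
The operator `ad_{F_c}` is locally nilpotent on `B` (`adAct_locally_nilpotent`), so `ξ_c` is a
locally finite sum. Modulo `J̄` it is equivariant for the right action of `U(𝔥̂)` up to the shift by
`ε_c` (`mkQ_xi_rightU`), because `[F_c, H] = ε_c(H) F_c` and the resulting sum telescopes. The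
denominators also form a right Ore set, and their shifted right action on `B̄ / J̄` is invertible,
so `ξ_c` extends to `B̄` (`exists_extension`, `exists_isXiBar`).

The transformation `τ_c` permutes the root vectors of `𝔫̂` other than `F_c` and those of `𝔫̂'` other
than `E_c`, and it interchanges `E_c` and `F_c`. On the other hand, `ξ_c` sends to `J̄` the
subspaces `E_c B` and `B F_c` (`mkQ_xi_nodeE`, `mkQ_xi_rightU_nodeF`; two more telescoping sums), it
sends `X B` to `J̄` for the remaining root vectors `X` of `𝔫̂`, and `B X` to `J̄'` for the remaining
root vectors `X` of `𝔫̂'` (`mkQ_xi_negSpan`, `xi_rightU_posSpan`). Therefore `η_c` is well defined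
and preserves the images of `J̄'` and `Ī`. The isomorphism with the coinvariants is the right
exactness of the tensor product (`ker_toW`, `toW_mem_nW_iff`).

The operators `z_p` exist on the tensor product with any smooth module over `𝔰𝔩̂ₘ`. The relations of
`z_p` with the variables and the permutations are properties of Dunkl operators. They imply that the
difference of the two sides of `[z_p, z_q] = σ_pq (z_p - z_q)` commutes with multiplication by the
variables (`CherednikRel.zDefect_commute`). It is therefore enough to evaluate this difference on
vectors that do not depend on the variables, where it vanishes by the classical Yang–Baxter equation
for the currents (`curr_commutator`, `zDefect_zOp_const`). The relation implies the commutativity of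
the `u_p` (`commute_z_add_jucysMurphy`).

The operators `z_p` commute with `𝔰𝔩ₘ`. Modulo the image of `𝔫̂`, they also commute with `t⁻¹ 𝔰𝔩ₘ`:
the central term is proportional to the level `ℓ`, the derivative contributes `-κ`, the boundary
term of the sum of currents contributes `m`, and these cancel since `ℓ = κ - m`
(`zOp_diagAct_sub_mem`). As `t⁻¹ 𝔰𝔩ₘ` generates the rest of `𝔫̂`, the action descends to the
coinvariants (`map_nSub_le`).

An operator on `B̄` that preserves the image of `B` and commutes with `E_c`, `F_c`, `τ_c` and the
right action commutes with all the ingredients of `η_c` (`IsCompatible`,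
`zhelobenkoQ_commute_of_rep`). For `x_p` and the permutations this is immediate. The operator `z_p`
is not defined on `B̄`, but on any two given vectors of the quotient it is induced by a truncated
sum `zTrunc`, and for `c ≠ 0` the truncated sum is compatible, as it is invariant under `𝔰𝔩ₘ` and
under the permutations of the basis of `ℂᵐ`. For `c = 0` the truncated sum is replaced by its
conjugate by the translation that multiplies the last basis vector of `ℂᵐ` by `t` and carries
constant root vectors to `E_0` and `F_0` (`affBbar_mul_zTrunc`, `isCompatible_zTrunc_add_zCorr`). On
the coinvariants this conjugation changes `z_p` only by the scalar `-κ / m` (`mkQ_zCorr`), again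
because of the relation between the level and `κ`; a scalar does not affect the commutation with
`T`.
-/

open Filter
open scoped TensorProduct LaurentPolynomial

noncomputable section

namespace Zhel

attribute [local instance 100] LieRing.ofAssociativeRing

/-! ### Operators on `𝔓_N ⊗ (ℂᵐ)^{⊗N}` -/

/-- The commutator of a Dunkl operator with a variable, after multiplication by the denominator: `x`
and `y` play the roles of `x_p` and `x_r`, and `d` that of `x (x - y)⁻¹ (t - s)`. The factor `x - y`
is cancelled later by `xOp_sub_xOp_cancel`. -/
theorem sub_mul_commutator_right {R : Type*} [Ring R] {x y d t s : R} (hxy : Commute x y)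
    (ht : Commute t y) (hs : s * y = x * s) (h : (x - y) * d = x * (t - s)) :
    (x - y) * (d * y - y * d) = (x - y) * -(x * s) := by
  have hc : (x - y) * (y * d) = y * ((x - y) * d) := by
    rw [← mul_assoc, ← mul_assoc, sub_mul, mul_sub, hxy.eq]
  rw [mul_sub, hc, ← mul_assoc, h, mul_assoc, sub_mul, ht.eq, hs, ← mul_assoc y x, ← hxy.eq,
    mul_neg, sub_mul, ← mul_assoc y x, ← hxy.eq]
  noncomm_ring

theorem sub_mul_commutator_left {R : Type*} [Ring R] {x y d t s : R} (hxy : Commute x y)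
    (ht : Commute t x) (hs : s * x = y * s) (h : (x - y) * d = x * (t - s)) :
    (x - y) * (d * x - x * d) = (x - y) * (x * s) := by
  have hc : (x - y) * (x * d) = x * ((x - y) * d) := by
    rw [← mul_assoc, ← mul_assoc, sub_mul, mul_sub, hxy.eq]
  rw [mul_sub, hc, ← mul_assoc, h, mul_assoc, sub_mul, ht.eq, hs, sub_mul, ← mul_assoc y x,
    ← hxy.eq]
  noncomm_ring

theorem sub_mul_commutator {R : Type*} [Ring R] {x y d t s X Y : R} (hx : Commute x X)
    (hy : Commute y X) (hs : Commute s X) (h : (x - y) * d = x * (t - s))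
    (hY : x * (t * X - X * t) = (x - y) * Y) : (x - y) * (d * X - X * d) = (x - y) * Y := by
  have hc : (x - y) * (X * d) = X * ((x - y) * d) := by
    rw [← mul_assoc, ← mul_assoc, sub_mul, mul_sub, hx.eq, hy.eq]
  rw [← hY, mul_sub, hc, ← mul_assoc, h, ← mul_assoc X x, ← hx.eq, mul_assoc, mul_assoc, sub_mul,
    hs.eq]
  noncomm_ring

section OperatorsOnP

variable {m N : ℕ}

theorem xOp_basisP (p : Fin N) (j : ℤ) (k : Mon m N) :
    xOp p j (basisP k) = basisP (Function.update k.1 p (k.1 p + j), k.2) :=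
  opOfBasis_basisP _ _

theorem EOp_basisP (p : Fin N) (a b : Fin m) (k : Mon m N) :
    EOp p a b (basisP k) =
      if k.2 p = b then basisP (k.1, Function.update k.2 p a) else 0 :=
  opOfBasis_basisP _ _

theorem permOp_basisP (σ : Equiv.Perm (Fin N)) (k : Mon m N) :
    permOp σ (basisP k) = basisP (k.1 ∘ σ.symm, k.2 ∘ σ.symm) :=
  opOfBasis_basisP _ _

theorem tensorPermOp_basisP (σ : Equiv.Perm (Fin N)) (k : Mon m N) :
    tensorPermOp σ (basisP k) = basisP (k.1, k.2 ∘ σ.symm) :=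
  opOfBasis_basisP _ _

theorem eulerOp_basisP (p : Fin N) (k : Mon m N) :
    eulerOp p (basisP k) = (k.1 p : ℂ) • basisP k :=
  opOfBasis_basisP _ _

theorem permOp_one : permOp (m := m) (1 : Equiv.Perm (Fin N)) = 1 :=
  opP_ext fun k => by rw [permOp_basisP]; rfl

theorem permOp_mul (σ τ : Equiv.Perm (Fin N)) :
    permOp (m := m) (σ * τ) = permOp σ * permOp τ :=
  opP_ext fun k => by rw [Module.End.mul_apply]; simp only [permOp_basisP]; rfl

theorem update_comp_symm {α : Type*} (σ : Equiv.Perm (Fin N)) (f : Fin N → α) (p : Fin N) (y : α) :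
    Function.update f p y ∘ σ.symm = Function.update (f ∘ σ.symm) (σ p) y := by
  ext q
  simp [Function.update_apply, Equiv.symm_apply_eq]

theorem permOp_mul_xOp (σ : Equiv.Perm (Fin N)) (p : Fin N) (j : ℤ) :
    permOp (m := m) σ * xOp p j = xOp (σ p) j * permOp σ :=
  opP_ext fun k => by
    simp only [Module.End.mul_apply, permOp_basisP, xOp_basisP, update_comp_symm]
    simp

theorem permOp_mul_EOp (σ : Equiv.Perm (Fin N)) (p : Fin N) (a b : Fin m) :
    permOp σ * EOp p a b = EOp (σ p) a b * permOp σ :=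
  opP_ext fun k => by
    simp only [Module.End.mul_apply, permOp_basisP, EOp_basisP]
    split_ifs with h1 h2 h2
    · simp only [permOp_basisP, update_comp_symm]
    · simp [h1] at h2
    · simp [h1] at h2
    · simp

theorem permOp_mul_eulerOp (σ : Equiv.Perm (Fin N)) (p : Fin N) :
    permOp (m := m) σ * eulerOp p = eulerOp (σ p) * permOp σ :=
  opP_ext fun k => by
    simp only [Module.End.mul_apply, permOp_basisP, eulerOp_basisP, map_smul]
    simp

theorem permOp_mul_tensorPermOp (σ τ : Equiv.Perm (Fin N)) :
    permOp (m := m) σ * tensorPermOp τ = tensorPermOp (σ * τ * σ⁻¹) * permOp σ :=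
  opP_ext fun k => by
    simp only [Module.End.mul_apply, permOp_basisP, tensorPermOp_basisP]
    congr 2
    ext q
    rw [← Equiv.Perm.inv_def, ← Equiv.Perm.inv_def, ← Equiv.Perm.inv_def]
    simp

theorem tensorPermOp_commute_xOp (σ : Equiv.Perm (Fin N)) (p : Fin N) (j : ℤ) :
    Commute (tensorPermOp (m := m) σ) (xOp p j) :=
  opP_ext fun k => by
    simp only [Module.End.mul_apply, tensorPermOp_basisP, xOp_basisP]

theorem tensorPermOp_mul_EOp (σ : Equiv.Perm (Fin N)) (p : Fin N) (a b : Fin m) :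
    tensorPermOp σ * EOp p a b = EOp (σ p) a b * tensorPermOp σ :=
  opP_ext fun k => by
    simp only [Module.End.mul_apply, tensorPermOp_basisP, EOp_basisP]
    split_ifs with h1 h2 h2
    · simp only [tensorPermOp_basisP, update_comp_symm]
    · simp [h1] at h2
    · simp [h1] at h2
    · simp

theorem sum_EOp_diag (p : Fin N) : ∑ a, EOp (m := m) p a a = 1 :=
  opP_ext fun k => by
    simp [LinearMap.sum_apply, EOp_basisP]

/-- The transposition of two tensor factors in terms of matrix units. -/
theorem tensorPermOp_swap_eq_sum {p q : Fin N} (hpq : p ≠ q) :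
    tensorPermOp (m := m) (Equiv.swap p q) = ∑ a, ∑ b, EOp p a b * EOp q b a :=
  opP_ext fun k => by
    simp only [LinearMap.sum_apply, Module.End.mul_apply, tensorPermOp_basisP, EOp_basisP]
    rw [Finset.sum_eq_single (k.2 q), Finset.sum_eq_single (k.2 p)]
    · simp only [if_true, EOp_basisP, Function.update_of_ne hpq]
      congr 2
      ext r
      by_cases h : r = p
      · subst h; simp
      · by_cases h' : r = q
        · subst h'; rw [Function.update_of_ne h]; simp
        · simp [h, h', Equiv.swap_apply_of_ne_of_ne]
    · intro b _ hb
      simp [EOp_basisP, hpq, Ne.symm hb]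
    · simp
    · intro a _ ha
      simp [Ne.symm ha]
    · simp

/-- Multiplying `tensorPermOp_swap_eq_sum` by a matrix unit. -/
theorem tensorPermOp_mul_EOp_eq_sum {p q : Fin N} (hpq : p ≠ q) (a b : Fin m) :
    tensorPermOp (Equiv.swap p q) * EOp p a b = ∑ c, EOp p c b * EOp q a c := by
  rw [tensorPermOp_swap_eq_sum hpq]
  simp only [Finset.sum_mul, mul_assoc, (EOp_commute hpq.symm _ _ _ _).eq]
  simp only [← mul_assoc, EOp_mul_EOp, ite_mul, zero_mul, Finset.sum_ite_eq',
    Finset.mem_univ, if_true]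

theorem eulerOp_mul_xOp (p q : Fin N) (j : ℤ) :
    eulerOp (m := m) p * xOp q j =
      xOp q j * eulerOp p + if p = q then (j : ℂ) • xOp q j else 0 :=
  opP_ext fun k => by
    simp only [Module.End.mul_apply, LinearMap.add_apply, eulerOp_basisP, xOp_basisP, map_smul]
    split_ifs with h
    · subst h
      rw [LinearMap.smul_apply, xOp_basisP, Function.update_self]
      push_cast
      rw [add_smul]
    · simp [h]

theorem eulerOp_commute_EOp (p q : Fin N) (a b : Fin m) :
    Commute (eulerOp p) (EOp q a b) :=
  opP_ext fun k => by
    simp only [Module.End.mul_apply, eulerOp_basisP, EOp_basisP, map_smul]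
    split_ifs
    · rw [eulerOp_basisP]
    · simp

theorem repr_xOp (p : Fin N) (j : ℤ) (f : P m N) (k : Mon m N) :
    (basisMon m N).repr (xOp p j f) k =
      (basisMon m N).repr f (Function.update k.1 p (k.1 p - j), k.2) := by
  have h : Finsupp.lapply k ∘ₗ (basisMon m N).repr.toLinearMap ∘ₗ xOp p j =
      Finsupp.lapply (Function.update k.1 p (k.1 p - j), k.2) ∘ₗ
        (basisMon m N).repr.toLinearMap := by
    refine (basisMon m N).ext fun l => ?_
    change (basisMon m N).repr (xOp p j (basisP l)) k =
      (basisMon m N).repr (basisMon m N l) (Function.update k.1 p (k.1 p - j), k.2)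
    rw [xOp_basisP, basisP, Module.Basis.repr_self, Module.Basis.repr_self,
      Finsupp.single_apply, Finsupp.single_apply]
    congr 1
    rw [eq_iff_iff]
    constructor
    · rintro rfl
      simp
    · rintro rfl
      simp
  exact LinearMap.congr_fun h f

/-- `𝔓_N ⊗ (ℂᵐ)^{⊗N}` has no torsion with respect to `x_p - x_r`: a vector killed by it would have
infinitely many equal coefficients. -/
theorem xOp_sub_xOp_injective {p r : Fin N} (hpr : p ≠ r) :
    Function.Injective (xOp p 1 - xOp r 1 : Module.End ℂ (P m N)) := by
  rw [injective_iff_map_eq_zero]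
  intro f hf
  rw [LinearMap.sub_apply, sub_eq_zero] at hf
  set g := (basisMon m N).repr f with hg
  have h1 : ∀ (i : Fin N → ℤ) (a : Fin N → Fin m),
      g (i, a) = g (Function.update (Function.update i p (i p + 1)) r (i r - 1), a) := by
    intro i a
    have := congrArg (fun y => (basisMon m N).repr y (Function.update i p (i p + 1), a)) hf
    simpa [repr_xOp, ← hg, Ne.symm hpr] using this
  have h2 : ∀ (n : ℕ) (i : Fin N → ℤ) (a : Fin N → Fin m),
      g (i, a) = g (Function.update (Function.update i p (i p + n)) r (i r - n), a) := by
    intro n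
    induction n with
    | zero => simp
    | succ n ih =>
      intro i a
      rw [h1, ih]
      congr 2
      ext q
      by_cases hq : q = r
      · subst hq; simp; ring
      · by_cases hq' : q = p
        · subst hq'; simp [hpr]; ring
        · simp [hq, hq']
  have h3 : g = 0 := by
    ext ⟨i, a⟩
    by_contra hne
    have hinj : Function.Injective fun n : ℕ => ((Function.update (Function.update i p (i p + n)) r
        (i r - n), a) : Mon m N) := by
      intro n n' h
      have := congrFun (congrArg Prod.fst h) r
      simpa using this
    refine Set.infinite_of_injective_forall_mem hinj (s := (g.support : Set (Mon m N))) ?_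
      g.support.finite_toSet
    intro n
    rw [Finset.mem_coe, Finsupp.mem_support_iff, ← h2]
    exact hne
  exact (basisMon m N).repr.map_eq_zero_iff.mp h3

theorem xOp_sub_xOp_cancel {p r : Fin N} (hpr : p ≠ r) {f g : Module.End ℂ (P m N)}
    (h : (xOp p 1 - xOp r 1) * f = (xOp p 1 - xOp r 1) * g) : f = g := by
  ext1 y
  exact xOp_sub_xOp_injective hpr (LinearMap.congr_fun h y)

theorem permOp_swap_mul_xOp (p r : Fin N) (j : ℤ) :
    permOp (m := m) (Equiv.swap p r) * xOp r j = xOp p j * permOp (Equiv.swap p r) := by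
  rw [permOp_mul_xOp, Equiv.swap_apply_right]

theorem permOp_swap_mul_xOp' (p r : Fin N) (j : ℤ) :
    permOp (m := m) (Equiv.swap p r) * xOp p j = xOp r j * permOp (Equiv.swap p r) := by
  rw [permOp_mul_xOp, Equiv.swap_apply_left]

theorem dunklOp_commute_xOp {p r q : Fin N} (hpr : p ≠ r) (hp : q ≠ p) (hr : q ≠ r) :
    Commute (dunklOp (m := m) p r) (xOp q 1) := by
  refine xOp_sub_xOp_cancel hpr ?_
  have hc : (xOp p 1 - xOp r 1 : Module.End ℂ (P m N)) * xOp q 1 =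
      xOp q 1 * (xOp p 1 - xOp r 1) := by
    rw [sub_mul, mul_sub, (xOp_commute p q 1 1).eq, (xOp_commute r q 1 1).eq]
  rw [← mul_assoc, ← mul_assoc, hc, mul_assoc (xOp q 1), dunklOp_spec p r hpr,
    mul_assoc, sub_mul, (tensorPermOp_commute_xOp _ _ _).eq, permOp_mul_xOp,
    Equiv.swap_apply_of_ne_of_ne hp hr, ← mul_sub, ← mul_assoc, ← mul_assoc,
    (xOp_commute p q 1 1).eq]

theorem dunklOp_mul_xOp_right {p r : Fin N} (hpr : p ≠ r) :
    dunklOp (m := m) p r * xOp r 1 - xOp r 1 * dunklOp p r =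
      -(xOp p 1 * permOp (Equiv.swap p r)) :=
  xOp_sub_xOp_cancel hpr (sub_mul_commutator_right (xOp_commute p r 1 1)
    (tensorPermOp_commute_xOp _ _ _) (permOp_swap_mul_xOp p r 1) (dunklOp_spec p r hpr))

theorem dunklOp_mul_xOp_left {p r : Fin N} (hpr : p ≠ r) :
    dunklOp (m := m) p r * xOp p 1 - xOp p 1 * dunklOp p r =
      xOp p 1 * permOp (Equiv.swap p r) :=
  xOp_sub_xOp_cancel hpr (sub_mul_commutator_left (xOp_commute p r 1 1)
    (tensorPermOp_commute_xOp _ _ _) (permOp_swap_mul_xOp' p r 1) (dunklOp_spec p r hpr))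

theorem permOp_mul_dunklOp (σ : Equiv.Perm (Fin N)) {p r : Fin N} (hpr : p ≠ r) :
    permOp (m := m) σ * dunklOp p r = dunklOp (σ p) (σ r) * permOp σ := by
  have hpr' : σ p ≠ σ r := fun h => hpr (σ.injective h)
  have hs : σ * Equiv.swap p r * σ⁻¹ = Equiv.swap (σ p) (σ r) := by
    rw [Equiv.swap_apply_apply]
  refine xOp_sub_xOp_cancel hpr' ?_
  have h1 : (xOp (σ p) 1 - xOp (σ r) 1 : Module.End ℂ (P m N)) * permOp σ =
      permOp σ * (xOp p 1 - xOp r 1) := by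
    rw [mul_sub, sub_mul, permOp_mul_xOp, permOp_mul_xOp]
  rw [← mul_assoc, h1, mul_assoc, dunklOp_spec p r hpr, ← mul_assoc,
    ← mul_assoc (_ - _), dunklOp_spec _ _ hpr', permOp_mul_xOp, mul_assoc, mul_assoc, mul_sub,
    sub_mul, permOp_mul_tensorPermOp,
    ← permOp_mul, ← permOp_mul, hs, ← hs, inv_mul_cancel_right]

/-- The Dunkl operator is `x_p / (x_p - x_r)` times an operator, so that its commutator with an
operator `X` commuting with `x_p - x_r` and with permutations is determined by the commutator of
`X` with the transposition of tensor factors. -/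
theorem dunklOp_commutator {p r : Fin N} (hpr : p ≠ r) {X Y : Module.End ℂ (P m N)}
    (hX : ∀ q, Commute (xOp q 1) X) (hs : Commute (permOp (Equiv.swap p r)) X)
    (hY : xOp p 1 * (tensorPermOp (Equiv.swap p r) * X - X * tensorPermOp (Equiv.swap p r)) =
      (xOp p 1 - xOp r 1) * Y) :
    dunklOp p r * X - X * dunklOp p r = Y :=
  xOp_sub_xOp_cancel hpr (sub_mul_commutator (hX p) (hX r) hs (dunklOp_spec p r hpr) hY)

/-- The monomials of degree zero in every variable generate `𝔓_N ⊗ (ℂᵐ)^{⊗N}` under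
multiplication by the variables and their inverses. -/
theorem submodule_eq_top_of_const {M : Submodule ℂ (P m N)} (h0 : ∀ a, basisP (0, a) ∈ M)
    (hx : ∀ p j, ∀ y ∈ M, xOp p j y ∈ M) : M = ⊤ := by
  have key : ∀ (s : Finset (Fin N)) (i : Fin N → ℤ) (a : Fin N → Fin m),
      (∀ q ∉ s, i q = 0) → basisP (i, a) ∈ M := by
    intro s
    induction s using Finset.induction_on with
    | empty =>
      intro i a hi
      have : i = 0 := funext fun q => hi q (by simp)
      exact this ▸ h0 a
    | insert p s hp ih =>
      intro i a hi
      have h1 := hx p (i p) _ (ih (Function.update i p 0) a fun q hq => by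
        by_cases hqp : q = p
        · subst hqp; simp
        · rw [Function.update_of_ne hqp]
          exact hi q (by simp [hq, hqp]))
      rw [xOp_basisP] at h1
      simpa using h1
  rw [eq_top_iff, ← (basisMon m N).span_eq, Submodule.span_le]
  rintro _ ⟨⟨i, a⟩, rfl⟩
  exact key Finset.univ i a (by simp)

theorem dunklOp_const (p r : Fin N) (a : Fin N → Fin m) : dunklOp p r (basisP (0, a)) = 0 := by
  simp [dunklOp]

theorem eulerOp_const (p : Fin N) (a : Fin N → Fin m) : eulerOp p (basisP (0, a)) = 0 := by
  simp [eulerOp_basisP]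

/-- The value of a Dunkl operator on `x_q^{-n}` for `n ≥ 0`. -/
theorem dunklOp_xOp_const {p r : Fin N} (hpr : p ≠ r) (q : Fin N) (hq : q ≠ p) (n : ℕ)
    (a : Fin N → Fin m) :
    dunklOp p r (xOp q (-n) (basisP (0, a))) = if q = r then
      ∑ s ∈ Finset.range n, xOp p (-s) (xOp r (-(n - s : ℤ))
        (tensorPermOp (Equiv.swap p r) (basisP (0, a)))) else 0 := by
  split_ifs with h
  · subst h
    simp only [xOp_basisP, dunklOp, opOfBasis_basisP, tensorPermOp_basisP, Equiv.symm_swap]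
    simp only [Pi.zero_apply, zero_add, Function.update_self, Function.update_of_ne hpr,
      sub_neg_eq_add, Int.toNat_natCast, sub_zero]
    rw [show (-(n : ℤ)).toNat = 0 by omega, Finset.sum_range_zero, sub_zero]
    refine Finset.sum_congr rfl fun s _ => ?_
    congr 2
    ext t
    by_cases ht : t = q
    · subst ht; simp [hq]; ring
    · by_cases ht' : t = p
      · subst ht'; simp [hpr]
      · simp [ht, ht']
  · simp [xOp_basisP, dunklOp, Ne.symm hq, Ne.symm h, Function.update_of_ne]

end OperatorsOnP

/-! ### The elements `(E_ab - δ_ab I / m) t^i` of `𝔰𝔩̂ₘ` -/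

section LieAlgebra

variable {m N : ℕ}

/-- The matrix `M tⁱ` of Laurent polynomials, for a complex matrix `M`. -/
def loopMat (M : Matrix (Fin m) (Fin m) ℂ) (i : ℤ) : Matrix (Fin m) (Fin m) ℂ[T;T⁻¹] :=
  M.map fun z => AddMonoidAlgebra.single i z

theorem loopMat_apply (M : Matrix (Fin m) (Fin m) ℂ) (i : ℤ) (a b : Fin m) :
    loopMat M i a b = AddMonoidAlgebra.single i (M a b) := rfl

theorem coeff_loopMat (M : Matrix (Fin m) (Fin m) ℂ) (i : ℤ) (a b : Fin m) (n : ℤ) :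
    (loopMat M i a b).coeff n = if i = n then M a b else 0 := by
  rw [loopMat_apply, AddMonoidAlgebra.coeff_single, Finsupp.single_apply]

theorem matrix_laurent_ext {A B : Matrix (Fin m) (Fin m) ℂ[T;T⁻¹]}
    (h : ∀ a b n, (A a b).coeff n = (B a b).coeff n) : A = B := by
  ext a b n
  exact h a b n

theorem loopMat_sub (M M' : Matrix (Fin m) (Fin m) ℂ) (i : ℤ) :
    loopMat (M - M') i = loopMat M i - loopMat M' i :=
  matrix_laurent_ext fun a b n => by
    simp only [Matrix.sub_apply, AddMonoidAlgebra.coeff_sub, Finsupp.sub_apply, coeff_loopMat]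
    split_ifs <;> simp

theorem loopMat_zero (i : ℤ) : loopMat (0 : Matrix (Fin m) (Fin m) ℂ) i = 0 :=
  matrix_laurent_ext fun a b n => by
    simp only [coeff_loopMat, Matrix.zero_apply]
    simp

theorem loopMat_mul (M M' : Matrix (Fin m) (Fin m) ℂ) (i j : ℤ) :
    loopMat M i * loopMat M' j = loopMat (M * M') (i + j) := by
  ext1 a b
  rw [Matrix.mul_apply, loopMat_apply, Matrix.mul_apply]
  simp only [loopMat_apply, AddMonoidAlgebra.single_mul_single]
  exact (map_sum (AddMonoidAlgebra.singleAddHom (i + j)) _ _).symm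

theorem eulerMat_loopMat (M : Matrix (Fin m) (Fin m) ℂ) (i : ℤ) :
    eulerMat m (loopMat M i) = (i : ℂ) • loopMat M i :=
  matrix_laurent_ext fun a b n => by
    simp only [eulerMat, LinearMap.mapMatrix_apply, Matrix.map_apply, coeff_euler,
      Matrix.smul_apply, AddMonoidAlgebra.coeff_smul, Finsupp.smul_apply, coeff_loopMat]
    split_ifs with h
    · subst h; rfl
    · simp

theorem trace0_loopMat (M : Matrix (Fin m) (Fin m) ℂ) (i : ℤ) :
    trace0 m (loopMat M i) = if i = 0 then M.trace else 0 := by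
  change (∑ a, loopMat M i a a).coeff 0 = _
  rw [AddMonoidAlgebra.coeff_sum, Finsupp.finsetSum_apply]
  simp only [coeff_loopMat]
  split_ifs
  · rfl
  · simp

theorem lie_mk_loopMat (M M' : Matrix (Fin m) (Fin m) ℂ) (i j : ℤ) :
    ⁅AffineGL.mk (loopMat M i) 0, AffineGL.mk (loopMat M' j) 0⁆ =
      AffineGL.mk (loopMat (M * M' - M' * M) (i + j))
        (if i + j = 0 then (i : ℂ) * (M * M').trace else 0) := by
  ext1
  · rw [AffineGL.mat_lie]
    simp only [AffineGL.mat_mk]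
    rw [loopMat_mul, loopMat_mul, add_comm j i, loopMat_sub]
  · rw [AffineGL.cen_lie]
    simp only [AffineGL.mat_mk, AffineGL.cen_mk]
    rw [eulerMat_loopMat, smul_mul_assoc, loopMat_mul, map_smul, trace0_loopMat, smul_eq_mul]
    split_ifs <;> simp

theorem lie_slC (X : affineSL m) : ⁅X, slC m⁆ = 0 := by
  apply Subtype.ext
  rw [LieSubalgebra.coe_bracket]
  ext1
  · rw [AffineGL.mat_lie]
    simp [slC, AffineGL.C]
  · rw [AffineGL.cen_lie]
    simp [slC, AffineGL.C]

theorem slC_lie (X : affineSL m) : ⁅slC m, X⁆ = 0 := by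
  rw [← lie_skew, lie_slC, neg_zero]

variable [NeZero m]

/-- The coefficient `δ_ab / m`. -/
def trc (a b : Fin m) : ℂ := if a = b then (m : ℂ)⁻¹ else 0

/-- The traceless matrix `E_ab - δ_ab I / m`. -/
def slMat (a b : Fin m) : Matrix (Fin m) (Fin m) ℂ := Matrix.single a b 1 - trc a b • 1

theorem slE_val (a b : Fin m) (i : ℤ) : (slE a b i).1 = AffineGL.mk (loopMat (slMat a b) i) 0 := by
  change AffineGL.E a b i - trc a b • ∑ d : Fin m, AffineGL.E d d i = _
  ext1
  · rw [map_sub, map_smul, map_sum]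
    refine matrix_laurent_ext fun x y n => ?_
    simp only [AffineGL.E, AffineGL.mat_mk, Matrix.sub_apply, Matrix.smul_apply,
      AddMonoidAlgebra.coeff_sub, AddMonoidAlgebra.coeff_smul, Finsupp.sub_apply,
      Finsupp.smul_apply, coeff_loopMat, slMat, Matrix.sum_apply, AddMonoidAlgebra.coeff_sum,
      Finsupp.finsetSum_apply, Matrix.single_apply, Matrix.one_apply, smul_eq_mul]
    have hT : ∀ (q : Prop) [Decidable q], (if q then (LaurentPolynomial.T i : ℂ[T;T⁻¹])
        else 0).coeff n = if q ∧ i = n then 1 else 0 := by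
      intro q _
      by_cases hq : q
      · simp [hq, LaurentPolynomial.T, AddMonoidAlgebra.coeff_single, Finsupp.single_apply,
          -LaurentPolynomial.single_eq_C_mul_T]
      · simp [hq]
    simp only [hT]
    by_cases hin : i = n
    · simp only [hin, and_true, if_true]
      congr 2
      by_cases hxy : x = y
      · subst hxy
        simp
      · rw [if_neg hxy]
        exact Finset.sum_eq_zero fun d _ => if_neg fun h => hxy (h.1.symm.trans h.2)
    · simp [hin]
  · rw [map_sub, map_smul, map_sum]
    simp [AffineGL.E]

theorem mat_slE (a b : Fin m) (i : ℤ) : (slE a b i).1.mat = loopMat (slMat a b) i := by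
  rw [slE_val, AffineGL.mat_mk]

theorem cen_slE (a b : Fin m) (i : ℤ) : (slE a b i).1.cen = 0 := by
  rw [slE_val, AffineGL.cen_mk]

theorem natCast_ne_zero (m : ℕ) [NeZero m] : (m : ℂ) ≠ 0 := NeZero.ne _

theorem sum_trc : ∑ a : Fin m, trc a a = 1 := by
  simp [trc, natCast_ne_zero m]

omit [NeZero m] in
theorem single_one_mul_single_one (a b c d : Fin m) :
    Matrix.single a b (1 : ℂ) * Matrix.single c d 1 =
      if b = c then Matrix.single a d 1 else 0 := by
  split_ifs with h
  · subst h
    rw [Matrix.single_mul_single_same, one_mul]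
  · rw [Matrix.single_mul_single_of_ne _ _ _ _ h]

omit [NeZero m] in
theorem slMat_commutator (a b c d : Fin m) :
    slMat a b * slMat c d - slMat c d * slMat a b =
      (if b = c then slMat a d else 0) - if d = a then slMat c b else 0 := by
  have h1 : slMat a b * slMat c d - slMat c d * slMat a b =
      Matrix.single a b 1 * Matrix.single c d 1 - Matrix.single c d 1 * Matrix.single a b 1 := by
    simp only [slMat]
    simp only [sub_mul, mul_sub, smul_mul_assoc, mul_smul_comm, one_mul, mul_one, smul_sub]
    rw [smul_comm (trc c d)]
    abel
  rw [h1, single_one_mul_single_one, single_one_mul_single_one]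
  by_cases hbc : b = c <;> by_cases hda : d = a
  · subst hbc hda
    simp [slMat, trc]
  · simp [hbc, hda, slMat, trc, Ne.symm hda]
  · simp [hbc, hda, slMat, trc, Ne.symm hbc]
  · simp [hbc, hda]

theorem trace_slMat_mul (a b c d : Fin m) :
    (slMat a b * slMat c d).trace =
      (if b = c ∧ d = a then 1 else 0) - if c = d then trc a b else 0 := by
  simp only [slMat, sub_mul, mul_sub, smul_mul_assoc, mul_smul_comm, one_mul, mul_one,
    Matrix.trace_sub, Matrix.trace_smul, Matrix.trace_one, single_one_mul_single_one]
  have h1 : (if b = c then Matrix.single a d (1 : ℂ) else 0).trace =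
      if b = c ∧ d = a then 1 else 0 := by
    by_cases hbc : b = c <;> by_cases hda : d = a
    · simp [hbc, hda]
    · simp [hbc, hda, Ne.symm hda]
    · simp [hbc]
    · simp [hbc]
  have h2 : ∀ x y : Fin m, (Matrix.single x y (1 : ℂ)).trace = if x = y then 1 else 0 := by
    intro x y
    by_cases h : x = y
    · simp [h]
    · simp [h]
  rw [h1, h2, h2]
  by_cases hab : a = b <;> by_cases hcd : c = d
  · simp [hab, hcd, trc, natCast_ne_zero m]
  · simp [hab, hcd, trc]
  · simp [hab, hcd, trc]
  · simp [hab, hcd, trc]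

/-- The coefficient of the central element in the bracket of `slE a b i` and `slE c d j`. -/
def cocycle (a b c d : Fin m) (i j : ℤ) : ℂ :=
  if i + j = 0 then
    (i : ℂ) * ((if b = c ∧ d = a then 1 else 0) - if c = d then trc a b else 0) else 0

/-- The brackets of the traceless projections of the matrix units. The corrections by the scalar
matrices affect only the central term. -/
theorem slE_lie (a b c d : Fin m) (i j : ℤ) :
    ⁅slE a b i, slE c d j⁆ = (if b = c then slE a d (i + j) else 0) -
      (if d = a then slE c b (i + j) else 0) + cocycle a b c d i j • slC m := by
  have hif : ∀ (q : Prop) [Decidable q] (X : affineSL m),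
      ((if q then X else 0 : affineSL m) : AffineGL m) = if q then (X : AffineGL m) else 0 := by
    intro q _ X
    split_ifs <;> rfl
  apply Subtype.ext
  rw [LieSubalgebra.coe_bracket, slE_val, slE_val, lie_mk_loopMat, slMat_commutator,
    trace_slMat_mul, ← cocycle]
  change _ = ((if b = c then slE a d (i + j) else 0 : affineSL m) : AffineGL m) -
      ((if d = a then slE c b (i + j) else 0 : affineSL m) : AffineGL m) +
      cocycle a b c d i j • AffineGL.C m
  rw [hif, hif, slE_val, slE_val]
  ext1
  · rw [map_add, map_sub, map_smul, AffineGL.mat_mk, loopMat_sub]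
    split_ifs <;> simp [AffineGL.C, loopMat_zero]
  · rw [map_add, map_sub, map_smul, AffineGL.cen_mk]
    split_ifs <;> simp [AffineGL.C]

theorem slE_lie_of_ne (a b c d : Fin m) (i j : ℤ) (h : i + j ≠ 0) :
    ⁅slE a b i, slE c d j⁆ = (if b = c then slE a d (i + j) else 0) -
      (if d = a then slE c b (i + j) else 0) := by
  rw [slE_lie, cocycle, if_neg h, zero_smul, add_zero]

/-- The elements `slE a b i` span, but they are not linearly independent. -/
theorem sum_slE_diag (i : ℤ) : ∑ a : Fin m, slE a a i = 0 := by
  apply Subtype.ext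
  have : ((∑ a : Fin m, slE a a i : affineSL m) : AffineGL m) =
      ∑ a : Fin m, (slE a a i : AffineGL m) := by
    simp
  rw [this]
  ext1
  · rw [map_sum]
    refine matrix_laurent_ext fun x y n => ?_
    simp only [mat_slE, Matrix.sum_apply, AddMonoidAlgebra.coeff_sum, Finsupp.finsetSum_apply,
      coeff_loopMat, slMat, Matrix.sub_apply, Matrix.smul_apply, Matrix.single_apply,
      Matrix.one_apply, smul_eq_mul]
    by_cases hin : i = n
    · simp only [hin, if_true, Finset.sum_sub_distrib]
      by_cases hxy : x = y
      · subst hxy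
        simp [sum_trc]
      · simp only [if_neg hxy, mul_zero, Finset.sum_const_zero, sub_zero]
        exact Finset.sum_eq_zero fun d _ => if_neg fun h => hxy (h.1.symm.trans h.2)
    · simp [hin]
  · rw [map_sum]
    simp [cen_slE]

/-- The expansion of an element of the affine Lie algebra in the elements `slE a b j` and `C`. -/
theorem eq_sum_slE (X : affineSL m) (s : Finset ℤ)
    (hs : ∀ a b, (X.1.mat a b).coeff.support ⊆ s) :
    X = ∑ a, ∑ b, ∑ j ∈ s, (X.1.mat a b).coeff j • slE a b j + X.1.cen • slC m := by
  apply Subtype.ext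
  have hX := X.2
  rw [mem_affineSL] at hX
  have hX' : ∀ n, ∑ a, (X.1.mat a a).coeff n = 0 := by
    intro n
    have := congrArg (fun f : ℂ[T;T⁻¹] => f.coeff n) hX
    simpa [Matrix.trace, AddMonoidAlgebra.coeff_sum] using this
  have hcoe : ((∑ a, ∑ b, ∑ j ∈ s, (X.1.mat a b).coeff j • slE a b j + X.1.cen • slC m :
      affineSL m) : AffineGL m) =
      ∑ a, ∑ b, ∑ j ∈ s, (X.1.mat a b).coeff j • (slE a b j).1 + X.1.cen • AffineGL.C m := by
    simp [slC]
  rw [hcoe]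
  ext1
  · refine matrix_laurent_ext fun x y n => ?_
    rw [map_add, map_smul]
    simp only [map_sum, map_smul, mat_slE]
    have hC : (AffineGL.C m).mat = 0 := rfl
    rw [hC, smul_zero, add_zero]
    simp only [Matrix.sum_apply, AddMonoidAlgebra.coeff_sum, Finsupp.finsetSum_apply,
      Matrix.smul_apply, AddMonoidAlgebra.coeff_smul, Finsupp.smul_apply, coeff_loopMat,
      smul_eq_mul, mul_ite, mul_zero, Finset.sum_ite_eq']
    by_cases hn : n ∈ s
    · simp only [hn, if_true, slMat, Matrix.sub_apply, Matrix.smul_apply, Matrix.single_apply,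
        smul_eq_mul, mul_sub, Finset.sum_sub_distrib]
      have h1 : ∑ a, ∑ b, (X.1.mat a b).coeff n * (if a = x ∧ b = y then 1 else 0) =
          (X.1.mat x y).coeff n := by
        rw [Finset.sum_eq_single x, Finset.sum_eq_single y]
        · simp
        · intro b _ hb; simp [hb]
        · simp
        · intro a _ ha; simp [ha]
        · simp
      have h2 : ∑ a, ∑ b, (X.1.mat a b).coeff n * (trc a b * (1 : Matrix _ _ ℂ) x y) = 0 := by
        have : ∀ a : Fin m, ∑ b, (X.1.mat a b).coeff n * (trc a b * (1 : Matrix _ _ ℂ) x y) =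
            (X.1.mat a a).coeff n * ((m : ℂ)⁻¹ * (1 : Matrix _ _ ℂ) x y) := by
          intro a
          rw [Finset.sum_eq_single a]
          · simp [trc]
          · intro b _ hb; simp [trc, Ne.symm hb]
          · simp
        simp only [this, ← Finset.sum_mul, hX', zero_mul]
      rw [h1, h2, sub_zero]
    · simp only [hn, if_false, Finset.sum_const_zero]
      by_contra hne
      exact hn (hs x y (Finsupp.mem_support_iff.mpr hne))
  · rw [map_add, map_smul]
    simp [cen_slE, AffineGL.C]

/-- A linear statement about `𝔰𝔩̂ₘ` has to be checked on the elements `slE a b j` and on `C`. -/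
theorem affineSL_induction {M : Submodule ℂ (affineSL m)} (hE : ∀ a b j, slE a b j ∈ M)
    (hC : slC m ∈ M) (X : affineSL m) : X ∈ M := by
  classical
  rw [eq_sum_slE X (Finset.univ.biUnion fun a => Finset.univ.biUnion fun b =>
    (X.1.mat a b).coeff.support) fun a b j hj => Finset.mem_biUnion.mpr ⟨a, Finset.mem_univ _,
      Finset.mem_biUnion.mpr ⟨b, Finset.mem_univ _, hj⟩⟩]
  exact add_mem (sum_mem fun a _ => sum_mem fun b _ => sum_mem fun j _ =>
    M.smul_mem _ (hE a b j)) (M.smul_mem _ hC)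

/-- An element whose coefficients are supported in a set of indices is a linear combination of
the corresponding elements `slE a b j`. -/
theorem mem_of_support {M : Submodule ℂ (affineSL m)} {r : Fin m → Fin m → ℤ → Prop}
    (hE : ∀ a b j, r a b j → slE a b j ∈ M) {X : affineSL m} (hc : X.1.cen = 0)
    (hX : ∀ a b, ∀ j ∈ (X.1.mat a b).coeff.support, r a b j) : X ∈ M := by
  classical
  rw [eq_sum_slE X (Finset.univ.biUnion fun a => Finset.univ.biUnion fun b =>
    (X.1.mat a b).coeff.support) fun a b j hj => Finset.mem_biUnion.mpr ⟨a, Finset.mem_univ _,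
      Finset.mem_biUnion.mpr ⟨b, Finset.mem_univ _, hj⟩⟩, hc, zero_smul, add_zero]
  refine sum_mem fun a _ => sum_mem fun b _ => sum_mem fun j _ => ?_
  by_cases h : j ∈ (X.1.mat a b).coeff.support
  · exact M.smul_mem _ (hE a b j (hX a b j h))
  · rw [Finsupp.notMem_support_iff.mp h, zero_smul]
    exact M.zero_mem

theorem coeff_mat_slE (a b x y : Fin m) (i n : ℤ) :
    ((slE a b i).1.mat x y).coeff n = if i = n then slMat a b x y else 0 := by
  rw [mat_slE, coeff_loopMat]

theorem slE_mem_of_ne {r : ℤ → Fin m → Fin m → Prop} {a b : Fin m} {i : ℤ} (hr : r i a b)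
    (hd : a = b → ∀ d, r i d d) (x y : Fin m) (j : ℤ)
    (hj : j ∈ ((slE a b i).1.mat x y).coeff.support) : r j x y := by
  rw [Finsupp.mem_support_iff, coeff_mat_slE] at hj
  have hij : i = j := by
    by_contra h
    exact hj (if_neg h)
  subst hij
  rw [if_pos rfl, slMat, Matrix.sub_apply, Matrix.smul_apply, Matrix.single_apply,
    Matrix.one_apply] at hj
  by_cases h : a = x ∧ b = y
  · exact h.1 ▸ h.2 ▸ hr
  · by_cases hab : a = b
    · by_cases hxy : x = y
      · exact hxy ▸ hd hab x
      · simp [h, hxy] at hj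
    · simp [h, trc, hab] at hj

theorem slE_mem_nhat {a b : Fin m} {j : ℤ} (h : j < 0 ∨ (j = 0 ∧ b < a)) : slE a b j ∈ nhat m :=
  ⟨cen_slE a b j, fun x y n hn => slE_mem_of_ne (r := fun j a b => j < 0 ∨ (j = 0 ∧ b < a)) h
    (fun hab d => by subst hab; simpa using h) x y n hn⟩

theorem slE_mem_nhat' {a b : Fin m} {j : ℤ} (h : 0 < j ∨ (j = 0 ∧ a < b)) : slE a b j ∈ nhat' m :=
  ⟨cen_slE a b j, fun x y n hn => slE_mem_of_ne (r := fun j a b => 0 < j ∨ (j = 0 ∧ a < b)) h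
    (fun hab d => by subst hab; simpa using h) x y n hn⟩

omit [NeZero m] in
theorem xHom_single (q : Fin N) (n : ℤ) (z : ℂ) :
    xHom (m := m) q (AddMonoidAlgebra.single n z) = z • xOp q n := by
  rw [LaurentPolynomial.single_eq_C_mul_T, xHom_C_mul_T]

/-- The traceless matrix unit `E_ab - δ_ab I / m` in the `q`-th tensor factor. -/
def slOp (q : Fin N) (a b : Fin m) : Module.End ℂ (P m N) := EOp q a b - trc a b • 1

theorem currentOp_slE (q : Fin N) (a b : Fin m) (i : ℤ) :
    currentOp q (slE a b i).1.mat = xOp q i * slOp q a b := by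
  rw [mat_slE]
  change ∑ x, ∑ y, xHom (m := m) (N := N) q (loopMat (slMat a b) i x y) * EOp q x y = _
  simp only [loopMat_apply, xHom_single, smul_mul_assoc, ← mul_smul_comm, ← Finset.mul_sum]
  congr 1
  simp only [slMat, Matrix.sub_apply, Matrix.smul_apply, Matrix.one_apply, smul_eq_mul, sub_smul,
    Finset.sum_sub_distrib, mul_ite, mul_one, mul_zero, ite_smul, zero_smul, Finset.sum_ite_eq,
    Finset.mem_univ, if_true, ← Finset.smul_sum, sum_EOp_diag, slOp]
  congr 1
  rw [Finset.sum_eq_single a, Finset.sum_eq_single b]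
  · simp
  · intro y _ hy; simp [Ne.symm hy]
  · simp
  · intro x _ hx; simp [Ne.symm hx]
  · simp

theorem loopRep_slE (a b : Fin m) (i : ℤ) :
    loopRep m N (slE a b i) = ∑ q, xOp q i * slOp q a b := by
  change ∑ q, currentOp q (slE a b i).1.mat = _
  exact Finset.sum_congr rfl fun q _ => currentOp_slE q a b i

omit [NeZero m] in
theorem loopRep_slC : loopRep m N (slC m) = 0 := by
  change ∑ q, currentOp q (0 : Matrix (Fin m) (Fin m) ℂ[T;T⁻¹]) = 0
  simp only [map_zero, Finset.sum_const_zero]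

/-- The map `E_ab t^i ↦ E_{w a, w b} t^{i + s_a - s_b}`, with its central correction, on the
traceless projections. The sum of all the shifts enters through the trace part. -/
theorem affineMapSL_slE (w : Equiv.Perm (Fin m)) (s : Fin m → ℤ) (a b : Fin m) (i : ℤ) :
    affineMapSL w s (slE a b i) = slE (w a) (w b) (i + s a - s b) +
      (if i = 0 then (if a = b then (s a : ℂ) else 0) - trc a b * ∑ d, (s d : ℂ) else 0) •
        slC m := by
  apply Subtype.ext
  change affineMap w s (slE a b i).1 = (slE (w a) (w b) (i + s a - s b)).1 + _ • AffineGL.C m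
  ext1
  · change (Matrix.of fun x y => LaurentPolynomial.T (s (w.symm x) - s (w.symm y)) *
      (slE a b i).1.mat (w.symm x) (w.symm y)) = _
    rw [map_add, map_smul]
    have hC : (AffineGL.C m).mat = 0 := rfl
    rw [hC, smul_zero, add_zero, mat_slE, mat_slE]
    refine matrix_laurent_ext fun x y n => ?_
    rw [Matrix.of_apply, loopMat_apply, LaurentPolynomial.T, AddMonoidAlgebra.single_mul_single,
      AddMonoidAlgebra.coeff_single, Finsupp.single_apply, coeff_loopMat, one_mul]
    simp only [slMat, Matrix.sub_apply, Matrix.smul_apply, Matrix.single_apply, Matrix.one_apply,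
      Equiv.eq_symm_apply, EmbeddingLike.apply_eq_iff_eq, trc]
    by_cases hab : a = b
    · subst hab
      by_cases hxy : x = y
      · subst hxy; simp
      · have : ¬ (w a = x ∧ w a = y) := fun h => hxy (h.1.symm.trans h.2)
        simp [hxy, this]
    · by_cases h : w a = x ∧ w b = y
      · obtain ⟨rfl, rfl⟩ := h
        simp only [Equiv.symm_apply_apply]
        congr 1
        rw [eq_iff_iff]
        constructor <;> intro h <;> omega
      · simp [hab, h]
  · change (slE a b i).1.cen + ∑ d, (s d : ℂ) * ((slE a b i).1.mat d d).coeff 0 = _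
    rw [map_add, map_smul, cen_slE, cen_slE]
    simp only [coeff_mat_slE]
    by_cases hi : i = 0
    · simp only [hi, if_true, slMat, Matrix.sub_apply, Matrix.smul_apply, Matrix.single_apply,
        Matrix.one_apply_eq, smul_eq_mul, mul_one, mul_sub, Finset.sum_sub_distrib,
        ← Finset.sum_mul, AffineGL.C, AffineGL.cen_mk]
      rw [mul_comm (trc a b)]
      congr 2
      by_cases hab : a = b
      · subst hab; simp
      · rw [if_neg hab]
        refine Finset.sum_eq_zero fun d _ => ?_
        rw [if_neg fun h => hab (h.1.trans h.2.symm), mul_zero]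
    · simp [hi]

omit [NeZero m] in
theorem affineMapSL_slC (w : Equiv.Perm (Fin m)) (s : Fin m → ℤ) :
    affineMapSL w s (slC m) = slC m := by
  apply Subtype.ext
  change affineMap w s (AffineGL.C m) = AffineGL.C m
  ext1
  · change (Matrix.of fun x y => LaurentPolynomial.T (s (w.symm x) - s (w.symm y)) *
      (0 : ℂ[T;T⁻¹])) = 0
    ext1 x y
    simp
  · change (1 : ℂ) + ∑ d, (s d : ℂ) * ((0 : Matrix (Fin m) (Fin m) ℂ[T;T⁻¹]) d d).coeff 0 = 1
    simp

end LieAlgebra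

/-! ### Relations of the trigonometric Cherednik algebra -/

section CherednikRelations

variable {R : Type*} [Ring R] [Algebra ℂ R] {N : ℕ}

/-- The relations between the elements `x_p`, `z_p` and the permutations in the trigonometric
Cherednik algebra, apart from the commutation relations between the elements `z_p`. -/
structure CherednikRel (κ : ℂ) (s : Equiv.Perm (Fin N) →* R) (x z : Fin N → R) : Prop where
  x_comm : ∀ p q, Commute (x p) (x q)
  s_x : ∀ σ p, s σ * x p = x (σ p) * s σ
  s_z : ∀ σ p, s σ * z p = z (σ p) * s σ
  z_x : ∀ p q, q ≠ p → z p * x q = x q * z p - x p * s (Equiv.swap p q)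
  z_x_same : ∀ p, z p * x p = x p * z p + (κ • x p +
    ∑ r ∈ Finset.univ.filter (· ≠ p), x p * s (Equiv.swap p r))

/-- The difference of the two sides of the relation `[z_p, z_q] = σ_pq (z_p - z_q)`. -/
def zDefect (s : Equiv.Perm (Fin N) →* R) (z : Fin N → R) (p q : Fin N) : R :=
  z p * z q - z q * z p - s (Equiv.swap p q) * (z p - z q)

variable {κ : ℂ} {s : Equiv.Perm (Fin N) →* R} {x z : Fin N → R}

omit [Algebra ℂ R] in
theorem s_swap_mul_self (s : Equiv.Perm (Fin N) →* R) (p q : Fin N) :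
    s (Equiv.swap p q) * s (Equiv.swap p q) = 1 := by
  rw [← map_mul, Equiv.swap_mul_self, map_one]

omit [Algebra ℂ R] in
theorem zDefect_swap (s : Equiv.Perm (Fin N) →* R) (z : Fin N → R) (p q : Fin N) :
    zDefect s z q p = -zDefect s z p q := by
  rw [zDefect, zDefect, Equiv.swap_comm q p]
  noncomm_ring

theorem CherednikRel.zDefect_commute_of_ne (h : CherednikRel κ s x z) {p q r : Fin N}
    (hpq : p ≠ q) (hrp : r ≠ p) (hrq : r ≠ q) : zDefect s z p q * x r = x r * zDefect s z p q := by
  have hqp := hpq.symm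
  have e1 : z p * z q * x r = x r * (z p * z q) - x p * (z q * s (Equiv.swap p r)) -
      x q * (z p * s (Equiv.swap q r)) +
      x p * (s (Equiv.swap p q) * s (Equiv.swap q r)) := by
    rw [mul_assoc, h.z_x q r hrq, mul_sub, ← mul_assoc, h.z_x p r hrp, ← mul_assoc (z p),
      h.z_x p q hqp]
    have := h.s_z (Equiv.swap p r) q
    rw [Equiv.swap_apply_of_ne_of_ne hqp hrq.symm] at this
    rw [← this]
    noncomm_ring
  have e2 : z q * z p * x r = x r * (z q * z p) - x q * (z p * s (Equiv.swap q r)) -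
      x p * (z q * s (Equiv.swap p r)) +
      x q * (s (Equiv.swap p q) * s (Equiv.swap p r)) := by
    rw [mul_assoc, h.z_x p r hrp, mul_sub, ← mul_assoc, h.z_x q r hrq, ← mul_assoc (z q),
      h.z_x q p hpq]
    have := h.s_z (Equiv.swap q r) p
    rw [Equiv.swap_apply_of_ne_of_ne hpq hrp.symm] at this
    rw [← this, Equiv.swap_comm q p]
    noncomm_ring
  have e3 : s (Equiv.swap p q) * z p * x r = x r * (s (Equiv.swap p q) * z p) -
      x q * (s (Equiv.swap p q) * s (Equiv.swap p r)) := by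
    rw [mul_assoc, h.z_x p r hrp, mul_sub, ← mul_assoc, h.s_x, ← mul_assoc _ (x p), h.s_x,
      Equiv.swap_apply_of_ne_of_ne hrp hrq, Equiv.swap_apply_left, mul_assoc, mul_assoc]
  have e4 : s (Equiv.swap p q) * z q * x r = x r * (s (Equiv.swap p q) * z q) -
      x p * (s (Equiv.swap p q) * s (Equiv.swap q r)) := by
    rw [mul_assoc, h.z_x q r hrq, mul_sub, ← mul_assoc, h.s_x, ← mul_assoc _ (x q), h.s_x,
      Equiv.swap_apply_of_ne_of_ne hrp hrq, Equiv.swap_apply_right, mul_assoc, mul_assoc]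
  rw [zDefect, mul_sub, sub_mul, sub_mul, sub_mul, e1, e2, e3, e4]
  noncomm_ring

/-- The terms with `x_p` and `x_q` left over from the two products `z_p z_q` and `z_q z_p` are
cancelled by those from `σ_pq (z_p - z_q)`, using `z_q σ_pq = σ_pq z_p`. -/
theorem CherednikRel.zDefect_commute_left (h : CherednikRel κ s x z) {p q : Fin N}
    (hpq : p ≠ q) : zDefect s z p q * x p = x p * zDefect s z p q := by
  have hqp := hpq.symm
  set σ := s (Equiv.swap p q) with hσ
  have hσσ : σ * σ = 1 := s_swap_mul_self s p q
  set A := κ • x p + ∑ r ∈ Finset.univ.filter (· ≠ p), x p * s (Equiv.swap p r) with hA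
  have hσz : σ * z q = z p * σ := by rw [hσ, h.s_z, Equiv.swap_apply_right]
  have hσz' : σ * z p = z q * σ := by rw [hσ, h.s_z, Equiv.swap_apply_left]
  have hσx : σ * x p = x q * σ := by rw [hσ, h.s_x, Equiv.swap_apply_left]
  have hσx' : σ * x q = x p * σ := by rw [hσ, h.s_x, Equiv.swap_apply_right]
  have hzx : z q * x p = x p * z q - x q * σ := by rw [h.z_x q p hpq, Equiv.swap_comm q p]
  have e1 : z p * z q * x p = x p * (z p * z q) + A * z q - x q * (z p * σ) + x p := by
    rw [mul_assoc, hzx, mul_sub, ← mul_assoc, h.z_x_same p, ← mul_assoc (z p), h.z_x p q hqp,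
      ← hσ, ← hA, sub_mul, mul_assoc (x p) σ σ, hσσ]
    noncomm_ring
  set A' := κ • σ + ∑ r ∈ Finset.univ.filter (· ≠ p), σ * s (Equiv.swap p r) with hA'
  have hσA : σ * A = x q * A' := by
    rw [hA, hA', mul_add, mul_add, mul_smul_comm, hσx, Finset.mul_sum, Finset.mul_sum,
      mul_smul_comm]
    congr 1
    exact Finset.sum_congr rfl fun r _ => by rw [← mul_assoc, hσx, mul_assoc]
  have hzs : ∀ r ∈ Finset.univ.filter (· ≠ p), z q * (x p * s (Equiv.swap p r)) =
      x p * s (Equiv.swap p r) * z q - x q * (σ * s (Equiv.swap p r)) +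
        if r = q then x p * (σ * z p - σ * z q) else 0 := by
    intro r _
    rw [← mul_assoc, hzx, sub_mul]
    split_ifs with hrq
    · subst hrq
      rw [← hσ, hσz']
      noncomm_ring
    · have := h.s_z (Equiv.swap p r) q
      rw [Equiv.swap_apply_of_ne_of_ne hqp (Ne.symm hrq)] at this
      rw [mul_assoc, ← this]
      noncomm_ring
  have eA : z q * A = A * z q - x q * A' + x p * (σ * z p - σ * z q) := by
    rw [hA, hA', mul_add, Finset.mul_sum, Finset.sum_congr rfl hzs, Finset.sum_add_distrib,
      Finset.sum_sub_distrib, Finset.sum_ite_eq', if_pos (by simp [hqp]), mul_smul_comm, hzx,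
      add_mul, Finset.sum_mul, mul_add, Finset.mul_sum, smul_mul_assoc, mul_smul_comm, smul_sub]
    abel
  have e2 : z q * z p * x p = x p * (z q * z p) - x q * (σ * z p) + A * z q - x q * A' +
      x p * (σ * z p - σ * z q) := by
    rw [mul_assoc, h.z_x_same p, ← hA, mul_add, eA, ← mul_assoc, hzx]
    noncomm_ring
  have e3 : σ * z p * x p = x q * (σ * z p) + x q * A' := by
    rw [mul_assoc, h.z_x_same p, ← hA, mul_add, hσA, ← mul_assoc, hσx, mul_assoc]
  have e4 : σ * z q * x p = x q * (σ * z q) - x p := by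
    rw [mul_assoc, hzx, mul_sub, ← mul_assoc, hσx, ← mul_assoc, hσx', mul_assoc, mul_assoc, hσσ,
      mul_one]
  rw [zDefect, ← hσ, mul_sub, sub_mul, sub_mul, sub_mul, e1, e2, e3, e4, ← hσz]
  noncomm_ring

/-- The difference of the two sides of the relation `[z_p, z_q] = σ_pq (z_p - z_q)` commutes with
the elements `x_r`, as a consequence of the other relations. -/
theorem CherednikRel.zDefect_commute (h : CherednikRel κ s x z) {p q : Fin N}
    (hpq : p ≠ q) (r : Fin N) : Commute (zDefect s z p q) (x r) := by
  by_cases hrp : r = p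
  · subst hrp
    exact h.zDefect_commute_left hpq
  · by_cases hrq : r = q
    · subst hrq
      rw [← neg_neg (zDefect s z p r), ← zDefect_swap]
      exact Commute.neg_left (h.zDefect_commute_left hpq.symm)
    · exact h.zDefect_commute_of_ne hpq hrp hrq

/-- The Jucys–Murphy element `∑_{a < p} σ_ap`. -/
def jucysMurphy (s : Equiv.Perm (Fin N) →* R) (p : Fin N) : R :=
  ∑ a ∈ Finset.univ.filter (· < p), s (Equiv.swap a p)

omit [Algebra ℂ R] in
/-- A permutation that fixes `p` and preserves the set of indices below `p` commutes with the
Jucys–Murphy element at `p`. -/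
theorem s_commute_jucysMurphy (s : Equiv.Perm (Fin N) →* R) {σ : Equiv.Perm (Fin N)} {p : Fin N}
    (hp : σ p = p) (hσ : ∀ a, σ a < p ↔ a < p) : Commute (s σ) (jucysMurphy s p) := by
  change s σ * _ = _ * s σ
  rw [jucysMurphy, Finset.mul_sum, Finset.sum_mul]
  refine Finset.sum_equiv σ (fun a => by simp [hσ]) fun a _ => ?_
  rw [← map_mul, ← map_mul]
  congr 1
  nth_rw 2 [← hp]
  rw [Equiv.swap_apply_apply, inv_mul_cancel_right]

omit [Algebra ℂ R] in
/-- The elements `u_p = z_p + ∑_{a < p} σ_ap` commute pairwise. -/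
theorem commute_z_add_jucysMurphy {s : Equiv.Perm (Fin N) →* R} {z : Fin N → R}
    (hz : ∀ p q, p ≠ q → zDefect s z p q = 0)
    (hsz : ∀ σ p, s σ * z p = z (σ p) * s σ) (p q : Fin N) :
    Commute (z p + jucysMurphy s p) (z q + jucysMurphy s q) := by
  wlog hpq : p < q generalizing p q
  · rcases eq_or_lt_of_le (not_lt.mp hpq) with rfl | h
    · exact Commute.refl _
    · exact (this q p h).symm
  have h1 : jucysMurphy s p * z q = z q * jucysMurphy s p := by
    rw [jucysMurphy, Finset.mul_sum, Finset.sum_mul]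
    refine Finset.sum_congr rfl fun a ha => ?_
    rw [hsz, Equiv.swap_apply_of_ne_of_ne _ hpq.ne']
    exact ((Finset.mem_filter.mp ha).2.trans hpq).ne'
  have h2 : jucysMurphy s p * jucysMurphy s q = jucysMurphy s q * jucysMurphy s p := by
    refine Commute.sum_left _ _ _ fun a ha => s_commute_jucysMurphy s ?_ fun b => ?_
    · exact Equiv.swap_apply_of_ne_of_ne ((Finset.mem_filter.mp ha).2.trans hpq).ne' hpq.ne'
    · have ha' := (Finset.mem_filter.mp ha).2
      rw [Equiv.swap_apply_def]
      split_ifs with h h'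
      · subst h; simp [hpq, ha'.trans hpq]
      · subst h'; simp [hpq, ha'.trans hpq]
      · rfl
  have h3 : z p * jucysMurphy s q = jucysMurphy s q * z p + (z p - z q) * s (Equiv.swap p q) := by
    have : ∀ b ∈ Finset.univ.filter (· < q), z p * s (Equiv.swap b q) =
        s (Equiv.swap b q) * z p + if b = p then (z p - z q) * s (Equiv.swap p q) else 0 := by
      intro b _
      split_ifs with hb
      · subst hb
        rw [hsz, Equiv.swap_apply_left]
        noncomm_ring
      · rw [hsz, Equiv.swap_apply_of_ne_of_ne (Ne.symm hb) hpq.ne, add_zero]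
    rw [jucysMurphy, Finset.mul_sum, Finset.sum_congr rfl this, Finset.sum_add_distrib,
      Finset.sum_ite_eq', if_pos (by simp [hpq]), Finset.sum_mul]
  have h4 : (z p - z q) * s (Equiv.swap p q) = -(s (Equiv.swap p q) * (z p - z q)) := by
    rw [mul_sub, hsz, hsz, Equiv.swap_apply_left, Equiv.swap_apply_right]
    noncomm_ring
  have h5 := hz p q hpq.ne
  rw [zDefect] at h5
  change (_ + _) * (_ + _) = (_ + _) * (_ + _)
  rw [add_mul, mul_add, mul_add, add_mul, mul_add, mul_add, h1, h2, h3, h4]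
  rw [sub_sub, sub_eq_zero] at h5
  rw [h5]
  abel

omit [Algebra ℂ R] in
theorem s_mul_z_add_jucysMurphy_of_ne {s : Equiv.Perm (Fin N) →* R} {z : Fin N → R}
    (hsz : ∀ σ p, s σ * z p = z (σ p) * s σ) {p p' q : Fin N} (hp : p'.val = p.val + 1)
    (hq : q ≠ p) (hq' : q ≠ p') :
    s (Equiv.swap p p') * (z q + jucysMurphy s q) =
      (z q + jucysMurphy s q) * s (Equiv.swap p p') := by
  have hf := Equiv.swap_apply_of_ne_of_ne hq hq'
  rw [mul_add, add_mul, hsz, hf, (s_commute_jucysMurphy s hf fun a => ?_).eq]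
  have hq1 : q.val ≠ p.val := fun h => hq (Fin.ext h)
  have hq2 : q.val ≠ p'.val := fun h => hq' (Fin.ext h)
  rw [Equiv.swap_apply_def]
  split_ifs with h h'
  · subst h; simp only [Fin.lt_def]; omega
  · subst h'; simp only [Fin.lt_def]; omega
  · rfl

omit [Algebra ℂ R] in
/-- The degenerate affine Hecke relation `σ_p u_p = u_{p+1} σ_p - 1`, where `u_p` is the sum of
`z_p` and the Jucys–Murphy element. -/
theorem s_mul_z_add_jucysMurphy {s : Equiv.Perm (Fin N) →* R} {z : Fin N → R}
    (hsz : ∀ σ p, s σ * z p = z (σ p) * s σ) {p p' : Fin N} (hp : p'.val = p.val + 1) :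
    s (Equiv.swap p p') * (z p + jucysMurphy s p) =
      (z p' + jucysMurphy s p') * s (Equiv.swap p p') - 1 := by
  have hpp : p < p' := by rw [Fin.lt_def]; omega
  have hset : Finset.univ.filter (· < p') = insert p (Finset.univ.filter (· < p)) := by
    ext a
    simp only [Finset.mem_filter, Finset.mem_univ, true_and, Finset.mem_insert, Fin.lt_def,
      Fin.ext_iff]
    omega
  have hj : jucysMurphy s p' * s (Equiv.swap p p') =
      1 + s (Equiv.swap p p') * jucysMurphy s p := by
    rw [jucysMurphy, hset, Finset.sum_insert (by simp), add_mul, s_swap_mul_self, jucysMurphy,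
      Finset.mul_sum, Finset.sum_mul]
    congr 1
    refine Finset.sum_congr rfl fun a ha => ?_
    have ha' := (Finset.mem_filter.mp ha).2
    rw [← map_mul, ← map_mul]
    congr 1
    have := Equiv.swap_apply_apply (Equiv.swap p p') a p
    rw [Equiv.swap_apply_left, Equiv.swap_apply_of_ne_of_ne ha'.ne (ha'.trans hpp).ne] at this
    rw [this, inv_mul_cancel_right]
  rw [mul_add, add_mul, hsz, Equiv.swap_apply_left, hj]
  abel

/-- A homomorphism from the trigonometric Cherednik algebra given by its values on `x_p`, `z_p` and
on permutations. -/
theorem exists_cherednik_lift (h : CherednikRel κ s x z) {xinv : Fin N → R}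
    (hx : ∀ p, x p * xinv p = 1) (hx' : ∀ p, xinv p * x p = 1)
    (hz : ∀ p q, p ≠ q → zDefect s z p q = 0) :
    ∃ ρ : Cherednik N κ →ₐ[ℂ] R, (∀ p, ρ (Cherednik.x κ p) = x p) ∧
      (∀ p, ρ (Cherednik.xinv κ p) = xinv p) ∧ (∀ σ, ρ (Cherednik.s κ σ) = s σ) ∧
      ∀ p, ρ (Cherednik.z κ p) = z p := by
  let g : CherednikGen N → R := fun t => match t with
    | .s σ => s σ
    | .u p => z p + jucysMurphy s p
    | .x p => x p
    | .xinv p => xinv p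
  let f : FreeAlgebra ℂ (CherednikGen N) →ₐ[ℂ] R := FreeAlgebra.lift ℂ g
  have fs : ∀ σ, f (CherednikGen.fs σ) = s σ := fun σ => FreeAlgebra.lift_ι_apply g _
  have fu : ∀ p, f (CherednikGen.fu p) = z p + jucysMurphy s p :=
    fun σ => FreeAlgebra.lift_ι_apply g _
  have fx : ∀ p, f (CherednikGen.fx p) = x p := fun σ => FreeAlgebra.lift_ι_apply g _
  have fxinv : ∀ p, f (CherednikGen.fxinv p) = xinv p := fun σ => FreeAlgebra.lift_ι_apply g _
  have fz : ∀ p, f (CherednikGen.fz p) = z p := by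
    intro p
    simp only [CherednikGen.fz, map_sub, map_sum, fu, fs, jucysMurphy, add_sub_cancel_right]
  have hf : ∀ ⦃a b⦄, CherednikGen.Rel κ a b → f a = f b := by
    intro a b hab
    cases hab with
    | s_one => rw [fs, map_one, map_one]
    | s_mul σ τ => rw [fs, map_mul, map_mul, fs, fs]
    | u_comm p q => simp only [map_mul, fu, (commute_z_add_jucysMurphy hz h.s_z p q).eq]
    | s_u p p' q hp hq hq' =>
      simp only [map_mul, fu, fs, s_mul_z_add_jucysMurphy_of_ne h.s_z hp hq hq']
    | s_u_same p p' hp =>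
      simp only [map_mul, map_sub, map_one, fu, fs, s_mul_z_add_jucysMurphy h.s_z hp]
    | x_comm p q => simp only [map_mul, fx, (h.x_comm p q).eq]
    | x_xinv p => simp only [map_mul, map_one, fx, fxinv, hx]
    | xinv_x p => simp only [map_mul, map_one, fx, fxinv, hx']
    | s_x σ p => simp only [map_mul, fs, fx, h.s_x]
    | z_x p q hpq =>
      simp only [map_mul, map_sub, map_neg, fz, fx, fs, h.z_x p q hpq]
      abel
    | z_x_same p =>
      simp only [map_mul, map_sub, map_add, map_smul, map_sum, fz, fx, fs, h.z_x_same p]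
      abel
  refine ⟨RingQuot.liftAlgHom ℂ ⟨f, hf⟩, fun p => ?_, fun p => ?_, fun σ => ?_, fun p => ?_⟩
  · exact (RingQuot.liftAlgHom_mkAlgHom_apply ℂ f hf _).trans (fx p)
  · exact (RingQuot.liftAlgHom_mkAlgHom_apply ℂ f hf _).trans (fxinv p)
  · exact (RingQuot.liftAlgHom_mkAlgHom_apply ℂ f hf _).trans (fs σ)
  · exact (RingQuot.liftAlgHom_mkAlgHom_apply ℂ f hf _).trans (fz p)

/-- The trigonometric Cherednik algebra is generated by `x_p`, `x_p⁻¹`, `z_p` and permutations. -/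
theorem cherednik_generators {κ : ℂ} (A : Subalgebra ℂ (Cherednik N κ))
    (hx : ∀ p, Cherednik.x κ p ∈ A) (hxinv : ∀ p, Cherednik.xinv κ p ∈ A)
    (hs : ∀ σ, Cherednik.s κ σ ∈ A) (hz : ∀ p, Cherednik.z κ p ∈ A) (a : Cherednik N κ) :
    a ∈ A := by
  obtain ⟨a, rfl⟩ := RingQuot.mkAlgHom_surjective ℂ (CherednikGen.Rel (N := N) κ) a
  change Cherednik.mk N κ a ∈ A
  induction a using FreeAlgebra.induction with
  | grade0 r => rw [AlgHom.commutes]; exact A.algebraMap_mem r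
  | grade1 t =>
    cases t with
    | s σ => exact hs σ
    | u p =>
      have : Cherednik.mk N κ (FreeAlgebra.ι ℂ (CherednikGen.u p)) = Cherednik.z κ p +
          ∑ q ∈ Finset.univ.filter (· < p), Cherednik.s κ (Equiv.swap q p) := by
        simp only [Cherednik.z, Cherednik.s, CherednikGen.fz, CherednikGen.fu, map_sub, map_sum,
          sub_add_cancel]
      rw [this]
      exact A.add_mem (hz p) (A.sum_mem fun q _ => hs _)
    | x p => exact hx p
    | xinv p => exact hxinv p
  | mul a b ha hb => rw [map_mul]; exact A.mul_mem ha hb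
  | add a b ha hb => rw [map_add]; exact A.add_mem ha hb

end CherednikRelations

/-! ### Locally finite sums and commutators of currents -/

section LocallyFiniteSums

variable {V W : Type} [AddCommGroup V] [Module ℂ V] [AddCommGroup W] [Module ℂ W]

/-- A sequence of linear maps such that almost all of them vanish on any given vector. -/
def LocallyFinite (t : ℕ → V →ₗ[ℂ] W) : Prop := ∀ y, ∃ K, ∀ n, K ≤ n → t n y = 0

theorem LocallyFinite.finite {t : ℕ → V →ₗ[ℂ] W} (h : LocallyFinite t) (y : V) :
    (Function.support fun n => t n y).Finite := by
  obtain ⟨K, hK⟩ := h y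
  refine (Finset.range K).finite_toSet.subset fun n hn => ?_
  rw [Finset.mem_coe, Finset.mem_range]
  by_contra hle
  exact hn (hK n (not_lt.mp hle))

/-- The sum of a locally finite sequence of linear maps. -/
def lfSum (t : ℕ → V →ₗ[ℂ] W) (h : LocallyFinite t) : V →ₗ[ℂ] W where
  toFun y := ∑ᶠ n, t n y
  map_add' y z := by
    simp only [map_add]
    exact finsum_add_distrib (h.finite y) (h.finite z)
  map_smul' c y := by
    simp only [map_smul, RingHom.id_apply]
    exact (smul_finsum c _).symm

theorem lfSum_eq {t : ℕ → V →ₗ[ℂ] W} (h : LocallyFinite t) {y : V} {K : ℕ}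
    (hK : ∀ n, K ≤ n → t n y = 0) : lfSum t h y = ∑ n ∈ Finset.range K, t n y := by
  refine finsum_eq_sum_of_support_subset _ fun n hn => ?_
  rw [Finset.coe_range, Set.mem_Iio]
  by_contra hle
  exact hn (hK n (not_lt.mp hle))

theorem isLocallyFiniteSum_lfSum {t : ℕ → V →ₗ[ℂ] W} (h : LocallyFinite t) :
    IsLocallyFiniteSum t (lfSum t h) := by
  intro y
  obtain ⟨K, hK⟩ := h y
  filter_upwards [eventually_ge_atTop K] with K' hK'
  exact lfSum_eq h fun n hn => hK n (hK'.trans hn)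

theorem IsLocallyFiniteSum.unique {t : ℕ → V →ₗ[ℂ] W} {f g : V →ₗ[ℂ] W}
    (hf : IsLocallyFiniteSum t f) (hg : IsLocallyFiniteSum t g) : f = g := by
  ext1 y
  obtain ⟨K, h1, h2⟩ := ((hf y).and (hg y)).exists
  rw [h1, h2]

/-- Operators that intertwine the summands intertwine the sums. -/
theorem IsLocallyFiniteSum.intertwine {V' W' : Type} [AddCommGroup V'] [Module ℂ V']
    [AddCommGroup W'] [Module ℂ W'] {t : ℕ → V →ₗ[ℂ] W} {t' : ℕ → V' →ₗ[ℂ] W'} {f : V →ₗ[ℂ] W}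
    {f' : V' →ₗ[ℂ] W'} (hf : IsLocallyFiniteSum t f) (hf' : IsLocallyFiniteSum t' f')
    {A : V →ₗ[ℂ] V'} {B : W →ₗ[ℂ] W'} (h : ∀ n y, B (t n y) = t' n (A y)) (y : V) :
    B (f y) = f' (A y) := by
  obtain ⟨K, h1, h2⟩ := ((hf y).and (hf' (A y))).exists
  rw [h1, h2, map_sum]
  exact Finset.sum_congr rfl fun n _ => h n y

end LocallyFiniteSums

section Commutators

variable {R ι : Type*} [Ring R] [Fintype ι] [DecidableEq ι]

omit [DecidableEq ι] in
theorem sum_mul_sum_sub (f g : ι → ι → R) :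
    (∑ a, ∑ b, f a b) * (∑ c, ∑ d, g c d) - (∑ c, ∑ d, g c d) * (∑ a, ∑ b, f a b) =
      ∑ a, ∑ b, ∑ c, ∑ d, (f a b * g c d - g c d * f a b) := by
  have h : ∀ y : R, (∑ a, ∑ b, f a b) * y - y * (∑ a, ∑ b, f a b) =
      ∑ a, ∑ b, (f a b * y - y * f a b) := by
    intro y
    simp only [Finset.sum_mul, Finset.mul_sum, ← Finset.sum_sub_distrib]
  rw [h]
  refine Finset.sum_congr rfl fun a _ => Finset.sum_congr rfl fun b _ => ?_
  simp only [Finset.sum_mul, Finset.mul_sum, ← Finset.sum_sub_distrib]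

/-- The classical Yang–Baxter equation in abstract form: `E` and `E'` are the matrix units in two
tensor factors, `f`, `g` and `h` are currents whose powers of `t` add up, and `t` is the permutation
of the factors. -/
theorem sum_mul_commutator {E E' f g h : ι → ι → R} {t : R}
    (hE : ∀ a b c d, E a b * E' c d = E' c d * E a b)
    (hf : ∀ a b c d, f a b * E' c d = E' c d * f a b)
    (hg : ∀ a b c d, g a b * E c d = E c d * g a b)
    (hfg : ∀ a b c d, f b a * g d c - g d c * f b a =
      (if a = d then h b c else 0) - if c = b then h d a else 0)
    (ht : ∀ a b, t * E a b = ∑ c, E c b * E' a c)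
    (ht' : ∀ a b, t * E' a b = ∑ c, E a c * E' c b) :
    (∑ a, ∑ b, E a b * f b a) * (∑ c, ∑ d, E' c d * g d c) -
        (∑ c, ∑ d, E' c d * g d c) * (∑ a, ∑ b, E a b * f b a) =
      t * (∑ a, ∑ b, E a b * h b a - ∑ a, ∑ b, E' a b * h b a) := by
  have hterm : ∀ a b c d, E a b * f b a * (E' c d * g d c) - E' c d * g d c * (E a b * f b a) =
      E a b * E' c d * ((if a = d then h b c else 0) - if c = b then h d a else 0) := by
    intro a b c d
    rw [← hfg, mul_assoc, ← mul_assoc (f b a), hf, mul_assoc (E' c d) (g d c),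
      ← mul_assoc (g d c), hg, mul_assoc (E a b) (g d c), ← mul_assoc (E' c d) (E a b), ← hE]
    noncomm_ring
  have hd : ∀ a b c, ∑ d, E a b * E' c d * ((if a = d then h b c else 0) -
      if c = b then h d a else 0) = E a b * E' c a * h b c -
        if c = b then ∑ d, E a b * E' c d * h d a else 0 := by
    intro a b c
    simp only [mul_sub, Finset.sum_sub_distrib, mul_ite, mul_zero, Finset.sum_ite_eq,
      Finset.mem_univ, if_true]
    split_ifs <;> simp
  have e1 : ∑ a, ∑ b, t * (E a b * h b a) = ∑ a, ∑ b, ∑ c, E a b * E' c a * h b c := by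
    simp only [← mul_assoc, ht, Finset.sum_mul]
    rw [Finset.sum_congr rfl fun x _ => Finset.sum_comm, Finset.sum_comm]
    exact Finset.sum_congr rfl fun x _ => Finset.sum_comm
  have e2 : ∑ a, ∑ b, t * (E' a b * h b a) = ∑ a, ∑ b, ∑ d, E a b * E' b d * h d a := by
    simp only [← mul_assoc, ht', Finset.sum_mul]
    exact Finset.sum_congr rfl fun x _ => Finset.sum_comm
  rw [sum_mul_sum_sub, mul_sub, Finset.mul_sum, Finset.mul_sum]
  simp only [hterm, hd, Finset.mul_sum, e1, e2, Finset.sum_sub_distrib, Finset.sum_ite_eq',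
    Finset.mem_univ, if_true]

end Commutators

section CherednikOperators

variable {m N : ℕ}

section operators

variable (V : Type) [AddCommGroup V] [Module ℂ V]

/-- The action of operators on `𝔓_N ⊗ (ℂᵐ)^{⊗N}` in the first tensor factor. -/
def rA : Module.End ℂ (P m N) →ₐ[ℂ] Module.End ℂ (P m N ⊗[ℂ] V) :=
  Module.End.rTensorAlgHom ℂ (P m N) V

variable {V}

/-- The action of operators on `V` in the second tensor factor. -/
def lA (N : ℕ) : Module.End ℂ V →ₐ[ℂ] Module.End ℂ (P m N ⊗[ℂ] V) :=
  Module.End.lTensorAlgHom ℂ V (P m N)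

theorem rA_apply (f : Module.End ℂ (P m N)) : rA V f = LinearMap.rTensor V f := rfl

theorem rA_tmul (f : Module.End ℂ (P m N)) (y : P m N) (v : V) :
    rA V f (y ⊗ₜ v) = f y ⊗ₜ v := rfl

theorem lA_tmul (g : Module.End ℂ V) (y : P m N) (v : V) :
    lA (m := m) N g (y ⊗ₜ v) = y ⊗ₜ g v := rfl

theorem rA_commute_lA (f : Module.End ℂ (P m N)) (g : Module.End ℂ V) :
    Commute (rA V f) (lA N g) :=
  TensorProduct.ext' fun _ _ => rfl

theorem map_eq_rA_mul_lA (f : Module.End ℂ (P m N)) (g : Module.End ℂ V) :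
    TensorProduct.map f g = rA V f * lA N g :=
  TensorProduct.ext' fun _ _ => rfl

end operators

variable [NeZero m] {V : Type} [AddCommGroup V] [Module ℂ V] (F : U m →ₐ[ℂ] Module.End ℂ V)

/-- The action of `slE a b k` on the second factor of `𝔓_N ⊗ (ℂᵐ)^{⊗N} ⊗ V`. -/
def eV (N : ℕ) (a b : Fin m) (k : ℤ) : Module.End ℂ (P m N ⊗[ℂ] V) :=
  lA N (F (UniversalEnvelopingAlgebra.ι ℂ (slE a b k)))

/-- The action of `C` on the second factor of `𝔓_N ⊗ (ℂᵐ)^{⊗N} ⊗ V`. -/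
def cV (N : ℕ) : Module.End ℂ (P m N ⊗[ℂ] V) :=
  lA N (F (UniversalEnvelopingAlgebra.ι ℂ (slC m)))

theorem rA_commute_eV (f : Module.End ℂ (P m N)) (a b : Fin m) (k : ℤ) :
    Commute (rA V f) (eV F N a b k) :=
  rA_commute_lA _ _

theorem eV_commutator (a b c d : Fin m) (i j : ℤ) :
    eV F N a b i * eV F N c d j - eV F N c d j * eV F N a b i =
      (if b = c then eV F N a d (i + j) else 0) - (if d = a then eV F N c b (i + j) else 0) +
        cocycle a b c d i j • cV F N := by
  have h := congrArg (fun X => lA (m := m) N (F (UniversalEnvelopingAlgebra.ι ℂ X)))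
    (slE_lie a b c d i j)
  simp only [LieHom.map_lie, LieRing.of_associative_ring_bracket, map_sub, map_mul, map_add,
    map_smul] at h
  rw [eV, eV, h]
  congr 2
  · split_ifs <;> simp [eV]
  · split_ifs <;> simp [eV]

/-- The operator `∑_{a,b} E_ab^{(p)} ⊗ (E_ba - δ_ab I / m) t^k`. -/
def curr (p : Fin N) (k : ℤ) : Module.End ℂ (P m N ⊗[ℂ] V) :=
  ∑ a, ∑ b, rA V (EOp p a b) * eV F N b a k

theorem cherednikTerm_eq (p : Fin N) (i : ℕ) :
    cherednikTerm F p i = rA V (xOp p (-(i : ℤ))) * curr F p i := by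
  simp only [cherednikTerm, curr, map_eq_rA_mul_lA, map_mul, Finset.mul_sum, mul_assoc, eV]

theorem curr_mul_comm_rA {p q : Fin N} {f : Module.End ℂ (P m N)}
    (h : ∀ a b, f * EOp p a b = EOp q a b * f) (k : ℤ) :
    rA V f * curr F p k = curr F q k * rA V f := by
  simp only [curr, Finset.mul_sum, Finset.sum_mul]
  refine Finset.sum_congr rfl fun a _ => Finset.sum_congr rfl fun b _ => ?_
  rw [← mul_assoc, ← map_mul, h, map_mul, mul_assoc, mul_assoc, (rA_commute_eV F f b a k).eq]

theorem rA_commute_curr {p : Fin N} {f : Module.End ℂ (P m N)}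
    (h : ∀ a b, Commute f (EOp p a b)) (k : ℤ) : Commute (rA V f) (curr F p k) :=
  curr_mul_comm_rA F h k

/-- The commutators of the operators `curr`: this is the classical Yang–Baxter equation for the
rational `r`-matrix. -/
theorem curr_commutator {p q : Fin N} (hpq : p ≠ q) (i j : ℕ) :
    curr F p i * curr F q j - curr F q j * curr F p i =
      rA V (tensorPermOp (Equiv.swap p q)) * (curr F p (i + j : ℕ) - curr F q (i + j : ℕ)) := by
  have hcoc : ∀ a b c d : Fin m, cocycle b a d c i j = 0 := by
    intro a b c d
    rw [cocycle]
    by_cases h : (i : ℤ) + j = 0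
    · rw [if_pos h]
      have : i = 0 := by omega
      rw [this, Int.cast_natCast, Nat.cast_zero, zero_mul]
    · rw [if_neg h]
  refine sum_mul_commutator (fun a b c d => ?_) (fun a b c d => (rA_commute_eV F _ _ _ _).symm)
    (fun a b c d => (rA_commute_eV F _ _ _ _).symm) (fun a b c d => ?_) (fun a b => ?_)
    (fun a b => ?_)
  · rw [← map_mul, ← map_mul, (EOp_commute hpq a b c d).eq]
  · have h := eV_commutator F (N := N) b a d c i j
    rw [hcoc, zero_smul, add_zero, ← Nat.cast_add] at h
    exact h
  · rw [← map_mul, tensorPermOp_mul_EOp_eq_sum hpq, map_sum]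
    simp only [map_mul]
  · rw [← map_mul, Equiv.swap_comm, tensorPermOp_mul_EOp_eq_sum hpq.symm, map_sum]
    refine Finset.sum_congr rfl fun c _ => ?_
    rw [(EOp_commute hpq.symm c b a c).eq, map_mul]

end CherednikOperators

/-! ### The action of the Cherednik algebra on smooth modules -/

section SmoothModules

variable {m N : ℕ} [NeZero m] {V : Type} [AddCommGroup V] [Module ℂ V]
  {F : U m →ₐ[ℂ] Module.End ℂ V}

/-- A module over `𝔰𝔩̂ₘ` is smooth if every vector of it is killed by `𝔰𝔩ₘ t^k` for all
sufficiently large `k`. -/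
def IsSmooth (F : U m →ₐ[ℂ] Module.End ℂ V) : Prop :=
  ∀ v, ∃ K : ℕ, ∀ k : ℤ, K ≤ k → ∀ a b, F (UniversalEnvelopingAlgebra.ι ℂ (slE a b k)) v = 0

theorem IsSmooth.eV_eq_zero (hF : IsSmooth F) (w : P m N ⊗[ℂ] V) :
    ∃ K : ℕ, ∀ k : ℤ, K ≤ k → ∀ a b, eV F N a b k w = 0 := by
  induction w using TensorProduct.induction_on with
  | zero => exact ⟨0, fun k _ a b => map_zero _⟩
  | tmul y v =>
    obtain ⟨K, hK⟩ := hF v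
    exact ⟨K, fun k hk a b => by rw [eV, lA_tmul, hK k hk, TensorProduct.tmul_zero]⟩
  | add w w' hw hw' =>
    obtain ⟨K, hK⟩ := hw
    obtain ⟨K', hK'⟩ := hw'
    refine ⟨max K K', fun k hk a b => ?_⟩
    rw [Nat.cast_max, max_le_iff] at hk
    rw [map_add, hK k hk.1, hK' k hk.2, add_zero]

theorem IsSmooth.curr_eq_zero (hF : IsSmooth F) (w : P m N ⊗[ℂ] V) :
    ∃ K : ℕ, ∀ k : ℤ, K ≤ k → ∀ p, curr F p k w = 0 := by
  obtain ⟨K, hK⟩ := hF.eV_eq_zero w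
  refine ⟨K, fun k hk p => ?_⟩
  simp only [curr, LinearMap.sum_apply, Module.End.mul_apply, hK k hk, map_zero,
    Finset.sum_const_zero]

theorem IsSmooth.locallyFinite (hF : IsSmooth F) (p : Fin N) :
    LocallyFinite (cherednikTerm F p) := by
  intro w
  obtain ⟨K, hK⟩ := hF.curr_eq_zero w
  refine ⟨K, fun n hn => ?_⟩
  rw [cherednikTerm_eq, Module.End.mul_apply, hK n (by exact_mod_cast hn), map_zero]

/-- The part of the Cherednik operator involving the action on `V`. -/
def currentPart (hF : IsSmooth F) (p : Fin N) : Module.End ℂ (P m N ⊗[ℂ] V) :=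
  lfSum (cherednikTerm F p) (hF.locallyFinite p)

theorem currentPart_spec (hF : IsSmooth F) (p : Fin N) :
    IsLocallyFiniteSum (cherednikTerm F p) (currentPart hF p) :=
  isLocallyFiniteSum_lfSum _

/-- The Cherednik operator on `𝔓_N ⊗ (ℂᵐ)^{⊗N} ⊗ V`. -/
def zOp (κ : ℂ) (hF : IsSmooth F) (p : Fin N) : Module.End ℂ (P m N ⊗[ℂ] V) :=
  rA V (dunklPart κ p) + currentPart hF p

variable (m V) in
/-- The action of permutations on `𝔓_N ⊗ (ℂᵐ)^{⊗N} ⊗ V`. -/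
def permHom (N : ℕ) : Equiv.Perm (Fin N) →* Module.End ℂ (P m N ⊗[ℂ] V) where
  toFun σ := rA V (permOp σ)
  map_one' := by rw [permOp_one, map_one]
  map_mul' σ τ := by rw [permOp_mul, map_mul]

omit [NeZero m] in
theorem permHom_apply (σ : Equiv.Perm (Fin N)) : permHom m V N σ = rA V (permOp σ) := rfl

omit [NeZero m] in
theorem permOp_mul_dunklPart (κ : ℂ) (σ : Equiv.Perm (Fin N)) (p : Fin N) :
    permOp (m := m) σ * dunklPart κ p = dunklPart κ (σ p) * permOp σ := by
  have h : ∑ r ∈ Finset.univ.filter (· ≠ p), permOp (m := m) σ * dunklOp p r =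
      ∑ r ∈ Finset.univ.filter (· ≠ σ p), dunklOp (σ p) r * permOp σ :=
    Finset.sum_equiv σ (fun a => by simp) fun r hr =>
      permOp_mul_dunklOp σ (Finset.mem_filter.mp hr).2.symm
  rw [dunklPart, dunklPart, mul_add, add_mul, mul_smul_comm, permOp_mul_eulerOp, smul_mul_assoc,
    Finset.mul_sum, Finset.sum_mul, h]

omit [NeZero m] in
theorem dunklPart_mul_xOp_of_ne (κ : ℂ) {p q : Fin N} (hqp : q ≠ p) :
    dunklPart (m := m) κ p * xOp q 1 =
      xOp q 1 * dunklPart κ p - xOp p 1 * permOp (Equiv.swap p q) := by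
  have h : ∀ r ∈ Finset.univ.filter (· ≠ p), dunklOp (m := m) p r * xOp q 1 =
      xOp q 1 * dunklOp p r - if q = r then xOp p 1 * permOp (Equiv.swap p q) else 0 := by
    intro r hr
    have hr' := (Finset.mem_filter.mp hr).2.symm
    split_ifs with hqr
    · subst hqr
      rw [sub_eq_add_neg, ← sub_eq_iff_eq_add', dunklOp_mul_xOp_right hr']
    · rw [(dunklOp_commute_xOp hr' hqp hqr).eq, sub_zero]
  rw [dunklPart, add_mul, mul_add, Finset.sum_mul, Finset.sum_congr rfl h, smul_mul_assoc,
    eulerOp_mul_xOp, if_neg hqp.symm, add_zero, mul_smul_comm, Finset.sum_sub_distrib,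
    Finset.sum_ite_eq, if_pos (by simp [hqp]), Finset.mul_sum, add_sub_assoc]

omit [NeZero m] in
theorem dunklPart_mul_xOp_same (κ : ℂ) (p : Fin N) :
    dunklPart (m := m) κ p * xOp p 1 =
      xOp p 1 * dunklPart κ p + (κ • xOp p 1 +
        ∑ r ∈ Finset.univ.filter (· ≠ p), xOp p 1 * permOp (Equiv.swap p r)) := by
  have h : ∀ r ∈ Finset.univ.filter (· ≠ p), dunklOp (m := m) p r * xOp p 1 =
      xOp p 1 * dunklOp p r + xOp p 1 * permOp (Equiv.swap p r) := by
    intro r hr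
    have hr' := (Finset.mem_filter.mp hr).2.symm
    rw [← sub_eq_iff_eq_add', dunklOp_mul_xOp_left hr']
  rw [dunklPart, add_mul, mul_add, Finset.sum_mul, Finset.sum_congr rfl h, smul_mul_assoc,
    eulerOp_mul_xOp, if_pos rfl, mul_smul_comm, Finset.sum_add_distrib, Finset.mul_sum, smul_add,
    Int.cast_one, one_smul]
  abel

theorem rA_commute_currentPart (hF : IsSmooth F) {p q : Fin N} {f : Module.End ℂ (P m N)}
    (hx : ∀ i, f * xOp p i = xOp q i * f) (hE : ∀ a b, f * EOp p a b = EOp q a b * f) :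
    rA V f * currentPart hF p = currentPart hF q * rA V f := by
  refine LinearMap.ext fun w => ?_
  refine IsLocallyFiniteSum.intertwine (A := rA V f) (B := rA V f) (currentPart_spec hF p)
    (currentPart_spec hF q) (fun n y => ?_) w
  rw [← Module.End.mul_apply, ← Module.End.mul_apply]
  congr 1
  rw [cherednikTerm_eq, cherednikTerm_eq, ← mul_assoc, ← map_mul, hx, map_mul, mul_assoc,
    curr_mul_comm_rA F hE, mul_assoc]

/-- All the relations except those between the `z_p` come from the Dunkl operators alone, since the
currents commute with multiplication by the variables and are permuted by the symmetric group. -/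
theorem zOp_cherednikRel (κ : ℂ) (hF : IsSmooth F) :
    CherednikRel κ (permHom m V N) (fun p => rA V (xOp p 1)) (zOp κ hF) where
  x_comm p q := by
    rw [Commute, SemiconjBy, ← map_mul, ← map_mul, (xOp_commute p q 1 1).eq]
  s_x σ p := by
    rw [permHom_apply, ← map_mul, ← map_mul, permOp_mul_xOp]
  s_z σ p := by
    rw [permHom_apply, zOp, zOp, mul_add, add_mul, ← map_mul, permOp_mul_dunklPart, map_mul,
      rA_commute_currentPart hF (fun i => permOp_mul_xOp σ p i) fun a b => permOp_mul_EOp σ p a b]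
  z_x p q hqp := by
    rw [permHom_apply, zOp, mul_add, add_mul, ← map_mul, ← map_mul, ← map_mul,
      dunklPart_mul_xOp_of_ne κ hqp, rA_commute_currentPart hF (p := p) (q := p)
        (fun i => (xOp_commute q p 1 i).eq) fun a b => (xOp_EOp_commute q p 1 a b).eq, map_sub]
    abel
  z_x_same p := by
    simp only [permHom_apply]
    rw [zOp, mul_add, add_mul, ← map_mul, ← map_mul, dunklPart_mul_xOp_same,
      rA_commute_currentPart hF (p := p) (q := p)
        (fun i => (xOp_commute p p 1 i).eq) fun a b => (xOp_EOp_commute p p 1 a b).eq]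
    simp only [map_add, map_smul, map_sum, map_mul]
    abel

/-- The projection onto the span of the monomials of degree zero in every variable. -/
def constProj (m N : ℕ) : Module.End ℂ (P m N) :=
  opOfBasis fun k => if k.1 = 0 then basisP k else 0

omit [NeZero m] in
theorem constProj_basisP (k : Mon m N) :
    constProj m N (basisP k) = if k.1 = 0 then basisP k else 0 := opOfBasis_basisP _ _

omit [NeZero m] in
theorem constProj_commute_EOp (p : Fin N) (a b : Fin m) :
    Commute (constProj m N) (EOp p a b) :=
  opP_ext fun k => by
    simp only [Module.End.mul_apply, constProj_basisP, EOp_basisP]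
    split_ifs <;> simp_all [constProj_basisP, EOp_basisP]

omit [NeZero m] in
theorem mul_constProj_ext {f g : Module.End ℂ (P m N)}
    (h : ∀ a, f (basisP (0, a)) = g (basisP (0, a))) :
    f * constProj m N = g * constProj m N :=
  opP_ext fun ⟨i, a⟩ => by
    simp only [Module.End.mul_apply, constProj_basisP]
    split_ifs with h0
    · subst h0; exact h a
    · simp

omit [NeZero m] in
theorem dunklPart_mul_constProj (κ : ℂ) (p : Fin N) : dunklPart κ p * constProj m N = 0 := by
  rw [← zero_mul (constProj m N)]
  refine mul_constProj_ext fun a => ?_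
  simp [dunklPart, LinearMap.sum_apply, eulerOp_const, dunklOp_const]

omit [NeZero m] in
/-- On a monomial in one other variable `x_q`, the Dunkl operator is a finite geometric sum. -/
theorem dunklPart_mul_xOp_mul_constProj (κ : ℂ) {p q : Fin N} (hpq : p ≠ q) (n : ℕ) :
    dunklPart κ p * xOp q (-n) * constProj m N = (∑ s ∈ Finset.range n,
      xOp p (-s) * xOp q (-(n - s : ℤ)) * tensorPermOp (Equiv.swap p q)) * constProj m N := by
  refine mul_constProj_ext fun a => ?_
  rw [Module.End.mul_apply, dunklPart, LinearMap.add_apply, LinearMap.sum_apply,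
    LinearMap.smul_apply, ← Module.End.mul_apply (eulerOp p), eulerOp_mul_xOp, if_neg hpq,
    add_zero, Module.End.mul_apply, eulerOp_const, map_zero, smul_zero, zero_add,
    Finset.sum_congr rfl fun r hr => dunklOp_xOp_const (Finset.mem_filter.mp hr).2.symm q
      hpq.symm n a, Finset.sum_ite_eq, if_pos (by simp [hpq.symm]), LinearMap.sum_apply]
  rfl

omit [NeZero m] in
theorem permOp_mul_constProj (σ : Equiv.Perm (Fin N)) :
    permOp σ * constProj m N = tensorPermOp σ * constProj m N := by
  refine mul_constProj_ext fun a => ?_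
  rw [permOp_basisP, tensorPermOp_basisP]
  rfl

omit [NeZero m] in
theorem commute_rA_xOp {D : Module.End ℂ (P m N ⊗[ℂ] V)} {r : Fin N}
    (h : Commute D (rA V (xOp r 1))) (j : ℤ) : Commute D (rA V (xOp r j)) := by
  have h1 : ∀ i : ℤ, rA (m := m) (N := N) V (xOp r i) * rA V (xOp r (-i)) = 1 := fun i => by
    rw [← map_mul, ← xOp_add, add_neg_cancel, xOp_zero, map_one]
  have hm : Commute D (rA V (xOp r (-1))) := by
    have e : rA V (xOp r (-1)) * D * (rA V (xOp r 1) * rA V (xOp r (-1))) =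
        D * rA V (xOp r (-1)) := by
      rw [← mul_assoc, mul_assoc _ D, h.eq, ← mul_assoc]
      have := h1 (-1)
      rw [neg_neg] at this
      rw [this, one_mul]
    rw [h1, mul_one] at e
    exact e.symm
  induction j using Int.induction_on with
  | zero => rw [xOp_zero, map_one]; exact Commute.one_right D
  | succ i hi => rw [xOp_add, map_mul]; exact hi.mul_right h
  | pred i hi => rw [sub_eq_add_neg, xOp_add, map_mul]; exact hi.mul_right hm

theorem cherednikTerm_commutator {p q : Fin N} (hpq : p ≠ q) (i j : ℕ) :
    cherednikTerm F p i * cherednikTerm F q j - cherednikTerm F q j * cherednikTerm F p i =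
      rA V (xOp p (-(i : ℤ)) * xOp q (-(j : ℤ))) * (rA V (tensorPermOp (Equiv.swap p q)) *
        (curr F p (i + j : ℕ) - curr F q (i + j : ℕ))) := by
  have hx : ∀ (r t : Fin N) (u k : ℤ), Commute (rA V (xOp r u)) (curr F t k) := fun r t u k =>
    rA_commute_curr F (fun a b => xOp_EOp_commute r t u a b) k
  rw [← curr_commutator F hpq, cherednikTerm_eq, cherednikTerm_eq, mul_sub, map_mul]
  congr 1
  · rw [mul_assoc, ← mul_assoc (curr F p i), ← (hx q p _ _).eq]
    simp only [mul_assoc]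
  · rw [mul_assoc, ← mul_assoc (curr F q j), ← (hx p q _ _).eq, ← map_mul, (xOp_commute p q _ _).eq,
      map_mul]
    simp only [mul_assoc]

/-- The sum of the monomials `x_p^{-i} x_q^{-j}` over `i + j = k` with `i, j ≥ 0`. -/
def monSum (m : ℕ) {N : ℕ} (p q : Fin N) (k : ℕ) : Module.End ℂ (P m N) :=
  ∑ s ∈ Finset.range (k + 1), xOp p (-(s : ℤ)) * xOp q (-(k - s : ℤ))

omit [NeZero m] in
theorem monSum_eq (p q : Fin N) (k : ℕ) : monSum m p q k =
    ∑ s ∈ Finset.range k, xOp p (-(s : ℤ)) * xOp q (-(k - s : ℤ)) + xOp p (-(k : ℤ)) := by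
  rw [monSum, Finset.sum_range_succ, sub_self, neg_zero, xOp_zero, mul_one]

omit [NeZero m] in
theorem monSum_comm (p q : Fin N) (k : ℕ) : monSum m p q k = monSum m q p k := by
  rw [monSum, monSum, ← Finset.sum_range_reflect]
  refine Finset.sum_congr rfl fun s hs => ?_
  have h : s ≤ k := Nat.lt_succ_iff.mp (Finset.mem_range.mp hs)
  rw [(xOp_commute p q _ _).eq]
  congr 2 <;> omega

/-- The value of `[z_p, z_q] - σ_pq (z_p - z_q)` on vectors of degree zero in every variable. -/
theorem zDefect_zOp_const (κ : ℂ) (hF : IsSmooth F) {p q : Fin N} (hpq : p ≠ q)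
    {w : P m N ⊗[ℂ] V} (hw : rA V (constProj m N) w = w) :
    zDefect (permHom m V N) (zOp κ hF) p q w = 0 := by
  obtain ⟨K₀, hK₀⟩ := hF.curr_eq_zero w
  have hT : ∀ r (n : ℕ), K₀ ≤ n → cherednikTerm F r n w = 0 := fun r n hn => by
    rw [cherednikTerm_eq, Module.End.mul_apply, hK₀ n (by exact_mod_cast hn), map_zero]
  have hev : ∀ r t : Fin N, ∀ᶠ K in atTop, ∀ j ∈ Finset.range K₀,
      currentPart hF r (cherednikTerm F t j w) =
        ∑ i ∈ Finset.range K, cherednikTerm F r i (cherednikTerm F t j w) := fun r t =>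
    (Filter.eventually_all_finset _).mpr fun j _ => currentPart_spec hF r _
  obtain ⟨K, h1, h2, hK⟩ := ((hev p q).and ((hev q p).and (eventually_ge_atTop K₀))).exists
  -- the operators on `w` as finite sums
  have hL : ∀ r, currentPart hF r w = ∑ k ∈ Finset.range K, cherednikTerm F r k w := fun r =>
    lfSum_eq _ fun n hn => hT r n (hK.trans hn)
  have hLL : ∀ r t : Fin N, (∀ j ∈ Finset.range K₀,
      currentPart hF r (cherednikTerm F t j w) =
        ∑ i ∈ Finset.range K, cherednikTerm F r i (cherednikTerm F t j w)) →
      currentPart hF r (currentPart hF t w) =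
        ∑ i ∈ Finset.range K, ∑ j ∈ Finset.range K,
          cherednikTerm F r i (cherednikTerm F t j w) := by
    intro r t h
    have h0 : ∀ j ∈ Finset.range K, j ∉ Finset.range K₀ →
        ∑ i ∈ Finset.range K, cherednikTerm F r i (cherednikTerm F t j w) = 0 := fun j _ hj => by
      rw [hT t j (by simpa using hj)]
      simp
    rw [show currentPart hF t w = ∑ k ∈ Finset.range K₀, cherednikTerm F t k w from
      lfSum_eq _ fun n hn => hT t n hn, map_sum, Finset.sum_congr rfl h, Finset.sum_comm (γ := ℕ)
      (s := Finset.range K) (t := Finset.range K)]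
    exact Finset.sum_subset (Finset.range_mono hK) h0
  have hconst : ∀ r k, rA V (constProj m N) (curr F r k w) = curr F r k w := fun r k => by
    rw [← Module.End.mul_apply, (rA_commute_curr F (constProj_commute_EOp r) k).eq,
      Module.End.mul_apply, hw]
  have hdw : ∀ r, rA V (dunklPart κ r) w = 0 := fun r => by
    rw [← hw, ← Module.End.mul_apply, ← map_mul, dunklPart_mul_constProj, map_zero,
      LinearMap.zero_apply]
  have hd : ∀ r t, r ≠ t → ∀ k : ℕ, rA V (dunklPart κ r) (cherednikTerm F t k w) =
      rA V (monSum m r t k - xOp r (-(k : ℤ)))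
        (rA V (tensorPermOp (Equiv.swap r t)) (curr F t k w)) := by
    intro r t hrt k
    rw [cherednikTerm_eq, Module.End.mul_apply, ← hconst, ← Module.End.mul_apply (rA V (xOp t _)),
      ← map_mul, ← Module.End.mul_apply, ← map_mul, ← mul_assoc,
      dunklPart_mul_xOp_mul_constProj κ hrt, monSum_eq, add_sub_cancel_right, map_mul,
      Module.End.mul_apply, ← Finset.sum_mul, map_mul, Module.End.mul_apply]
  have hs : ∀ (r : Fin N) (k : ℕ), rA V (permOp (Equiv.swap p q)) (cherednikTerm F r k w) =
      rA V (xOp (Equiv.swap p q r) (-(k : ℤ)))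
        (rA V (tensorPermOp (Equiv.swap p q)) (curr F r k w)) := by
    intro r k
    rw [cherednikTerm_eq, Module.End.mul_apply, ← hconst, ← Module.End.mul_apply,
      ← Module.End.mul_apply, ← map_mul, ← map_mul, permOp_mul_xOp, mul_assoc,
      permOp_mul_constProj, map_mul, map_mul, Module.End.mul_apply, Module.End.mul_apply]
  -- the commutator of the current parts
  have hcomm : currentPart hF p (currentPart hF q w) - currentPart hF q (currentPart hF p w) =
      ∑ k ∈ Finset.range K, rA V (monSum m p q k) (rA V (tensorPermOp (Equiv.swap p q))
        (curr F p k w - curr F q k w)) := by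
    let f : ℕ → ℕ → P m N ⊗[ℂ] V := fun i j => rA V (xOp p (-(i : ℤ)) * xOp q (-(j : ℤ)))
      (rA V (tensorPermOp (Equiv.swap p q)) (curr F p (i + j : ℕ) w - curr F q (i + j : ℕ) w))
    have hf : ∀ i j, cherednikTerm F p i (cherednikTerm F q j w) -
        cherednikTerm F q j (cherednikTerm F p i w) = f i j := fun i j =>
      LinearMap.congr_fun (cherednikTerm_commutator (F := F) hpq i j) w
    have hf0 : ∀ i j, K₀ ≤ i + j → f i j = 0 := by
      intro i j hij
      have hij' : (K₀ : ℤ) ≤ ((i + j : ℕ) : ℤ) := by exact_mod_cast hij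
      simp only [f, hK₀ _ hij', sub_self, map_zero]
    rw [hLL p q h1, hLL q p h2, Finset.sum_comm (s := Finset.range K) (t := Finset.range K)
      (f := fun i j => cherednikTerm F q i (cherednikTerm F p j w)), ← Finset.sum_sub_distrib]
    simp only [← Finset.sum_sub_distrib, hf]
    have h3 : ∀ i ∈ Finset.range K, ∑ j ∈ Finset.range K, f i j =
        ∑ j ∈ Finset.range (K - i), f i j := by
      intro i _
      refine (Finset.sum_subset (Finset.range_mono (Nat.sub_le _ _)) fun j _ hj => hf0 i j ?_).symm
      rw [Finset.mem_range, not_lt] at hj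
      omega
    rw [Finset.sum_congr rfl h3, ← Finset.sum_range_diag_flip]
    refine Finset.sum_congr rfl fun k _ => ?_
    rw [monSum, map_sum, LinearMap.sum_apply]
    refine Finset.sum_congr rfl fun s hs => ?_
    have hsk : s ≤ k := Nat.lt_succ_iff.mp (Finset.mem_range.mp hs)
    simp only [f]
    rw [Nat.add_sub_cancel' hsk, Nat.cast_sub hsk]
  have hz : ∀ r t, zOp κ hF r (zOp κ hF t w) = rA V (dunklPart κ r) (currentPart hF t w) +
      currentPart hF r (currentPart hF t w) := by
    intro r t
    rw [zOp, zOp, LinearMap.add_apply, LinearMap.add_apply, hdw, zero_add]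
  have hzw : ∀ r, zOp κ hF r w = currentPart hF r w := fun r => by
    rw [zOp, LinearMap.add_apply, hdw, zero_add]
  have hgoal : zDefect (permHom m V N) (zOp κ hF) p q w =
      zOp κ hF p (zOp κ hF q w) - zOp κ hF q (zOp κ hF p w) -
        (rA V (permOp (Equiv.swap p q)) (zOp κ hF p w) -
          rA V (permOp (Equiv.swap p q)) (zOp κ hF q w)) := by
    rw [← map_sub]
    rfl
  rw [hgoal, hz, hz, hzw, hzw, add_sub_add_comm, hcomm, hL, hL, map_sum, map_sum, map_sum, map_sum,
    ← Finset.sum_sub_distrib, ← Finset.sum_sub_distrib, ← Finset.sum_add_distrib,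
    ← Finset.sum_sub_distrib]
  refine Finset.sum_eq_zero fun k _ => ?_
  rw [hd p q hpq, hd q p hpq.symm, hs p, hs q, Equiv.swap_apply_left, Equiv.swap_apply_right,
    Equiv.swap_comm q p, monSum_comm q p, map_sub, map_sub, LinearMap.sub_apply,
    LinearMap.sub_apply, map_sub, map_sub]
  abel

/-- The relation `[z_p, z_q] = σ_pq (z_p - z_q)`. The difference of its two sides commutes with
multiplication by the Laurent polynomials by `CherednikRel.zDefect_commute`, so that it is enough to
consider vectors that do not depend on the variables. -/
theorem zDefect_zOp (κ : ℂ) (hF : IsSmooth F) {p q : Fin N} (hpq : p ≠ q) :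
    zDefect (permHom m V N) (zOp κ hF) p q = 0 := by
  set D := zDefect (permHom m V N) (zOp κ hF) p q
  have hD : ∀ r j, Commute D (rA V (xOp r j)) := fun r =>
    commute_rA_xOp ((zOp_cherednikRel κ hF).zDefect_commute hpq r)
  let M : Submodule ℂ (P m N) :=
    { carrier := {y | ∀ v, D (y ⊗ₜ v) = 0}
      add_mem' := fun {y y'} hy hy' v => by rw [TensorProduct.add_tmul, map_add, hy, hy', add_zero]
      zero_mem' := fun v => by rw [TensorProduct.zero_tmul, map_zero]
      smul_mem' := fun c y hy v => by rw [← TensorProduct.smul_tmul', map_smul, hy, smul_zero] }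
  have hM : M = ⊤ := by
    refine submodule_eq_top_of_const (fun a v => ?_) fun r j y hy v => ?_
    · refine zDefect_zOp_const κ hF hpq ?_
      rw [rA_tmul, constProj_basisP, if_pos rfl]
    · rw [← rA_tmul, ← Module.End.mul_apply, (hD r j).eq, Module.End.mul_apply, hy v, map_zero]
  refine TensorProduct.ext' fun y v => ?_
  have : y ∈ M := hM ▸ Submodule.mem_top
  exact this v

/-- The action of the trigonometric Cherednik algebra on `𝔓_N ⊗ (ℂᵐ)^{⊗N} ⊗ V` for a smooth module
`V` of an arbitrary level. -/
theorem exists_cherednikAction (κ : ℂ) (hF : IsSmooth F) :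
    ∃ ρ : Cherednik N κ →ₐ[ℂ] Module.End ℂ (P m N ⊗[ℂ] V), IsCherednikAction κ F ρ ∧
      ∀ p, ρ (Cherednik.z κ p) = zOp κ hF p := by
  obtain ⟨ρ, hx, hxinv, hs, hz⟩ := exists_cherednik_lift (zOp_cherednikRel κ hF)
    (xinv := fun p => rA V (xOp p (-1)))
    (fun p => by rw [← map_mul, ← xOp_add, add_neg_cancel, xOp_zero, map_one])
    (fun p => by rw [← map_mul, ← xOp_add, neg_add_cancel, xOp_zero, map_one])
    (fun p q hpq => zDefect_zOp (N := N) κ hF hpq)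
  refine ⟨ρ, ⟨hx, hxinv, hs, fun p => ?_⟩, hz⟩
  rw [hz, zOp, ← rA_apply, add_sub_cancel_left]
  exact currentPart_spec hF p

/-- The action is determined by the generators, and the value of a locally finite sum is unique. -/
theorem IsCherednikAction.unique {κ : ℂ} {ρ ρ' : Cherednik N κ →ₐ[ℂ] Module.End ℂ (P m N ⊗[ℂ] V)}
    (h : IsCherednikAction κ F ρ) (h' : IsCherednikAction κ F ρ') : ρ' = ρ := by
  obtain ⟨hx, hxinv, hs, hz⟩ := h
  obtain ⟨hx', hxinv', hs', hz'⟩ := h'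
  refine AlgHom.ext fun a => ?_
  refine cherednik_generators (AlgHom.equalizer ρ' ρ) (fun p => ?_) (fun p => ?_) (fun σ => ?_)
    (fun p => ?_) a
  · rw [AlgHom.mem_equalizer, hx, hx']
  · rw [AlgHom.mem_equalizer, hxinv, hxinv']
  · rw [AlgHom.mem_equalizer, hs, hs']
  · rw [AlgHom.mem_equalizer]
    exact sub_left_injective ((hz' p).unique (hz p))

end SmoothModules

/-! ### Commutators with the action of `𝔰𝔩̂ₘ` -/

section CommutatorsWithLieAlgebra

variable {m N : ℕ} [NeZero m] {V : Type} [AddCommGroup V] [Module ℂ V]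
  (F : U m →ₐ[ℂ] Module.End ℂ V)

omit [NeZero m] in
theorem diagAct_apply (X : affineSL m) :
    diagAct N F X = rA V (loopRep m N X) + lA N (F (UniversalEnvelopingAlgebra.ι ℂ X)) := rfl

theorem diagAct_slE (c d : Fin m) (j : ℤ) :
    diagAct N F (slE c d j) = rA V (loopRep m N (slE c d j)) + eV F N c d j := rfl

/-- The operator `∑_b E_cb^{(p)} ⊗ E_bd t^k - ∑_a E_ad^{(p)} ⊗ E_ca t^k`. -/
def brCurr (p : Fin N) (c d : Fin m) (k : ℤ) : Module.End ℂ (P m N ⊗[ℂ] V) :=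
  ∑ b, rA V (EOp p c b) * eV F N b d k - ∑ a, rA V (EOp p a d) * eV F N c a k

theorem sum_mul_commutator_right {R ι : Type*} [Ring R] [Fintype ι] {E f : ι → ι → R} {y : R}
    (h : ∀ a b, E a b * y = y * E a b) :
    (∑ a, ∑ b, E a b * f b a) * y - y * (∑ a, ∑ b, E a b * f b a) =
      ∑ a, ∑ b, E a b * (f b a * y - y * f b a) := by
  simp only [Finset.sum_mul, Finset.mul_sum, ← Finset.sum_sub_distrib, mul_sub, ← mul_assoc, h]

theorem sum_mul_commutator_left {R ι : Type*} [Ring R] [Fintype ι] {E f : ι → ι → R} {y : R}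
    (h : ∀ a b, f a b * y = y * f a b) :
    (∑ a, ∑ b, E a b * f b a) * y - y * (∑ a, ∑ b, E a b * f b a) =
      ∑ a, ∑ b, (E a b * y - y * E a b) * f b a := by
  simp only [Finset.sum_mul, Finset.mul_sum, ← Finset.sum_sub_distrib, sub_mul, mul_assoc, h]

omit [NeZero m] in
/-- The sum over the matrix units of the central terms in the commutators of their currents. -/
theorem sum_cocycle (p : Fin N) (c d : Fin m) (i j : ℤ) :
    ∑ a, ∑ b, cocycle b a c d i j • EOp p a b =
      (if i + j = 0 then (i : ℂ) else 0) • slOp p c d := by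
  by_cases h : i + j = 0
  · have h1 : ∀ a b, cocycle b a c d i j • EOp p a b = (i : ℂ) •
        ((if a = c then (if b = d then EOp p c d else 0) else 0) -
          trc c d • if a = b then EOp p a a else 0) := by
      intro a b
      rw [cocycle, if_pos h, mul_smul, sub_smul]
      congr 2
      · by_cases hac : a = c
        · by_cases hbd : b = d
          · simp [hac, hbd]
          · simp [hac, hbd, Ne.symm hbd]
        · simp [hac]
      · by_cases hcd : c = d
        · by_cases hab : a = b
          · simp [hcd, hab, trc]
          · simp [hcd, hab, Ne.symm hab, trc]
        · simp [hcd, trc]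
    simp only [h1, ← Finset.smul_sum, Finset.sum_sub_distrib, Finset.sum_ite_eq,
      Finset.mem_univ, if_true, sum_EOp_diag, if_pos h, slOp]
    simp
  · simp only [cocycle, if_neg h, zero_smul, Finset.sum_const_zero]

theorem mul_commutator_of_commute {R : Type*} [Ring R] {x y k b : R} (hx : Commute x k)
    (h : k * y - y * k = -b) : k * (x * y) - x * y * k = -(x * b) := by
  rw [← mul_neg, ← h, ← mul_assoc, ← hx.eq, mul_sub, mul_assoc, mul_assoc]

theorem curr_commutator_eV (p : Fin N) (c d : Fin m) (i j : ℤ) :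
    curr F p i * eV F N c d j - eV F N c d j * curr F p i = brCurr F p c d (i + j) +
      (if i + j = 0 then (i : ℂ) else 0) • (rA V (slOp p c d) * cV F N) := by
  rw [curr, sum_mul_commutator_right fun a b => (rA_commute_eV F _ _ _ _).eq]
  simp only [eV_commutator, mul_add, mul_sub, mul_ite, mul_zero, Finset.sum_add_distrib,
    Finset.sum_sub_distrib]
  congr 1
  · rw [brCurr]
    congr 1
    · rw [Finset.sum_comm]
      simp only [Finset.sum_ite_eq', Finset.mem_univ, if_true]
    · simp only [Finset.sum_ite_eq, Finset.mem_univ, if_true]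
  · simp only [mul_smul_comm, ← smul_mul_assoc, ← map_smul, ← Finset.sum_mul, ← map_sum]
    rw [sum_cocycle]

theorem curr_commutator_slOp (p : Fin N) (c d : Fin m) (i : ℤ) :
    curr F p i * rA V (slOp p c d) - rA V (slOp p c d) * curr F p i = -brCurr F p c d i := by
  have h : ∀ a b, EOp (N := N) p a b * slOp p c d - slOp p c d * EOp p a b =
      (if b = c then EOp p a d else 0) - if d = a then EOp p c b else 0 := by
    intro a b
    rw [slOp, mul_sub, sub_mul, mul_smul_comm, smul_mul_assoc, mul_one, one_mul,
      sub_sub_sub_cancel_right, EOp_mul_EOp, EOp_mul_EOp]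
  rw [curr, sum_mul_commutator_left fun a b => (rA_commute_eV F _ _ _ _).symm.eq]
  simp only [← map_mul, ← map_sub, h]
  simp only [map_sub, sub_mul, Finset.sum_sub_distrib]
  rw [brCurr, neg_sub]
  congr 1
  · refine Finset.sum_congr rfl fun a _ => ?_
    rw [Finset.sum_eq_single c]
    · simp
    · intro b _ hb; simp [hb]
    · simp
  · rw [Finset.sum_comm]
    refine Finset.sum_congr rfl fun b _ => ?_
    rw [Finset.sum_eq_single d]
    · simp
    · intro a _ ha; simp [Ne.symm ha]
    · simp

omit [NeZero m] in
theorem slOp_commute_EOp {p q : Fin N} (hpq : p ≠ q) (a b c d : Fin m) :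
    Commute (slOp p a b) (EOp q c d) :=
  (EOp_commute hpq a b c d).sub_left ((Commute.one_left _).smul_left _)

omit [NeZero m] in
theorem xOp_commute_slOp (p q : Fin N) (j : ℤ) (a b : Fin m) :
    Commute (xOp p j) (slOp q a b) :=
  (xOp_EOp_commute p q j a b).sub_right ((Commute.one_right _).smul_right _)

theorem xOp_commute_loopRep (p : Fin N) (i : ℤ) (X : affineSL m) :
    Commute (xOp p i) (loopRep m N X) := by
  have hX : X ∈ (LinearMap.ker (((LinearMap.mulLeft ℂ (xOp p i) - LinearMap.mulRight ℂ (xOp p i)) :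
      Module.End ℂ (Module.End ℂ (P m N))) ∘ₗ (loopRep m N : affineSL m →ₗ[ℂ] _))) := by
    refine affineSL_induction (fun a b j => ?_) ?_ X
    · rw [LinearMap.mem_ker]
      change xOp p i * loopRep m N (slE a b j) - loopRep m N (slE a b j) * xOp p i = 0
      rw [loopRep_slE, sub_eq_zero]
      exact Commute.sum_right _ _ _ fun q _ => (xOp_commute p q i j).mul_right
        (xOp_commute_slOp p q i a b)
    · rw [LinearMap.mem_ker]
      change xOp p i * loopRep m N (slC m) - loopRep m N (slC m) * xOp p i = 0
      rw [loopRep_slC, mul_zero, zero_mul, sub_zero]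
  exact sub_eq_zero.mp hX

theorem permOp_commute_loopRep (σ : Equiv.Perm (Fin N)) (X : affineSL m) :
    Commute (permOp σ) (loopRep m N X) := by
  have hX : X ∈ (LinearMap.ker (((LinearMap.mulLeft ℂ (permOp σ) - LinearMap.mulRight ℂ (permOp σ)) :
      Module.End ℂ (Module.End ℂ (P m N))) ∘ₗ (loopRep m N : affineSL m →ₗ[ℂ] _))) := by
    refine affineSL_induction (fun a b j => ?_) ?_ X
    · rw [LinearMap.mem_ker]
      change permOp σ * loopRep m N (slE a b j) - loopRep m N (slE a b j) * permOp σ = 0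
      rw [loopRep_slE, sub_eq_zero, Finset.mul_sum, Finset.sum_mul]
      refine Finset.sum_equiv σ (by simp) fun q _ => ?_
      rw [← mul_assoc, permOp_mul_xOp, mul_assoc, mul_assoc, slOp, slOp, mul_sub, sub_mul,
        permOp_mul_EOp, mul_smul_comm, smul_mul_assoc, mul_one, one_mul]
    · rw [LinearMap.mem_ker]
      change permOp σ * loopRep m N (slC m) - loopRep m N (slC m) * permOp σ = 0
      rw [loopRep_slC, mul_zero, zero_mul, sub_zero]
  exact sub_eq_zero.mp hX

/-- Only the summand of `loopRep` with the index `p` contributes to this commutator. -/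
theorem curr_commutator_loopRep (p : Fin N) (c d : Fin m) (i j : ℤ) :
    curr F p i * rA V (loopRep m N (slE c d j)) - rA V (loopRep m N (slE c d j)) * curr F p i =
      -(rA V (xOp p j) * brCurr F p c d i) := by
  have hx : ∀ q, Commute (rA V (xOp q j)) (curr F p i) := fun q =>
    rA_commute_curr F (fun a b => xOp_EOp_commute q p j a b) i
  have h : ∀ q, curr F p i * rA V (xOp q j * slOp q c d) - rA V (xOp q j * slOp q c d) *
      curr F p i = if p = q then -(rA V (xOp p j) * brCurr F p c d i) else 0 := by
    intro q
    split_ifs with hpq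
    · subst hpq
      rw [map_mul]
      exact mul_commutator_of_commute (hx p) (curr_commutator_slOp F p c d i)
    · rw [sub_eq_zero]
      refine (rA_commute_curr F (fun a b => ?_) i).symm
      exact (xOp_EOp_commute q p j a b).mul_left (slOp_commute_EOp (Ne.symm hpq) c d a b)
  rw [loopRep_slE, map_sum, Finset.mul_sum, Finset.sum_mul, ← Finset.sum_sub_distrib]
  simp only [h, Finset.sum_ite_eq, Finset.mem_univ, if_true]

/-- The commutator of a summand of the Cherednik operator with `E_cd t^j`. -/
theorem cherednikTerm_commutator_diagAct (p : Fin N) (c d : Fin m) (i : ℕ) (j : ℤ) :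
    cherednikTerm F p i * diagAct N F (slE c d j) - diagAct N F (slE c d j) * cherednikTerm F p i =
      rA V (xOp p (-(i : ℤ))) * brCurr F p c d (i + j) -
        rA V (xOp p (j - i)) * brCurr F p c d i +
        (if (i : ℤ) + j = 0 then (i : ℂ) else 0) •
          (rA V (xOp p (-(i : ℤ)) * slOp p c d) * cV F N) := by
  have h1 : Commute (rA V (xOp p (-(i : ℤ)))) (diagAct N F (slE c d j)) := by
    rw [diagAct_slE]
    refine Commute.add_right ?_ (rA_commute_eV F _ _ _ _)
    rw [Commute, SemiconjBy, ← map_mul, (xOp_commute_loopRep p _ _).eq, map_mul]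
  have h2 : curr F p i * diagAct N F (slE c d j) - diagAct N F (slE c d j) * curr F p i =
      brCurr F p c d (i + j) + (if (i : ℤ) + j = 0 then (i : ℂ) else 0) •
        (rA V (slOp p c d) * cV F N) - rA V (xOp p j) * brCurr F p c d i := by
    have e1 := curr_commutator_eV F p c d i j
    have e2 := curr_commutator_loopRep F p c d i j
    rw [Int.cast_natCast] at e1
    rw [← e1, sub_eq_add_neg _ (rA V (xOp p j) * _), ← e2, diagAct_slE, mul_add, add_mul]
    abel
  rw [cherednikTerm_eq, mul_assoc, ← mul_assoc (diagAct N F _), ← h1.eq, mul_assoc, ← mul_sub, h2,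
    mul_sub, mul_add, ← mul_assoc, ← map_mul, ← xOp_add, mul_smul_comm, ← mul_assoc, ← map_mul,
    neg_add_eq_sub]
  abel

theorem dunklPart_commute_loopRep_const (κ : ℂ) (p : Fin N) (c d : Fin m) :
    Commute (dunklPart κ p) (loopRep m N (slE c d 0)) := by
  have hE : Commute (eulerOp p) (loopRep m N (slE c d 0)) := by
    rw [loopRep_slE]
    refine Commute.sum_right _ _ _ fun q _ => ?_
    rw [xOp_zero, one_mul]
    exact (eulerOp_commute_EOp p q c d).sub_right ((Commute.one_right _).smul_right _)
  refine (hE.smul_left κ).add_left (Commute.sum_left _ _ _ fun r hr => ?_)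
  have hpr := (Finset.mem_filter.mp hr).2.symm
  refine sub_eq_zero.mp (dunklOp_commutator hpr (fun q => xOp_commute_loopRep q 1 _)
    (permOp_commute_loopRep _ _) ?_)
  have ht : tensorPermOp (Equiv.swap p r) * loopRep m N (slE c d 0) =
      loopRep m N (slE c d 0) * tensorPermOp (Equiv.swap p r) := by
    rw [loopRep_slE, Finset.mul_sum, Finset.sum_mul]
    refine Finset.sum_equiv (Equiv.swap p r) (by simp) fun q _ => ?_
    rw [xOp_zero, xOp_zero, one_mul, one_mul, slOp, slOp, mul_sub, sub_mul, tensorPermOp_mul_EOp,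
      mul_smul_comm, smul_mul_assoc, mul_one, one_mul]
  rw [ht, sub_self, mul_zero, mul_zero]

/-- The summands of the Cherednik operator commute with the subalgebra `𝔰𝔩ₘ`. -/
theorem cherednikTerm_commute_const (p : Fin N) (c d : Fin m) (i : ℕ) :
    Commute (cherednikTerm F p i) (diagAct N F (slE c d 0)) := by
  have h := cherednikTerm_commutator_diagAct F p c d i 0
  rw [add_zero, zero_sub, sub_self, zero_add] at h
  refine sub_eq_zero.mp (h.trans ?_)
  split_ifs with hi
  · rw [Nat.cast_eq_zero.mp hi, Nat.cast_zero, zero_smul]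
  · rw [zero_smul]

/-- The terms with `x_p⁻¹` come from the derivative, and those with the other variables from the
Dunkl operators. Together with the currents they cancel modulo `𝔫̂`. -/
theorem dunklPart_commutator_loopRep (κ : ℂ) (p : Fin N) (c d : Fin m) :
    dunklPart κ p * loopRep m N (slE c d (-1)) - loopRep m N (slE c d (-1)) * dunklPart κ p =
      -(κ • (xOp p (-1) * slOp p c d)) - ∑ r ∈ Finset.univ.filter (· ≠ p),
        xOp r (-1) * (tensorPermOp (Equiv.swap p r) * (slOp p c d - slOp r c d)) := by
  have hE : eulerOp p * loopRep m N (slE c d (-1)) - loopRep m N (slE c d (-1)) * eulerOp p =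
      -(xOp p (-1) * slOp p c d) := by
    have h : ∀ q, eulerOp p * (xOp q (-1) * slOp q c d) - xOp q (-1) * slOp q c d * eulerOp p =
        if p = q then -(xOp p (-1) * slOp p c d) else 0 := by
      intro q
      have hc : Commute (eulerOp p) (slOp q c d) :=
        (eulerOp_commute_EOp p q c d).sub_right ((Commute.one_right _).smul_right _)
      rw [← mul_assoc, eulerOp_mul_xOp, add_mul, mul_assoc, hc.eq, ← mul_assoc,
        add_sub_cancel_left]
      split_ifs with hpq
      · subst hpq
        simp
      · rw [zero_mul]
    rw [loopRep_slE, Finset.mul_sum, Finset.sum_mul, ← Finset.sum_sub_distrib]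
    simp only [h, Finset.sum_ite_eq, Finset.mem_univ, if_true]
  have hd : ∀ r ∈ Finset.univ.filter (· ≠ p), dunklOp p r * loopRep m N (slE c d (-1)) -
      loopRep m N (slE c d (-1)) * dunklOp p r =
      -(xOp r (-1) * (tensorPermOp (Equiv.swap p r) * (slOp p c d - slOp r c d))) := by
    intro r hr
    have hpr := (Finset.mem_filter.mp hr).2.symm
    refine dunklOp_commutator hpr (fun q => xOp_commute_loopRep q 1 _)
      (permOp_commute_loopRep _ _) ?_
    set t := tensorPermOp (m := m) (Equiv.swap p r) with ht
    have htS : ∀ q, t * slOp q c d = slOp (Equiv.swap p r q) c d * t := fun q => by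
      rw [slOp, slOp, mul_sub, sub_mul, ht, tensorPermOp_mul_EOp, mul_smul_comm, smul_mul_assoc,
        mul_one, one_mul]
    have h1 : t * loopRep m N (slE c d (-1)) = ∑ q, xOp q (-1) * (t * slOp q c d) := by
      rw [loopRep_slE, Finset.mul_sum]
      refine Finset.sum_congr rfl fun q _ => ?_
      rw [← mul_assoc, ht, (tensorPermOp_commute_xOp _ _ _).eq, mul_assoc]
    have h2 : loopRep m N (slE c d (-1)) * t =
        ∑ q, xOp q (-1) * (t * slOp (Equiv.swap p r q) c d) := by
      rw [loopRep_slE, Finset.sum_mul]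
      refine Finset.sum_congr rfl fun q _ => ?_
      rw [htS, Equiv.swap_apply_self, mul_assoc]
    have h3 : t * loopRep m N (slE c d (-1)) - loopRep m N (slE c d (-1)) * t =
        (xOp p (-1) - xOp r (-1)) * (t * (slOp p c d - slOp r c d)) := by
      rw [h1, h2, ← Finset.sum_sub_distrib, ← Finset.sum_subset (Finset.subset_univ {p, r}),
        Finset.sum_pair hpr, Equiv.swap_apply_left, Equiv.swap_apply_right]
      · noncomm_ring
      · intro q _ hq
        rw [Finset.mem_insert, Finset.mem_singleton, not_or] at hq
        rw [Equiv.swap_apply_of_ne_of_ne hq.1 hq.2, sub_self]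
    have h4 : xOp (m := m) p 1 * (xOp p (-1) - xOp r (-1)) =
        -((xOp p 1 - xOp r 1) * xOp r (-1)) := by
      rw [mul_sub, sub_mul, ← xOp_add, ← xOp_add, add_neg_cancel, xOp_zero, xOp_zero, neg_sub]
    rw [h3, ← mul_assoc, h4, mul_neg, neg_mul, mul_assoc]
  rw [dunklPart, add_mul, mul_add, add_sub_add_comm, smul_mul_assoc, mul_smul_comm, ← smul_sub, hE,
    Finset.sum_mul, Finset.mul_sum, ← Finset.sum_sub_distrib, Finset.sum_congr rfl hd,
    Finset.sum_neg_distrib, smul_neg, sub_eq_add_neg]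

end CommutatorsWithLieAlgebra

/-! ### The action on the coinvariants -/

section Coinvariants

variable {m N : ℕ} {V : Type} [AddCommGroup V] [Module ℂ V] {F : U m →ₐ[ℂ] Module.End ℂ V}

variable (N F) in
/-- The subspace `𝔫̂ (𝔓_N ⊗ (ℂᵐ)^{⊗N} ⊗ V)`. -/
def nSub : Submodule ℂ (P m N ⊗[ℂ] V) :=
  Submodule.span ℂ {w | ∃ X ∈ nhat m, ∃ v, w = diagAct N F X v}

theorem diagAct_mem_nSub {X : affineSL m} (hX : X ∈ nhat m) (w : P m N ⊗[ℂ] V) :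
    diagAct N F X w ∈ nSub N F :=
  Submodule.subset_span ⟨X, hX, w, rfl⟩

variable [NeZero m]

omit [NeZero m] in
/-- The result of moving the operator `∑_b E_cb^{(p)} ⊗ E_bd t⁻¹ - ∑_a E_ad^{(p)} ⊗ E_ca t⁻¹` from
`V`
to the `q`-th tensor factor. -/
theorem sum_slOp_mul_EOp (p q : Fin N) (c d : Fin m) (h : (m : ℂ) ≠ 0) :
    ∑ b, slOp q b d * EOp p c b - ∑ a, slOp q c a * EOp p a d =
      if q = p then -((m : ℂ) • slOp p c d) else
        -(tensorPermOp (Equiv.swap p q) * (slOp p c d - slOp q c d)) := by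
  have h1 : ∑ b, slOp q b d * EOp p c b - ∑ a, slOp q c a * EOp p a d =
      ∑ b, EOp q b d * EOp p c b - ∑ a, EOp q c a * EOp p a d := by
    have e1 : ∑ b, trc b d • EOp p c b = trc d d • EOp p c d := by
      rw [Finset.sum_eq_single d]
      · intro b _ hb; simp [trc, hb]
      · simp
    have e2 : ∑ a, trc c a • EOp p a d = trc c c • EOp p c d := by
      rw [Finset.sum_eq_single c]
      · intro b _ hb; simp [trc, Ne.symm hb]
      · simp
    have e3 : (trc d d : ℂ) = trc c c := by simp [trc]
    simp only [slOp, sub_mul, smul_mul_assoc, one_mul, Finset.sum_sub_distrib, e1, e2, e3]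
    abel
  rw [h1]
  split_ifs with hqp
  · subst hqp
    simp only [EOp_mul_EOp, if_true, Finset.sum_const, Finset.card_univ, Fintype.card_fin, slOp,
      smul_sub, smul_smul]
    by_cases hcd : c = d
    · subst hcd
      simp only [if_true, sum_EOp_diag, trc, mul_inv_cancel₀ h, one_smul, Nat.cast_smul_eq_nsmul]
      abel
    · simp [hcd, Ne.symm hcd, trc, Nat.cast_smul_eq_nsmul]
  · have e1 : tensorPermOp (Equiv.swap p q) * slOp q c d - tensorPermOp (Equiv.swap p q) *
        slOp p c d = tensorPermOp (Equiv.swap p q) * EOp q c d - tensorPermOp (Equiv.swap p q) *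
        EOp p c d := by
      simp only [slOp, mul_sub]
      abel
    have e2 : ∑ a, EOp q c a * EOp p a d = ∑ a, EOp p a d * EOp q c a :=
      Finset.sum_congr rfl fun a _ => (EOp_commute hqp c a a d).eq
    rw [mul_sub, neg_sub, e1, tensorPermOp_mul_EOp_eq_sum (Ne.symm hqp), Equiv.swap_comm,
      tensorPermOp_mul_EOp_eq_sum hqp, e2]

/-- The boundary term of `currentPart_commutator`, with the elements of degree `-1` moved from `V`
to `𝔓_N ⊗ (ℂᵐ)^{⊗N}` modulo the image of `𝔫̂`. -/
theorem brCurr_add_mem_nSub (p : Fin N) (c d : Fin m) (w : P m N ⊗[ℂ] V) :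
    brCurr F p c d (-1) w + rA V (∑ q, xOp q (-1) *
      (∑ b, slOp q b d * EOp p c b - ∑ a, slOp q c a * EOp p a d)) w ∈ nSub N F := by
  have h : ∀ a b (f : Module.End ℂ (P m N)), (rA V f * eV F N a b (-1)) w =
      diagAct N F (slE a b (-1)) (rA V f w) - rA V (∑ q, xOp q (-1) * (slOp q a b * f)) w := by
    intro a b f
    rw [(rA_commute_eV F f a b (-1)).eq, Module.End.mul_apply, diagAct_slE, LinearMap.add_apply,
      loopRep_slE, ← Module.End.mul_apply, ← Module.End.mul_apply, ← map_mul, Finset.sum_mul]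
    simp only [mul_assoc, add_sub_cancel_left]
  have e : brCurr F p c d (-1) w + rA V (∑ q, xOp q (-1) *
      (∑ b, slOp q b d * EOp p c b - ∑ a, slOp q c a * EOp p a d)) w =
      ∑ b, diagAct N F (slE b d (-1)) (rA V (EOp p c b) w) -
        ∑ a, diagAct N F (slE c a (-1)) (rA V (EOp p a d) w) := by
    rw [brCurr, LinearMap.sub_apply, LinearMap.sum_apply, LinearMap.sum_apply,
      Finset.sum_congr rfl fun b _ => h b d (EOp p c b),
      Finset.sum_congr rfl fun a _ => h c a (EOp p a d), Finset.sum_sub_distrib,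
      Finset.sum_sub_distrib]
    have e2 : ∀ f g : Fin m → Fin N → Module.End ℂ (P m N),
        rA V (∑ q, xOp q (-1) * (∑ b, f b q - ∑ a, g a q)) w =
          ∑ b, rA V (∑ q, xOp q (-1) * f b q) w - ∑ b, rA V (∑ q, xOp q (-1) * g b q) w := by
      intro f g
      simp only [mul_sub, Finset.sum_sub_distrib, Finset.mul_sum, map_sub, LinearMap.sub_apply,
        map_sum, LinearMap.sum_apply]
      rw [Finset.sum_comm, Finset.sum_comm (γ := Fin N)]
    rw [e2 (fun b q => slOp q b d * EOp p c b) fun a q => slOp q c a * EOp p a d]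
    abel
  rw [e]
  exact sub_mem (sum_mem fun b _ => diagAct_mem_nSub (slE_mem_nhat (Or.inl (by norm_num))) _)
    (sum_mem fun b _ => diagAct_mem_nSub (slE_mem_nhat (Or.inl (by norm_num))) _)

/-- The current part of a Cherednik operator commutes with `E_cd t⁻¹` up to a boundary term and a
central term. -/
theorem currentPart_commutator (hF : IsSmooth F) {l : ℂ}
    (hC : F (UniversalEnvelopingAlgebra.ι ℂ (slC m)) = l • 1) (p : Fin N) (c d : Fin m)
    (w : P m N ⊗[ℂ] V) :
    currentPart hF p (diagAct N F (slE c d (-1)) w) -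
      diagAct N F (slE c d (-1)) (currentPart hF p w) =
      brCurr F p c d (-1) w + l • rA V (xOp p (-1) * slOp p c d) w := by
  set X := diagAct N F (slE c d (-1)) with hX
  obtain ⟨K₀, hK₀⟩ := hF.eV_eq_zero w
  obtain ⟨K, h1, h2, hK, hK2⟩ := ((currentPart_spec hF p (X w)).and
    ((currentPart_spec hF p w).and ((eventually_ge_atTop (K₀ + 1)).and
      (eventually_ge_atTop 2)))).exists
  have hcV : cV F N w = l • w := by
    rw [cV, hC, map_smul, map_one]
    rfl
  let g : ℕ → P m N ⊗[ℂ] V := fun i => rA V (xOp p (-(i : ℤ))) (brCurr F p c d (i + -1) w)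
  have hg0 : g 0 = brCurr F p c d (-1) w := by
    simp only [g]
    rw [Nat.cast_zero, neg_zero, zero_add, xOp_zero, map_one]
    rfl
  have hgK : g K = 0 := by
    have hb : brCurr F p c d (K + -1) w = 0 := by
      have : (K₀ : ℤ) ≤ K + -1 := by omega
      simp only [brCurr, LinearMap.sub_apply, LinearMap.sum_apply, Module.End.mul_apply,
        hK₀ _ this, map_zero, Finset.sum_const_zero, sub_zero]
    simp only [g]
    rw [hb, map_zero]
  have hterm : ∀ i : ℕ, cherednikTerm F p i (X w) - X (cherednikTerm F p i w) =
      g i - g (i + 1) + if i = 1 then l • rA V (xOp p (-1) * slOp p c d) w else 0 := by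
    intro i
    have h := LinearMap.congr_fun (cherednikTerm_commutator_diagAct F p c d i (-1)) w
    rw [← hX] at h
    refine h.trans ?_
    rw [LinearMap.add_apply, LinearMap.sub_apply, Module.End.mul_apply, Module.End.mul_apply]
    congr 1
    · simp only [g]
      congr 4 <;> push_cast <;> ring
    · by_cases hi : i = 1
      · subst hi
        rw [if_pos rfl, if_pos (by norm_num), Nat.cast_one, one_smul, Module.End.mul_apply, hcV,
          map_smul, Nat.cast_one]
      · rw [if_neg hi, if_neg (by omega), zero_smul, LinearMap.zero_apply]
  rw [h1, h2, map_sum, ← Finset.sum_sub_distrib, Finset.sum_congr rfl fun i _ => hterm i,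
    Finset.sum_add_distrib, Finset.sum_range_sub', hg0, hgK, sub_zero, Finset.sum_ite_eq',
    if_pos (Finset.mem_range.mpr hK2)]

theorem rA_dunklPart_commutator (κ : ℂ) (p : Fin N) (c d : Fin m) (w : P m N ⊗[ℂ] V) :
    rA V (dunklPart κ p) (diagAct N F (slE c d (-1)) w) -
      diagAct N F (slE c d (-1)) (rA V (dunklPart κ p) w) =
      -(κ • rA V (xOp p (-1) * slOp p c d) w) - rA V (∑ r ∈ Finset.univ.filter (· ≠ p),
        xOp r (-1) * (tensorPermOp (Equiv.swap p r) * (slOp p c d - slOp r c d))) w := by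
  have e : ∀ f g : Module.End ℂ (P m N), -(κ • rA V f w) - rA V g w =
      rA V (-(κ • f) - g) w := by
    intro f g
    rw [map_sub, map_neg, map_smul]
    rfl
  have h := LinearMap.congr_fun (rA_commute_eV F (dunklPart κ p) c d (-1)).eq w
  rw [Module.End.mul_apply, Module.End.mul_apply] at h
  rw [e, ← dunklPart_commutator_loopRep, map_sub, map_mul, map_mul, LinearMap.sub_apply,
    Module.End.mul_apply, Module.End.mul_apply, diagAct_slE, LinearMap.add_apply,
    LinearMap.add_apply, map_add, h, add_sub_add_right_eq_sub]

/-- The summand of index `p` contributes the dual Coxeter number `m`, and the other summands agree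
with the terms of `rA_dunklPart_commutator` that come from the Dunkl operators. -/
theorem sum_xOp_mul_sum_slOp (p : Fin N) (c d : Fin m) :
    ∑ q, xOp q (-1) * (∑ b, slOp q b d * EOp p c b - ∑ a, slOp q c a * EOp p a d) =
      -((m : ℂ) • (xOp p (-1) * slOp p c d)) - ∑ r ∈ Finset.univ.filter (· ≠ p),
        xOp r (-1) * (tensorPermOp (Equiv.swap p r) * (slOp p c d - slOp r c d)) := by
  simp only [sum_slOp_mul_EOp _ _ _ _ (natCast_ne_zero m)]
  rw [← Finset.add_sum_erase _ _ (Finset.mem_univ p), if_pos rfl, mul_neg, mul_smul_comm,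
    sub_eq_add_neg, ← Finset.sum_neg_distrib, Finset.filter_ne']
  have h : ∀ r ∈ Finset.univ.erase p, (xOp r (-1) * if r = p then -((m : ℂ) • slOp p c d) else
      -(tensorPermOp (Equiv.swap p r) * (slOp p c d - slOp r c d))) =
      -(xOp r (-1) * (tensorPermOp (Equiv.swap p r) * (slOp p c d - slOp r c d))) := by
    intro r hr
    rw [if_neg (Finset.ne_of_mem_erase hr), mul_neg]
  rw [Finset.sum_congr rfl h]

/-- The Cherednik operators commute with `E_cd t⁻¹` up to `𝔫̂ (𝔓_N ⊗ (ℂᵐ)^{⊗N} ⊗ V)`. This is where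
the level `κ - m` is needed. -/
theorem zOp_diagAct_sub_mem (κ : ℂ) (hF : IsSmooth F)
    (hC : F (UniversalEnvelopingAlgebra.ι ℂ (slC m)) = (κ - m) • 1) (p : Fin N) (c d : Fin m)
    (w : P m N ⊗[ℂ] V) :
    zOp κ hF p (diagAct N F (slE c d (-1)) w) - diagAct N F (slE c d (-1)) (zOp κ hF p w) ∈
      nSub N F := by
  have hmem := brCurr_add_mem_nSub (F := F) p c d w
  have e : ∀ f g : Module.End ℂ (P m N), rA V (-((m : ℂ) • f) - g) w =
      -((m : ℂ) • rA V f w) - rA V g w := by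
    intro f g
    rw [map_sub, map_neg, map_smul]
    rfl
  have e2 : ∀ b u v : P m N ⊗[ℂ] V, -(κ • u) - v + (b + (κ - m) • u) =
      b + (-((m : ℂ) • u) - v) := by
    intro b u v
    module
  rw [sum_xOp_mul_sum_slOp, e, ← e2, ← rA_dunklPart_commutator, ← currentPart_commutator hF hC,
    ← add_sub_add_comm, ← map_add] at hmem
  exact hmem

omit [NeZero m] in
theorem diagAct_lie_apply (X Y : affineSL m) (w : P m N ⊗[ℂ] V) :
    diagAct N F ⁅X, Y⁆ w = diagAct N F X (diagAct N F Y w) - diagAct N F Y (diagAct N F X w) := by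
  rw [LieHom.map_lie, LieRing.of_associative_ring_bracket]
  rfl

/-- An endomorphism which commutes with `𝔰𝔩ₘ`, and commutes with `𝔰𝔩ₘ t⁻¹` up to the subspace
`𝔫̂ (𝔓_N ⊗ (ℂᵐ)^{⊗N} ⊗ V)`, preserves this subspace. -/
theorem map_nSub_le {Z : Module.End ℂ (P m N ⊗[ℂ] V)}
    (h0 : ∀ a b w, Z (diagAct N F (slE a b 0) w) = diagAct N F (slE a b 0) (Z w))
    (h1 : ∀ a b w, Z (diagAct N F (slE a b (-1)) w) - diagAct N F (slE a b (-1)) (Z w) ∈ nSub N F)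
    {w : P m N ⊗[ℂ] V} (hw : w ∈ nSub N F) : Z w ∈ nSub N F := by
  let G : Submodule ℂ (affineSL m) :=
    { carrier := {X | ∀ w, diagAct N F X w ∈ nSub N F ∧
        Z (diagAct N F X w) - diagAct N F X (Z w) ∈ nSub N F}
      add_mem' := fun {X Y} hX hY w => by
        rw [map_add, LinearMap.add_apply, LinearMap.add_apply, map_add, add_sub_add_comm]
        exact ⟨add_mem (hX w).1 (hY w).1, add_mem (hX w).2 (hY w).2⟩
      zero_mem' := fun w => by simp
      smul_mem' := fun z X hX w => by
        rw [map_smul, LinearMap.smul_apply, LinearMap.smul_apply, map_smul, ← smul_sub]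
        exact ⟨Submodule.smul_mem _ z (hX w).1, Submodule.smul_mem _ z (hX w).2⟩ }
  have hlie : ∀ X ∈ G, ∀ Y ∈ G, ⁅X, Y⁆ ∈ G := by
    intro X hX Y hY w
    rw [diagAct_lie_apply, diagAct_lie_apply, map_sub]
    refine ⟨sub_mem (hX _).1 (hY _).1, ?_⟩
    have e : Z (diagAct N F X (diagAct N F Y w)) - Z (diagAct N F Y (diagAct N F X w)) -
        (diagAct N F X (diagAct N F Y (Z w)) - diagAct N F Y (diagAct N F X (Z w))) =
        (Z (diagAct N F X (diagAct N F Y w)) - diagAct N F X (Z (diagAct N F Y w))) +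
        diagAct N F X (Z (diagAct N F Y w) - diagAct N F Y (Z w)) -
        ((Z (diagAct N F Y (diagAct N F X w)) - diagAct N F Y (Z (diagAct N F X w))) +
        diagAct N F Y (Z (diagAct N F X w) - diagAct N F X (Z w))) := by
      simp only [map_sub]
      abel
    rw [e]
    exact sub_mem (add_mem (hX _).2 (hX _).1) (add_mem (hY _).2 (hY _).1)
  have hneg : ∀ (n : ℕ) (a b : Fin m), slE a b (-(n : ℤ) - 1) ∈ G := by
    intro n
    induction n with
    | zero =>
      intro a b w
      rw [Nat.cast_zero, neg_zero, zero_sub]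
      exact ⟨diagAct_mem_nSub (slE_mem_nhat (Or.inl (by norm_num))) w, h1 a b w⟩
    | succ n ih =>
      have hne : -((0 : ℕ) : ℤ) - 1 + (-(n : ℤ) - 1) ≠ 0 := by push_cast; omega
      have hs : -((0 : ℕ) : ℤ) - 1 + (-(n : ℤ) - 1) = -((n + 1 : ℕ) : ℤ) - 1 := by push_cast; ring
      have ih0 : ∀ a b : Fin m, slE a b (-((0 : ℕ) : ℤ) - 1) ∈ G := by
        intro a b w
        rw [Nat.cast_zero, neg_zero, zero_sub]
        exact ⟨diagAct_mem_nSub (slE_mem_nhat (Or.inl (by norm_num))) w, h1 a b w⟩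
      intro a b
      by_cases hab : a = b
      · subst hab
        have hd : ∀ d, slE a a (-((n + 1 : ℕ) : ℤ) - 1) - slE d d (-((n + 1 : ℕ) : ℤ) - 1) ∈ G := by
          intro d
          have := hlie _ (ih0 a d) _ (ih d a)
          rw [slE_lie_of_ne _ _ _ _ _ _ hne, if_pos rfl, if_pos rfl, hs] at this
          exact this
        have hsum := G.smul_mem ((m : ℂ)⁻¹) (sum_mem (t := Finset.univ) fun d _ => hd d)
        rw [Finset.sum_sub_distrib, sum_slE_diag, sub_zero, Finset.sum_const, Finset.card_univ,
          Fintype.card_fin, ← Nat.cast_smul_eq_nsmul ℂ, smul_smul,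
          inv_mul_cancel₀ (natCast_ne_zero m), one_smul] at hsum
        exact hsum
      · have := hlie _ (ih0 a a) _ (ih a b)
        rw [slE_lie_of_ne _ _ _ _ _ _ hne, if_pos rfl, if_neg (Ne.symm hab), sub_zero, hs] at this
        exact this
  have hn : ∀ X ∈ nhat m, X ∈ G := by
    intro X hX
    refine mem_of_support (r := fun a b j => j < 0 ∨ (j = 0 ∧ b < a)) (fun a b j hj => ?_) hX.1 hX.2
    rcases hj with hj | ⟨rfl, hj⟩
    · have := hneg (-j - 1).toNat a b
      rw [Int.toNat_of_nonneg (by omega)] at this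
      simpa using this
    · intro w
      rw [h0, sub_self]
      exact ⟨diagAct_mem_nSub (slE_mem_nhat (Or.inr ⟨rfl, hj⟩)) w, zero_mem _⟩
  induction hw using Submodule.span_induction with
  | mem w hw =>
    obtain ⟨X, hX, v, rfl⟩ := hw
    have := add_mem (hn X hX v).2 (hn X hX (Z v)).1
    rwa [sub_add_cancel] at this
  | zero => rw [map_zero]; exact zero_mem _
  | add x y _ _ hx hy => rw [map_add]; exact add_mem hx hy
  | smul c x _ hx => rw [map_smul]; exact Submodule.smul_mem _ c hx

theorem map_nSub_le_of_commute {f : Module.End ℂ (P m N)}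
    (hf : ∀ X, Commute f (loopRep m N X)) {w : P m N ⊗[ℂ] V} (hw : w ∈ nSub N F) :
    rA V f w ∈ nSub N F := by
  have h : ∀ X w, rA V f (diagAct N F X w) = diagAct N F X (rA V f w) := by
    intro X w
    rw [diagAct_apply, ← Module.End.mul_apply, ← Module.End.mul_apply, mul_add, add_mul, ← map_mul,
      (hf X).eq, map_mul, (rA_commute_lA f _).eq]
  refine map_nSub_le (fun a b w => h _ w) (fun a b w => ?_) hw
  rw [h, sub_self]
  exact zero_mem _

/-- The action of the trigonometric Cherednik algebra descends to the coinvariants. -/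
theorem cherednikAction_mem_nSub {κ : ℂ} (hF : IsSmooth F)
    (hC : F (UniversalEnvelopingAlgebra.ι ℂ (slC m)) = (κ - m) • 1)
    {ρ : Cherednik N κ →ₐ[ℂ] Module.End ℂ (P m N ⊗[ℂ] V)} (hρ : IsCherednikAction κ F ρ)
    (hz : ∀ p, ρ (Cherednik.z κ p) = zOp κ hF p)
    (a : Cherednik N κ) {w : P m N ⊗[ℂ] V} (hw : w ∈ nSub N F) : ρ a w ∈ nSub N F := by
  let A : Subalgebra ℂ (Cherednik N κ) :=
    { carrier := {a | ∀ w ∈ nSub N F, ρ a w ∈ nSub N F}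
      mul_mem' := fun {a b} ha hb w hw => by
        rw [map_mul, Module.End.mul_apply]
        exact ha _ (hb _ hw)
      add_mem' := fun {a b} ha hb w hw => by
        rw [map_add, LinearMap.add_apply]
        exact add_mem (ha _ hw) (hb _ hw)
      algebraMap_mem' := fun c w hw => by
        rw [AlgHom.commutes, Module.algebraMap_end_apply]
        exact Submodule.smul_mem _ c hw }
  refine cherednik_generators A (fun p w hw => ?_) (fun p w hw => ?_) (fun σ w hw => ?_)
    (fun p w hw => ?_) a w hw
  · rw [hρ.1]
    exact map_nSub_le_of_commute (xOp_commute_loopRep p 1) hw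
  · rw [hρ.2.1]
    exact map_nSub_le_of_commute (xOp_commute_loopRep p (-1)) hw
  · rw [hρ.2.2.1]
    exact map_nSub_le_of_commute (permOp_commute_loopRep σ) hw
  · rw [hz]
    refine map_nSub_le (fun a b w => ?_) (zOp_diagAct_sub_mem κ hF hC p) hw
    have h1 : rA V (dunklPart κ p) * diagAct N F (slE a b 0) =
        diagAct N F (slE a b 0) * rA V (dunklPart κ p) := by
      rw [diagAct_apply, mul_add, add_mul, ← map_mul,
        (dunklPart_commute_loopRep_const κ p a b).eq, map_mul, (rA_commute_lA _ _).eq]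
    have h2 := IsLocallyFiniteSum.intertwine (A := diagAct N F (slE a b 0))
      (B := diagAct N F (slE a b 0)) (currentPart_spec hF p) (currentPart_spec hF p)
      (fun n y => LinearMap.congr_fun (cherednikTerm_commute_const F p a b n).symm.eq y) w
    rw [zOp, LinearMap.add_apply, LinearMap.add_apply, map_add, ← h2]
    exact congrArg (· + _) (LinearMap.congr_fun h1 w)

end Coinvariants

open UniversalEnvelopingAlgebra (ι)

/-! ### Weights and common denominators -/

section Weights

variable {m : ℕ}

/-- A subalgebra of an enveloping algebra that contains the Lie algebra is the whole algebra. -/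
theorem uea_induction {L : Type} [LieRing L] [LieAlgebra ℂ L]
    {M : Subalgebra ℂ (UniversalEnvelopingAlgebra ℂ L)} (h : ∀ X, ι ℂ X ∈ M)
    (u : UniversalEnvelopingAlgebra ℂ L) : u ∈ M := by
  have h1 : Algebra.adjoin ℂ (Set.range (ι ℂ (L := L))) ≤ M :=
    Algebra.adjoin_le (by rintro _ ⟨X, rfl⟩; exact h X)
  exact h1 (adjoin_range_uea (L := L) ▸ Algebra.mem_top)

theorem ι_mul_ι (X Y : affineSL m) : ι ℂ X * ι ℂ Y = ι ℂ Y * ι ℂ X + ι ℂ ⁅X, Y⁆ := by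
  rw [LieHom.map_lie, LieRing.of_associative_ring_bracket, add_sub_cancel]

/-- The automorphism `X ↦ X + λ(X)` of `U(𝔥̂)`, where `λ` is a functional on `𝔥̂`. -/
def shiftBy (lam : hhat m →ₗ[ℂ] ℂ) : Uh m →ₐ[ℂ] Uh m :=
  UniversalEnvelopingAlgebra.lift ℂ
    { toFun := fun X => ι ℂ X + algebraMap ℂ (Uh m) (lam X)
      map_add' := fun X Y => by simp only [map_add]; abel
      map_smul' := fun z X => by
        simp only [map_smul, smul_eq_mul, map_mul, Algebra.smul_def, RingHom.id_apply]
        exact (mul_add (R := Uh m) _ _ _).symm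
      map_lie' := fun {X Y} => by
        change ι ℂ ⁅X, Y⁆ + algebraMap ℂ (Uh m) (lam ⁅X, Y⁆) = _
        rw [lie_hhat, map_zero, map_zero, map_zero, add_zero]
        exact (sub_eq_zero.mpr (mul_comm (G := Uh m) _ _)).symm }

theorem shiftBy_ι (lam : hhat m →ₗ[ℂ] ℂ) (X : hhat m) :
    shiftBy lam (ι ℂ X) = ι ℂ X + algebraMap ℂ (Uh m) (lam X) :=
  UniversalEnvelopingAlgebra.lift_ι_apply _ _ _

theorem shiftBy_shiftBy (lam mu : hhat m →ₗ[ℂ] ℂ) (h : Uh m) :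
    shiftBy lam (shiftBy mu h) = shiftBy (lam + mu) h := by
  have e : (shiftBy lam).comp (shiftBy mu) = shiftBy (lam + mu) := by
    apply UniversalEnvelopingAlgebra.hom_ext
    ext X
    change shiftBy lam (shiftBy mu (ι ℂ X)) = shiftBy (lam + mu) (ι ℂ X)
    rw [shiftBy_ι, map_add, AlgHom.commutes, shiftBy_ι, shiftBy_ι, LinearMap.add_apply, map_add,
      add_assoc]
  exact DFunLike.congr_fun e h

theorem shiftBy_zero (h : Uh m) : shiftBy 0 h = h := by
  have e : shiftBy 0 = AlgHom.id ℂ (Uh m) := by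
    apply UniversalEnvelopingAlgebra.hom_ext
    ext X
    change shiftBy 0 (ι ℂ X) = ι ℂ X
    rw [shiftBy_ι, LinearMap.zero_apply, map_zero, add_zero]
  exact DFunLike.congr_fun e h

/-- A functional on `𝔥̂` is integral if it takes integer values at all `E_aa - E_bb + i C`. -/
def IsIntegral (lam : hhat m →ₗ[ℂ] ℂ) : Prop := ∀ a b i, ∃ k : ℤ, lam (hElem a b i) = k

theorem IsIntegral.neg {lam : hhat m →ₗ[ℂ] ℂ} (h : IsIntegral lam) : IsIntegral (-lam) := by
  intro a b i
  obtain ⟨k, hk⟩ := h a b i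
  exact ⟨-k, by rw [LinearMap.neg_apply, hk]; push_cast; rfl⟩

theorem IsIntegral.sub {lam mu : hhat m →ₗ[ℂ] ℂ} (h : IsIntegral lam) (h' : IsIntegral mu) :
    IsIntegral (lam - mu) := by
  intro a b i
  obtain ⟨k, hk⟩ := h a b i
  obtain ⟨k', hk'⟩ := h' a b i
  exact ⟨k - k', by rw [LinearMap.sub_apply, hk, hk']; push_cast; rfl⟩

theorem isIntegral_diagCoord (d : Fin m) : IsIntegral (diagCoord d) :=
  fun a b i => ⟨_, diagCoord_hElem d a b i⟩

/-- Integral shifts preserve the set of denominators. -/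
theorem shiftBy_mem {lam : hhat m →ₗ[ℂ] ℂ} (hl : IsIntegral lam) {d : Uh m} (hd : d ∈ Sh m) :
    shiftBy lam d ∈ Sh m := by
  have h : Sh m ≤ (Sh m).comap (shiftBy lam) := by
    refine Submonoid.closure_le.mpr ?_
    rintro _ ⟨a, b, i, j, hab, rfl⟩
    obtain ⟨k, hk⟩ := hl a b i
    refine Submonoid.subset_closure ⟨a, b, i, k + j, hab, ?_⟩
    rw [map_add, AlgHom.commutes, shiftBy_ι, hk, add_assoc, ← map_add, Int.cast_add]
  exact h hd

/-- The homomorphism `U(𝔥̂) → Ū(𝔰𝔩̂ₘ)`. -/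
def hU (m : ℕ) : Uh m →ₐ[ℂ] Ubar m := (numer m).comp (UhToU m)

theorem hU_apply (h : Uh m) : hU m h = numer m (UhToU m h) := rfl

theorem hU_ι (X : hhat m) : hU m (ι ℂ X) = numer m (ι ℂ X.1) := by
  rw [hU_apply, UhToU_ι]

theorem isUnit_hU {h : Uh m} (hh : h ∈ Sh m) : IsUnit (hU m h) :=
  OreLocalization.numerator_isUnit (S := S m) ⟨_, h, hh, rfl⟩

/-- Every element of `Ū(𝔰𝔩̂ₘ)` is a left fraction. -/
theorem exists_left_fraction (x : Ubar m) : ∃ h ∈ Sh m, ∃ u, hU m h * x = numer m u := by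
  induction x using OreLocalization.ind with
  | c r s =>
    obtain ⟨_, h, hh, rfl⟩ := s
    refine ⟨h, hh, r, ?_⟩
    exact OreLocalization.mul_cancel (s := (⟨_, h, hh, rfl⟩ : S m)) (t := 1)

theorem numer_eq_iff {u v : U m} :
    numer m u = numer m v ↔ ∃ h ∈ Sh m, UhToU m h * u = UhToU m h * v := by
  constructor
  · intro h
    have h1 : (u /ₒ (1 : S m) : Ubar m) = v /ₒ 1 := h
    rw [OreLocalization.oreDiv_eq_iff] at h1
    obtain ⟨⟨_, s, hs, rfl⟩, w, h2, h3⟩ := h1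
    refine ⟨s, hs, ?_⟩
    change UhToU m s * v = w * u at h2
    change UhToU m s * 1 = w * 1 at h3
    rw [mul_one, mul_one] at h3
    rw [h2, h3]
  · rintro ⟨h, hh, e⟩
    refine (isUnit_hU hh).mul_left_cancel ?_
    rw [hU_apply, ← map_mul, e, map_mul]

/-- An element `v` of `U(𝔰𝔩̂ₘ)` has the weight `λ` if `h v = v (h + λ(h))` for `h ∈ 𝔥̂`. -/
def HasWeight (v : U m) (lam : hhat m →ₗ[ℂ] ℂ) : Prop :=
  ∀ h, UhToU m h * v = v * UhToU m (shiftBy lam h)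

/-- Commuting `H - λ(H)` past a vector of weight `λ` extends from `𝔥̂` to `U(𝔥̂)`. -/
theorem hasWeight_of_lie {X : affineSL m} {lam : hhat m →ₗ[ℂ] ℂ}
    (hX : ∀ H : hhat m, ⁅H.1, X⁆ = lam H • X) : HasWeight (ι ℂ X) lam := by
  intro h
  let M : Subalgebra ℂ (Uh m) :=
    { carrier := {h | UhToU m h * ι ℂ X = ι ℂ X * UhToU m (shiftBy lam h)}
      mul_mem' := fun {x y} hx hy => by
        change UhToU m (x * y) * _ = _
        change _ = _ at hx
        change _ = _ at hy
        rw [map_mul, mul_assoc, hy, ← mul_assoc, hx, map_mul, map_mul, mul_assoc]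
      add_mem' := fun {x y} hx hy => by
        change UhToU m (x + y) * _ = _
        change _ = _ at hx
        change _ = _ at hy
        rw [map_add, map_add, map_add, add_mul, hx, hy, mul_add]
      algebraMap_mem' := fun z => by
        change UhToU m (algebraMap _ _ z) * _ = _
        rw [AlgHom.commutes, AlgHom.commutes, AlgHom.commutes, Algebra.commutes] }
  refine uea_induction (M := M) (fun H => ?_) h
  change UhToU m (ι ℂ H) * ι ℂ X = ι ℂ X * UhToU m (shiftBy lam (ι ℂ H))
  rw [shiftBy_ι, map_add, UhToU_ι, AlgHom.commutes, mul_add, ι_mul_ι, hX, map_smul,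
    Algebra.smul_def,
    Algebra.commutes]

theorem HasWeight.mul_UhToU {v : U m} {lam : hhat m →ₗ[ℂ] ℂ} (hv : HasWeight v lam) (h : Uh m) :
    v * UhToU m h = UhToU m (shiftBy (-lam) h) * v := by
  rw [hv, shiftBy_shiftBy, add_neg_cancel, shiftBy_zero]

theorem HasWeight.hU_mul {v : U m} {lam : hhat m →ₗ[ℂ] ℂ} (hv : HasWeight v lam) (h : Uh m) :
    hU m h * numer m v = numer m v * hU m (shiftBy lam h) := by
  rw [hU_apply, hU_apply, ← map_mul, ← map_mul, hv]

theorem HasWeight.mul_hU {v : U m} {lam : hhat m →ₗ[ℂ] ℂ} (hv : HasWeight v lam) (h : Uh m) :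
    numer m v * hU m h = hU m (shiftBy (-lam) h) * numer m v := by
  rw [hU_apply, hU_apply, ← map_mul, ← map_mul, hv.mul_UhToU]

theorem numer_slC_commute (x : Ubar m) : Commute (numer m (ι ℂ (slC m))) x := by
  have h1 : ∀ u : U m, ι ℂ (slC m) * u = u * ι ℂ (slC m) := by
    intro u
    refine (Subalgebra.mem_centralizer_iff (R := ℂ)).mp (uea_induction (M :=
      Subalgebra.centralizer ℂ {ι ℂ (slC m)}) (fun X => ?_) u) _ rfl
    rw [Subalgebra.mem_centralizer_iff]
    rintro _ rfl
    rw [ι_mul_ι, slC_lie, map_zero, add_zero]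
  obtain ⟨h, hh, u, e⟩ := exists_left_fraction x
  refine (isUnit_hU hh).mul_left_cancel ?_
  rw [← mul_assoc, ← mul_assoc, e, ← map_mul, ← h1, map_mul, ← e, hU_apply, ← map_mul, ← h1,
    map_mul,
    mul_assoc]

variable [NeZero m]

theorem lie_hhat_slE (X : hhat m) (a b : Fin m) (j : ℤ) :
    ⁅X.1, slE a b j⁆ = (diagCoord a X - diagCoord b X) • slE a b j := by
  have he := eulerMat_hhat X
  obtain ⟨X, f, hf⟩ := X
  have hd : ∀ d, diagCoord d (⟨X, f, hf⟩ : hhat m) = f d := by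
    intro d
    change (X.1.mat d d).coeff 0 = f d
    rw [hf, Matrix.diagonal_apply_eq, LaurentPolynomial.C_apply, if_pos rfl]
  rw [hd, hd]
  apply Subtype.ext
  ext1
  · rw [LieSubalgebra.coe_bracket, SetLike.val_smul, map_smul, AffineGL.mat_lie, mat_slE, hf]
    refine matrix_laurent_ext fun x y n => ?_
    rw [Matrix.sub_apply, Matrix.diagonal_mul, Matrix.mul_diagonal,
      mul_comm _ (LaurentPolynomial.C _),
      ← LaurentPolynomial.smul_eq_C_mul, ← LaurentPolynomial.smul_eq_C_mul, Matrix.smul_apply]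
    simp only [AddMonoidAlgebra.coeff_sub, AddMonoidAlgebra.coeff_smul, Finsupp.sub_apply,
      Finsupp.smul_apply, coeff_loopMat, smul_eq_mul]
    split_ifs
    · simp only [slMat, Matrix.sub_apply, Matrix.smul_apply, Matrix.single_apply, Matrix.one_apply,
        trc, smul_eq_mul]
      by_cases hx : a = x <;> by_cases hy : b = y <;> by_cases hxy : x = y <;>
        by_cases hab : a = b <;> simp_all
    · ring
  · rw [LieSubalgebra.coe_bracket, SetLike.val_smul, map_smul, AffineGL.cen_lie, cen_slE]
    change trace0 m (eulerMat m X.1.mat * _) = _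
    rw [he, zero_mul, map_zero, smul_zero]

/-- The weight of `E_ab t^j`. -/
def rootOf (a b : Fin m) : hhat m →ₗ[ℂ] ℂ := diagCoord a - diagCoord b

omit [NeZero m] in
theorem isIntegral_rootOf (a b : Fin m) : IsIntegral (rootOf a b) :=
  (isIntegral_diagCoord a).sub (isIntegral_diagCoord b)

theorem hasWeight_slE (a b : Fin m) (j : ℤ) : HasWeight (ι ℂ (slE a b j)) (rootOf a b) :=
  hasWeight_of_lie fun H => lie_hhat_slE H a b j

end Weights

/-! ### Smoothness of the universal Verma module -/

section Smooth

variable {m : ℕ} [NeZero m]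

/-- Every vector of the universal Verma module is annihilated by all `E_ab t^k` with `k`
sufficiently
large. -/
theorem isSmooth_FVerma (l : ℂ) : IsSmooth (FVerma m l) := by
  let M : Submodule ℂ (Ubar m) :=
    { carrier := {x | ∃ K : ℕ, ∀ k : ℤ, K ≤ k → ∀ a b,
        numer m (ι ℂ (slE a b k)) * x ∈ vermaIdeal m l}
      add_mem' := by
        rintro x y ⟨K, hK⟩ ⟨K', hK'⟩
        refine ⟨max K K', fun k hk a b => ?_⟩
        rw [mul_add]
        exact add_mem (hK k (by omega) a b) (hK' k (by omega) a b)
      zero_mem' := ⟨0, fun k _ a b => by rw [mul_zero]; exact zero_mem _⟩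
      smul_mem' := by
        rintro z x ⟨K, hK⟩
        refine ⟨K, fun k hk a b => ?_⟩
        rw [mul_smul_comm]
        exact ((vermaIdeal m l).restrictScalars ℂ).smul_mem z (hK k hk a b) }
  have hone : (1 : Ubar m) ∈ M := by
    refine ⟨1, fun k hk a b => ?_⟩
    rw [mul_one]
    exact Submodule.subset_span (Or.inl ⟨_, slE_mem_nhat' (Or.inl (by exact_mod_cast hk)), rfl⟩)
  have hgen : ∀ X : affineSL m, ∀ x ∈ M, numer m (ι ℂ X) * x ∈ M := by
    intro X
    let G : Submodule ℂ (affineSL m) :=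
      { carrier := {X | ∀ x ∈ M, numer m (ι ℂ X) * x ∈ M}
        add_mem' := fun {X Y} hX hY x hx => by
          rw [map_add, map_add, add_mul]
          exact M.add_mem (hX x hx) (hY x hx)
        zero_mem' := fun x _ => by
          rw [map_zero, map_zero, zero_mul]
          exact M.zero_mem
        smul_mem' := fun z X hX x hx => by
          rw [map_smul, map_smul, smul_mul_assoc]
          exact M.smul_mem z (hX x hx) }
    refine affineSL_induction (M := G) (fun c d j => ?_) ?_ X
    · rintro x ⟨K, hK⟩
      refine ⟨K + (1 + j.natAbs), fun k hk a b => ?_⟩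
      push_cast at hk
      have hj := neg_abs_le j
      have hj' := abs_nonneg j
      have hne : k + j ≠ 0 := by omega
      have hif : ∀ (q : Prop) [Decidable q] (a b : Fin m),
          numer m (ι ℂ (if q then slE a b (k + j) else 0)) * x ∈ vermaIdeal m l := by
        intro q _ a b
        split_ifs
        · exact hK _ (by omega) a b
        · rw [map_zero, map_zero, zero_mul]
          exact zero_mem _
      rw [← mul_assoc, ← map_mul, ι_mul_ι, slE_lie_of_ne _ _ _ _ _ _ hne, map_add, map_mul, add_mul,
        mul_assoc, map_sub, map_sub, sub_mul]
      exact add_mem ((vermaIdeal m l).smul_mem _ (hK k (by omega) a b))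
        (sub_mem (hif _ _ _) (hif _ _ _))
    · rintro x ⟨K, hK⟩
      refine ⟨K, fun k hk a b => ?_⟩
      rw [(numer_slC_commute x).eq, ← mul_assoc, ← (numer_slC_commute _).eq]
      exact (vermaIdeal m l).smul_mem _ (hK k hk a b)
  have hnum : ∀ u : U m, ∀ x ∈ M, numer m u * x ∈ M := by
    intro u
    let A : Subalgebra ℂ (U m) :=
      { carrier := {u | ∀ x ∈ M, numer m u * x ∈ M}
        mul_mem' := fun {a b} ha hb x hx => by
          rw [map_mul, mul_assoc]
          exact ha _ (hb x hx)
        add_mem' := fun {a b} ha hb x hx => by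
          rw [map_add, add_mul]
          exact M.add_mem (ha x hx) (hb x hx)
        algebraMap_mem' := fun z x hx => by
          rw [AlgHom.commutes, ← Algebra.smul_def]
          exact M.smul_mem z hx }
    exact uea_induction (M := A) hgen u
  have hall : ∀ x : Ubar m, x ∈ M := by
    intro x
    obtain ⟨h, hh, u, e⟩ := exists_left_fraction x
    obtain ⟨K, hK⟩ := hnum u 1 hone
    refine ⟨K, fun k hk a b => ?_⟩
    have h1 := hK k hk a b
    rw [mul_one, ← e, ← mul_assoc, (hasWeight_slE a b k).mul_hU, mul_assoc] at h1
    obtain ⟨y, hy⟩ := (isUnit_hU (shiftBy_mem (isIntegral_rootOf a b).neg hh)).exists_left_inv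
    have h2 := (vermaIdeal m l).smul_mem y h1
    rwa [smul_eq_mul, ← mul_assoc, hy, one_mul] at h2
  intro v
  obtain ⟨x, rfl⟩ := Submodule.Quotient.mk_surjective _ v
  obtain ⟨K, hK⟩ := hall x
  exact ⟨K, fun k hk a b => (Submodule.Quotient.mk_eq_zero _).mpr (hK k hk a b)⟩

omit [NeZero m] in
theorem FVerma_slC (l : ℂ) : FVerma m l (ι ℂ (slC m)) = l • 1 := by
  refine LinearMap.ext fun v => ?_
  obtain ⟨x, rfl⟩ := Submodule.Quotient.mk_surjective _ v
  change (Submodule.Quotient.mk (numer m (ι ℂ (slC m)) * x) : Verma m l) =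
    l • Submodule.Quotient.mk x
  rw [← Submodule.Quotient.mk_smul, Submodule.Quotient.eq, (numer_slC_commute x).eq,
    Algebra.smul_def, Algebra.commutes, ← mul_sub]
  refine (vermaIdeal m l).smul_mem x (Submodule.subset_span (Or.inr ?_))
  rw [map_sub, AlgHom.commutes]
  rfl

end Smooth

open UniversalEnvelopingAlgebra (ι)

/-! ### Right fractions -/

section RightFractions

variable {m : ℕ}

open MulOpposite in
/-- The set of denominators is also a right Ore set. -/
theorem nonempty_oreSet_op (m : ℕ) : Nonempty (OreLocalization.OreSet (S m).op) := by
  rw [S_eq_closure, Submonoid.op_closure]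
  refine oreSet_of_weights _ (unop ⁻¹' ((ι ℂ : affineSL m →ₗ⁅ℂ⁆ U m) ''
      {X : affineSL m | ∀ (a b : Fin m) (i : ℤ), ∃ k : ℤ, ⁅(hElem a b i).1, X⁆ = (k : ℂ) • X}))
    ?_ ?_ ?_ ?_
  · rw [← Subalgebra.op_adjoin, adjoin_weights, Subalgebra.op_top]
  · rintro d ⟨d', _, hd⟩ e ⟨e', _, he⟩
    apply unop_injective
    rw [unop_mul, unop_mul, ← hd, ← he, ← map_mul, mul_comm, map_mul]
  · rintro d ⟨_, ⟨a, b, i, j, hab, rfl⟩, hd⟩ k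
    refine ⟨_, ⟨a, b, i, j + k, hab, rfl⟩, ?_⟩
    rw [unop_add, ← hd]
    change _ = _ + algebraMap ℂ (U m) k
    push_cast
    simp only [map_add, AlgHom.commutes, add_assoc]
  · rintro g ⟨X, hX, hg⟩ d ⟨_, ⟨a, b, i, j, hab, rfl⟩, hd⟩
    obtain ⟨k, hk⟩ := hX a b i
    refine ⟨k, unop_injective ?_⟩
    rw [unop_mul, unop_mul, unop_add, ← hd, ← hg]
    change _ * (_ + algebraMap ℂ (U m) k) = _
    have h := congrArg (ι ℂ) hk
    rw [LieHom.map_lie, LieRing.of_associative_ring_bracket, map_smul, sub_eq_iff_eq_add] at h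
    simp only [map_add, AlgHom.commutes, add_mul, mul_add, UhToU_ι, h, Algebra.smul_def,
      Algebra.commutes (j : ℂ), Algebra.commutes (k : ℂ)]
    abel

open MulOpposite in
theorem exists_right_ore (u : U m) {h : Uh m} (hh : h ∈ Sh m) :
    ∃ h' ∈ Sh m, ∃ u', u * UhToU m h' = UhToU m h * u' := by
  obtain ⟨i⟩ := nonempty_oreSet_op m
  let s : (S m).op := ⟨op (UhToU m h), ⟨h, hh, rfl⟩⟩
  have e := congrArg unop (OreLocalization.ore_eq (op u) s)
  obtain ⟨h', hh', e'⟩ := (OreLocalization.oreDenom (op u) s).2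
  refine ⟨h', hh', unop (OreLocalization.oreNum (op u) s), ?_⟩
  rw [unop_mul, unop_mul] at e
  rw [← unop_op u, ← unop_op (UhToU m h)]
  refine Eq.trans (congrArg _ e') e

open MulOpposite in
theorem exists_right_cancel {u v : U m} {h : Uh m} (hh : h ∈ Sh m)
    (e : UhToU m h * u = UhToU m h * v) : ∃ h' ∈ Sh m, u * UhToU m h' = v * UhToU m h' := by
  obtain ⟨i⟩ := nonempty_oreSet_op m
  let s : (S m).op := ⟨op (UhToU m h), ⟨h, hh, rfl⟩⟩
  obtain ⟨⟨t, h', hh', ht⟩, e'⟩ := OreLocalization.ore_right_cancel (op u) (op v) s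
    (unop_injective e)
  refine ⟨h', hh', ?_⟩
  have e2 := congrArg unop e'
  rw [unop_mul, unop_mul] at e2
  exact (congrArg (u * ·) ht).trans (e2.trans (congrArg (v * ·) ht).symm)

/-- Every element of `Ū(𝔰𝔩̂ₘ)` is a right fraction. -/
theorem exists_right_fraction (x : Ubar m) : ∃ h ∈ Sh m, ∃ u, x * hU m h = numer m u := by
  obtain ⟨h, hh, u, e⟩ := exists_left_fraction x
  obtain ⟨h', hh', u', e'⟩ := exists_right_ore u hh
  refine ⟨h', hh', u', (isUnit_hU hh).mul_left_cancel ?_⟩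
  rw [← mul_assoc, e, hU_apply, hU_apply, ← map_mul, ← map_mul, e']

theorem numer_eq_imp_right {u v : U m} (e : numer m u = numer m v) :
    ∃ h ∈ Sh m, u * UhToU m h = v * UhToU m h := by
  obtain ⟨h, hh, e'⟩ := numer_eq_iff.mp e
  exact exists_right_cancel hh e'

/-- A linear map on `U(𝔰𝔩̂ₘ)` which is equivariant for right multiplication by `U(𝔥̂)` extends to
`Ū(𝔰𝔩̂ₘ)` as soon as the denominators act invertibly on the target. -/
theorem exists_extension {M : Type} [AddCommGroup M] [Module ℂ M] (f : U m →ₗ[ℂ] M)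
    (θ : Uh m →ₐ[ℂ] Module.End ℂ M) (hf : ∀ u h, f (u * UhToU m h) = θ h (f u))
    (hθ : ∀ h ∈ Sh m, IsUnit (θ h)) :
    ∃ g : Ubar m →ₗ[ℂ] M, ∀ x u h, h ∈ Sh m → x * hU m h = numer m u → θ h (g x) = f u := by
  have inj : ∀ h ∈ Sh m, Function.Injective (θ h) := fun h hh =>
    ((Module.End.isUnit_iff _).mp (hθ h hh)).1
  have surj : ∀ h ∈ Sh m, Function.Surjective (θ h) := fun h hh =>
    ((Module.End.isUnit_iff _).mp (hθ h hh)).2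
  have hcomm : ∀ h h' y, θ h (θ h' y) = θ h' (θ h y) := by
    intro h h' y
    rw [← Module.End.mul_apply, ← Module.End.mul_apply, ← map_mul, ← map_mul, mul_comm]
  have hwd : ∀ x u h u' h', x * hU m h = numer m u → x * hU m h' = numer m u' →
      θ h' (f u) = θ h (f u') := by
    intro x u h u' h' e e'
    have e2 : numer m (u * UhToU m h') = numer m (u' * UhToU m h) := by
      rw [map_mul, map_mul, ← e, ← e', mul_assoc, mul_assoc, ← hU_apply, ← hU_apply, ← map_mul,
        ← map_mul, mul_comm h]
    obtain ⟨h2, hh2, e3⟩ := numer_eq_imp_right e2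
    refine inj h2 hh2 ?_
    rw [← hf, ← hf, ← hf, ← hf, e3]
  choose d hd n hn using exists_right_fraction (m := m)
  choose g hg using fun x => surj (d x) (hd x) (f (n x))
  have key : ∀ x u h, h ∈ Sh m → x * hU m h = numer m u → θ h (g x) = f u := by
    intro x u h hh e
    refine inj (d x) (hd x) ?_
    rw [hcomm, hg, hwd x u h (n x) (d x) e (hn x)]
  have huniq : ∀ x u h y, h ∈ Sh m → x * hU m h = numer m u → θ h y = f u → g x = y := by
    intro x u h y hh e hy
    exact inj h hh ((key x u h hh e).trans hy.symm)
  refine ⟨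
    { toFun := g
      map_add' := fun x y => huniq _ (n x * UhToU m (d y) + n y * UhToU m (d x)) (d x * d y) _
        ((Sh m).mul_mem (hd x) (hd y)) ?_ ?_
      map_smul' := fun z x => huniq _ (z • n x) (d x) _ (hd x) ?_ ?_ }, key⟩
  · rw [map_add, map_mul (numer m), map_mul (numer m), ← hn, ← hn, add_mul, ← hU_apply,
      ← hU_apply, mul_assoc, mul_assoc, ← map_mul, ← map_mul, mul_comm (d y)]
  · rw [map_add, map_add, hf, hf, ← hg, ← hg, ← Module.End.mul_apply, ← Module.End.mul_apply,
      ← map_mul, ← map_mul, mul_comm (d y)]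
  · rw [map_smul, ← hn, smul_mul_assoc]
  · rw [map_smul, map_smul, RingHom.id_apply, hg]

/-- The embedding of `B` in `B̄` (up to torsion). -/
def toBbar (m N : ℕ) : B m N →ₗ[ℂ] Bbar m N := LinearMap.lTensor (P m N) (numer m).toLinearMap

theorem toBbar_tmul {N : ℕ} (p : P m N) (u : U m) : toBbar m N (p ⊗ₜ u) = p ⊗ₜ numer m u := rfl

theorem rightUbar_tmul {N : ℕ} (A : Ubar m) (p : P m N) (x : Ubar m) :
    rightUbar N A (p ⊗ₜ x) = p ⊗ₜ (x * A) := rfl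

theorem rightU_tmul {N : ℕ} (A : U m) (p : P m N) (x : U m) :
    rightU N A (p ⊗ₜ x) = p ⊗ₜ (x * A) := rfl

theorem rightUbar_mul {N : ℕ} (A A' : Ubar m) (y : Bbar m N) :
    rightUbar N (A * A') y = rightUbar N A' (rightUbar N A y) := by
  have h : rightUbar N (A * A') = rightUbar N A' * rightUbar (m := m) N A :=
    TensorProduct.ext' fun p x => by
      rw [Module.End.mul_apply, rightUbar_tmul, rightUbar_tmul, rightUbar_tmul, mul_assoc]
  rw [h, Module.End.mul_apply]

theorem rightUbar_one {N : ℕ} (y : Bbar m N) : rightUbar N 1 y = y := by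
  have h : rightUbar N (1 : Ubar m) = 1 :=
    TensorProduct.ext' fun p x => by rw [rightUbar_tmul, mul_one, Module.End.one_apply]
  rw [h, Module.End.one_apply]

theorem rightUbar_add {N : ℕ} (A A' : Ubar m) (y : Bbar m N) :
    rightUbar N (A + A') y = rightUbar N A y + rightUbar N A' y := by
  have h : rightUbar N (A + A') = rightUbar N A + rightUbar (m := m) N A' :=
    TensorProduct.ext' fun p x => by
      rw [LinearMap.add_apply, rightUbar_tmul, rightUbar_tmul, rightUbar_tmul, mul_add,
        TensorProduct.tmul_add]
  rw [h, LinearMap.add_apply]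

theorem rightUbar_smul {N : ℕ} (z : ℂ) (A : Ubar m) (y : Bbar m N) :
    rightUbar N (z • A) y = z • rightUbar N A y := by
  have h : rightUbar N (z • A) = z • rightUbar (m := m) N A :=
    TensorProduct.ext' fun p x => by
      rw [LinearMap.smul_apply, rightUbar_tmul, rightUbar_tmul, mul_smul_comm,
        TensorProduct.tmul_smul]
  rw [h, LinearMap.smul_apply]

theorem toBbar_rightU {N : ℕ} (A : U m) (y : B m N) :
    toBbar m N (rightU N A y) = rightUbar N (numer m A) (toBbar m N y) := by
  have h : toBbar m N ∘ₗ rightU N A = rightUbar N (numer m A) ∘ₗ toBbar m N :=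
    TensorProduct.ext' fun p x => by
      simp only [LinearMap.comp_apply, rightU_tmul, rightUbar_tmul, toBbar_tmul, map_mul]
  exact LinearMap.congr_fun h y

/-- Every element of `B̄` has the form `Y h⁻¹` with `Y ∈ B` and a denominator `h`. -/
theorem exists_right_fraction_Bbar {N : ℕ} (y : Bbar m N) :
    ∃ h ∈ Sh m, ∃ Y, rightUbar N (hU m h) y = toBbar m N Y := by
  induction y using TensorProduct.induction_on with
  | zero => exact ⟨1, (Sh m).one_mem, 0, by rw [map_zero, map_zero]⟩
  | tmul p x =>
    obtain ⟨h, hh, u, e⟩ := exists_right_fraction x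
    exact ⟨h, hh, p ⊗ₜ u, by rw [rightUbar_tmul, e, toBbar_tmul]⟩
  | add y z hy hz =>
    obtain ⟨h, hh, Y, e⟩ := hy
    obtain ⟨h', hh', Y', e'⟩ := hz
    refine ⟨h * h', (Sh m).mul_mem hh hh', rightU N (UhToU m h') Y + rightU N (UhToU m h) Y', ?_⟩
    rw [map_add, map_add, toBbar_rightU, toBbar_rightU, ← e, ← e', map_mul, rightUbar_mul,
      ← hU_apply, ← hU_apply, ← rightUbar_mul _ _ z, ← map_mul, mul_comm h, map_mul, rightUbar_mul]

end RightFractions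

open UniversalEnvelopingAlgebra (ι)

/-! ### The left and right actions on `B` and `B̄` -/

section LeftRight

variable {m N : ℕ}

theorem leftUbar_numer (u : U m) : leftUbar m N (numer m u) = diagActU N (FUbar m) u :=
  oreLift_numerator _ (isUnit_diagActU m N) u

theorem leftUbar_ι (X : affineSL m) :
    leftUbar m N (numer m (ι ℂ X)) = diagAct N (FUbar m) X := by
  rw [leftUbar_numer, diagActU_ι]
  rfl

theorem leftUbar_mul (A A' : Ubar m) (y : Bbar m N) :
    leftUbar m N (A * A') y = leftUbar m N A (leftUbar m N A' y) := by
  rw [map_mul, Module.End.mul_apply]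

theorem leftUbar_one (y : Bbar m N) : leftUbar m N 1 y = y := by
  rw [map_one, Module.End.one_apply]

theorem leftUbar_smul (z : ℂ) (A : Ubar m) (y : Bbar m N) :
    leftUbar m N (z • A) y = z • leftUbar m N A y := by
  have h : leftUbar m N (algebraMap ℂ (Ubar m) z) = z • 1 := by
    rw [← AlgHom.commutes (numer m), leftUbar_numer, AlgHom.commutes]
    rfl
  rw [Algebra.smul_def, leftUbar_mul, h]
  rfl

theorem diagAct_rightU (X : affineSL m) (A : U m) (Y : B m N) :
    diagAct N (FU m) X (rightU N A Y) = rightU N A (diagAct N (FU m) X Y) := by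
  have h : diagAct N (FU m) X ∘ₗ rightU N A = rightU N A ∘ₗ diagAct N (FU m) X :=
    TensorProduct.ext' fun p u => by
      simp only [LinearMap.comp_apply, rightU_tmul, diagAct_apply, LinearMap.add_apply, rA_tmul,
        lA_tmul, map_add]
      congr 2
      exact (mul_assoc _ _ _).symm
  exact LinearMap.congr_fun h Y

theorem diagAct_rightUbar (X : affineSL m) (A : Ubar m) (y : Bbar m N) :
    diagAct N (FUbar m) X (rightUbar N A y) = rightUbar N A (diagAct N (FUbar m) X y) := by
  have h : diagAct N (FUbar m) X ∘ₗ rightUbar N A = rightUbar N A ∘ₗ diagAct N (FUbar m) X :=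
    TensorProduct.ext' fun p u => by
      simp only [LinearMap.comp_apply, rightUbar_tmul, diagAct_apply, LinearMap.add_apply, rA_tmul,
        lA_tmul, map_add]
      congr 2
      exact (mul_assoc _ _ _).symm
  exact LinearMap.congr_fun h y

/-- An operator on `B̄` commuting with the left action of `𝔰𝔩̂ₘ` commutes with the left action
of `Ū(𝔰𝔩̂ₘ)`. -/
theorem leftUbar_commute_of_diagAct {G : Module.End ℂ (Bbar m N)}
    (hG : ∀ X, Commute (diagAct N (FUbar m) X) G) (A : Ubar m) : Commute (leftUbar m N A) G := by
  have h1 : ∀ u : U m, Commute (leftUbar m N (numer m u)) G := by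
    intro u
    rw [leftUbar_numer]
    refine (Subalgebra.mem_centralizer_iff (R := ℂ) (s := {G})).mp
      (uea_induction (M := (Subalgebra.centralizer ℂ {G}).comap (diagActU N (FUbar m)))
        (fun X => ?_) u) G rfl |>.symm
    rw [Subalgebra.mem_comap, Subalgebra.mem_centralizer_iff]
    rintro _ rfl
    rw [diagActU_ι]
    exact (hG X).eq.symm
  obtain ⟨h, hh, u, e⟩ := exists_left_fraction A
  have h2 : IsUnit (leftUbar m N (hU m h)) := (isUnit_hU hh).map _
  refine h2.mul_left_cancel ?_
  rw [← mul_assoc, ← mul_assoc, ← map_mul, e, (h1 u).eq, ← e, map_mul, ← mul_assoc, hU_apply,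
    (h1 _).eq]

theorem leftUbar_rightUbar (A A' : Ubar m) (y : Bbar m N) :
    leftUbar m N A (rightUbar N A' y) = rightUbar N A' (leftUbar m N A y) :=
  LinearMap.congr_fun (leftUbar_commute_of_diagAct (G := rightUbar N A')
    (fun X => LinearMap.ext fun y => diagAct_rightUbar X A' y) A).eq y

theorem toBbar_diagAct (X : affineSL m) (Y : B m N) :
    toBbar m N (diagAct N (FU m) X Y) = leftUbar m N (numer m (ι ℂ X)) (toBbar m N Y) := by
  rw [leftUbar_ι]
  have h : toBbar m N ∘ₗ diagAct N (FU m) X = diagAct N (FUbar m) X ∘ₗ toBbar m N :=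
    TensorProduct.ext' fun p u => by
      simp only [LinearMap.comp_apply, toBbar_tmul, diagAct_apply, LinearMap.add_apply, rA_tmul,
        lA_tmul, map_add]
      congr 2
      exact map_mul (numer m) _ _
  exact LinearMap.congr_fun h Y

/-- The adjoint action of `𝔰𝔩̂ₘ` on `B`. -/
def adAct (N : ℕ) (X : affineSL m) : Module.End ℂ (B m N) :=
  diagAct N (FU m) X - rightU N (ι ℂ X)

theorem adAct_apply (X : affineSL m) (Y : B m N) :
    adAct N X Y = diagAct N (FU m) X Y - rightU N (ι ℂ X) Y := rfl

theorem rightU_rightU (A A' : U m) (Y : B m N) :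
    rightU N A (rightU N A' Y) = rightU N (A' * A) Y := by
  have h : rightU N A ∘ₗ rightU N A' = rightU N (A' * A) :=
    TensorProduct.ext' fun p u => by
      simp only [LinearMap.comp_apply, rightU_tmul, mul_assoc]
  exact LinearMap.congr_fun h Y

theorem rightU_add (A A' : U m) (Y : B m N) :
    rightU N (A + A') Y = rightU N A Y + rightU N A' Y := by
  have h : rightU N (A + A') = rightU N A + rightU N A' :=
    TensorProduct.ext' fun p u => by
      simp only [LinearMap.add_apply, rightU_tmul, mul_add, TensorProduct.tmul_add]
  exact LinearMap.congr_fun h Y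

theorem rightU_smul (z : ℂ) (A : U m) (Y : B m N) : rightU N (z • A) Y = z • rightU N A Y := by
  have h : rightU N (z • A) = z • rightU N A :=
    TensorProduct.ext' fun p u => by
      simp only [LinearMap.smul_apply, rightU_tmul, mul_smul_comm, TensorProduct.tmul_smul]
  exact LinearMap.congr_fun h Y

theorem rightU_algebraMap (z : ℂ) (Y : B m N) : rightU N (algebraMap ℂ (U m) z) Y = z • Y := by
  have h : rightU N (algebraMap ℂ (U m) z) = z • 1 :=
    TensorProduct.ext' fun p u => by
      rw [rightU_tmul, ← Algebra.commutes, ← Algebra.smul_def, TensorProduct.tmul_smul]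
      rfl
  exact LinearMap.congr_fun h Y

theorem adAct_rightU (X Z : affineSL m) (Y : B m N) :
    adAct N X (rightU N (ι ℂ Z) Y) =
      rightU N (ι ℂ Z) (adAct N X Y) + rightU N (ι ℂ ⁅X, Z⁆) Y := by
  rw [adAct_apply, adAct_apply, map_sub, diagAct_rightU, rightU_rightU, rightU_rightU, ι_mul_ι X Z,
    rightU_add]
  abel

theorem adAct_diagAct (X Z : affineSL m) (Y : B m N) :
    adAct N X (diagAct N (FU m) Z Y) =
      diagAct N (FU m) Z (adAct N X Y) + diagAct N (FU m) ⁅X, Z⁆ Y := by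
  rw [adAct_apply, adAct_apply, map_sub, diagAct_rightU, diagAct_lie_apply]
  abel

end LeftRight

/-! ### Local nilpotency of the adjoint action -/

section Nilpotent

variable {m N : ℕ}

/-- If `X² = 0` as a matrix and `X` is homogeneous in `t`, then `ad X` is nilpotent of order three.
-/
theorem lie_lie_lie_eq_zero {X : affineSL m} (h : X.1.mat * X.1.mat = 0) {z : ℂ}
    (he : eulerMat m X.1.mat = z • X.1.mat) (Y : affineSL m) : ⁅X, ⁅X, ⁅X, Y⁆⁆⁆ = 0 := by
  have h2 : ∀ A B : Matrix (Fin m) (Fin m) ℂ[T;T⁻¹], A * A = 0 →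
      A * (A * B - B * A) - (A * B - B * A) * A = -(2 : ℂ) • (A * B * A) := by
    intro A B hA
    rw [mul_sub, sub_mul, ← mul_assoc, hA, mul_assoc B, hA, zero_mul, mul_zero, ← mul_assoc]
    module
  have h3 : ∀ B : Matrix (Fin m) (Fin m) ℂ[T;T⁻¹], X.1.mat * (X.1.mat * B * X.1.mat) = 0 := by
    intro B
    rw [← mul_assoc, ← mul_assoc, h, zero_mul, zero_mul]
  have h4 : ∀ B : Matrix (Fin m) (Fin m) ℂ[T;T⁻¹], (X.1.mat * B * X.1.mat) * X.1.mat = 0 := by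
    intro B
    rw [mul_assoc, h, mul_zero]
  apply Subtype.ext
  ext1
  · simp only [LieSubalgebra.coe_bracket, AffineGL.mat_lie, h2 _ _ h, mul_smul_comm, smul_mul_assoc,
      h3, h4]
    simp
  · simp only [LieSubalgebra.coe_bracket, AffineGL.mat_lie, AffineGL.cen_lie, h2 _ _ h,
      mul_smul_comm, smul_mul_assoc, he, h3]
    simp

/-- The Leibniz rule: if `ad X` is nilpotent on `Y` and on `Z`, it is nilpotent on `YZ`. -/
theorem adAct_pow_rightU {X : affineSL m} (k : ℕ) : ∀ (n : ℕ) (Y : B m N) (Z : affineSL m),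
    (adAct N X ^ n) Y = 0 → (LieAlgebra.ad ℂ (affineSL m) X ^ k) Z = 0 →
      (adAct N X ^ (n + k)) (rightU N (ι ℂ Z) Y) = 0 := by
  induction k with
  | zero =>
    intro n Y Z _ hZ
    rw [pow_zero, Module.End.one_apply] at hZ
    have h0 := rightU_smul (N := N) 0 (0 : U m) Y
    rw [zero_smul, zero_smul] at h0
    rw [hZ, map_zero, h0, map_zero]
  | succ k ihk =>
    intro n
    induction n with
    | zero =>
      intro Y Z hY _
      rw [pow_zero, Module.End.one_apply] at hY
      rw [hY, map_zero, map_zero]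
    | succ n ihn =>
      intro Y Z hY hZ
      rw [show n + 1 + (k + 1) = (n + (k + 1)) + 1 by ring, pow_succ, Module.End.mul_apply,
        adAct_rightU, map_add, ihn, show n + (k + 1) = n + 1 + k by ring, ihk, add_zero]
      · exact hY
      · rwa [pow_succ, Module.End.mul_apply] at hZ
      · rwa [pow_succ, Module.End.mul_apply] at hY
      · exact hZ

/-- The adjoint action of `E_ab t^j` on `B` is locally nilpotent for `a ≠ b`. -/
theorem adAct_locally_nilpotent [NeZero m] {a b : Fin m} (hab : a ≠ b) (j : ℤ) (Y : B m N) :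
    ∃ K, (adAct N (slE a b j) ^ K) Y = 0 := by
  set X := slE a b j with hX
  have hslO : ∀ q : Fin N, slOp q a b = EOp q a b := fun q => by simp [slOp, trc, hab]
  have hnil : IsNilpotent (loopRep m N X) := by
    rw [hX, loopRep_slE]
    refine Commute.isNilpotent_sum (fun q _ => ⟨2, ?_⟩) fun q r _ _ => ?_
    · have hc := xOp_EOp_commute (m := m) q q j a b
      rw [pow_two, hslO, mul_assoc, ← mul_assoc (EOp q a b), ← hc.eq, mul_assoc (xOp q j),
        EOp_mul_EOp, if_neg (Ne.symm hab), mul_zero, mul_zero]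
    · rw [hslO, hslO]
      by_cases hqr : q = r
      · subst hqr
        exact Commute.refl _
      · exact ((xOp_commute q r j j).mul_right (xOp_EOp_commute q r j a b)).mul_left
          ((xOp_EOp_commute r q j a b).symm.mul_right (EOp_commute hqr a b a b))
  have had : ∀ Z, (LieAlgebra.ad ℂ (affineSL m) X ^ 3) Z = 0 := by
    intro Z
    refine lie_lie_lie_eq_zero (z := j) ?_ ?_ Z
    · rw [hX, mat_slE, loopMat_mul]
      have : slMat a b * slMat a b = 0 := by
        simp only [slMat, trc, if_neg hab, zero_smul, sub_zero, single_one_mul_single_one,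
          if_neg (Ne.symm hab)]
      rw [this, loopMat_zero]
    · rw [hX, mat_slE, eulerMat_loopMat]
  obtain ⟨k, hk⟩ := hnil
  have hone : ∀ n p, (adAct N X ^ n) (p ⊗ₜ (1 : U m)) = (loopRep m N X ^ n) p ⊗ₜ 1 := by
    intro n p
    induction n with
    | zero => rfl
    | succ n ih =>
      rw [pow_succ', pow_succ', Module.End.mul_apply, Module.End.mul_apply, ih, adAct_apply,
        diagAct_apply, LinearMap.add_apply, rA_tmul, lA_tmul, rightU_tmul, one_mul]
      change _ + _ ⊗ₜ[ℂ] (ι ℂ X * 1) - _ = _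
      rw [mul_one, add_sub_cancel_right]
  have hadd : ∀ Y Y' : B m N, (∃ K, (adAct N X ^ K) Y = 0) → (∃ K, (adAct N X ^ K) Y' = 0) →
      ∃ K, (adAct N X ^ K) (Y + Y') = 0 := by
    rintro Y Y' ⟨K, hK⟩ ⟨K', hK'⟩
    refine ⟨K + K', ?_⟩
    have e' : (adAct N X ^ (K + K')) Y' = 0 := by
      rw [pow_add, Module.End.mul_apply, hK', map_zero]
    have e : (adAct N X ^ (K + K')) Y = 0 := by
      rw [add_comm, pow_add, Module.End.mul_apply, hK, map_zero]
    rw [map_add, e, e', add_zero]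
  let M : Submodule ℂ (U m) :=
    { carrier := {u | ∀ Y : B m N, (∃ K, (adAct N X ^ K) Y = 0) →
        ∃ K, (adAct N X ^ K) (rightU N u Y) = 0}
      add_mem' := fun {u v} hu hv Y hY => by
        rw [rightU_add]
        exact hadd _ _ (hu Y hY) (hv Y hY)
      zero_mem' := fun Y _ => ⟨0, by
        have h0 := rightU_smul (N := N) 0 (0 : U m) Y
        rw [zero_smul, zero_smul] at h0
        rw [h0, map_zero]⟩
      smul_mem' := fun z u hu Y hY => by
        obtain ⟨K, hK⟩ := hu Y hY
        exact ⟨K, by rw [rightU_smul, map_smul, hK, smul_zero]⟩ }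
  let A : Subalgebra ℂ (U m) :=
    { carrier := M
      mul_mem' := fun {u v} hu hv Y hY => by
        rw [← rightU_rightU]
        exact hv _ (hu Y hY)
      add_mem' := fun {u v} hu hv => M.add_mem hu hv
      algebraMap_mem' := fun z Y hY => by
        obtain ⟨K, hK⟩ := hY
        exact ⟨K, by rw [rightU_algebraMap, map_smul, hK, smul_zero]⟩ }
  induction Y using TensorProduct.induction_on with
  | zero => exact ⟨0, map_zero _⟩
  | tmul p u =>
    have h1 := uea_induction (M := A) (fun Z Y hY => ?_) u (p ⊗ₜ 1) ⟨k, by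
      rw [hone, hk, LinearMap.zero_apply, TensorProduct.zero_tmul]⟩
    · rwa [rightU_tmul, one_mul] at h1
    · obtain ⟨K, hK⟩ := hY
      exact ⟨_, adAct_pow_rightU 3 K Y Z hK (had Z)⟩
  | add Y Y' hY hY' => exact hadd _ _ hY hY'

end Nilpotent

open UniversalEnvelopingAlgebra (ι)

/-! ### The maps `ξ_c` -/

section PowIdentities

variable {A : Type*} [Ring A] {e f H : A}

theorem mul_pow_of_mul_eq (he : H * e = e * (H + 2)) (n : ℕ) :
    H * e ^ n = e ^ n * (H + 2 * n) := by
  induction n with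
  | zero => simp
  | succ n ih =>
    have h : (2 * (n : A)) * e = e * (2 * n) := by
      exact_mod_cast (Nat.cast_commute (2 * n) e).eq
    rw [pow_succ, ← mul_assoc, ih, mul_assoc, add_mul, he, h, Nat.cast_succ, mul_assoc, ← mul_add,
      mul_add 2, mul_one,
      add_assoc, add_comm (2 : A)]

/-- The identity `[e^{n+1}, f] = (n + 1) (H - n) e^n` of the enveloping algebra of `𝔰𝔩₂`. -/
theorem pow_succ_mul_of_commutator (hef : e * f = f * e + H) (he : H * e = e * (H + 2)) (n : ℕ) :
    e ^ (n + 1) * f = f * e ^ (n + 1) + (n + 1 : ℕ) * ((H - n) * e ^ n) := by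
  induction n with
  | zero => simp [hef]
  | succ n ih =>
    have h1 : e * ((n + 1 : ℕ) * ((H - n) * e ^ n)) = (n + 1 : ℕ) * ((H - n - 2) * e ^ (n + 1)) := by
      have h2 : e * H = (H - 2) * e := by
        rw [sub_mul, he, mul_add, (show (2 : A) * e = e * 2 from (Nat.cast_commute 2 e).eq)]
        abel
      rw [← mul_assoc, ← (Nat.cast_commute (n + 1) e).eq, mul_assoc, ← mul_assoc e, mul_sub, h2,
        ← (Nat.cast_commute n e).eq, ← sub_mul, mul_assoc, pow_succ']
      congr 2
      abel
    rw [pow_succ' e (n + 1), mul_assoc, ih, mul_add, ← mul_assoc, hef, h1]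
    push_cast
    noncomm_ring

end PowIdentities

section Chevalley

variable {m : ℕ} [m.AtLeastTwo] (c : Fin m)

/-- The element `E_c` of `𝔰𝔩̂ₘ`. -/
def nodeE : affineSL m := slE (c - 1) c (nodeDeg c)

/-- The element `F_c` of `𝔰𝔩̂ₘ`. -/
def nodeF : affineSL m := slE c (c - 1) (-nodeDeg c)

theorem nodeE_lie_nodeF : ⁅nodeE c, nodeF c⁆ = (chevH c).1 := by
  have h : (chevH c).1 = slE (c - 1) (c - 1) 0 - slE c c 0 + (nodeDeg c : ℂ) • slC m := by
    apply Subtype.ext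
    change AffineGL.E _ _ 0 - AffineGL.E _ _ 0 + (nodeDeg c : ℂ) • AffineGL.C m =
      (AffineGL.E _ _ 0 - _) - (AffineGL.E _ _ 0 - _) + (nodeDeg c : ℂ) • AffineGL.C m
    simp
  rw [h, nodeE, nodeF, slE_lie, if_pos rfl, if_pos rfl, cocycle, add_neg_cancel, if_pos rfl]
  simp [(sub_one_ne c).symm]

theorem lie_nodeF (h : hhat m) : ⁅nodeF c, h.1⁆ = epsilon c h • nodeF c := by
  rw [← lie_skew, nodeF, lie_hhat_slE, ← neg_smul, neg_sub]
  rfl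

theorem lie_nodeE (h : hhat m) : ⁅h.1, nodeE c⁆ = epsilon c h • nodeE c := by
  rw [nodeE, lie_hhat_slE]
  rfl

theorem epsilon_chevH : epsilon c (chevH c) = 2 := by
  rw [epsilon, LinearMap.sub_apply, chevH, diagCoord_hElem, diagCoord_hElem]
  have hm : m ≠ 1 := fun h => absurd (Nat.AtLeastTwo.prop (n := m)) (by omega)
  simp [hm, (sub_one_ne c).symm]
  norm_num

theorem val_sub_one_of_ne {c : Fin m} (hc : c ≠ 0) : ((c - 1 : Fin m) : ℕ) = c - 1 := by
  have h1 : 1 < m := Nat.AtLeastTwo.prop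
  have hv : ((1 : Fin m) : ℕ) = 1 := by
    rw [Fin.coe_ofNat_eq_mod, Nat.mod_eq_of_lt h1]
  have hc' : c.val ≠ 0 := fun h => hc (Fin.ext (by rw [h, Fin.val_zero]))
  rw [Fin.sub_val_of_le, hv]
  rw [Fin.le_def, hv]
  omega

theorem val_zero_sub_one : ((0 - 1 : Fin m) : ℕ) = m - 1 := by
  have h1 : 1 < m := Nat.AtLeastTwo.prop
  have hv : ((1 : Fin m) : ℕ) = 1 := by
    rw [Fin.coe_ofNat_eq_mod, Nat.mod_eq_of_lt h1]
  rw [Fin.sub_def]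
  simp only [hv, Fin.val_zero, add_zero]
  exact Nat.mod_eq_of_lt (by omega)

theorem nodeF_mem_nhat : nodeF c ∈ nhat m := by
  refine slE_mem_nhat ?_
  by_cases hc : c = 0
  · left; simp [nodeDeg, hc]
  · right
    refine ⟨by simp [nodeDeg, hc], ?_⟩
    have hc' : c.val ≠ 0 := fun h => hc (Fin.ext (by rw [h, Fin.val_zero]))
    rw [Fin.lt_def, val_sub_one_of_ne hc]
    omega

/-- The coefficient `(n! H_c (H_c - 1) ⋯ (H_c - n + 1))⁻¹ E_c^n`. -/
def xiCoeff (n : ℕ) : Ubar m := (n.factorial : ℂ)⁻¹ • (chevE c ^ n /ₒ fallingH c n)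

/-- The product `H_c (H_c - 1) ⋯ (H_c - n + 1)`, as an element of `U(𝔥̂)`. -/
def fallH (n : ℕ) : Uh m := ∏ j ∈ Finset.range n, (ι ℂ (chevH c) - algebraMap ℂ (Uh m) j)

theorem fallH_mem (n : ℕ) : fallH c n ∈ Sh m :=
  (Sh m).prod_mem fun j _ => Submonoid.subset_closure ⟨c - 1, c, nodeDeg c, -(j : ℤ), sub_one_ne c, by
    rw [chevH, Int.cast_neg, map_neg, sub_eq_add_neg, Int.cast_natCast]⟩

theorem hU_fallH_mul (n : ℕ) :
    hU m (fallH c n) * (chevE c ^ n /ₒ fallingH c n) = numer m (chevE c) ^ n := by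
  rw [← map_pow]
  exact OreLocalization.mul_cancel (s := fallingH c n) (t := 1)

theorem hU_fallH_succ (n : ℕ) :
    hU m (fallH c (n + 1)) = (hU m (ι ℂ (chevH c)) - n) * hU m (fallH c n) := by
  rw [fallH, Finset.prod_range_succ, ← fallH, mul_comm, map_mul, map_sub, AlgHom.commutes,
    map_natCast]

theorem numer_chevE_mul_chevF : numer m (chevE c) * numer m (chevF c) =
    numer m (chevF c) * numer m (chevE c) + hU m (ι ℂ (chevH c)) := by
  rw [← map_mul, ← map_mul, hU_ι, ← map_add, ← nodeE_lie_nodeF]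
  exact congrArg _ (ι_mul_ι _ _)

theorem hU_chevH_mul_chevE : hU m (ι ℂ (chevH c)) * numer m (chevE c) =
    numer m (chevE c) * (hU m (ι ℂ (chevH c)) + 2) := by
  have h : chevE c = ι ℂ (nodeE c) := rfl
  rw [hU_ι, h, mul_add, ← map_mul (numer m), ← map_mul (numer m), ι_mul_ι, lie_nodeE,
    epsilon_chevH, map_add, map_smul,
    map_smul, mul_two, two_smul]

theorem oreDiv_mul_chevF (n : ℕ) : ∃ b : Ubar m,
    (chevE c ^ (n + 1) /ₒ fallingH c (n + 1)) * numer m (chevF c) =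
      (n + 1 : ℕ) * (chevE c ^ n /ₒ fallingH c n) + numer m (chevF c) * b := by
  have hw : HasWeight (chevF c) (rootOf c (c - 1)) := hasWeight_slE _ _ _
  obtain ⟨u, hu⟩ := isUnit_hU (shiftBy_mem (isIntegral_rootOf c (c - 1)) (fallH_mem c (n + 1)))
  refine ⟨(u⁻¹ : (Ubar m)ˣ) * numer m (chevE c) ^ (n + 1),
    (isUnit_hU (fallH_mem c (n + 1))).mul_left_cancel ?_⟩
  rw [← mul_assoc, hU_fallH_mul, pow_succ_mul_of_commutator (numer_chevE_mul_chevF c)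
    (hU_chevH_mul_chevE c), mul_add, ← mul_assoc _ (numer m (chevF c)), hw.hU_mul, ← hu,
    mul_assoc _ (u : Ubar m),
    Units.mul_inv_cancel_left, add_comm, ← mul_assoc _ ((n + 1 : ℕ) : Ubar m),
    ← (Nat.cast_commute (n + 1) _).eq, mul_assoc, hU_fallH_succ, mul_assoc, hU_fallH_mul]

theorem oreDiv_mul_chevE (n : ℕ) :
    (chevE c ^ n /ₒ fallingH c n) * numer m (chevE c) =
      (chevE c ^ (n + 1) /ₒ fallingH c (n + 1)) * (hU m (ι ℂ (chevH c)) + (n + 2 : ℕ)) := by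
  refine (isUnit_hU (fallH_mem c (n + 1))).mul_left_cancel ?_
  have h := mul_pow_of_mul_eq (hU_chevH_mul_chevE c) (n + 1)
  rw [← mul_assoc, ← mul_assoc, hU_fallH_mul, hU_fallH_succ, mul_assoc _ (hU m (fallH c n)),
    hU_fallH_mul, mul_assoc, ← pow_succ, sub_mul, h, (Nat.cast_commute n _).eq, ← mul_sub]
  congr 1
  push_cast
  rw [← one_add_one_eq_two, add_mul, one_mul]
  abel

omit [m.AtLeastTwo] in
theorem factorial_inv_smul (n : ℕ) (x : Ubar m) :
    ((n + 1).factorial : ℂ)⁻¹ • (((n + 1 : ℕ) : Ubar m) * x) = (n.factorial : ℂ)⁻¹ • x := by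
  have h : ((n + 1 : ℕ) : Ubar m) = algebraMap ℂ (Ubar m) ((n + 1 : ℕ) : ℂ) := (map_natCast _ _).symm
  have h2 : ((n + 1 : ℕ) : ℂ) ≠ 0 := Nat.cast_ne_zero.mpr n.succ_ne_zero
  rw [h, ← Algebra.smul_def, smul_smul, Nat.factorial_succ, Nat.cast_mul, mul_inv_rev, mul_assoc,
    inv_mul_cancel₀ h2, mul_one]

/-- Modulo `F_c Ū`, right multiplication by `F_c` lowers the index of the coefficient by one. -/
theorem xiCoeff_succ_mul_chevF (n : ℕ) : ∃ b : Ubar m,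
    xiCoeff c (n + 1) * numer m (chevF c) = xiCoeff c n + numer m (chevF c) * b := by
  obtain ⟨b, hb⟩ := oreDiv_mul_chevF c n
  refine ⟨((n + 1).factorial : ℂ)⁻¹ • b, ?_⟩
  rw [xiCoeff, smul_mul_assoc, hb, smul_add, factorial_inv_smul, mul_smul_comm]
  rfl

/-- Right multiplication by `E_c` raises the index of the coefficient by one. -/
theorem xiCoeff_mul_chevE (n : ℕ) :
    xiCoeff c n * numer m (chevE c) =
      (n + 1 : ℂ) • (xiCoeff c (n + 1) * (hU m (ι ℂ (chevH c)) + (n + 2 : ℕ))) := by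
  rw [xiCoeff, smul_mul_assoc, oreDiv_mul_chevE, ← factorial_inv_smul, xiCoeff, smul_mul_assoc,
    smul_comm, Algebra.smul_def (n + 1 : ℂ), map_add, map_one, map_natCast, Nat.cast_succ]

variable (N : ℕ)

/-- The composition of multiplication by the coefficient `xiCoeff` with the projection onto
`B̄ / J̄`. -/
def xiProj (n : ℕ) : Bbar m N →ₗ[ℂ] Bbar m N ⧸ Jbar m N :=
  (Jbar m N).mkQ ∘ₗ leftUbar m N (xiCoeff c n)

variable {N}

omit [m.AtLeastTwo] in
theorem leftUbar_mem_Jbar {X : affineSL m} (hX : X ∈ nhat m) (y : Bbar m N) :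
    leftUbar m N (numer m (ι ℂ X)) y ∈ Jbar m N :=
  Submodule.subset_span ⟨X, hX, y, rfl⟩

theorem mkQ_leftUbar_chevF (y : Bbar m N) :
    (Jbar m N).mkQ (leftUbar m N (numer m (chevF c)) y) = 0 :=
  (Submodule.Quotient.mk_eq_zero _).mpr (leftUbar_mem_Jbar (nodeF_mem_nhat c) y)

theorem xiCoeff_zero : xiCoeff c 0 = 1 := by
  have h := hU_fallH_mul c 0
  rw [fallH, Finset.prod_range_zero, map_one, one_mul] at h
  rw [xiCoeff, h, pow_zero, Nat.factorial_zero, Nat.cast_one, inv_one, one_smul]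

theorem xiProj_zero (y : Bbar m N) : xiProj c N 0 y = (Jbar m N).mkQ y := by
  rw [xiProj, LinearMap.comp_apply, xiCoeff_zero, leftUbar_one]

theorem xiProj_zero_chevF (y : Bbar m N) :
    xiProj c N 0 (leftUbar m N (numer m (chevF c)) y) = 0 := by
  rw [xiProj_zero, mkQ_leftUbar_chevF]

theorem xiProj_succ_chevF (n : ℕ) (y : Bbar m N) :
    xiProj c N (n + 1) (leftUbar m N (numer m (chevF c)) y) = xiProj c N n y := by
  obtain ⟨b, hb⟩ := xiCoeff_succ_mul_chevF c n
  rw [xiProj, LinearMap.comp_apply, ← leftUbar_mul, hb, map_add, LinearMap.add_apply, map_add,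
    leftUbar_mul, mkQ_leftUbar_chevF, add_zero]
  rfl

theorem xiProj_chevE (n : ℕ) (y : Bbar m N) :
    xiProj c N n (leftUbar m N (numer m (chevE c)) y) =
      (n + 1 : ℂ) • xiProj c N (n + 1) (leftUbar m N (numer m (ι ℂ (chevH c).1)) y) +
      ((n + 2 : ℂ) * (n + 1)) • xiProj c N (n + 1) y := by
  have h : ((n + 2 : ℕ) : Ubar m) = (n + 2 : ℂ) • 1 := by
    rw [Algebra.smul_def, mul_one, map_add, map_natCast, map_ofNat]
    push_cast
    rfl
  rw [xiProj, LinearMap.comp_apply, ← leftUbar_mul, xiCoeff_mul_chevE, leftUbar_smul, leftUbar_mul,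
    map_add, LinearMap.add_apply, h, leftUbar_smul, leftUbar_one, hU_ι, map_add, map_smul, map_smul,
    map_add, map_smul, smul_add, smul_smul, mul_comm (n + 1 : ℂ)]
  rfl

theorem adF_eq : adF N c = adAct N (nodeF c) := by
  rw [adF, adAct]
  congr 1
  exact diagActU_ι N (FU m) (nodeF c)

theorem xiTerm_apply (n : ℕ) (Y : B m N) : xiTerm N c n Y =
    leftUbar m N (xiCoeff c n) (toBbar m N ((adAct N (nodeF c) ^ n) Y)) := by
  rw [xiTerm, adF_eq, xiCoeff, leftUbar_smul]
  rfl

variable (N) in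
theorem locallyFinite_xiTerm : LocallyFinite (xiTerm N c) := by
  intro Y
  obtain ⟨K, hK⟩ := adAct_locally_nilpotent (sub_one_ne c).symm (-nodeDeg c) Y
  refine ⟨K, fun n hn => ?_⟩
  obtain ⟨k, rfl⟩ := Nat.exists_eq_add_of_le hn
  have h : (adAct N (nodeF c) ^ (K + k)) Y = 0 := by
    rw [add_comm, pow_add, Module.End.mul_apply]
    exact (congrArg _ hK).trans (map_zero _)
  rw [xiTerm_apply, h, map_zero, map_zero]

variable (N) in
/-- The map `ξ_c`. -/
def xi : B m N →ₗ[ℂ] Bbar m N := lfSum (xiTerm N c) (locallyFinite_xiTerm c N)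

variable (N) in
theorem isXi_xi : IsXi c (xi c N) := isLocallyFiniteSum_lfSum _

/-- The component of `ξ_c(Y) + J̄` with the index `n`. -/
def xiComp (n : ℕ) (Y : B m N) : Bbar m N ⧸ Jbar m N :=
  xiProj c N n (toBbar m N ((adAct N (nodeF c) ^ n) Y))

/-- The class of `ξ_c(Y)` modulo `J̄` as a finite sum; every sufficiently large bound is allowed. -/
theorem mkQ_xi (Y : B m N) : ∃ K₀, ∀ K, K₀ ≤ K → (adAct N (nodeF c) ^ K) Y = 0 ∧
    (Jbar m N).mkQ (xi c N Y) = ∑ n ∈ Finset.range K, xiComp c n Y := by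
  obtain ⟨K, hK⟩ := adAct_locally_nilpotent (sub_one_ne c).symm (-nodeDeg c) Y
  have h : ∀ n, K ≤ n → (adAct N (nodeF c) ^ n) Y = 0 := by
    intro n hn
    obtain ⟨k, rfl⟩ := Nat.exists_eq_add_of_le hn
    rw [add_comm, pow_add, Module.End.mul_apply]
    exact (congrArg _ hK).trans (map_zero _)
  refine ⟨K, fun n hn => ⟨h n hn, ?_⟩⟩
  rw [xi, lfSum_eq (locallyFinite_xiTerm c N) (K := n) fun k hk => ?_, map_sum]
  · refine Finset.sum_congr rfl fun k _ => ?_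
    rw [xiTerm_apply]
    rfl
  · rw [xiTerm_apply, h k (hn.trans hk), map_zero, map_zero]

end Chevalley

open UniversalEnvelopingAlgebra (ι)

/-! ### Heights of roots and simple reflections -/

section Heights

variable {m : ℕ}

/-- The height of the root of `E_ab t^j`. -/
def ht (a b : Fin m) (j : ℤ) : ℤ := j * m + b - a

theorem eq_zero_of_mul_eq {k x : ℤ} (hx : |x| < m) (h : k * m = x) : x = 0 :=
  Int.eq_zero_of_abs_lt_dvd ⟨k, by rw [← h, mul_comm]⟩ hx

theorem abs_val_sub_lt (a b : Fin m) : |(a : ℤ) - b| < m := by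
  have := a.2
  have := b.2
  rw [abs_lt]
  omega

theorem lt_of_ht_neg {a b : Fin m} {j : ℤ} (h : ht a b j < 0) : j < 0 ∨ (j = 0 ∧ b < a) := by
  have h1 := abs_lt.mp (abs_val_sub_lt b a)
  rw [ht] at h
  rcases lt_trichotomy j 0 with hj | hj | hj
  · exact Or.inl hj
  · subst hj
    exact Or.inr ⟨rfl, by rw [Fin.lt_def]; omega⟩
  · nlinarith

theorem ht_neg_of_lt {a b : Fin m} {j : ℤ} (h : j < 0 ∨ (j = 0 ∧ b < a)) : ht a b j < 0 := by
  have h1 := abs_lt.mp (abs_val_sub_lt b a)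
  rw [ht]
  rcases h with hj | ⟨rfl, hj⟩
  · nlinarith
  · rw [Fin.lt_def] at hj
    omega

theorem lt_of_ht_pos {a b : Fin m} {j : ℤ} (h : 0 < ht a b j) : 0 < j ∨ (j = 0 ∧ a < b) := by
  have h1 := abs_lt.mp (abs_val_sub_lt b a)
  rw [ht] at h
  rcases lt_trichotomy j 0 with hj | hj | hj
  · nlinarith
  · subst hj
    exact Or.inr ⟨rfl, by rw [Fin.lt_def]; omega⟩
  · exact Or.inl hj

theorem ht_pos_of_lt {a b : Fin m} {j : ℤ} (h : 0 < j ∨ (j = 0 ∧ a < b)) : 0 < ht a b j := by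
  have h1 := abs_lt.mp (abs_val_sub_lt b a)
  rw [ht]
  rcases h with hj | ⟨rfl, hj⟩
  · nlinarith
  · rw [Fin.lt_def] at hj
    omega

variable [m.AtLeastTwo] (c : Fin m)

theorem one_lt_cast : (1 : ℤ) < m := by
  exact_mod_cast Nat.AtLeastTwo.prop

theorem val_sub_one : ((c - 1 : Fin m) : ℤ) = c - 1 + m * nodeDeg c := by
  have h1 := one_lt_cast (m := m)
  by_cases hc : c = 0
  · subst hc
    rw [val_zero_sub_one, nodeDeg, if_pos rfl, Fin.val_zero]
    push_cast [show 1 ≤ m by omega]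
    ring
  · have hc' : c.val ≠ 0 := fun h => hc (Fin.ext (by rw [h, Fin.val_zero]))
    rw [val_sub_one_of_ne hc, nodeDeg, if_neg hc]
    omega

/-- The change of the position `a - m i` of the vector `e_a tⁱ` made by `τ_c`. -/
def tauMove (a : Fin m) : ℤ := (if a = c - 1 then 1 else 0) - (if a = c then 1 else 0)

theorem tauShift_eq (a : Fin m) :
    tauShift c a = nodeDeg c * ((if a = c then 1 else 0) - (if a = c - 1 then 1 else 0)) := by
  rw [tauShift, nodeDeg]
  split_ifs <;> simp

/-- The image of `e_a` under `τ_c`, in the numbering of the vectors `e_a t^i` by the integers `a - m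
i`: the numbers congruent to `c - 1` modulo `m` move up by one, and those congruent to `c` down by
one. -/
theorem val_tauPerm (a : Fin m) : ((tauPerm c a : Fin m) :
    ℤ) = a + tauMove c a + m * tauShift c a := by
  have h := val_sub_one c
  rw [tauShift_eq, tauMove, tauPerm]
  by_cases h1 : a = c - 1
  · subst h1
    rw [Equiv.swap_apply_left, if_pos rfl, if_neg (sub_one_ne c), h]
    ring
  · by_cases h2 : a = c
    · subst h2
      rw [Equiv.swap_apply_right, if_pos rfl, if_neg h1, h]
      ring
    · rw [Equiv.swap_apply_of_ne_of_ne h1 h2, if_neg h1, if_neg h2]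
      ring

theorem ht_tau (a b : Fin m) (j : ℤ) :
    ht (tauPerm c a) (tauPerm c b) (j + tauShift c a - tauShift c b) =
      ht a b j + tauMove c b - tauMove c a := by
  rw [ht, ht, val_tauPerm, val_tauPerm]
  ring

/-- The roots of `𝔫̂` other than the root of `F_c`. -/
def IsNegRoot (a b : Fin m) (j : ℤ) : Prop := ht a b j < 0 ∧ (a = c → ht a b j ≠ -1)

/-- The roots of `𝔫̂'` other than the root of `E_c`. -/
def IsPosRoot (a b : Fin m) (j : ℤ) : Prop := 0 < ht a b j ∧ (b = c → ht a b j ≠ 1)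

theorem tauPerm_eq_iff (a : Fin m) : tauPerm c a = c ↔ a = c - 1 := by
  rw [tauPerm, Equiv.swap_apply_eq_iff, Equiv.swap_apply_right]

theorem ht_ne_of_eq {a b : Fin m} {j : ℤ} (h : a = b) {k : ℤ} (hk : |k| = 1) : ht a b j ≠ k := by
  subst h
  intro h
  rw [ht, add_sub_cancel_right] at h
  have h1 := eq_zero_of_mul_eq (by rw [hk]; exact one_lt_cast) h
  rw [h1, abs_zero] at hk
  exact absurd hk (by norm_num)

theorem eq_of_ht_right {a b : Fin m} {j : ℤ} (h : ht a b j = -1) (hb : b = c - 1) : a = c := by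
  subst hb
  rw [ht, val_sub_one] at h
  have h1 := eq_zero_of_mul_eq (k := j + nodeDeg c) (abs_val_sub_lt a c) (by linarith)
  exact Fin.ext (by omega)

theorem eq_of_ht_left {a b : Fin m} {j : ℤ} (h : ht a b j = 1) (ha : a = c - 1) : b = c := by
  subst ha
  rw [ht, val_sub_one] at h
  have h1 := eq_zero_of_mul_eq (k := j - nodeDeg c) (abs_val_sub_lt c b) (by linarith)
  exact Fin.ext (by omega)

theorem eq_of_ht_left' {a b : Fin m} {j : ℤ} (h : ht a b j = -1) (ha : a = c) : b = c - 1 := by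
  subst ha
  rw [ht] at h
  have hv := val_sub_one a
  have h1 := eq_zero_of_mul_eq (k := j + nodeDeg a) (abs_val_sub_lt (a - 1) b)
    (by rw [hv]; linarith)
  exact Fin.ext (by omega)

theorem eq_of_ht_right' {a b : Fin m} {j : ℤ} (h : ht a b j = 1) (hb : b = c) : a = c - 1 := by
  subst hb
  rw [ht] at h
  have hv := val_sub_one b
  have h1 := eq_zero_of_mul_eq (k := j - nodeDeg b) (abs_val_sub_lt a (b - 1))
    (by rw [hv]; linarith)
  exact Fin.ext (by omega)

theorem ht_ne_neg_two {b : Fin m} {j : ℤ} (hb : b = c - 1) : ht c b j ≠ -2 := by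
  subst hb
  intro h
  rw [ht, val_sub_one] at h
  have h1 := eq_zero_of_mul_eq (m := m) (k := j + nodeDeg c) (x := -1) (by
    rw [abs_neg, abs_one]
    exact one_lt_cast) (by linarith)
  exact absurd h1 (by norm_num)

theorem ht_ne_two {a : Fin m} {j : ℤ} (ha : a = c - 1) : ht a c j ≠ 2 := by
  subst ha
  intro h
  rw [ht, val_sub_one] at h
  have h1 := eq_zero_of_mul_eq (m := m) (k := j - nodeDeg c) (x := 1) (by
    rw [abs_one]
    exact one_lt_cast) (by linarith)
  exact absurd h1 (by norm_num)

variable {c}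

/-- The reflection `τ_c` permutes the negative roots other than the root of `F_c`. -/
theorem IsNegRoot.tau {a b : Fin m} {j : ℤ} (h : IsNegRoot c a b j) :
    IsNegRoot c (tauPerm c a) (tauPerm c b) (j + tauShift c a - tauShift c b) := by
  obtain ⟨h1, h2⟩ := h
  have hne := sub_one_ne c
  have h3 : ht a b j = -1 → b = c - 1 → a = c := eq_of_ht_right c
  have h4 : a = c → b = c - 1 → ht a b j ≠ -2 := by
    rintro rfl hb
    exact ht_ne_neg_two a hb
  have h5 : a = b → ht a b j ≠ -1 := fun e => ht_ne_of_eq e (by norm_num)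
  rw [IsNegRoot, tauPerm_eq_iff, ht_tau, tauMove, tauMove]
  generalize ht a b j = t at *
  generalize c - 1 = d at *
  refine ⟨?_, ?_⟩ <;> grind

/-- The reflection `τ_c` permutes the positive roots other than the root of `E_c`. -/
theorem IsPosRoot.tau {a b : Fin m} {j : ℤ} (h : IsPosRoot c a b j) :
    IsPosRoot c (tauPerm c a) (tauPerm c b) (j + tauShift c a - tauShift c b) := by
  obtain ⟨h1, h2⟩ := h
  have hne := sub_one_ne c
  have h3 : ht a b j = 1 → a = c - 1 → b = c := eq_of_ht_left c
  have h4 : b = c → a = c - 1 → ht a b j ≠ 2 := by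
    rintro rfl ha
    exact ht_ne_two b ha
  have h5 : a = b → ht a b j ≠ 1 := fun e => ht_ne_of_eq e (by norm_num)
  rw [IsPosRoot, tauPerm_eq_iff, ht_tau, tauMove, tauMove]
  generalize ht a b j = t at *
  generalize c - 1 = d at *
  refine ⟨?_, ?_⟩ <;> grind

variable (c)

/-- The span of the negative root vectors other than `F_c`. -/
def negSpan : Submodule ℂ (affineSL m) :=
  Submodule.span ℂ {X | ∃ a b j, IsNegRoot c a b j ∧ X = slE a b j}

/-- The span of the positive root vectors other than `E_c`. -/
def posSpan : Submodule ℂ (affineSL m) :=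
  Submodule.span ℂ {X | ∃ a b j, IsPosRoot c a b j ∧ X = slE a b j}

omit [m.AtLeastTwo] in
theorem slE_lie_mem [NeZero m] {M : Submodule ℂ (affineSL m)} {a b x y : Fin m} {i j : ℤ} (hab :
    a ≠ b)
    (h1 : b = x → slE a y (i + j) ∈ M) (h2 : y = a → slE x b (i + j) ∈ M)
    (h3 : b = x → y = a → i + j ≠ 0) : ⁅slE a b i, slE x y j⁆ ∈ M := by
  have hc : cocycle a b x y i j = 0 := by
    rw [cocycle]
    by_cases h : i + j = 0
    · have h4 : ¬(b = x ∧ y = a) := fun h5 => h3 h5.1 h5.2 h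
      simp [h4, trc, hab]
    · rw [if_neg h]
  rw [slE_lie, hc, zero_smul, add_zero]
  refine M.sub_mem ?_ ?_
  · split_ifs with h
    exacts [h1 h, M.zero_mem]
  · split_ifs with h
    exacts [h2 h, M.zero_mem]

omit [m.AtLeastTwo] in
theorem lie_mem_of_span {M : Submodule ℂ (affineSL m)} {X : affineSL m} {s : Set (affineSL m)}
    (h : ∀ Y ∈ s, ⁅X, Y⁆ ∈ M) {Y : affineSL m} (hY : Y ∈ Submodule.span ℂ s) : ⁅X, Y⁆ ∈ M := by
  induction hY using Submodule.span_induction with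
  | mem Y hY => exact h Y hY
  | zero => rw [lie_zero]; exact M.zero_mem
  | add Y Z _ _ hY hZ => rw [lie_add]; exact M.add_mem hY hZ
  | smul z Y _ hY => rw [lie_smul]; exact M.smul_mem z hY

theorem ht_nodeF_left (b : Fin m) (j : ℤ) : ht c b (-nodeDeg c + j) = ht (c - 1) b j - 1 := by
  rw [ht, ht, val_sub_one]
  ring

theorem ht_nodeF_right (a : Fin m) (j : ℤ) : ht a (c - 1) (-nodeDeg c + j) = ht a c j - 1 := by
  rw [ht, ht, val_sub_one]
  ring

theorem ht_nodeE_left (b : Fin m) (j : ℤ) : ht (c - 1) b (nodeDeg c + j) = ht c b j + 1 := by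
  rw [ht, ht, val_sub_one]
  ring

theorem ht_nodeE_right (a : Fin m) (j : ℤ) : ht a c (nodeDeg c + j) = ht a (c - 1) j + 1 := by
  rw [ht, ht, val_sub_one]
  ring

/-- The nilradical `negSpan` of a minimal parabolic subalgebra is invariant under its Levi factor.
-/
theorem nodeF_lie_negSpan {X : affineSL m} (hX : X ∈ negSpan c) : ⁅nodeF c, X⁆ ∈ negSpan c := by
  refine lie_mem_of_span ?_ hX
  rintro _ ⟨a, b, j, ⟨h1, h2⟩, rfl⟩
  refine slE_lie_mem (sub_one_ne c).symm ?_ ?_ ?_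
  · rintro rfl
    exact Submodule.subset_span ⟨_, _, _, ⟨by rw [ht_nodeF_left]; omega,
      fun _ => by rw [ht_nodeF_left]; omega⟩, rfl⟩
  · rintro rfl
    exact Submodule.subset_span ⟨_, _, _, ⟨by rw [ht_nodeF_right]; omega,
      fun _ => by rw [ht_nodeF_right]; omega⟩, rfl⟩
  · rintro rfl rfl h
    have := ht_nodeF_left b b j
    rw [h, ht] at this
    omega

/-- The exclusion of `F_c` is needed here, since `[E_c, F_c] = H_c`. -/
theorem nodeE_lie_negSpan {X : affineSL m} (hX : X ∈ negSpan c) : ⁅nodeE c, X⁆ ∈ negSpan c := by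
  refine lie_mem_of_span ?_ hX
  rintro _ ⟨a, b, j, ⟨h1, h2⟩, rfl⟩
  refine slE_lie_mem (sub_one_ne c) ?_ ?_ ?_
  · rintro rfl
    have := h2 rfl
    exact Submodule.subset_span ⟨_, _, _, ⟨by rw [ht_nodeE_left]; omega,
      fun h => absurd h (sub_one_ne c)⟩, rfl⟩
  · rintro rfl
    refine Submodule.subset_span ⟨_, _, _, ⟨?_, fun h => ?_⟩, rfl⟩
    · rw [ht_nodeE_right]
      have : ht a (c - 1) j ≠ -1 := fun h => h2 (eq_of_ht_right c h rfl) h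
      omega
    · subst h
      have := ht_ne_neg_two a (j := j) rfl
      rw [ht_nodeE_right]
      omega
  · rintro rfl rfl h
    have := ht_nodeE_left c (c - 1) j
    rw [h, ht] at this
    exact h2 rfl (by omega)

theorem nodeF_lie_posSpan {X : affineSL m} (hX : X ∈ posSpan c) : ⁅nodeF c, X⁆ ∈ posSpan c := by
  refine lie_mem_of_span ?_ hX
  rintro _ ⟨a, b, j, ⟨h1, h2⟩, rfl⟩
  refine slE_lie_mem (sub_one_ne c).symm ?_ ?_ ?_
  · rintro rfl
    refine Submodule.subset_span ⟨_, _, _, ⟨?_, fun h => ?_⟩, rfl⟩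
    · rw [ht_nodeF_left]
      have : ht (c - 1) b j ≠ 1 := fun h => h2 (eq_of_ht_left c h rfl) h
      omega
    · subst h
      have := ht_ne_two b (j := j) rfl
      rw [ht_nodeF_left]
      omega
  · rintro rfl
    have := h2 rfl
    exact Submodule.subset_span ⟨_, _, _, ⟨by rw [ht_nodeF_right]; omega,
      fun h => absurd h (sub_one_ne _)⟩, rfl⟩
  · rintro rfl rfl h
    have := ht_nodeF_left b b j
    rw [h, ht] at this
    exact h2 rfl (by omega)

/-- The only root vector of `𝔫̂` excluded by `IsNegRoot` is `F_c`. -/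
theorem isNegRoot_or_eq {a b : Fin m} {j : ℤ} (h : ht a b j < 0) :
    IsNegRoot c a b j ∨ (a = c ∧ b = c - 1 ∧ j = -nodeDeg c) := by
  by_cases h1 : a = c ∧ ht a b j = -1
  · obtain ⟨rfl, h2⟩ := h1
    have hb := eq_of_ht_left' a h2 rfl
    subst hb
    refine Or.inr ⟨rfl, rfl, ?_⟩
    rw [ht, val_sub_one] at h2
    have h3 : (j + nodeDeg a) * m = 0 := by linarith
    have h4 := one_lt_cast (m := m)
    rcases mul_eq_zero.mp h3 with h5 | h5 <;> omega
  · exact Or.inl ⟨h, fun ha h2 => h1 ⟨ha, h2⟩⟩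

/-- The only root vector of `𝔫̂'` excluded by `IsPosRoot` is `E_c`. -/
theorem isPosRoot_or_eq {a b : Fin m} {j : ℤ} (h : 0 < ht a b j) :
    IsPosRoot c a b j ∨ (a = c - 1 ∧ b = c ∧ j = nodeDeg c) := by
  by_cases h1 : b = c ∧ ht a b j = 1
  · obtain ⟨rfl, h2⟩ := h1
    have ha := eq_of_ht_right' b h2 rfl
    subst ha
    refine Or.inr ⟨rfl, rfl, ?_⟩
    rw [ht, val_sub_one] at h2
    have h3 : (j - nodeDeg b) * m = 0 := by linarith
    have h4 := one_lt_cast (m := m)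
    rcases mul_eq_zero.mp h3 with h5 | h5 <;> omega
  · exact Or.inl ⟨h, fun hb h2 => h1 ⟨hb, h2⟩⟩

/-- The action of `τ_c` on `𝔰𝔩̂ₘ`. -/
abbrev tauSL : affineSL m →ₗ⁅ℂ⁆ affineSL m := affineMapSL (tauPerm c) (tauShift c)

/-- Away from height zero the central correction in the definition of `τ_c` vanishes. -/
theorem tauSL_slE {a b : Fin m} {j : ℤ} (h : ht a b j ≠ 0) :
    tauSL c (slE a b j) = slE (tauPerm c a) (tauPerm c b) (j + tauShift c a - tauShift c b) := by
  rw [affineMapSL_slE]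
  have h1 : j = 0 → a ≠ b := by
    rintro rfl rfl
    exact h (by rw [ht]; ring)
  by_cases hj : j = 0
  · simp [h1 hj, trc]
  · simp [hj]

theorem tauSL_nodeF : tauSL c (nodeF c) = nodeE c := by
  have h : ht c (c - 1) (-nodeDeg c) ≠ 0 := by
    rw [ht, val_sub_one]
    ring_nf
    norm_num
  rw [nodeF, tauSL_slE c h, nodeE, tauPerm, Equiv.swap_apply_left, Equiv.swap_apply_right,
    tauShift_eq, tauShift_eq]
  congr 1
  simp only [if_true, if_neg (sub_one_ne c), if_neg (sub_one_ne c).symm]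
  ring

theorem tauSL_nodeE : tauSL c (nodeE c) = nodeF c := by
  have h : ht (c - 1) c (nodeDeg c) ≠ 0 := by
    rw [ht, val_sub_one]
    ring_nf
    norm_num
  rw [nodeE, tauSL_slE c h, nodeF, tauPerm, Equiv.swap_apply_left, Equiv.swap_apply_right,
    tauShift_eq, tauShift_eq]
  congr 1
  simp only [if_true, if_neg (sub_one_ne c), if_neg (sub_one_ne c).symm]
  ring

end Heights

open UniversalEnvelopingAlgebra (ι)

/-! ### Properties of the maps `ξ_c` modulo `J̄` -/

section XiProperties

variable {m N : ℕ}

theorem rightUbar_mem_Jbar (A : Ubar m) {y : Bbar m N} (hy : y ∈ Jbar m N) :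
    rightUbar N A y ∈ Jbar m N := by
  induction hy using Submodule.span_induction with
  | mem y hy =>
    obtain ⟨X, hX, z, rfl⟩ := hy
    rw [← leftUbar_rightUbar]
    exact leftUbar_mem_Jbar hX _
  | zero => rw [map_zero]; exact zero_mem _
  | add y z _ _ hy hz => rw [map_add]; exact add_mem hy hz
  | smul z y _ hy => rw [map_smul]; exact Submodule.smul_mem _ z hy

theorem pow_succ_apply {V : Type*} [AddCommGroup V] [Module ℂ V] (f : Module.End ℂ V) (n : ℕ)
    (y : V) : (f ^ (n + 1)) y = f ((f ^ n) y) := by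
  rw [pow_succ', Module.End.mul_apply]

variable (N) in
/-- The right action of `Ū(𝔰𝔩̂ₘ)` on `B̄ / J̄`. -/
def rightJ (A : Ubar m) : Module.End ℂ (Bbar m N ⧸ Jbar m N) :=
  (Jbar m N).mapQ (Jbar m N) (rightUbar N A) fun _ hy => rightUbar_mem_Jbar A hy

theorem rightJ_mkQ (A : Ubar m) (y : Bbar m N) :
    rightJ N A ((Jbar m N).mkQ y) = (Jbar m N).mkQ (rightUbar N A y) := rfl

theorem adAct_pow_rightU_of_lie {X Z : affineSL m} {lam : ℂ} (h : ⁅X, Z⁆ = lam • X) (n : ℕ)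
    (Y : B m N) : (adAct N X ^ (n + 1)) (rightU N (ι ℂ Z) Y) =
      rightU N (ι ℂ Z) ((adAct N X ^ (n + 1)) Y) +
        ((n + 1) * lam) • rightU N (ι ℂ X) ((adAct N X ^ n) Y) := by
  induction n with
  | zero =>
    rw [zero_add, pow_one, pow_zero, adAct_rightU, h, map_smul, rightU_smul, Nat.cast_zero,
      zero_add,
      one_mul]
    rfl
  | succ n ih =>
    have hX : ∀ W : B m N, adAct N X (rightU N (ι ℂ X) W) = rightU N (ι ℂ X) (adAct N X W) := by
      intro W
      rw [adAct_rightU, lie_self, map_zero, ← zero_smul ℂ (0 : U m), rightU_smul, zero_smul,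
        add_zero]
    rw [pow_succ_apply, ih, map_add, map_smul, hX, adAct_rightU, h, map_smul, rightU_smul,
      ← pow_succ_apply, ← pow_succ_apply, add_assoc, ← add_smul]
    congr 2
    push_cast
    ring

theorem rightU_eq (X : affineSL m) (W : B m N) :
    rightU N (ι ℂ X) W = diagAct N (FU m) X W - adAct N X W := by
  rw [adAct_apply, sub_sub_cancel]

variable [m.AtLeastTwo] (c : Fin m)

theorem xiProj_rightUbar (n : ℕ) (A : Ubar m) (y : Bbar m N) :
    xiProj c N n (rightUbar N A y) = rightJ N A (xiProj c N n y) := by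
  rw [xiProj, LinearMap.comp_apply, leftUbar_rightUbar]
  rfl

theorem xiComp_rightU {Z : affineSL m} {lam : ℂ} (h : ⁅nodeF c, Z⁆ = lam • nodeF c) (n : ℕ)
    (Y : B m N) : xiComp c (n + 1) (rightU N (ι ℂ Z) Y) =
      rightJ N (numer m (ι ℂ Z)) (xiComp c (n + 1) Y) +
        ((n + 1) * lam) • (xiComp c n Y - xiComp c (n + 1) Y) := by
  have hF : ∀ W : B m N, toBbar m N (diagAct N (FU m) (nodeF c) W) =
      leftUbar m N (numer m (chevF c)) (toBbar m N W) := toBbar_diagAct (nodeF c)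
  rw [xiComp, adAct_pow_rightU_of_lie h, map_add, map_add, map_smul, map_smul, toBbar_rightU,
    xiProj_rightUbar, rightU_eq, map_sub, map_sub, hF, xiProj_succ_chevF, ← Module.End.mul_apply,
    ← pow_succ']
  rfl

theorem xiComp_zero_rightU (Z : affineSL m) (Y : B m N) : xiComp c 0 (rightU N (ι ℂ Z) Y) =
    rightJ N (numer m (ι ℂ Z)) (xiComp c 0 Y) := by
  rw [xiComp, pow_zero, Module.End.one_apply, toBbar_rightU, xiProj_rightUbar]
  rfl

theorem sum_range_telescope {M : Type*} [AddCommGroup M] [Module ℂ M] (g : ℕ → M) (lam : ℂ) (K :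
    ℕ) :
    ∑ n ∈ Finset.range K, (((n : ℂ) + 1) * lam) • (g n - g (n + 1)) =
      lam • ∑ n ∈ Finset.range K, g n - (K * lam) • g K := by
  induction K with
  | zero => simp
  | succ K ih =>
    rw [Finset.sum_range_succ, ih, Finset.sum_range_succ]
    push_cast
    module

theorem xiComp_eq_zero {n : ℕ} {Y : B m N} (h : (adAct N (nodeF c) ^ n) Y = 0) :
    xiComp c n Y = 0 := by
  rw [xiComp, h, map_zero, map_zero]

/-- The commutator `[F_c, H] = ε_c(H) F_c` produces the shift by `ε_c`; the sum telescopes. -/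
theorem mkQ_xi_rightU_hhat (H : hhat m) (Y : B m N) :
    (Jbar m N).mkQ (xi c N (rightU N (ι ℂ H.1) Y)) =
      rightJ N (numer m (ι ℂ H.1)) ((Jbar m N).mkQ (xi c N Y)) +
        epsilon c H • (Jbar m N).mkQ (xi c N Y) := by
  obtain ⟨K₁, h1⟩ := mkQ_xi c (rightU N (ι ℂ H.1) Y)
  obtain ⟨K₂, h2⟩ := mkQ_xi c Y
  obtain ⟨K, hK1, hK2⟩ : ∃ K, K₁ ≤ K + 1 ∧ K₂ ≤ K := ⟨max K₁ K₂, by omega, by omega⟩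
  have e2 := (h2 K hK2).2
  have e2' := (h2 (K + 1) (by omega)).2
  rw [(h1 (K + 1) hK1).2, Finset.sum_range_succ', xiComp_zero_rightU,
    Finset.sum_congr rfl fun n _ => xiComp_rightU c (lie_nodeF c H) n Y, Finset.sum_add_distrib,
    sum_range_telescope, ← e2, xiComp_eq_zero c (h2 K hK2).1, smul_zero, sub_zero, ← map_sum,
    add_right_comm, ← map_add, ← Finset.sum_range_succ' (fun n => xiComp c n Y), ← e2']

/-- The map `ξ_c` followed by the projection onto `B̄ / J̄` is equivariant for the right action of
`U(𝔥̂)` up to the shift by `ε_c`. -/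
theorem mkQ_xi_rightU (h : Uh m) (Y : B m N) :
    (Jbar m N).mkQ (xi c N (rightU N (UhToU m h) Y)) =
      rightJ N (hU m (shiftUh c h)) ((Jbar m N).mkQ (xi c N Y)) := by
  let M : Subalgebra ℂ (Uh m) :=
    { carrier := {h | ∀ Y : B m N, (Jbar m N).mkQ (xi c N (rightU N (UhToU m h) Y)) =
        rightJ N (hU m (shiftUh c h)) ((Jbar m N).mkQ (xi c N Y))}
      mul_mem' := fun {a b} ha hb Y => by
        rw [map_mul, ← rightU_rightU, hb, ha, rightJ_mkQ, rightJ_mkQ, rightJ_mkQ, ← rightUbar_mul,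
          map_mul, map_mul]
      add_mem' := fun {a b} ha hb Y => by
        rw [map_add, rightU_add, map_add, map_add, ha, hb, rightJ_mkQ, rightJ_mkQ, rightJ_mkQ,
          map_add,
          map_add, rightUbar_add, map_add]
      algebraMap_mem' := fun z Y => by
        rw [AlgHom.commutes, rightU_algebraMap, AlgHom.commutes, AlgHom.commutes, rightJ_mkQ,
          Algebra.algebraMap_eq_smul_one, rightUbar_smul, rightUbar_one, map_smul, map_smul] }
  refine uea_induction (M := M) (fun H Y => ?_) h Y
  rw [UhToU_ι, mkQ_xi_rightU_hhat, shiftUh_ι, rightJ_mkQ, rightJ_mkQ, map_add, AlgHom.commutes,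
    hU_ι,
    rightUbar_add, Algebra.algebraMap_eq_smul_one, rightUbar_smul, rightUbar_one, map_add, map_smul]

/-- The adjoint action of the powers of `F_c` on `E_c Y`, from `[F_c, E_c] = -H_c` and `[F_c, H_c] =
2 F_c`. -/
theorem adAct_pow_diagAct_nodeE (n : ℕ) (Y : B m N) :
    (adAct N (nodeF c) ^ (n + 1)) (diagAct N (FU m) (nodeE c) Y) =
      diagAct N (FU m) (nodeE c) ((adAct N (nodeF c) ^ (n + 1)) Y) -
        (n + 1 : ℂ) • diagAct N (FU m) (chevH c).1 ((adAct N (nodeF c) ^ n) Y) -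
        ((n + 1 : ℂ) * n) • diagAct N (FU m) (nodeF c) ((adAct N (nodeF c) ^ (n - 1)) Y) := by
  have hE : ∀ W : B m N, adAct N (nodeF c) (diagAct N (FU m) (nodeE c) W) =
      diagAct N (FU m) (nodeE c) (adAct N (nodeF c) W) - diagAct N (FU m) (chevH c).1 W := by
    intro W
    rw [adAct_diagAct, ← lie_skew, nodeE_lie_nodeF, map_neg, LinearMap.neg_apply, sub_eq_add_neg]
  have hH : ∀ W : B m N, adAct N (nodeF c) (diagAct N (FU m) (chevH c).1 W) =
      diagAct N (FU m) (chevH c).1 (adAct N (nodeF c) W) +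
        (2 : ℂ) • diagAct N (FU m) (nodeF c) W := by
    intro W
    rw [adAct_diagAct, lie_nodeF, epsilon_chevH, map_smul, LinearMap.smul_apply]
  have hF : ∀ W : B m N, adAct N (nodeF c) (diagAct N (FU m) (nodeF c) W) =
      diagAct N (FU m) (nodeF c) (adAct N (nodeF c) W) := by
    intro W
    rw [adAct_diagAct, lie_self, map_zero, LinearMap.zero_apply, add_zero]
  induction n with
  | zero =>
    rw [zero_add, pow_one, hE]
    simp
  | succ n ih =>
    rw [pow_succ_apply, ih, map_sub, map_sub, map_smul, map_smul, hE, hH, hF, ← pow_succ_apply,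
      ← pow_succ_apply, Nat.add_sub_cancel]
    rcases n with _ | n
    · simp only [Nat.cast_zero, mul_zero, zero_smul]
      push_cast
      module
    · rw [Nat.add_sub_cancel, ← pow_succ_apply]
      push_cast
      module

/-- The map `ξ_c` sends `E_c B` to `J̄`. Moving `E_c` and `F_c` through the coefficients turns the
sum into a telescoping one, whose last term vanishes by local nilpotency. -/
theorem mkQ_xi_nodeE (Y : B m N) :
    (Jbar m N).mkQ (xi c N (diagAct N (FU m) (nodeE c) Y)) = 0 := by
  set y : ℕ → Bbar m N := fun n => toBbar m N ((adAct N (nodeF c) ^ n) Y) with hy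
  set q : ℕ → Bbar m N ⧸ Jbar m N := fun n =>
    xiProj c N (n + 1) (leftUbar m N (numer m (ι ℂ (chevH c).1)) (y n)) with hq
  set r : ℕ → Bbar m N ⧸ Jbar m N := fun n => xiProj c N (n + 1) (y n) with hr
  have hE : ∀ W : B m N, toBbar m N (diagAct N (FU m) (nodeE c) W) =
      leftUbar m N (numer m (chevE c)) (toBbar m N W) := toBbar_diagAct (nodeE c)
  have hF : ∀ W : B m N, toBbar m N (diagAct N (FU m) (nodeF c) W) =
      leftUbar m N (numer m (chevF c)) (toBbar m N W) := toBbar_diagAct (nodeF c)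
  have hp : ∀ n : ℕ, xiProj c N n (leftUbar m N (numer m (chevE c)) (y n)) =
      (n + 1 : ℂ) • q n + ((n + 2 : ℂ) * (n + 1)) • r n := fun n => xiProj_chevE c n (y n)
  have h0 : xiComp c 0 (diagAct N (FU m) (nodeE c) Y) = q 0 + (2 : ℂ) • r 0 := by
    rw [xiComp, pow_zero, Module.End.one_apply, hE]
    refine (hp 0).trans ?_
    rw [Nat.cast_zero]
    module
  have h1 : xiComp c 1 (diagAct N (FU m) (nodeE c) Y) = (2 : ℂ) • q 1 + (6 : ℂ) • r 1 - q 0 := by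
    have h := hp 1
    have e := adAct_pow_diagAct_nodeE c 0 Y
    rw [Nat.cast_zero, mul_zero, zero_smul, sub_zero, zero_add, zero_add, one_smul] at e
    rw [xiComp, e, map_sub, map_sub, hE, toBbar_diagAct]
    refine (congrArg (· - _) h).trans ?_
    rw [Nat.cast_one]
    simp only [hq, hy]
    module
  have h2 : ∀ n, xiComp c (n + 2) (diagAct N (FU m) (nodeE c) Y) =
      ((n + 3 : ℂ) • q (n + 2) + ((n + 4 : ℂ) * (n + 3)) • r (n + 2)) - (n + 2 : ℂ) • q (n + 1) -
        ((n + 2 : ℂ) * (n + 1)) • r n := by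
    intro n
    have h := hp (n + 2)
    rw [xiComp, adAct_pow_diagAct_nodeE, map_sub, map_sub, map_sub, map_sub, map_smul, map_smul,
      map_smul, map_smul, hE, hF, toBbar_diagAct, xiProj_succ_chevF, Nat.add_sub_cancel]
    refine (congrArg (· - _ - _) h).trans ?_
    push_cast
    simp only [hq, hr, hy]
    module
  have hsum : ∀ K : ℕ, ∑ n ∈ Finset.range (K + 2), xiComp c n (diagAct N (FU m) (nodeE c) Y) =
      (K + 2 : ℂ) • q (K + 1) + ((K + 2 : ℂ) * (K + 1)) • r K +
        ((K + 3 : ℂ) * (K + 2)) • r (K + 1) := by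
    intro K
    induction K with
    | zero =>
      rw [zero_add, Finset.sum_range_succ, Finset.sum_range_one, h0, h1, Nat.cast_zero]
      module
    | succ K ih =>
      rw [Finset.sum_range_succ, ih, h2]
      push_cast
      module
  obtain ⟨K₁, e1⟩ := mkQ_xi c (diagAct N (FU m) (nodeE c) Y)
  obtain ⟨K₂, e2⟩ := mkQ_xi c Y
  have hK : ∀ n, K₂ ≤ n → y n = 0 := fun n hn => by
    simp only [hy]
    rw [(e2 n hn).1, map_zero]
  rw [(e1 (max K₁ K₂ + 2) (by omega)).2, hsum]
  simp only [hq, hr, hK (max K₁ K₂ + 1) (by omega), hK (max K₁ K₂) (by omega), map_zero, smul_zero,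
    add_zero]

/-- The map `ξ_c` sends `B F_c` to `J̄`, again by telescoping: `Y F_c = F_c Y - ad_{F_c}(Y)`. -/
theorem mkQ_xi_rightU_nodeF (Y : B m N) :
    (Jbar m N).mkQ (xi c N (rightU N (ι ℂ (nodeF c)) Y)) = 0 := by
  set y : ℕ → Bbar m N := fun n => toBbar m N ((adAct N (nodeF c) ^ n) Y) with hy
  have hF : ∀ W : B m N, toBbar m N (diagAct N (FU m) (nodeF c) W) =
      leftUbar m N (numer m (chevF c)) (toBbar m N W) := toBbar_diagAct (nodeF c)
  have had : ∀ n, (adAct N (nodeF c) ^ n) (rightU N (ι ℂ (nodeF c)) Y) =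
      diagAct N (FU m) (nodeF c) ((adAct N (nodeF c) ^ n) Y) - (adAct N (nodeF c) ^ (n + 1)) Y := by
    intro n
    rw [pow_succ', Module.End.mul_apply, ← rightU_eq]
    cases n with
    | zero => rfl
    | succ n =>
      rw [adAct_pow_rightU_of_lie (lam := 0) (by rw [lie_self, zero_smul]), mul_zero, zero_smul,
        add_zero]
  have hsum : ∀ K : ℕ, ∑ n ∈ Finset.range (K + 1), xiComp c n (rightU N (ι ℂ (nodeF c)) Y) =
      -xiProj c N K (y (K + 1)) := by
    intro K
    induction K with
    | zero =>
      rw [zero_add, Finset.sum_range_one, xiComp, had, map_sub, map_sub, hF, xiProj_zero_chevF,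
        zero_sub]
    | succ K ih =>
      rw [Finset.sum_range_succ, ih, xiComp, had, map_sub, map_sub, hF, xiProj_succ_chevF,
        neg_add_eq_sub, sub_sub_cancel_left]
  obtain ⟨K₁, e1⟩ := mkQ_xi c (rightU N (ι ℂ (nodeF c)) Y)
  obtain ⟨K₂, e2⟩ := mkQ_xi c Y
  rw [(e1 (max K₁ K₂ + 1) (by omega)).2, hsum]
  simp only [hy]
  rw [(e2 (max K₁ K₂ + 1) (by omega)).1, map_zero, map_zero, neg_zero]

theorem xi_mem {M : Submodule ℂ (Bbar m N)} {Y : B m N}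
    (h : ∀ n, leftUbar m N (xiCoeff c n) (toBbar m N ((adAct N (nodeF c) ^ n) Y)) ∈ M) :
    xi c N Y ∈ M := by
  obtain ⟨K, hK⟩ := (isXi_xi c N Y).exists
  rw [hK]
  refine sum_mem fun n _ => ?_
  rw [xiTerm_apply]
  exact h n

omit [m.AtLeastTwo] in
theorem adAct_pow_mem {X : affineSL m} {M : Submodule ℂ (B m N)} (h : ∀ Y ∈ M, adAct N X Y ∈ M)
    {Y : B m N} (hY : Y ∈ M) (n : ℕ) : (adAct N X ^ n) Y ∈ M := by
  induction n with
  | zero => exact hY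
  | succ n ih =>
    rw [pow_succ', Module.End.mul_apply]
    exact h _ ih

theorem span_le_of_forall {V W : Type*} [AddCommGroup V] [Module ℂ V] [AddCommGroup W] [Module ℂ W]
    {s : Set V} {M : Submodule ℂ W} {f : V →ₗ[ℂ] W} (h : ∀ v ∈ s, f v ∈ M) {v : V}
    (hv : v ∈ Submodule.span ℂ s) : f v ∈ M :=
  (Submodule.span_le (p := M.comap f)).mpr h hv

/-- The span of all `X y`, where `X` is a negative root vector other than `F_c`. -/
def negJ (N : ℕ) : Submodule ℂ (Bbar m N) :=
  Submodule.span ℂ {y | ∃ a b j, IsNegRoot c a b j ∧ ∃ z,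
    y = leftUbar m N (numer m (ι ℂ (slE a b j))) z}

theorem leftUbar_mem_negJ {X : affineSL m} (hX : X ∈ negSpan c) (y : Bbar m N) :
    leftUbar m N (numer m (ι ℂ X)) y ∈ negJ c N := by
  rw [leftUbar_ι]
  refine span_le_of_forall (f := LinearMap.applyₗ y ∘ₗ (diagAct N (FUbar m)).toLinearMap) ?_ hX
  rintro _ ⟨a, b, j, h, rfl⟩
  refine Submodule.subset_span ⟨a, b, j, h, y, ?_⟩
  rw [leftUbar_ι]
  rfl

theorem negJ_le : negJ c N ≤ Jbar m N := by
  refine Submodule.span_le.mpr ?_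
  rintro _ ⟨a, b, j, h, z, rfl⟩
  exact leftUbar_mem_Jbar (slE_mem_nhat (lt_of_ht_neg h.1)) z

theorem chevE_negJ {y : Bbar m N} (hy : y ∈ negJ c N) :
    leftUbar m N (numer m (chevE c)) y ∈ negJ c N := by
  refine span_le_of_forall ?_ hy
  rintro _ ⟨a, b, j, h, z, rfl⟩
  have hX : slE a b j ∈ negSpan c := Submodule.subset_span ⟨a, b, j, h, rfl⟩
  have e : chevE c = ι ℂ (nodeE c) := rfl
  rw [← leftUbar_mul, e, ← map_mul, ι_mul_ι, map_add, map_add, LinearMap.add_apply, map_mul,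
    leftUbar_mul]
  exact add_mem (leftUbar_mem_negJ c hX _) (leftUbar_mem_negJ c (nodeE_lie_negSpan c hX) _)

/-- The subspace `negJ` is closed under division by denominators, because the root vectors spanning
`negSpan` are weight vectors of integral weight. -/
theorem mem_negJ_of_hU {h : Uh m} (hh : h ∈ Sh m) {y : Bbar m N}
    (hy : leftUbar m N (hU m h) y ∈ negJ c N) : y ∈ negJ c N := by
  obtain ⟨B, hB⟩ := (isUnit_hU hh).exists_left_inv
  have key : ∀ z ∈ negJ c N, leftUbar m N B z ∈ negJ c N := by
    intro z hz
    refine span_le_of_forall ?_ hz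
    rintro _ ⟨a, b, j, h', z, rfl⟩
    have hw := (hasWeight_slE a b j).hU_mul h
    obtain ⟨B', hB'⟩ := (isUnit_hU (shiftBy_mem (isIntegral_rootOf a b) hh)).exists_right_inv
    have e : B * numer m (ι ℂ (slE a b j)) = numer m (ι ℂ (slE a b j)) * B' := by
      have h1 := congrArg (fun x => B * x * B') hw
      simp only [← mul_assoc, hB, one_mul] at h1
      rw [h1, mul_assoc, mul_assoc, hB', mul_one]
    rw [← leftUbar_mul, e, leftUbar_mul]
    exact Submodule.subset_span ⟨a, b, j, h', _, rfl⟩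
  have := key _ hy
  rwa [← leftUbar_mul, hB, leftUbar_one] at this

theorem xiCoeff_negJ (n : ℕ) {y : Bbar m N} (hy : y ∈ negJ c N) :
    leftUbar m N (xiCoeff c n) y ∈ negJ c N := by
  rw [xiCoeff, leftUbar_smul]
  refine Submodule.smul_mem _ _ (mem_negJ_of_hU c (fallH_mem c n) ?_)
  rw [← leftUbar_mul, hU_fallH_mul]
  induction n with
  | zero => rwa [pow_zero, leftUbar_one]
  | succ n ih =>
    rw [pow_succ', leftUbar_mul]
    exact chevE_negJ c ih

/-- The map `ξ_c` sends `XB` to `J̄` for a negative root vector `X` other than `F_c`, because the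
span of these vectors is invariant under the brackets with `E_c` and `F_c`. -/
theorem mkQ_xi_negSpan {X : affineSL m} (hX : X ∈ negSpan c) (Y : B m N) :
    (Jbar m N).mkQ (xi c N (diagAct N (FU m) X Y)) = 0 := by
  refine (Submodule.Quotient.mk_eq_zero _).mpr (negJ_le c (xi_mem c fun n => xiCoeff_negJ c n ?_))
  let M : Submodule ℂ (B m N) :=
    Submodule.span ℂ {Y | ∃ X ∈ negSpan c, ∃ Z, Y = diagAct N (FU m) X Z}
  have h1 : ∀ Y ∈ M, adAct N (nodeF c) Y ∈ M := fun Y hY => by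
    refine span_le_of_forall ?_ hY
    rintro _ ⟨X, hX, Z, rfl⟩
    rw [adAct_diagAct]
    exact add_mem (Submodule.subset_span ⟨X, hX, _, rfl⟩)
      (Submodule.subset_span ⟨_, nodeF_lie_negSpan c hX, _, rfl⟩)
  refine span_le_of_forall ?_ (adAct_pow_mem h1 (Submodule.subset_span ⟨X, hX, Y, rfl⟩) n)
  rintro _ ⟨X, hX, Z, rfl⟩
  rw [toBbar_diagAct]
  exact leftUbar_mem_negJ c hX _

omit [m.AtLeastTwo] in
theorem leftUbar_mem_Jbar' (A : Ubar m) {y : Bbar m N} (hy : y ∈ Jbar' m N) :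
    leftUbar m N A y ∈ Jbar' m N := by
  refine span_le_of_forall ?_ hy
  rintro _ ⟨X, hX, z, rfl⟩
  rw [leftUbar_rightUbar]
  exact Submodule.subset_span ⟨X, hX, _, rfl⟩

theorem rightUbar_mem_Jbar'_of_posSpan {X : affineSL m} (hX : X ∈ posSpan c) (y : Bbar m N) :
    rightUbar N (numer m (ι ℂ X)) y ∈ Jbar' m N := by
  let f : affineSL m →ₗ[ℂ] Bbar m N :=
    { toFun := fun X => rightUbar N (numer m (ι ℂ X)) y
      map_add' := fun X Z => by rw [map_add, map_add, rightUbar_add]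
      map_smul' := fun z X => by rw [map_smul, map_smul, rightUbar_smul, RingHom.id_apply] }
  refine span_le_of_forall (f := f) ?_ hX
  rintro _ ⟨a, b, j, h, rfl⟩
  exact Submodule.subset_span ⟨_, slE_mem_nhat' (lt_of_ht_pos h.1), y, rfl⟩

/-- The map `ξ_c` sends `BX` to `J̄'` for a positive root vector `X` other than `E_c`. -/
theorem xi_rightU_posSpan {X : affineSL m} (hX : X ∈ posSpan c) (Y : B m N) :
    xi c N (rightU N (ι ℂ X) Y) ∈ Jbar' m N := by
  refine xi_mem c fun n => leftUbar_mem_Jbar' _ ?_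
  let M : Submodule ℂ (B m N) :=
    Submodule.span ℂ {Y | ∃ X ∈ posSpan c, ∃ Z, Y = rightU N (ι ℂ X) Z}
  have h1 : ∀ Y ∈ M, adAct N (nodeF c) Y ∈ M := fun Y hY => by
    refine span_le_of_forall ?_ hY
    rintro _ ⟨X, hX, Z, rfl⟩
    rw [adAct_rightU]
    exact add_mem (Submodule.subset_span ⟨X, hX, _, rfl⟩)
      (Submodule.subset_span ⟨_, nodeF_lie_posSpan c hX, _, rfl⟩)
  refine span_le_of_forall ?_ (adAct_pow_mem h1 (Submodule.subset_span ⟨X, hX, Y, rfl⟩) n)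
  rintro _ ⟨X, hX, Z, rfl⟩
  rw [toBbar_rightU]
  exact rightUbar_mem_Jbar'_of_posSpan c hX _

end XiProperties

open UniversalEnvelopingAlgebra (ι)

/-! ### The Zhelobenko operators -/

section Fractions

variable {m N : ℕ}

theorem UhbarToUbar_numerator (r : Uh m) :
    UhbarToUbar m (OreLocalization.numeratorRingHom r) = hU m r :=
  oreLift_numerator _ _ r

theorem exists_fraction_Uhbar (A : Uhbar m) : ∃ h ∈ Sh m, ∃ a : Uh m,
    A * OreLocalization.numeratorRingHom h = OreLocalization.numeratorRingHom a := by
  induction A using OreLocalization.ind with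
  | c r s =>
    refine ⟨s, s.2, r, ?_⟩
    rw [mul_comm]
    exact OreLocalization.mul_cancel (s := s) (t := 1)

/-- The inverse of a denominator. -/
def invH (h : Sh m) : Uhbar m := (1 : Uh m) /ₒ h

theorem invH_mul (h : Sh m) : invH h * OreLocalization.numeratorRingHom (h : Uh m) = 1 := by
  rw [mul_comm]
  exact (OreLocalization.mul_cancel (s := h) (t := 1)).trans OreLocalization.one_def.symm

theorem UhbarToUbar_invH_mul (h : Sh m) : UhbarToUbar m (invH h) * hU m h = 1 := by
  rw [← UhbarToUbar_numerator, ← map_mul, invH_mul, map_one]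

theorem mul_UhbarToUbar_invH (h : Sh m) : hU m h * UhbarToUbar m (invH h) = 1 := by
  rw [← UhbarToUbar_numerator, ← map_mul, mul_comm, invH_mul, map_one]

/-- Every element of `B̄` has the form `Y h⁻¹` with `Y ∈ B` and a denominator `h`. -/
theorem exists_eq_rightUbar_invH (y : Bbar m N) :
    ∃ (h : Sh m) (Y : B m N), y = rightUbar N (UhbarToUbar m (invH h)) (toBbar m N Y) := by
  obtain ⟨h, hh, Y, e⟩ := exists_right_fraction_Bbar y
  refine ⟨⟨h, hh⟩, Y, ?_⟩
  rw [← e, ← rightUbar_mul, mul_UhbarToUbar_invH ⟨h, hh⟩, rightUbar_one]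

theorem HasWeight.invH_mul {v : U m} {lam : hhat m →ₗ[ℂ] ℂ} (hv : HasWeight v lam)
    (hl : IsIntegral lam) (h : Sh m) : UhbarToUbar m (invH h) * numer m v =
      numer m v * UhbarToUbar m (invH ⟨shiftBy lam h, shiftBy_mem hl h.2⟩) := by
  have h1 := mul_UhbarToUbar_invH ⟨shiftBy lam h, shiftBy_mem hl h.2⟩
  have h2 := congrArg (fun x => UhbarToUbar m (invH h) * x *
    UhbarToUbar m (invH ⟨shiftBy lam h, shiftBy_mem hl h.2⟩)) (hv.hU_mul (h : Uh m))
  simp only [mul_assoc] at h2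
  rw [h1, mul_one, ← mul_assoc (UhbarToUbar m (invH h)) (hU m h), UhbarToUbar_invH_mul,
    one_mul] at h2
  exact h2.symm

theorem HasWeight.mul_invH {v : U m} {lam : hhat m →ₗ[ℂ] ℂ} (hv : HasWeight v lam)
    (hl : IsIntegral lam) (h : Sh m) : numer m v * UhbarToUbar m (invH h) =
      UhbarToUbar m (invH ⟨shiftBy (-lam) h, shiftBy_mem hl.neg h.2⟩) * numer m v := by
  rw [hv.invH_mul hl]
  have e : h = ⟨shiftBy lam (shiftBy (-lam) h), shiftBy_mem hl (shiftBy_mem hl.neg h.2)⟩ :=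
    Subtype.ext (by
      change (h : Uh m) = shiftBy lam (shiftBy (-lam) h)
      rw [shiftBy_shiftBy, add_neg_cancel, shiftBy_zero])
  rw [← e]

theorem Jbar_induction [NeZero m] {M : Submodule ℂ (Bbar m N)}
    (h : ∀ a b j z, ht a b j < 0 → leftUbar m N (numer m (ι ℂ (slE a b j))) z ∈ M) {y : Bbar m N}
    (hy : y ∈ Jbar m N) : y ∈ M := by
  refine (Submodule.span_le (p := M)).mpr ?_ hy
  rintro _ ⟨X, hX, z, rfl⟩
  rw [leftUbar_ι]
  refine mem_of_support (M := M.comap (LinearMap.applyₗ z ∘ₗ (diagAct N (FUbar m)).toLinearMap))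
    (r := fun a b j => j < 0 ∨ (j = 0 ∧ b < a)) (fun a b j hj => ?_) hX.1 hX.2
  have := h a b j z (ht_neg_of_lt hj)
  rwa [leftUbar_ι] at this

theorem Jbar'_induction [NeZero m] {M : Submodule ℂ (Bbar m N)}
    (h : ∀ a b j z, 0 < ht a b j → rightUbar N (numer m (ι ℂ (slE a b j))) z ∈ M) {y : Bbar m N}
    (hy : y ∈ Jbar' m N) : y ∈ M := by
  refine (Submodule.span_le (p := M)).mpr ?_ hy
  rintro _ ⟨X, hX, z, rfl⟩
  let f : affineSL m →ₗ[ℂ] Bbar m N :=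
    { toFun := fun X => rightUbar N (numer m (ι ℂ X)) z
      map_add' := fun X Z => by rw [map_add, map_add, rightUbar_add]
      map_smul' := fun z X => by rw [map_smul, map_smul, rightUbar_smul, RingHom.id_apply] }
  exact mem_of_support (M := M.comap f) (r := fun a b j => 0 < j ∨ (j = 0 ∧ a < b))
    (fun a b j hj => h a b j z (ht_pos_of_lt hj)) hX.1 hX.2

theorem rightUbar_invH_mem_Jbar' [NeZero m] (h : Sh m) {y : Bbar m N} (hy : y ∈ Jbar' m N) :
    rightUbar N (UhbarToUbar m (invH h)) y ∈ Jbar' m N := by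
  refine Jbar'_induction (M := (Jbar' m N).comap (rightUbar N (UhbarToUbar m (invH h))))
    (fun a b j z hj => ?_) hy
  rw [Submodule.mem_comap, ← rightUbar_mul, (hasWeight_slE a b j).mul_invH (isIntegral_rootOf a b),
    rightUbar_mul]
  exact Submodule.subset_span ⟨_, slE_mem_nhat' (lt_of_ht_pos hj), _, rfl⟩

end Fractions

section AffineAction

variable {m N : ℕ} (w : Equiv.Perm (Fin m)) (s : Fin m → ℤ)

theorem affineMapUbar_numer (u : U m) :
    affineMapUbar w s (numer m u) = numer m (affineMapU w s u) :=
  oreLift_numerator _ (isUnit_affineMapU w s) u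

theorem affineMapP_basisP (k : Mon m N) : affineMapP N w s (basisP k) =
    basisP (fun q => k.1 q + s (k.2 q), fun q => w (k.2 q)) :=
  opOfBasis_basisP _ _

theorem affineMapP_mul_xOp (q : Fin N) (j : ℤ) :
    affineMapP N w s * xOp q j = xOp q j * affineMapP N w s := by
  refine opP_ext fun k => ?_
  rw [Module.End.mul_apply, Module.End.mul_apply, xOp_basisP, affineMapP_basisP, affineMapP_basisP,
    xOp_basisP]
  congr 2
  funext r
  by_cases hr : r = q
  · subst hr
    simp only [Function.update_self]
    ring
  · simp only [Function.update_of_ne hr]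

theorem affineMapP_mul_EOp (q : Fin N) (a b : Fin m) :
    affineMapP N w s * EOp q a b = xOp q (s a - s b) * EOp q (w a) (w b) * affineMapP N w s := by
  refine opP_ext fun k => ?_
  rw [Module.End.mul_apply, Module.End.mul_apply, Module.End.mul_apply, EOp_basisP,
    affineMapP_basisP, EOp_basisP]
  simp only [w.injective.eq_iff]
  split_ifs with h
  · rw [affineMapP_basisP, xOp_basisP]
    congr 2
    · funext r
      by_cases hr : r = q
      · subst hr
        simp only [Function.update_self, h]
        ring
      · simp only [Function.update_of_ne hr]
    · funext r
      by_cases hr : r = q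
      · subst hr
        simp only [Function.update_self]
      · simp only [Function.update_of_ne hr]
  · rw [map_zero, map_zero]

theorem affineMapP_mul_slOp [NeZero m] (q : Fin N) (a b : Fin m) :
    affineMapP N w s * slOp q a b = xOp q (s a - s b) * slOp q (w a) (w b) * affineMapP N w s := by
  have h : trc (w a) (w b) = trc a b := by simp only [trc, w.injective.eq_iff]
  rw [slOp, slOp, mul_sub, mul_sub, sub_mul, affineMapP_mul_EOp, h, mul_smul_comm, mul_smul_comm,
    mul_one, mul_one]
  congr 1
  by_cases hab : a = b
  · subst hab
    rw [sub_self, xOp_zero, smul_mul_assoc]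
    rfl
  · simp [trc, hab]

theorem affineMapP_mul_loopRep [NeZero m] (X : affineSL m) :
    affineMapP N w s * loopRep m N X = loopRep m N (affineMapSL w s X) * affineMapP N w s := by
  let M : Submodule ℂ (affineSL m) :=
    LinearMap.eqLocus (LinearMap.mulLeft ℂ (affineMapP N w s) ∘ₗ (loopRep m N).toLinearMap)
      (LinearMap.mulRight ℂ (affineMapP N w s) ∘ₗ (loopRep m N).toLinearMap ∘ₗ
        (affineMapSL w s).toLinearMap)
  refine affineSL_induction (M := M) (fun a b j => ?_) ?_ X
  · change affineMapP N w s * loopRep m N (slE a b j) =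
      loopRep m N (affineMapSL w s (slE a b j)) * affineMapP N w s
    rw [affineMapSL_slE, map_add, map_smul, loopRep_slC, smul_zero, add_zero, loopRep_slE,
      loopRep_slE, Finset.mul_sum, Finset.sum_mul]
    refine Finset.sum_congr rfl fun q _ => ?_
    rw [← mul_assoc, affineMapP_mul_xOp, mul_assoc, affineMapP_mul_slOp, ← mul_assoc, ← mul_assoc,
      ← xOp_add, add_sub_assoc]
  · change affineMapP N w s * loopRep m N (slC m) =
      loopRep m N (affineMapSL w s (slC m)) * affineMapP N w s
    rw [affineMapSL_slC, loopRep_slC, mul_zero, zero_mul]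

variable (N) in
/-- The action on `B̄` of the transformation given by a permutation `w` and a vector `s`. -/
def affBbar : Module.End ℂ (Bbar m N) :=
  TensorProduct.map (affineMapP N w s) (affineMapUbar w s).toLinearMap

theorem affBbar_tmul (p : P m N) (x : Ubar m) :
    affBbar N w s (p ⊗ₜ x) = affineMapP N w s p ⊗ₜ affineMapUbar w s x := rfl

theorem affBbar_rightUbar (A : Ubar m) (y : Bbar m N) :
    affBbar N w s (rightUbar N A y) = rightUbar N (affineMapUbar w s A) (affBbar N w s y) := by
  have h : affBbar N w s ∘ₗ rightUbar N A =
      rightUbar N (affineMapUbar w s A) ∘ₗ affBbar N w s :=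
    TensorProduct.ext' fun p x => by
      simp only [LinearMap.comp_apply, rightUbar_tmul, affBbar_tmul, map_mul]
  exact LinearMap.congr_fun h y

theorem affBbar_diagAct [NeZero m] (X : affineSL m) (y : Bbar m N) :
    affBbar N w s (diagAct N (FUbar m) X y) =
      diagAct N (FUbar m) (affineMapSL w s X) (affBbar N w s y) := by
  have h : affBbar N w s ∘ₗ diagAct N (FUbar m) X =
      diagAct N (FUbar m) (affineMapSL w s X) ∘ₗ affBbar N w s :=
    TensorProduct.ext' fun p x => by
      have h1 := LinearMap.congr_fun (affineMapP_mul_loopRep (N := N) w s X) p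
      rw [Module.End.mul_apply, Module.End.mul_apply] at h1
      have h2 : affineMapUbar w s (FUbar m (ι ℂ X) x) =
          FUbar m (ι ℂ (affineMapSL w s X)) (affineMapUbar w s x) := by
        change affineMapUbar w s (numer m (ι ℂ X) * x) =
          numer m (ι ℂ (affineMapSL w s X)) * affineMapUbar w s x
        rw [map_mul, affineMapUbar_numer, affineMapU_ι]
      simp only [LinearMap.comp_apply, diagAct_apply, LinearMap.add_apply, rA_tmul, lA_tmul,
        map_add,
        affBbar_tmul, h1, h2]
  exact LinearMap.congr_fun h y

theorem affBbar_leftUbar_ι [NeZero m] (X : affineSL m) (y : Bbar m N) :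
    affBbar N w s (leftUbar m N (numer m (ι ℂ X)) y) =
      leftUbar m N (numer m (ι ℂ (affineMapSL w s X))) (affBbar N w s y) := by
  rw [leftUbar_ι, leftUbar_ι, affBbar_diagAct]

end AffineAction

section Zhelobenko

variable {m N : ℕ} [m.AtLeastTwo] (c : Fin m)

theorem shiftUh_mem' {h : Uh m} (hh : h ∈ Sh m) : shiftUh c h ∈ Sh m := shiftUh_mem c ⟨h, hh⟩

omit [m.AtLeastTwo] in
theorem rightJ_rightJ (A A' : Ubar m) (y : Bbar m N ⧸ Jbar m N) :
    rightJ N A (rightJ N A' y) = rightJ N (A' * A) y := by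
  obtain ⟨y, rfl⟩ := (Jbar m N).mkQ_surjective y
  rw [rightJ_mkQ, rightJ_mkQ, rightJ_mkQ, rightUbar_mul]

omit [m.AtLeastTwo] in
theorem rightJ_one (y : Bbar m N ⧸ Jbar m N) : rightJ N 1 y = y := by
  obtain ⟨y, rfl⟩ := (Jbar m N).mkQ_surjective y
  rw [rightJ_mkQ, rightUbar_one]

variable (N) in
/-- The right action of `U(𝔥̂)` on `B̄ / J̄`, shifted by `ε_c`. -/
def shiftedRightJ : Uh m →ₐ[ℂ] Module.End ℂ (Bbar m N ⧸ Jbar m N) :=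
  AlgHom.ofLinearMap
    { toFun := fun h => rightJ N (hU m (shiftUh c h))
      map_add' := fun h h' => LinearMap.ext fun y => by
        obtain ⟨y, rfl⟩ := (Jbar m N).mkQ_surjective y
        rw [LinearMap.add_apply, rightJ_mkQ, rightJ_mkQ, rightJ_mkQ, map_add, map_add,
          rightUbar_add,
          map_add]
      map_smul' := fun z h => LinearMap.ext fun y => by
        obtain ⟨y, rfl⟩ := (Jbar m N).mkQ_surjective y
        rw [LinearMap.smul_apply, RingHom.id_apply, rightJ_mkQ, rightJ_mkQ, map_smul, map_smul,
          rightUbar_smul, map_smul] }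
    (LinearMap.ext fun y => by
      change rightJ N (hU m (shiftUh c 1)) y = y
      rw [map_one, map_one, rightJ_one])
    (fun h h' => LinearMap.ext fun y => by
      change rightJ N (hU m (shiftUh c (h * h'))) y =
        rightJ N (hU m (shiftUh c h)) (rightJ N (hU m (shiftUh c h')) y)
      rw [rightJ_rightJ, ← map_mul, ← map_mul, mul_comm])

theorem shiftedRightJ_apply (h : Uh m) (y : Bbar m N ⧸ Jbar m N) :
    shiftedRightJ N c h y = rightJ N (hU m (shiftUh c h)) y := rfl

theorem isUnit_shiftedRightJ {h : Uh m} (hh : h ∈ Sh m) : IsUnit (shiftedRightJ N c h) := by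
  obtain ⟨u, hu⟩ := isUnit_hU (shiftUh_mem' c hh)
  refine ⟨⟨shiftedRightJ N c h, rightJ N (u⁻¹ : (Ubar m)ˣ), LinearMap.ext fun y => ?_,
    LinearMap.ext fun y => ?_⟩, rfl⟩
  · rw [Module.End.mul_apply, shiftedRightJ_apply, rightJ_rightJ, ← hu, Units.inv_mul, rightJ_one]
    rfl
  · rw [Module.End.mul_apply, shiftedRightJ_apply, rightJ_rightJ, ← hu, Units.mul_inv, rightJ_one]
    rfl

theorem shiftUhbar_numerator (r : Uh m) :
    shiftUhbar c (OreLocalization.numeratorRingHom r) =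
      OreLocalization.numeratorRingHom (shiftUh c r) :=
  oreLift_numerator _ _ r

/-- The extension of `ξ_c` to `B̄` exists by the universal property of right fractions: the shifted
right action of the denominators on `B̄ / J̄` is invertible. -/
theorem exists_isXiBar : ∃ ξbar : Bbar m N →ₗ[ℂ] Bbar m N ⧸ Jbar m N, IsXiBar c (xi c N) ξbar := by
  have hf : ∀ (k : Mon m N) (u : U m) (h : Uh m),
      ((Jbar m N).mkQ ∘ₗ xi c N ∘ₗ TensorProduct.mk ℂ (P m N) (U m) (basisP k)) (u * UhToU m h) =
      shiftedRightJ N c h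
        (((Jbar m N).mkQ ∘ₗ xi c N ∘ₗ TensorProduct.mk ℂ (P m N) (U m) (basisP k)) u) :=
    fun k u h => mkQ_xi_rightU c h (basisP k ⊗ₜ u)
  choose g hg using fun k => exists_extension _ (shiftedRightJ N c) (hf k)
    fun h hh => isUnit_shiftedRightJ c hh
  refine ⟨TensorProduct.lift ((basisMon m N).constr ℂ g), fun Y A => ?_⟩
  have key : (TensorProduct.lift ((basisMon m N).constr ℂ g)) ∘ₗ
      rightUbar N (UhbarToUbar m A) ∘ₗ toBbar m N =
      rightJ N (UhbarToUbar m (shiftUhbar c A)) ∘ₗ (Jbar m N).mkQ ∘ₗ xi c N := by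
    refine opBbar_ext fun k u => ?_
    obtain ⟨h, hh, a, e⟩ := exists_fraction_Uhbar A
    have e1 : numer m u * UhbarToUbar m A * hU m h = numer m (u * UhToU m a) := by
      rw [mul_assoc, ← UhbarToUbar_numerator, ← map_mul, e, UhbarToUbar_numerator, map_mul]
      rfl
    have e2 : UhbarToUbar m (shiftUhbar c A) * hU m (shiftUh c h) = hU m (shiftUh c a) := by
      rw [← UhbarToUbar_numerator, ← shiftUhbar_numerator, ← map_mul, ← map_mul, e,
        shiftUhbar_numerator, UhbarToUbar_numerator]
    have e3 := (hg k _ _ h hh e1).trans (hf k u a)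
    have hconstr : (basisMon m N).constr ℂ g (basisP k) = g k := by simp [basisP]
    simp only [LinearMap.comp_apply, toBbar_tmul, rightUbar_tmul, TensorProduct.lift.tmul, hconstr]
    refine ((Module.End.isUnit_iff _).mp (isUnit_shiftedRightJ (N := N) c hh)).1 ?_
    rw [e3, shiftedRightJ_apply, shiftedRightJ_apply, rightJ_rightJ, e2]
    rfl
  exact LinearMap.congr_fun key Y

variable (N) in
/-- The map `B̄ → B̄ / J̄` determined by `ξ_c`. -/
def xiBar : Bbar m N →ₗ[ℂ] Bbar m N ⧸ Jbar m N := (exists_isXiBar c).choose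

variable (N) in
theorem isXiBar_xiBar : IsXiBar c (xi c N) (xiBar N c) := (exists_isXiBar c).choose_spec

theorem xiBar_apply (A : Uhbar m) (Y : B m N) :
    xiBar N c (rightUbar N (UhbarToUbar m A) (toBbar m N Y)) =
      rightJ N (UhbarToUbar m (shiftUhbar c A)) ((Jbar m N).mkQ (xi c N Y)) :=
  isXiBar_xiBar N c Y A

theorem tauBbar_eq : tauBbar N c = affBbar N (tauPerm c) (tauShift c) := rfl

theorem xiBar_leftUbar_negSpan {X : affineSL m} (hX : X ∈ negSpan c) (y : Bbar m N) :
    xiBar N c (leftUbar m N (numer m (ι ℂ X)) y) = 0 := by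
  obtain ⟨h, Y, rfl⟩ := exists_eq_rightUbar_invH y
  rw [leftUbar_rightUbar, ← toBbar_diagAct, xiBar_apply, mkQ_xi_negSpan c hX, map_zero]

theorem xiBar_leftUbar_nodeE (y : Bbar m N) :
    xiBar N c (leftUbar m N (numer m (ι ℂ (nodeE c))) y) = 0 := by
  obtain ⟨h, Y, rfl⟩ := exists_eq_rightUbar_invH y
  rw [leftUbar_rightUbar, ← toBbar_diagAct, xiBar_apply, mkQ_xi_nodeE, map_zero]

/-- The operator `η_c` is well defined: `τ_c` permutes the negative root vectors other than `F_c`,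
and carries `F_c` to `E_c`. -/
theorem xiBar_tauBbar_of_mem_Jbar {y : Bbar m N} (hy : y ∈ Jbar m N) :
    xiBar N c (tauBbar N c y) = 0 := by
  refine Jbar_induction (M := LinearMap.ker (xiBar N c ∘ₗ tauBbar N c)) (fun a b j z hj => ?_) hy
  rw [LinearMap.mem_ker, LinearMap.comp_apply, tauBbar_eq, affBbar_leftUbar_ι]
  rcases isNegRoot_or_eq c hj with h | ⟨rfl, rfl, rfl⟩
  · refine xiBar_leftUbar_negSpan c (Submodule.subset_span ⟨_, _, _, h.tau, ?_⟩) _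
    exact tauSL_slE c hj.ne
  · have := tauSL_nodeF a
    rw [nodeF] at this
    rw [this]
    exact xiBar_leftUbar_nodeE a _

/-- Moving a root vector through the inverse of a denominator. -/
theorem rightUbar_slE_invH (a b : Fin m) (j : ℤ) (h : Sh m) (Y : B m N) : ∃ h' : Sh m,
    rightUbar N (numer m (ι ℂ (slE a b j))) (rightUbar N (UhbarToUbar m (invH h)) (toBbar m N Y)) =
      rightUbar N (UhbarToUbar m (invH h')) (toBbar m N (rightU N (ι ℂ (slE a b j)) Y)) :=
  ⟨_, by rw [← rightUbar_mul, (hasWeight_slE a b j).invH_mul (isIntegral_rootOf a b), rightUbar_mul,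
    toBbar_rightU]⟩

theorem shiftUhbar_invH (h : Sh m) :
    shiftUhbar c (invH h) = invH ⟨shiftUh c h, shiftUh_mem c h⟩ := by
  have h1 := congrArg (shiftUhbar c) (invH_mul h)
  rw [map_mul, shiftUhbar_numerator, map_one] at h1
  have h2 := invH_mul ⟨shiftUh c h, shiftUh_mem c h⟩
  calc shiftUhbar c (invH h) = shiftUhbar c (invH h) * (invH ⟨shiftUh c h, shiftUh_mem c h⟩ *
        OreLocalization.numeratorRingHom (shiftUh c h)) := by rw [h2, mul_one]
    _ = shiftUhbar c (invH h) * OreLocalization.numeratorRingHom (shiftUh c h) *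
        invH ⟨shiftUh c h, shiftUh_mem c h⟩ := by ring
    _ = invH ⟨shiftUh c h, shiftUh_mem c h⟩ := by rw [h1, one_mul]

theorem xiBar_rightUbar_posSpan {a b : Fin m} {j : ℤ} (hX : slE a b j ∈ posSpan c) (y : Bbar m N) :
    xiBar N c (rightUbar N (numer m (ι ℂ (slE a b j))) y) ∈ (Jbar' m N).map (Jbar m N).mkQ := by
  obtain ⟨h, Y, rfl⟩ := exists_eq_rightUbar_invH y
  obtain ⟨h', e⟩ := rightUbar_slE_invH a b j h Y
  rw [e, xiBar_apply, rightJ_mkQ, shiftUhbar_invH]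
  exact Submodule.mem_map_of_mem (rightUbar_invH_mem_Jbar' _ (xi_rightU_posSpan c hX Y))

theorem xiBar_rightUbar_nodeF (y : Bbar m N) :
    xiBar N c (rightUbar N (numer m (ι ℂ (nodeF c))) y) = 0 := by
  obtain ⟨h, Y, rfl⟩ := exists_eq_rightUbar_invH y
  obtain ⟨h', e⟩ := rightUbar_slE_invH c (c - 1) (-nodeDeg c) h Y
  rw [nodeF, e, xiBar_apply, ← nodeF, mkQ_xi_rightU_nodeF, map_zero]

/-- The operator `η_c` preserves the image of `J̄'`: `τ_c` permutes the positive root vectors other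
than `E_c`, and carries `E_c` to `F_c`. -/
theorem xiBar_tauBbar_of_mem_Jbar' {y : Bbar m N} (hy : y ∈ Jbar' m N) :
    xiBar N c (tauBbar N c y) ∈ (Jbar' m N).map (Jbar m N).mkQ := by
  refine Jbar'_induction (M := ((Jbar' m N).map (Jbar m N).mkQ).comap (xiBar N c ∘ₗ tauBbar N c))
    (fun a b j z hj => ?_) hy
  rw [Submodule.mem_comap, LinearMap.comp_apply, tauBbar_eq, affBbar_rightUbar, affineMapUbar_numer,
    affineMapU_ι]
  rcases isPosRoot_or_eq c hj with h | ⟨rfl, rfl, rfl⟩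
  · have e := tauSL_slE c hj.ne'
    rw [tauSL] at e
    rw [e]
    exact xiBar_rightUbar_posSpan c (Submodule.subset_span ⟨_, _, _, h.tau, rfl⟩) _
  · have := tauSL_nodeE b
    rw [nodeE] at this
    rw [this, xiBar_rightUbar_nodeF]
    exact zero_mem _

/-- The central element `C`, as an element of `𝔥̂`. -/
def hhatC (m : ℕ) : hhat m := ⟨slC m, 0, by
  ext1 a b
  simp [slC, AffineGL.C, Matrix.diagonal_apply]⟩

theorem epsilon_hhatC : epsilon c (hhatC m) = 0 := by
  have h : ∀ d, diagCoord d (hhatC m) = 0 := fun d => by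
    change ((0 : Matrix (Fin m) (Fin m) ℂ[T;T⁻¹]) d d).coeff 0 = 0
    simp
  rw [epsilon, LinearMap.sub_apply, h, h, sub_zero]

/-- The operator `η_c` preserves the image of `Ī`, because `C` is central, fixed by `τ_c` and not
affected by the shift by `ε_c`. -/
theorem xiBar_tauBbar_of_mem_Ibar (l : ℂ) {y : Bbar m N} (hy : y ∈ Ibar m N l) :
    xiBar N c (tauBbar N c y) ∈ (Ibar m N l).map (Jbar m N).mkQ := by
  refine span_le_of_forall (f := xiBar N c ∘ₗ tauBbar N c) ?_ hy
  rintro _ ⟨z, rfl⟩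
  have hcomm : ∀ A, Commute (numer m (ι ℂ (slC m) - algebraMap ℂ (U m) l)) A := by
    intro A
    rw [map_sub, AlgHom.commutes]
    exact (numer_slC_commute A).sub_left (Algebra.commute_algebraMap_left l A)
  have hτ : affineMapUbar (tauPerm c) (tauShift c) (numer m (ι ℂ (slC m) - algebraMap ℂ (U m) l)) =
      numer m (ι ℂ (slC m) - algebraMap ℂ (U m) l) := by
    rw [affineMapUbar_numer, map_sub, affineMapU_ι, affineMapSL_slC, AlgHom.commutes]
  have hC : UhToU m (ι ℂ (hhatC m) - algebraMap ℂ (Uh m) l) =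
      ι ℂ (slC m) - algebraMap ℂ (U m) l := by
    rw [map_sub, UhToU_ι, AlgHom.commutes]
    rfl
  have hs : shiftUh c (ι ℂ (hhatC m) - algebraMap ℂ (Uh m) l) =
      ι ℂ (hhatC m) - algebraMap ℂ (Uh m) l := by
    rw [map_sub, shiftUh_ι, epsilon_hhatC, map_zero, add_zero, AlgHom.commutes]
  rw [LinearMap.comp_apply, tauBbar_eq, affBbar_rightUbar, hτ]
  obtain ⟨h, Y, e⟩ := exists_eq_rightUbar_invH (affBbar N (tauPerm c) (tauShift c) z)
  rw [e, ← rightUbar_mul, ← (hcomm _).eq, rightUbar_mul, ← toBbar_rightU, xiBar_apply, ← hC,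
    mkQ_xi_rightU, hs, rightJ_rightJ, hU_apply, hC, (hcomm _).eq, rightJ_mkQ, rightUbar_mul]
  exact Submodule.mem_map_of_mem (Submodule.subset_span ⟨_, rfl⟩)

variable (N) in
/-- The Zhelobenko operator `η_c`. -/
def zhelobenko : Module.End ℂ (Bbar m N ⧸ Jbar m N) :=
  (Jbar m N).liftQ (xiBar N c ∘ₗ tauBbar N c) fun _ hy => xiBar_tauBbar_of_mem_Jbar c hy

theorem zhelobenko_mkQ (y : Bbar m N) :
    zhelobenko N c ((Jbar m N).mkQ y) = xiBar N c (tauBbar N c y) := rfl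

theorem isZhelobenko_zhelobenko : IsZhelobenko c (zhelobenko N c) :=
  ⟨xi c N, xiBar N c, isXi_xi c N, isXiBar_xiBar N c, fun _ => rfl⟩

theorem isZhelobenko_unique {η : Module.End ℂ (Bbar m N ⧸ Jbar m N)} (h : IsZhelobenko c η) :
    η = zhelobenko N c := by
  obtain ⟨ξ, ξbar, h1, h2, h3⟩ := h
  have e : ξ = xi c N := h1.unique (isXi_xi c N)
  subst e
  refine LinearMap.ext fun y => ?_
  obtain ⟨y, rfl⟩ := (Jbar m N).mkQ_surjective y
  rw [h3, zhelobenko_mkQ]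
  obtain ⟨h, Y, e⟩ := exists_eq_rightUbar_invH (tauBbar N c y)
  rw [e, xiBar_apply]
  exact h2 Y (invH h)

omit [m.AtLeastTwo] in
theorem projQ_mkQ (l : ℂ) (y : Bbar m N) :
    projQ m N l ((Jbar m N).mkQ y) = (Jbar m N ⊔ Jbar' m N ⊔ Ibar m N l).mkQ y := rfl

omit [m.AtLeastTwo] in
theorem projQ_map_eq_zero (l : ℂ) {M : Submodule ℂ (Bbar m N)}
    (hM : M ≤ Jbar m N ⊔ Jbar' m N ⊔ Ibar m N l) {x : Bbar m N ⧸ Jbar m N}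
    (hx : x ∈ M.map (Jbar m N).mkQ) : projQ m N l x = 0 := by
  obtain ⟨y, hy, rfl⟩ := hx
  rw [projQ_mkQ]
  exact (Submodule.Quotient.mk_eq_zero _).mpr (hM hy)

variable (N) in
/-- The linear map on `B̄ / (J̄ + J̄' + Ī)` determined by the Zhelobenko operator. -/
def zhelobenkoQ (l : ℂ) : Module.End ℂ (Q m N l) :=
  (Jbar m N ⊔ Jbar' m N ⊔ Ibar m N l).liftQ (projQ m N l ∘ₗ xiBar N c ∘ₗ tauBbar N c) <| by
    refine sup_le (sup_le (fun y hy => ?_) fun y hy => ?_) fun y hy => ?_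
    · rw [LinearMap.mem_ker, LinearMap.comp_apply, LinearMap.comp_apply,
        xiBar_tauBbar_of_mem_Jbar c hy, map_zero]
    · exact projQ_map_eq_zero l (le_sup_right.trans le_sup_left) (xiBar_tauBbar_of_mem_Jbar' c hy)
    · exact projQ_map_eq_zero l le_sup_right (xiBar_tauBbar_of_mem_Ibar c l hy)

theorem zhelobenkoQ_mkQ (l : ℂ) (y : Bbar m N) :
    zhelobenkoQ N c l ((Jbar m N ⊔ Jbar' m N ⊔ Ibar m N l).mkQ y) =
      projQ m N l (xiBar N c (tauBbar N c y)) := rfl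

theorem zhelobenkoQ_projQ (l : ℂ) (y : Bbar m N ⧸ Jbar m N) :
    zhelobenkoQ N c l (projQ m N l y) = projQ m N l (zhelobenko N c y) := by
  obtain ⟨y, rfl⟩ := (Jbar m N).mkQ_surjective y
  rfl

end Zhelobenko

open UniversalEnvelopingAlgebra (ι)

/-! ### Coinvariants of the tensor product with the Verma module -/

section Coinvariants

variable {m N : ℕ} (l : ℂ)

variable (m N) in
/-- The map `B̄ → W` induced by the projection of `Ū(𝔰𝔩̂ₘ)` onto the universal Verma module. -/
def toW : Bbar m N →ₗ[ℂ] W m N l := LinearMap.lTensor (P m N) (vermaMk m l)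

theorem toW_tmul (v : P m N) (A : Ubar m) : toW m N l (v ⊗ₜ A) = v ⊗ₜ vermaMk m l A := rfl

theorem vermaMk_surjective : Function.Surjective (vermaMk m l) :=
  (vermaIdeal m l).mkQ_surjective

theorem toW_surjective : Function.Surjective (toW m N l) :=
  LinearMap.lTensor_surjective _ (vermaMk_surjective l)

theorem vermaMk_eq_zero {A : Ubar m} : vermaMk m l A = 0 ↔ A ∈ vermaIdeal m l :=
  Submodule.Quotient.mk_eq_zero _

theorem toW_diagAct (X : affineSL m) (y : Bbar m N) :
    toW m N l (diagAct N (FUbar m) X y) = diagAct N (FVerma m l) X (toW m N l y) := by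
  induction y using TensorProduct.induction_on with
  | zero => simp only [map_zero]
  | add y z hy hz => simp only [map_add, hy, hz]
  | tmul v A =>
    rw [diagAct_apply, diagAct_apply]
    rfl

theorem toW_rightUbar_eq_zero {g : Ubar m} (hg : g ∈ vermaIdeal m l) (y : Bbar m N) :
    toW m N l (rightUbar N g y) = 0 := by
  induction y using TensorProduct.induction_on with
  | zero => simp only [map_zero]
  | add y z hy hz => rw [map_add, map_add, hy, hz, add_zero]
  | tmul v A =>
    rw [rightUbar_tmul, toW_tmul, (vermaMk_eq_zero l).mpr, TensorProduct.tmul_zero]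
    exact (vermaIdeal m l).smul_mem A hg

theorem map_toW_Jbar : (Jbar m N).map (toW m N l) = nW m N l := by
  refine le_antisymm (Submodule.map_le_iff_le_comap.mpr (Submodule.span_le.mpr ?_))
    (Submodule.span_le.mpr ?_)
  · rintro _ ⟨X, hX, z, rfl⟩
    refine Submodule.subset_span ⟨X, hX, toW m N l z, ?_⟩
    rw [leftUbar_ι, toW_diagAct]
  · rintro _ ⟨X, hX, w, rfl⟩
    obtain ⟨z, rfl⟩ := toW_surjective l w
    exact ⟨_, Submodule.subset_span ⟨X, hX, z, rfl⟩, by rw [leftUbar_ι, toW_diagAct]⟩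

theorem tmul_mem_of_mem_vermaIdeal {A : Ubar m} (hA : A ∈ vermaIdeal m l) (v : P m N) :
    v ⊗ₜ A ∈ Jbar' m N ⊔ Ibar m N l := by
  suffices h : ∀ D : Ubar m, v ⊗ₜ[ℂ] (D * A) ∈ Jbar' m N ⊔ Ibar m N l by
    have h1 := h 1
    rwa [one_mul] at h1
  induction hA using Submodule.span_induction with
  | mem g hg =>
    intro D
    rcases hg with ⟨X, hX, rfl⟩ | rfl
    · exact Submodule.mem_sup_left (Submodule.subset_span ⟨X, hX, v ⊗ₜ D, rfl⟩)
    · exact Submodule.mem_sup_right (Submodule.subset_span ⟨v ⊗ₜ D, rfl⟩)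
  | zero =>
    intro D
    rw [mul_zero, TensorProduct.tmul_zero]
    exact zero_mem _
  | add A A' _ _ h h' =>
    intro D
    rw [mul_add, TensorProduct.tmul_add]
    exact add_mem (h D) (h' D)
  | smul A g _ h =>
    intro D
    rw [smul_eq_mul, ← mul_assoc]
    exact h _

/-- The kernel of `B̄ → W` is `J̄' + Ī`, by right exactness of the tensor product. -/
theorem ker_toW : LinearMap.ker (toW m N l) = Jbar' m N ⊔ Ibar m N l := by
  refine le_antisymm (fun y hy => ?_) (sup_le (Submodule.span_le.mpr ?_) (Submodule.span_le.mpr ?_))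
  · have hex : Function.Exact ((vermaIdeal m l).subtype.restrictScalars ℂ) (vermaMk m l) := by
      intro A
      rw [vermaMk_eq_zero]
      exact ⟨fun h => ⟨⟨A, h⟩, rfl⟩, fun ⟨x, hx⟩ => hx ▸ x.2⟩
    obtain ⟨t, rfl⟩ := (lTensor_exact (P m N) hex (vermaMk_surjective l) y).mp hy
    induction t using TensorProduct.induction_on with
    | zero => rw [map_zero]; exact zero_mem _
    | add s t hs ht =>
      rw [map_add]
      refine add_mem (hs ?_) (ht ?_) <;>
      exact (lTensor_exact (P m N) hex (vermaMk_surjective l)).apply_apply_eq_zero _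
    | tmul v A => exact tmul_mem_of_mem_vermaIdeal l A.2 v
  · rintro _ ⟨X, hX, z, rfl⟩
    exact toW_rightUbar_eq_zero l (Submodule.subset_span (Or.inl ⟨X, hX, rfl⟩)) z
  · rintro _ ⟨z, rfl⟩
    exact toW_rightUbar_eq_zero l (Submodule.subset_span (Or.inr rfl)) z

/-- The isomorphism of the quotient of `B̄` with the coinvariants is a consequence of this. -/
theorem toW_mem_nW_iff {y : Bbar m N} :
    toW m N l y ∈ nW m N l ↔ y ∈ Jbar m N ⊔ Jbar' m N ⊔ Ibar m N l := by
  rw [← map_toW_Jbar, ← Submodule.mem_comap, Submodule.comap_map_eq, ker_toW, sup_assoc]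

variable (m N) in
/-- The isomorphism of `B̄ / (J̄ + J̄' + Ī)` onto the space of coinvariants of `W`. -/
def coinvEquiv : Q m N l ≃ₗ[ℂ] Coinv m N l :=
  (Submodule.quotEquivOfEq _ (LinearMap.ker ((nW m N l).mkQ ∘ₗ toW m N l)) (by
    ext y
    rw [LinearMap.mem_ker, LinearMap.comp_apply, Submodule.mkQ_apply, Submodule.Quotient.mk_eq_zero,
      toW_mem_nW_iff])).trans
  (LinearMap.quotKerEquivOfSurjective _ ((nW m N l).mkQ_surjective.comp (toW_surjective l)))

theorem coinvEquiv_mk (y : Bbar m N) :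
    coinvEquiv m N l (Submodule.Quotient.mk y) = Submodule.Quotient.mk (toW m N l y) := rfl

end Coinvariants

section Action

variable {m N : ℕ} [m.AtLeastTwo] (κ l : ℂ)

variable (m N) in
/-- The action of the trigonometric Cherednik algebra on `W`. -/
def actW : Cherednik N κ →ₐ[ℂ] Module.End ℂ (W m N l) :=
  (exists_cherednikAction κ (isSmooth_FVerma l)).choose

theorem isCherednikAction_actW : IsCherednikAction κ (FVerma m l) (actW m N κ l) :=
  (exists_cherednikAction κ (isSmooth_FVerma l)).choose_spec.1

theorem actW_z (p : Fin N) : actW m N κ l (Cherednik.z κ p) = zOp κ (isSmooth_FVerma l) p :=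
  (exists_cherednikAction κ (isSmooth_FVerma l)).choose_spec.2 p

variable {κ l}

theorem actW_mem_nW (hl : l = κ - m) (a : Cherednik N κ) {w : W m N l} (hw : w ∈ nW m N l) :
    actW m N κ l a w ∈ nW m N l :=
  cherednikAction_mem_nSub (isSmooth_FVerma l) (by rw [FVerma_slC, hl])
    (isCherednikAction_actW κ l) (actW_z κ l) a hw

/-- The action of the trigonometric Cherednik algebra on the coinvariants. -/
def actCoinv (hl : l = κ - m) : Cherednik N κ →ₐ[ℂ] Module.End ℂ (Coinv m N l) where
  toFun a := (nW m N l).mapQ (nW m N l) (actW m N κ l a) fun _ hw => actW_mem_nW hl a hw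
  map_one' := by
    refine Submodule.linearMap_qext _ (LinearMap.ext fun w => ?_)
    change (nW m N l).mkQ (actW m N κ l 1 w) = (nW m N l).mkQ w
    rw [map_one]
    rfl
  map_mul' a b := by
    refine Submodule.linearMap_qext _ (LinearMap.ext fun w => ?_)
    change (nW m N l).mkQ (actW m N κ l (a * b) w) = (nW m N l).mkQ _
    rw [map_mul]
    rfl
  map_zero' := by
    refine Submodule.linearMap_qext _ (LinearMap.ext fun w => ?_)
    change (nW m N l).mkQ (actW m N κ l 0 w) = 0
    rw [map_zero, LinearMap.zero_apply, map_zero]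
  map_add' a b := by
    refine Submodule.linearMap_qext _ (LinearMap.ext fun w => ?_)
    change (nW m N l).mkQ (actW m N κ l (a + b) w) =
      (nW m N l).mkQ (actW m N κ l a w) + (nW m N l).mkQ (actW m N κ l b w)
    rw [map_add, LinearMap.add_apply, map_add]
  commutes' z := by
    refine Submodule.linearMap_qext _ (LinearMap.ext fun w => ?_)
    change (nW m N l).mkQ (actW m N κ l (algebraMap ℂ _ z) w) = z • (nW m N l).mkQ w
    rw [AlgHom.commutes]
    rfl

/-- The action of the trigonometric Cherednik algebra on `B̄ / (J̄ + J̄' + Ī)`. -/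
def actQ (hl : l = κ - m) : Cherednik N κ →ₐ[ℂ] Module.End ℂ (Q m N l) :=
  ((coinvEquiv m N l).symm.conjAlgEquiv ℂ).toAlgHom.comp (actCoinv hl)

theorem coinvEquiv_actQ (hl : l = κ - m) (a : Cherednik N κ) (x : Q m N l) :
    coinvEquiv m N l (actQ hl a x) = actCoinv hl a (coinvEquiv m N l x) := by
  change coinvEquiv m N l ((coinvEquiv m N l).symm (actCoinv hl a (coinvEquiv m N l x))) = _
  rw [LinearEquiv.apply_symm_apply]

/-- An operator on `B̄` that induces the action of `a` on one vector of `W`. -/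
theorem actQ_mk (hl : l = κ - m) (a : Cherednik N κ) {y y' : Bbar m N}
    (h : toW m N l y' = actW m N κ l a (toW m N l y)) :
    actQ hl a (Submodule.Quotient.mk y) = Submodule.Quotient.mk y' := by
  apply (coinvEquiv m N l).injective
  rw [coinvEquiv_actQ, coinvEquiv_mk, coinvEquiv_mk, h]
  rfl

end Action

open UniversalEnvelopingAlgebra (ι)

/-! ### Operators commuting with the Zhelobenko operators -/

section Compatible

variable {m N : ℕ} [m.AtLeastTwo] (c : Fin m)

/-- An operator on `B̄` that preserves the image of `B` and commutes with the right action, with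
the left actions of `E_c` and `F_c`, and with `τ_c`. Such an operator commutes with all the
ingredients of the Zhelobenko operator. -/
structure IsCompatible (G : Module.End ℂ (Bbar m N)) : Prop where
  exists_lift : ∃ GB : Module.End ℂ (B m N), ∀ Y, toBbar m N (GB Y) = G (toBbar m N Y)
  right : ∀ A, Commute G (rightUbar N A)
  nodeE : Commute G (diagAct N (FUbar m) (nodeE c))
  nodeF : Commute G (diagAct N (FUbar m) (nodeF c))
  tau : Commute G (tauBbar N c)

variable {c} {G : Module.End ℂ (Bbar m N)}

theorem IsCompatible.leftUbar_chevH (hG : IsCompatible c G) :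
    Commute G (leftUbar m N (hU m (ι ℂ (chevH c)))) := by
  rw [hU_ι, ← nodeE_lie_nodeF, leftUbar_ι, LieHom.map_lie, LieRing.of_associative_ring_bracket]
  exact (hG.nodeE.mul_right hG.nodeF).sub_right (hG.nodeF.mul_right hG.nodeE)

theorem IsCompatible.leftUbar_fallH (hG : IsCompatible c G) (n : ℕ) :
    Commute G (leftUbar m N (hU m (fallH c n))) := by
  induction n with
  | zero =>
    rw [fallH, Finset.prod_range_zero, map_one, map_one]
    exact Commute.one_right G
  | succ n ih =>
    rw [hU_fallH_succ, map_mul, map_sub, map_natCast]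
    exact (hG.leftUbar_chevH.sub_right (Nat.cast_commute n G).symm).mul_right ih

theorem IsCompatible.leftUbar_xiCoeff (hG : IsCompatible c G) (n : ℕ) (y : Bbar m N) :
    G (leftUbar m N (xiCoeff c n) y) = leftUbar m N (xiCoeff c n) (G y) := by
  have hu : IsUnit (leftUbar m N (hU m (fallH c n))) := (isUnit_hU (fallH_mem c n)).map _
  have he : Commute G (leftUbar m N (hU m (fallH c n)) *
      leftUbar m N (chevE c ^ n /ₒ fallingH c n)) := by
    rw [← map_mul, hU_fallH_mul, map_pow]
    refine Commute.pow_right ?_ n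
    have := hG.nodeE
    rwa [← leftUbar_ι] at this
  have hc : Commute G (leftUbar m N (chevE c ^ n /ₒ fallingH c n)) := by
    refine hu.mul_left_cancel ?_
    rw [← mul_assoc, ← (hG.leftUbar_fallH n).eq, mul_assoc, he.eq, mul_assoc]
  rw [xiCoeff, leftUbar_smul, leftUbar_smul, map_smul]
  exact congrArg _ (LinearMap.congr_fun hc.eq y)

/-- The adjoint action of `F_c` on `B̄`. -/
def adFbar (N : ℕ) (c : Fin m) : Module.End ℂ (Bbar m N) :=
  diagAct N (FUbar m) (nodeF c) - rightUbar N (numer m (ι ℂ (nodeF c)))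

theorem toBbar_adAct_pow (n : ℕ) (Y : B m N) :
    toBbar m N ((adAct N (nodeF c) ^ n) Y) = (adFbar N c ^ n) (toBbar m N Y) := by
  induction n with
  | zero => rfl
  | succ n ih =>
    rw [pow_succ', pow_succ', Module.End.mul_apply, Module.End.mul_apply, ← ih, adAct_apply,
      map_sub,
      toBbar_diagAct, toBbar_rightU, leftUbar_ι]
    rfl

/-- A compatible operator commutes with the summands of `ξ_c`. -/
theorem IsCompatible.xi_apply (hG : IsCompatible c G) {GB : Module.End ℂ (B m N)}
    (h : ∀ Y, toBbar m N (GB Y) = G (toBbar m N Y)) (Y : B m N) :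
    xi c N (GB Y) = G (xi c N Y) := by
  refine ((isXi_xi c N).intertwine (isXi_xi c N) (A := GB) (B := G) (fun n Y => ?_) Y).symm
  rw [xiTerm_apply, xiTerm_apply, toBbar_adAct_pow, toBbar_adAct_pow, hG.leftUbar_xiCoeff, h]
  exact congrArg _ (LinearMap.congr_fun ((hG.nodeF.sub_right (hG.right _)).pow_right n).eq _)

/-- On representatives, the map determined by the Zhelobenko operator commutes with compatible
operators. The representative `y'` does not depend on the operator. -/
theorem exists_zhelobenkoQ_rep (l : ℂ) (y : Bbar m N) : ∃ y' : Bbar m N,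
    zhelobenkoQ N c l (Submodule.Quotient.mk y) = Submodule.Quotient.mk y' ∧
    ∀ G, IsCompatible c G →
      zhelobenkoQ N c l (Submodule.Quotient.mk (G y)) = Submodule.Quotient.mk (G y') := by
  obtain ⟨h, Y, e⟩ := exists_eq_rightUbar_invH (tauBbar N c y)
  set A := UhbarToUbar m (shiftUhbar c (invH h))
  refine ⟨rightUbar N A (xi c N Y), ?_, fun G hG => ?_⟩
  · refine (zhelobenkoQ_mkQ c l y).trans ?_
    rw [e, xiBar_apply, rightJ_mkQ]
    rfl
  · obtain ⟨GB, hGB⟩ := hG.exists_lift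
    have h1 : ∀ D z, G (rightUbar N D z) = rightUbar N D (G z) :=
      fun D => LinearMap.congr_fun (hG.right D).eq
    have h2 : tauBbar N c (G y) = G (tauBbar N c y) := (LinearMap.congr_fun hG.tau.eq y).symm
    refine (zhelobenkoQ_mkQ c l (G y)).trans ?_
    rw [h2, e, h1, ← hGB, xiBar_apply, rightJ_mkQ, hG.xi_apply hGB, h1]
    rfl

/-- An operator on the quotient commutes with the Zhelobenko map if, on any two given vectors,
it is induced by one compatible operator up to a scalar. -/
theorem zhelobenkoQ_commute_of_rep {l : ℂ} {R : Module.End ℂ (Q m N l)}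
    (h : ∀ y y' : Bbar m N, ∃ (G : Module.End ℂ (Bbar m N)) (θ : ℂ), IsCompatible c G ∧
      R (Submodule.Quotient.mk y) = Submodule.Quotient.mk (G y) + θ • Submodule.Quotient.mk y ∧
      R (Submodule.Quotient.mk y') = Submodule.Quotient.mk (G y') + θ • Submodule.Quotient.mk y') :
    zhelobenkoQ N c l ∘ₗ R = R ∘ₗ zhelobenkoQ N c l := by
  refine LinearMap.ext fun x => ?_
  obtain ⟨y, rfl⟩ := Submodule.Quotient.mk_surjective _ x
  obtain ⟨y', e, hy'⟩ := exists_zhelobenkoQ_rep (c := c) l y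
  obtain ⟨G, θ, hG, h1, h2⟩ := h y y'
  rw [LinearMap.comp_apply, LinearMap.comp_apply, h1, map_add, map_smul, hy' G hG, e, h2]

end Compatible

open UniversalEnvelopingAlgebra (ι)

/-! ### Truncated Cherednik operators -/

section Truncated

variable {m N : ℕ} [NeZero m] {V V' : Type} [AddCommGroup V] [Module ℂ V] [AddCommGroup V']
  [Module ℂ V'] (F : U m →ₐ[ℂ] Module.End ℂ V) (F' : U m →ₐ[ℂ] Module.End ℂ V')

/-- The operator `x_p^{-j} ⊗ E_ab^{(p)} ⊗ (E_ba - δ_ab I / m) t^j`. -/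
def unitTerm (p : Fin N) (a b : Fin m) (j : ℤ) : Module.End ℂ (P m N ⊗[ℂ] V) :=
  rA V (xOp p (-j) * EOp p a b) * eV F N b a j

theorem cherednikTerm_eq_sum (p : Fin N) (i : ℕ) :
    cherednikTerm F p i = ∑ a, ∑ b, unitTerm F p a b i := by
  simp only [cherednikTerm, map_eq_rA_mul_lA]
  rfl

/-- The Cherednik operator with the sum over the powers of `t` truncated. Unlike the whole operator,
it makes sense on `B̄`. -/
def zTrunc (κ : ℂ) (K : ℕ) (p : Fin N) : Module.End ℂ (P m N ⊗[ℂ] V) :=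
  rA V (dunklPart κ p) + ∑ i ∈ Finset.range K, cherednikTerm F p i

/-- The contribution of the differential and the Dunkl operators to `zCorr`. -/
def dunklCorr (κ : ℂ) (e : Fin m) (p : Fin N) : Module.End ℂ (P m N) :=
  -(κ • EOp p e e) + ∑ r ∈ Finset.univ.filter (· ≠ p),
    (xOp p 1 * xOp r (-1) * (∑ a ∈ Finset.univ.filter (· ≠ e), EOp p e a * EOp r a e) -
      ∑ a ∈ Finset.univ.filter (· ≠ e), EOp p a e * EOp r e a)

/-- The contribution of the currents to `zCorr`. -/
def currCorr (K : ℕ) (e : Fin m) (p : Fin N) : Module.End ℂ (P m N ⊗[ℂ] V) :=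
  ∑ a ∈ Finset.univ.filter (· ≠ e), ((unitTerm F p e a (-1) - unitTerm F p e a (K - 1)) +
    (unitTerm F p a e K - unitTerm F p a e 0))

/-- The difference between the conjugate of the truncated Cherednik operator by the
transformation `e_a t^i ↦ e_a t^{i + δ_ae}` and the operator itself. -/
def zCorr (κ : ℂ) (K : ℕ) (e : Fin m) (p : Fin N) : Module.End ℂ (P m N ⊗[ℂ] V) :=
  rA V (dunklCorr κ e p) + currCorr F K e p + rA V (EOp p e e - (m : ℂ)⁻¹ • 1) * cV F N

section Naturality

variable {F F'} {f : V →ₗ[ℂ] V'} (hf : ∀ u, f ∘ₗ F u = F' u ∘ₗ f)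

omit [NeZero m] in
theorem lTensor_rA (g : Module.End ℂ (P m N)) (w : P m N ⊗[ℂ] V) :
    LinearMap.lTensor (P m N) f (rA V g w) = rA V' g (LinearMap.lTensor (P m N) f w) := by
  have h : LinearMap.lTensor (P m N) f ∘ₗ rA V g = rA V' g ∘ₗ LinearMap.lTensor (P m N) f :=
    TensorProduct.ext' fun _ _ => rfl
  exact LinearMap.congr_fun h w

omit [NeZero m] in
include hf in
theorem lTensor_lA (u : U m) (w : P m N ⊗[ℂ] V) : LinearMap.lTensor (P m N) f (lA N (F u) w) =
    lA N (F' u) (LinearMap.lTensor (P m N) f w) := by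
  have h : LinearMap.lTensor (P m N) f ∘ₗ lA N (F u) =
      lA N (F' u) ∘ₗ LinearMap.lTensor (P m N) f :=
    TensorProduct.ext' fun x v => congrArg (x ⊗ₜ ·) (LinearMap.congr_fun (hf u) v)
  exact LinearMap.congr_fun h w

include hf in
theorem lTensor_unitTerm (p : Fin N) (a b : Fin m) (j : ℤ) (w : P m N ⊗[ℂ] V) :
    LinearMap.lTensor (P m N) f (unitTerm F p a b j w) =
      unitTerm F' p a b j (LinearMap.lTensor (P m N) f w) := by
  rw [unitTerm, unitTerm, Module.End.mul_apply, Module.End.mul_apply, lTensor_rA, eV, eV,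
    lTensor_lA hf]

include hf in
theorem lTensor_zTrunc (κ : ℂ) (K : ℕ) (p : Fin N) (w : P m N ⊗[ℂ] V) :
    LinearMap.lTensor (P m N) f (zTrunc F κ K p w) =
      zTrunc F' κ K p (LinearMap.lTensor (P m N) f w) := by
  simp only [zTrunc, cherednikTerm_eq_sum, LinearMap.add_apply, LinearMap.sum_apply, map_add,
    map_sum, lTensor_rA, lTensor_unitTerm hf]

include hf in
theorem lTensor_zCorr (κ : ℂ) (K : ℕ) (e : Fin m) (p : Fin N) (w : P m N ⊗[ℂ] V) :
    LinearMap.lTensor (P m N) f (zCorr F κ K e p w) =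
      zCorr F' κ K e p (LinearMap.lTensor (P m N) f w) := by
  simp only [zCorr, currCorr, cV, LinearMap.add_apply, LinearMap.sub_apply, Module.End.mul_apply,
    LinearMap.sum_apply, map_add, map_sub, map_sum, lTensor_rA, lTensor_lA hf, lTensor_unitTerm hf]

end Naturality

/-- Each summand commutes with `𝔰𝔩ₘ`, so the truncation does not affect this property. -/
theorem zTrunc_commute_const (κ : ℂ) (K : ℕ) (p : Fin N) (c d : Fin m) :
    Commute (zTrunc F κ K p) (diagAct N F (slE c d 0)) := by
  refine Commute.add_left ?_ (Commute.sum_left _ _ _ fun i _ => cherednikTerm_commute_const F p c d i)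
  rw [diagAct_slE]
  refine Commute.add_right ?_ (rA_commute_eV F _ _ _ _)
  rw [commute_iff_eq, ← map_mul, ← map_mul, (dunklPart_commute_loopRep_const κ p c d).eq]

end Truncated

section Conjugation

variable {m N : ℕ} [NeZero m] (w : Equiv.Perm (Fin m)) (s : Fin m → ℤ)

omit [NeZero m] in
theorem affBbar_mul_rA {f f' : Module.End ℂ (P m N)}
    (h : affineMapP N w s * f = f' * affineMapP N w s) :
    affBbar N w s * rA (Ubar m) f = rA (Ubar m) f' * affBbar N w s :=
  TensorProduct.ext' fun x A => by
    rw [Module.End.mul_apply, Module.End.mul_apply, rA_tmul, affBbar_tmul, affBbar_tmul, rA_tmul]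
    exact congrArg (· ⊗ₜ _) (LinearMap.congr_fun h x)

omit [NeZero m] in
theorem affBbar_mul_lA (X : affineSL m) : affBbar N w s * lA N (FUbar m (ι ℂ X)) =
    lA N (FUbar m (ι ℂ (affineMapSL w s X))) * affBbar N w s :=
  TensorProduct.ext' fun x A => by
    rw [Module.End.mul_apply, Module.End.mul_apply, lA_tmul, affBbar_tmul, affBbar_tmul, lA_tmul]
    change _ ⊗ₜ affineMapUbar w s (numer m (ι ℂ X) * A) =
      _ ⊗ₜ (numer m (ι ℂ (affineMapSL w s X)) * affineMapUbar w s A)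
    rw [map_mul, affineMapUbar_numer, affineMapU_ι]

omit [NeZero m] in
theorem affineMapP_mul_unit (p : Fin N) (a b : Fin m) (j : ℤ) :
    affineMapP N w s * (xOp p j * EOp p a b) =
      xOp p (j + (s a - s b)) * EOp p (w a) (w b) * affineMapP N w s := by
  rw [← mul_assoc, affineMapP_mul_xOp, mul_assoc, affineMapP_mul_EOp, xOp_add]
  simp only [mul_assoc]

/-- Conjugation by the map `e_a t^i ↦ e_{w a} t^{i + s_a}` shifts the powers of `x_p` and `t` in a
summand, and the summands with `j = 0` acquire a central term. -/
theorem affBbar_mul_unitTerm (p : Fin N) (a b : Fin m) (j : ℤ) :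
    affBbar N w s * unitTerm (FUbar m) p a b j =
      (unitTerm (FUbar m) p (w a) (w b) (j + s b - s a) +
        (if j = 0 then (if b = a then (s b : ℂ) else 0) - trc b a * ∑ d, (s d : ℂ) else 0) •
          (rA (Ubar m) (xOp p (s a - s b) * EOp p (w a) (w b)) * cV (FUbar m) N)) *
        affBbar N w s := by
  rw [unitTerm, ← mul_assoc, affBbar_mul_rA w s (affineMapP_mul_unit w s p a b (-j)), mul_assoc, eV,
    affBbar_mul_lA, ← mul_assoc]
  have h1 : lA (m := m) N (FUbar m (ι ℂ (affineMapSL w s (slE b a j)))) =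
      eV (FUbar m) N (w b) (w a) (j + s b - s a) +
        (if j = 0 then (if b = a then (s b : ℂ) else 0) - trc b a * ∑ d, (s d : ℂ) else 0) •
          cV (FUbar m) N := by
    simp only [affineMapSL_slE, map_add, map_smul]
    rfl
  have h2 : -j + (s a - s b) = -(j + s b - s a) := by ring
  rw [h1, mul_add, mul_smul_comm, unitTerm, h2]
  by_cases h : j = 0
  · rw [if_pos h, h, zero_add, neg_sub]
  · rw [if_neg h, zero_smul, zero_smul]

end Conjugation

open UniversalEnvelopingAlgebra (ι)

/-! ### Conjugation by permutations and translations -/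

section Permutation

variable {m N : ℕ} (w : Equiv.Perm (Fin m)) (s : Fin m → ℤ)

theorem affineMapP_commute_permOp (σ : Equiv.Perm (Fin N)) :
    Commute (affineMapP N w s) (permOp σ) :=
  opP_ext fun k => by
    rw [Module.End.mul_apply, Module.End.mul_apply, permOp_basisP, affineMapP_basisP,
      affineMapP_basisP, permOp_basisP]
    rfl

theorem affineMapP_commute_dunklPart (κ : ℂ) (p : Fin N) :
    Commute (affineMapP N w 0) (dunklPart κ p) := by
  refine Commute.add_right (Commute.smul_right ?_ κ) (Commute.sum_right _ _ _ fun r _ => ?_)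
  · refine opP_ext fun k => ?_
    rw [Module.End.mul_apply, Module.End.mul_apply, eulerOp_basisP, map_smul, affineMapP_basisP,
      eulerOp_basisP]
    simp only [Pi.zero_apply, add_zero]
  · refine opP_ext fun k => ?_
    rw [Module.End.mul_apply, Module.End.mul_apply, dunklOp, opOfBasis_basisP, affineMapP_basisP,
      opOfBasis_basisP]
    simp only [map_sub, map_sum, affineMapP_basisP, Pi.zero_apply, add_zero]
    rfl

theorem commute_sum_sum_of_perm {R ι : Type*} [Ring R] [Fintype ι] (w : Equiv.Perm ι) {A : R}
    {t : ι → ι → R} (h : ∀ a b, A * t a b = t (w a) (w b) * A) : Commute A (∑ a, ∑ b, t a b) := by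
  rw [commute_iff_eq, Finset.mul_sum, Finset.sum_mul, ← Equiv.sum_comp w fun a => _ * A]
  refine Finset.sum_congr rfl fun a _ => ?_
  rw [Finset.mul_sum, Finset.sum_mul, ← Equiv.sum_comp w fun b => _ * A]
  exact Finset.sum_congr rfl fun b _ => h a b

theorem affBbar_mul_unitTerm_zero [NeZero m] (p : Fin N) (a b : Fin m) (j : ℤ) :
    affBbar N w 0 * unitTerm (FUbar m) p a b j =
      unitTerm (FUbar m) p (w a) (w b) j * affBbar N w 0 := by
  have h : (if j = 0 then (if b = a then (((0 : Fin m → ℤ) b : ℤ) : ℂ) else 0) -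
      trc b a * ∑ d, (((0 : Fin m → ℤ) d : ℤ) : ℂ) else 0) = 0 := by
    simp
  rw [affBbar_mul_unitTerm, h, zero_smul, add_zero, Pi.zero_apply, Pi.zero_apply, add_zero,
    sub_zero]

/-- Permutations of the basis vectors of `ℂᵐ` commute with the truncated Cherednik operators, which
settles the operators `τ_c` with `c ≠ 0`. -/
theorem affBbar_commute_zTrunc [NeZero m] (κ : ℂ) (K : ℕ) (p : Fin N) :
    Commute (affBbar N w 0) (zTrunc (FUbar m) κ K p) := by
  have h1 : Commute (affBbar N w 0) (rA (Ubar m) (dunklPart κ p)) :=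
    affBbar_mul_rA w 0 (affineMapP_commute_dunklPart w κ p).eq
  have h2 : ∀ i, Commute (affBbar N w 0) (cherednikTerm (FUbar m) p i) := fun i => by
    rw [cherednikTerm_eq_sum]
    exact commute_sum_sum_of_perm w fun a b => affBbar_mul_unitTerm_zero w p a b i
  exact h1.add_right (Commute.sum_right _ _ _ fun i _ => h2 i)

end Permutation

section Composition

variable {m N : ℕ} (w w' : Equiv.Perm (Fin m)) (s s' : Fin m → ℤ)

theorem affineMapP_mul : affineMapP N w s * affineMapP N w' s' =
    affineMapP N (w * w') fun a => s' a + s (w' a) :=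
  opP_ext fun k => by
    rw [Module.End.mul_apply]
    simp only [affineMapP_basisP, add_assoc]
    rfl

theorem affineMapSL_affineMapSL [NeZero m] (X : affineSL m) :
    affineMapSL w s (affineMapSL w' s' X) = affineMapSL (w * w') (fun a => s' a + s (w' a)) X := by
  refine affineSL_induction (M := LinearMap.eqLocus
    ((affineMapSL w s).toLinearMap ∘ₗ (affineMapSL w' s').toLinearMap)
    (affineMapSL (w * w') (fun a => s' a + s (w' a))).toLinearMap) (fun a b j => ?_) ?_ X
  · change affineMapSL w s (affineMapSL w' s' (slE a b j)) =
      affineMapSL (w * w') (fun a => s' a + s (w' a)) (slE a b j)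
    have ht : trc (w' a) (w' b) = trc a b := by simp only [trc, w'.injective.eq_iff]
    have hs : ∑ d, (s (w' d) : ℂ) = ∑ d, (s d : ℂ) := Equiv.sum_comp w' fun d => (s d : ℂ)
    rw [affineMapSL_slE, map_add, map_smul, affineMapSL_slC, affineMapSL_slE, affineMapSL_slE, ht,
      add_assoc, ← add_smul]
    simp only [w'.injective.eq_iff, Equiv.Perm.mul_apply, Int.cast_add, Finset.sum_add_distrib, hs]
    have h1 : j + s' a - s' b + s (w' a) - s (w' b) =
        j + (s' a + s (w' a)) - (s' b + s (w' b)) := by ring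
    rw [h1]
    congr 2
    by_cases hab : a = b
    · subst hab
      simp only [add_sub_cancel_right, if_true]
      split_ifs
      · ring
      · ring
    · simp [hab, trc]
  · change affineMapSL w s (affineMapSL w' s' (slC m)) = affineMapSL (w * w') _ (slC m)
    rw [affineMapSL_slC, affineMapSL_slC, affineMapSL_slC]

/-- A homomorphism from `Ū(𝔰𝔩̂ₘ)` is determined by its values on `𝔰𝔩̂ₘ`, because the denominators
are invertible. -/
theorem Ubar_algHom_ext {R : Type} [Ring R] [Algebra ℂ R] {f g : Ubar m →ₐ[ℂ] R}
    (h : ∀ X, f (numer m (ι ℂ X)) = g (numer m (ι ℂ X))) : f = g := by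
  have h1 : f.comp (numer m) = g.comp (numer m) := by
    apply UniversalEnvelopingAlgebra.hom_ext
    ext X
    exact h X
  refine AlgHom.ext fun x => ?_
  obtain ⟨d, hd, u, hu⟩ := exists_left_fraction x
  refine ((isUnit_hU hd).map f).mul_left_cancel ?_
  have h2 : f (hU m d) = g (hU m d) := AlgHom.congr_fun h1 (UhToU m d)
  have h3 : f (numer m u) = g (numer m u) := AlgHom.congr_fun h1 u
  rw [← map_mul, hu, h3, ← hu, map_mul, h2]

theorem affineMapUbar_comp [NeZero m] : (affineMapUbar w s).comp (affineMapUbar w' s') =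
    affineMapUbar (w * w') fun a => s' a + s (w' a) := by
  refine Ubar_algHom_ext fun X => ?_
  rw [AlgHom.comp_apply, affineMapUbar_numer, affineMapUbar_numer, affineMapUbar_numer,
    affineMapU_ι,
    affineMapU_ι, affineMapU_ι, affineMapSL_affineMapSL]

theorem affBbar_mul [NeZero m] : affBbar N w s * affBbar N w' s' =
    affBbar N (w * w') fun a => s' a + s (w' a) :=
  TensorProduct.ext' fun x A => by
    rw [Module.End.mul_apply]
    simp only [affBbar_tmul]
    rw [← affineMapP_mul, ← affineMapUbar_comp]
    rfl

theorem affBbar_one_zero [NeZero m] : affBbar N (1 : Equiv.Perm (Fin m)) 0 = 1 := by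
  have h1 : affineMapP N (1 : Equiv.Perm (Fin m)) 0 = 1 := opP_ext fun k => by
    rw [affineMapP_basisP]
    simp only [Pi.zero_apply, add_zero]
    rfl
  have h3 : ∀ X, affineMapSL (1 : Equiv.Perm (Fin m)) 0 X = X := fun X =>
    affineSL_induction (M := LinearMap.eqLocus (affineMapSL 1 0).toLinearMap LinearMap.id)
      (fun a b j => by
        change affineMapSL 1 0 (slE a b j) = slE a b j
        rw [affineMapSL_slE]
        simp)
      (affineMapSL_slC _ _) X
  have h2 : affineMapUbar (1 : Equiv.Perm (Fin m)) 0 = AlgHom.id ℂ (Ubar m) :=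
    Ubar_algHom_ext fun X => by
      rw [affineMapUbar_numer, affineMapU_ι, h3]
      rfl
  refine TensorProduct.ext' fun x A => ?_
  rw [affBbar_tmul, h1, h2]
  rfl

theorem affBbar_one_surjective [NeZero m] :
    Function.Surjective (affBbar N (1 : Equiv.Perm (Fin m)) s) := by
  have h : affBbar N (1 : Equiv.Perm (Fin m)) s * affBbar N 1 (-s) = 1 := by
    rw [affBbar_mul, mul_one, ← affBbar_one_zero]
    congr 1
    funext a
    simp
  exact fun y => ⟨_, LinearMap.congr_fun h y⟩

end Composition

section Translation

variable {m N : ℕ} (e : Fin m)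

/-- A double sum over all pairs whose terms vanish unless exactly one of the two indices is `e`. -/
theorem sum_sum_eq_of_cross {M : Type*} [AddCommMonoid M] {f : Fin m → Fin m → M}
    (hf : ∀ a b, (a = e ↔ b = e) → f a b = 0) :
    ∑ a, ∑ b, f a b = ∑ a ∈ Finset.univ.filter (· ≠ e), (f e a + f a e) := by
  have h1 : ∀ g : Fin m → M, ∑ a, g a = g e + ∑ a ∈ Finset.univ.filter (· ≠ e), g a := fun g => by
    rw [Finset.filter_ne', Finset.add_sum_erase _ _ (Finset.mem_univ e)]
  have h2 : ∀ a ∈ Finset.univ.filter (· ≠ e), ∑ b, f a b = f a e := by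
    intro a ha
    have ha' : a ≠ e := (Finset.mem_filter.mp ha).2
    rw [Finset.sum_eq_single e (fun b _ hb => hf a b (by simp [ha', hb])) (by simp)]
  rw [h1, Finset.sum_congr rfl h2, h1, hf e e Iff.rfl, zero_add, Finset.sum_add_distrib]

/-- The vector with the coordinate `1` at `e` and with the other coordinates `0`. -/
def unitVec (a : Fin m) : ℤ := if a = e then 1 else 0

variable (N) in
theorem affineMapP_mul_eulerOp (p : Fin N) : affineMapP N 1 (unitVec e) * eulerOp p =
    (eulerOp p - EOp p e e) * affineMapP N 1 (unitVec e) := by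
  refine opP_ext fun k => ?_
  rw [Module.End.mul_apply, Module.End.mul_apply, eulerOp_basisP, map_smul, affineMapP_basisP,
    LinearMap.sub_apply, eulerOp_basisP, EOp_basisP]
  simp only [Equiv.Perm.one_apply, unitVec]
  by_cases h : k.2 p = e
  · simp only [← h, Function.update_eq_self, if_true]
    push_cast
    module
  · simp only [h, if_false, add_zero, sub_zero]

theorem affineMapP_mul_EOp_EOp (s : Fin m → ℤ) {p r : Fin N} (a b : Fin m) :
    affineMapP N 1 s * (EOp p a b * EOp r b a) =
      xOp p (s a - s b) * xOp r (s b - s a) * (EOp p a b * EOp r b a) * affineMapP N 1 s := by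
  rw [← mul_assoc, affineMapP_mul_EOp, mul_assoc, affineMapP_mul_EOp]
  simp only [Equiv.Perm.one_apply, mul_assoc]
  rw [← mul_assoc (EOp p a b), ← (xOp_EOp_commute r p _ a b).eq]
  simp only [mul_assoc]

theorem affineMapP_mul_tensorPermOp {p r : Fin N} (hpr : p ≠ r) :
    affineMapP N 1 (unitVec e) * tensorPermOp (Equiv.swap p r) =
      (tensorPermOp (Equiv.swap p r) + ∑ a ∈ Finset.univ.filter (· ≠ e),
        ((xOp p 1 * xOp r (-1) - 1) * (EOp p e a * EOp r a e) +
          (xOp p (-1) * xOp r 1 - 1) * (EOp p a e * EOp r e a))) * affineMapP N 1 (unitVec e) := by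
  have h := sum_sum_eq_of_cross e (f := fun a b =>
    (xOp p (unitVec e a - unitVec e b) * xOp r (unitVec e b - unitVec e a) - 1) *
      (EOp p a b * EOp r b a)) fun a b hab => by
    have : unitVec e a = unitVec e b := by simp only [unitVec, hab]
    rw [this, sub_self, xOp_zero, xOp_zero, mul_one, sub_self, zero_mul]
  have h' : ∀ a ∈ Finset.univ.filter (· ≠ e), unitVec e a = 0 := fun a ha =>
    if_neg (Finset.mem_filter.mp ha).2
  have he : unitVec e e = 1 := if_pos rfl
  have h2 : ∑ a ∈ Finset.univ.filter (· ≠ e),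
        ((xOp p 1 * xOp r (-1) - 1) * (EOp p e a * EOp r a e) +
          (xOp p (-1) * xOp r 1 - 1) * (EOp p a e * EOp r e a)) = _ :=
    (Finset.sum_congr rfl fun a ha => by rw [h' a ha, he]; rfl).trans h.symm
  rw [h2, tensorPermOp_swap_eq_sum hpr]
  simp only [sub_mul, one_mul, Finset.sum_sub_distrib, add_sub_cancel, Finset.mul_sum,
    Finset.sum_mul, affineMapP_mul_EOp_EOp]

end Translation

open UniversalEnvelopingAlgebra (ι)

/-! ### The Cherednik operators under the translation -/

section Translation

variable {m N : ℕ} (e : Fin m)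

/-- The translation changes a Dunkl operator by an operator without denominators, because
`affineMapP_mul_tensorPermOp` changes the permutation by multiples of `x_p x_r⁻¹ - 1` and `x_p⁻¹ x_r
- 1`. -/
theorem affineMapP_mul_dunklOp {p r : Fin N} (hpr : p ≠ r) :
    affineMapP N 1 (unitVec e) * dunklOp p r =
      (dunklOp p r +
        (xOp p 1 * xOp r (-1) * (∑ a ∈ Finset.univ.filter (· ≠ e), EOp p e a * EOp r a e) -
          ∑ a ∈ Finset.univ.filter (· ≠ e), EOp p a e * EOp r e a)) *
        affineMapP N 1 (unitVec e) := by
  set D := affineMapP N 1 (unitVec e) with hD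
  have hp : D * xOp p 1 = xOp p 1 * D := affineMapP_mul_xOp _ _ _ _
  have hr : D * xOp r 1 = xOp r 1 * D := affineMapP_mul_xOp _ _ _ _
  have hσ : D * permOp (Equiv.swap p r) = permOp (Equiv.swap p r) * D :=
    (affineMapP_commute_permOp _ _ _).eq
  have hpp : xOp (m := m) p 1 * xOp p (-1) = 1 := by rw [← xOp_add, add_neg_cancel, xOp_zero]
  have hrr : xOp (m := m) r 1 * xOp r (-1) = 1 := by rw [← xOp_add, add_neg_cancel, xOp_zero]
  have hx : xOp (m := m) p 1 * xOp r 1 = xOp r 1 * xOp p 1 := xOp_commute p r 1 1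
  -- `x_p (x_p x_r⁻¹ - 1) = (x_p - x_r) x_p x_r⁻¹` and `x_p (x_p⁻¹ x_r - 1) = -(x_p - x_r)`
  have h1 : xOp (m := m) p 1 * (xOp p 1 * xOp r (-1) - 1) =
      (xOp p 1 - xOp r 1) * (xOp p 1 * xOp r (-1)) := by
    rw [mul_sub, sub_mul, ← mul_assoc (xOp r 1), ← hx, mul_assoc (xOp p 1) (xOp r 1), hrr]
  have h2 : xOp (m := m) p 1 * (xOp p (-1) * xOp r 1 - 1) = (xOp p 1 - xOp r 1) * (-1) := by
    rw [mul_sub, ← mul_assoc, hpp, one_mul, mul_one, mul_neg, mul_one, neg_sub]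
  have h3 : xOp (m := m) p 1 * ∑ a ∈ Finset.univ.filter (· ≠ e),
        ((xOp p 1 * xOp r (-1) - 1) * (EOp p e a * EOp r a e) +
          (xOp p (-1) * xOp r 1 - 1) * (EOp p a e * EOp r e a)) =
      (xOp p 1 - xOp r 1) *
        (xOp p 1 * xOp r (-1) * (∑ a ∈ Finset.univ.filter (· ≠ e), EOp p e a * EOp r a e) -
          ∑ a ∈ Finset.univ.filter (· ≠ e), EOp p a e * EOp r e a) := by
    rw [Finset.mul_sum (a := xOp p 1 * xOp r (-1)), ← Finset.sum_sub_distrib, Finset.mul_sum,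
      Finset.mul_sum]
    refine Finset.sum_congr rfl fun a _ => ?_
    rw [mul_add, ← mul_assoc (xOp p 1) (xOp p 1 * _ - 1), h1,
      ← mul_assoc (xOp p 1) (xOp p (-1) * _ - 1), h2, mul_sub, mul_assoc, mul_assoc _ (-1),
      neg_one_mul, mul_neg, ← sub_eq_add_neg]
  refine xOp_sub_xOp_cancel hpr ?_
  have h4 := dunklOp_spec (m := m) p r hpr
  calc (xOp p 1 - xOp r 1) * (D * dunklOp p r) = D * ((xOp p 1 - xOp r 1) * dunklOp p r) := by
        rw [← mul_assoc, ← mul_assoc, sub_mul, mul_sub, hp, hr]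
    _ = xOp p 1 * (D * tensorPermOp (Equiv.swap p r) - D * permOp (Equiv.swap p r)) := by
        rw [h4, ← mul_assoc, hp, mul_assoc, mul_sub]
    _ = _ := by
        rw [hD, affineMapP_mul_tensorPermOp e hpr, ← hD, hσ, ← sub_mul, add_sub_right_comm, add_mul,
          mul_add, ← mul_assoc, ← mul_assoc, h3, ← h4, add_mul, mul_add, mul_assoc, mul_assoc,
          mul_assoc]

theorem affineMapP_mul_dunklPart (κ : ℂ) (p : Fin N) :
    affineMapP N 1 (unitVec e) * dunklPart κ p =
      (dunklPart κ p + dunklCorr κ e p) * affineMapP N 1 (unitVec e) := by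
  have h : ∑ r ∈ Finset.univ.filter (· ≠ p), affineMapP N 1 (unitVec e) * dunklOp p r =
      ∑ r ∈ Finset.univ.filter (· ≠ p), (dunklOp p r +
        (xOp p 1 * xOp r (-1) * (∑ a ∈ Finset.univ.filter (· ≠ e), EOp p e a * EOp r a e) -
          ∑ a ∈ Finset.univ.filter (· ≠ e), EOp p a e * EOp r e a)) *
        affineMapP N 1 (unitVec e) :=
    Finset.sum_congr rfl fun r hr => affineMapP_mul_dunklOp e (Ne.symm (Finset.mem_filter.mp hr).2)
  rw [dunklPart, mul_add, mul_smul_comm, affineMapP_mul_eulerOp, Finset.mul_sum, h,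
    ← Finset.sum_mul,
    Finset.sum_add_distrib, ← smul_mul_assoc, ← add_mul, dunklCorr, smul_sub]
  congr 1
  abel

variable [NeZero m]

omit [NeZero m] in
theorem sum_unitVec : ∑ d, (unitVec e d : ℂ) = 1 := by
  simp [unitVec]

/-- The translation shifts the degrees in the sums of currents, so that the difference
telescopes. -/
theorem sum_unitTerm_shift {V : Type} [AddCommGroup V] [Module ℂ V] (F : U m →ₐ[ℂ] Module.End ℂ V)
    (K : ℕ) (p : Fin N) :
    ∑ i ∈ Finset.range K, ∑ a, ∑ b, unitTerm F p a b (i + unitVec e b - unitVec e a) =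
      ∑ i ∈ Finset.range K, cherednikTerm F p i + currCorr F K e p := by
  have h1 : ∑ i ∈ Finset.range K, ∑ a, ∑ b, unitTerm F p a b (i + unitVec e b - unitVec e a) -
      ∑ i ∈ Finset.range K, cherednikTerm F p i =
      ∑ a, ∑ b, ∑ i ∈ Finset.range K,
        (unitTerm F p a b (i + unitVec e b - unitVec e a) - unitTerm F p a b i) := by
    simp only [cherednikTerm_eq_sum, Finset.sum_sub_distrib]
    congr 1
    · rw [Finset.sum_comm]
      exact Finset.sum_congr rfl fun a _ => Finset.sum_comm
    · rw [Finset.sum_comm]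
      exact Finset.sum_congr rfl fun a _ => Finset.sum_comm
  have he : unitVec e e = 1 := if_pos rfl
  rw [← sub_eq_iff_eq_add', h1, sum_sum_eq_of_cross e, currCorr]
  · refine Finset.sum_congr rfl fun a ha => ?_
    have ha' : unitVec e a = 0 := if_neg (Finset.mem_filter.mp ha).2
    rw [ha', he]
    congr 1
    · have := Finset.sum_range_sub' (fun i : ℕ => unitTerm F p e a ((i : ℤ) - 1)) K
      rw [Nat.cast_zero, zero_sub] at this
      rw [← this]
      refine Finset.sum_congr rfl fun i _ => ?_
      rw [add_zero, Nat.cast_succ, add_sub_cancel_right]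
    · have := Finset.sum_range_sub (fun i : ℕ => unitTerm F p a e (i : ℤ)) K
      rw [Nat.cast_zero] at this
      rw [← this]
      refine Finset.sum_congr rfl fun i _ => ?_
      rw [sub_zero, Nat.cast_succ]
  · intro a b hab
    have h : unitVec e a = unitVec e b := by simp only [unitVec, hab]
    simp only [h, add_sub_cancel_right, sub_self, Finset.sum_const_zero]

/-- The scalar at `C` in the image of `(E_ba - δ_ab I / m) t^j` under the translation. -/
def centralCoeff (a b : Fin m) (j : ℤ) : ℂ :=
  if j = 0 then (if b = a then (unitVec e b : ℂ) else 0) - trc b a * ∑ d, (unitVec e d : ℂ) else 0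

omit [NeZero m] in
theorem sum_centralCoeff {V : Type} [AddCommGroup V] [Module ℂ V] (F : U m →ₐ[ℂ] Module.End ℂ V)
    {K : ℕ} (hK : 0 < K) (p : Fin N) :
    ∑ i ∈ Finset.range K, ∑ a, ∑ b, centralCoeff e a b i •
      (rA V (xOp p (unitVec e a - unitVec e b) * EOp p a b) * cV F N) =
      rA V (EOp p e e - (m : ℂ)⁻¹ • 1) * cV F N := by
  rw [Finset.sum_eq_single 0]
  · have h : ∀ a, ∑ b, centralCoeff e a b (0 : ℕ) •
        (rA V (xOp p (unitVec e a - unitVec e b) * EOp p a b) * cV F N) =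
        rA V ((unitVec e a : ℂ) • EOp p a a - (m : ℂ)⁻¹ • EOp p a a) * cV F N := by
      intro a
      rw [Finset.sum_eq_single a]
      · rw [centralCoeff, sum_unitVec, Nat.cast_zero, if_pos rfl, if_pos rfl, trc, if_pos rfl,
          mul_one, sub_self, xOp_zero, one_mul, ← sub_smul, map_smul, smul_mul_assoc]
      · intro b _ hb
        rw [centralCoeff, if_neg hb, trc, if_neg hb, zero_mul, sub_zero, ite_self, zero_smul]
      · simp
    simp only [h]
    rw [← Finset.sum_mul, ← map_sum, Finset.sum_sub_distrib, ← Finset.smul_sum, sum_EOp_diag]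
    congr 4
    simp [unitVec]
  · intro i _ hi
    refine Finset.sum_eq_zero fun a _ => Finset.sum_eq_zero fun b _ => ?_
    rw [centralCoeff, if_neg (by exact_mod_cast hi), zero_smul]
  · intro h
    exact absurd (Finset.mem_range.mpr hK) h

/-- Conjugating the truncated Cherednik operator by the translation adds `zCorr` to it. -/
theorem affBbar_mul_zTrunc (κ : ℂ) {K : ℕ} (hK : 0 < K) (p : Fin N) :
    affBbar N 1 (unitVec e) * zTrunc (FUbar m) κ K p =
      (zTrunc (FUbar m) κ K p + zCorr (FUbar m) κ K e p) * affBbar N 1 (unitVec e) := by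
  have h1 := affBbar_mul_rA 1 (unitVec e) (affineMapP_mul_dunklPart e κ p)
  have h2 : affBbar N 1 (unitVec e) * ∑ i ∈ Finset.range K, cherednikTerm (FUbar m) p i =
      (∑ i ∈ Finset.range K, cherednikTerm (FUbar m) p i + currCorr (FUbar m) K e p +
        rA (Ubar m) (EOp p e e - (m : ℂ)⁻¹ • 1) * cV (FUbar m) N) * affBbar N 1 (unitVec e) := by
    rw [← sum_unitTerm_shift, ← sum_centralCoeff e (FUbar m) hK p, ← Finset.sum_add_distrib,
      Finset.mul_sum, Finset.sum_mul]
    refine Finset.sum_congr rfl fun i _ => ?_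
    rw [cherednikTerm_eq_sum, ← Finset.sum_add_distrib, Finset.mul_sum, Finset.sum_mul]
    refine Finset.sum_congr rfl fun a _ => ?_
    rw [← Finset.sum_add_distrib, Finset.mul_sum, Finset.sum_mul]
    exact Finset.sum_congr rfl fun b _ => affBbar_mul_unitTerm 1 (unitVec e) p a b i
  rw [zTrunc, mul_add, h1, h2, ← add_mul, zCorr, map_add]
  congr 1
  abel

end Translation

open UniversalEnvelopingAlgebra (ι)

/-! ### The translation on the coinvariants -/

section Coinvariants

variable {m N : ℕ} [NeZero m] {e : Fin m}

omit [NeZero m] in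
theorem slOp_of_ne {a b : Fin m} (hab : a ≠ b) (q : Fin N) : slOp q a b = EOp q a b := by
  rw [slOp, trc, if_neg hab, zero_smul, sub_zero]

theorem loopRep_slE_mul_unit {a : Fin m} (ha : a ≠ e) (p : Fin N) :
    loopRep m N (slE a e (-1)) * (xOp p 1 * EOp p e a) = EOp p a a +
      ∑ r ∈ Finset.univ.filter (· ≠ p), xOp p 1 * xOp r (-1) * (EOp p e a * EOp r a e) := by
  rw [loopRep_slE, Finset.sum_mul, ← Finset.add_sum_erase _ _ (Finset.mem_univ p),
    Finset.filter_ne']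
  refine congrArg₂ (· + ·) ?_ ?_
  · rw [slOp_of_ne ha, mul_assoc, ← mul_assoc (EOp p a e), ← (xOp_EOp_commute p p 1 a e).eq,
      mul_assoc (xOp p 1), EOp_mul_EOp, if_pos rfl, ← mul_assoc, ← xOp_add, neg_add_cancel,
      xOp_zero,
      one_mul]
  · refine Finset.sum_congr rfl fun r hr => ?_
    have hrp : r ≠ p := (Finset.mem_erase.mp hr).1
    rw [slOp_of_ne ha, mul_assoc, ← mul_assoc (EOp r a e), ← (xOp_EOp_commute p r 1 a e).eq,
      mul_assoc (xOp p 1), (EOp_commute hrp a e e a).eq, ← mul_assoc, ← (xOp_commute p r 1 (-1)).eq]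

theorem loopRep_slE_mul_EOp {a : Fin m} (ha : a ≠ e) (p : Fin N) :
    loopRep m N (slE e a 0) * EOp p a e = EOp p e e +
      ∑ r ∈ Finset.univ.filter (· ≠ p), EOp p a e * EOp r e a := by
  rw [loopRep_slE, Finset.sum_mul, ← Finset.add_sum_erase _ _ (Finset.mem_univ p),
    Finset.filter_ne']
  simp only [xOp_zero, one_mul, slOp_of_ne ha.symm]
  refine congrArg₂ (· + ·) ?_ ?_
  · rw [EOp_mul_EOp, if_pos rfl]
  · refine Finset.sum_congr rfl fun r hr => ?_
    rw [(EOp_commute (Finset.mem_erase.mp hr).1 e a a e).eq]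

variable {V : Type} [AddCommGroup V] [Module ℂ V] {F : U m →ₐ[ℂ] Module.End ℂ V}

/-- Modulo the image of `𝔫̂`, the action of an element of `𝔫̂` on `V` can be moved to the first
factor. -/
theorem mkQ_rA_mul_eV {a b : Fin m} {j : ℤ} (h : slE a b j ∈ nhat m) (f : Module.End ℂ (P m N))
    (w : P m N ⊗[ℂ] V) : (nSub N F).mkQ ((rA V f * eV F N a b j) w) =
      -(nSub N F).mkQ (rA V (loopRep m N (slE a b j) * f) w) := by
  have h1 := diagAct_mem_nSub (F := F) h (rA V f w)
  rw [diagAct_slE, LinearMap.add_apply, ← Module.End.mul_apply, ← Module.End.mul_apply, ← map_mul,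
    ← (rA_commute_eV F f a b j).eq] at h1
  have h2 := (Submodule.Quotient.mk_eq_zero _).mpr h1
  rw [← Submodule.mkQ_apply, map_add, add_comm] at h2
  exact eq_neg_of_add_eq_zero_left h2

/-- This summand contains an element of `t⁻¹ 𝔰𝔩ₘ`, which is moved to the first factor. -/
theorem mkQ_unitTerm_raise {a : Fin m} (ha : a ≠ e) (p : Fin N) (w : P m N ⊗[ℂ] V) :
    (nSub N F).mkQ (unitTerm F p e a (-1) w) = -(nSub N F).mkQ (rA V (EOp p a a +
      ∑ r ∈ Finset.univ.filter (· ≠ p), xOp p 1 * xOp r (-1) * (EOp p e a * EOp r a e)) w) := by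
  rw [unitTerm, mkQ_rA_mul_eV (slE_mem_nhat (Or.inl (by decide))), neg_neg, loopRep_slE_mul_unit ha]

/-- This summand contains a strictly lower triangular matrix unit; the index `e` has to be the last
one for this. -/
theorem mkQ_unitTerm_lower {a : Fin m} (ha : a < e) (p : Fin N) (w : P m N ⊗[ℂ] V) :
    (nSub N F).mkQ (unitTerm F p a e 0 w) = -(nSub N F).mkQ (rA V (EOp p e e +
      ∑ r ∈ Finset.univ.filter (· ≠ p), EOp p a e * EOp r e a) w) := by
  rw [unitTerm, mkQ_rA_mul_eV (slE_mem_nhat (Or.inr ⟨rfl, ha⟩)), neg_zero, xOp_zero, one_mul,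
    loopRep_slE_mul_EOp ha.ne]

omit [NeZero m] in
theorem sum_filter_EOp (p : Fin N) :
    ∑ a ∈ Finset.univ.filter (· ≠ e), EOp p a a = 1 - EOp p e e := by
  rw [Finset.filter_ne', ← sum_EOp_diag p, ← Finset.add_sum_erase _ _ (Finset.mem_univ e),
    add_sub_cancel_left]

omit [NeZero m] in
/-- The sum of the operators that appear in `mkQ_unitTerm_raise` and `mkQ_unitTerm_lower`. -/
theorem sum_moved_terms (κ : ℂ) (p : Fin N) :
    ∑ a ∈ Finset.univ.filter (· ≠ e), ((EOp p e e +
        ∑ r ∈ Finset.univ.filter (· ≠ p), EOp p a e * EOp r e a) - (EOp p a a +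
        ∑ r ∈ Finset.univ.filter (· ≠ p), xOp p 1 * xOp r (-1) * (EOp p e a * EOp r a e))) =
      ((m : ℂ) - κ) • EOp p e e - 1 - dunklCorr κ e p := by
  have hm : 1 ≤ m := (Nat.zero_le _).trans_lt e.2
  have h1 : ∑ a ∈ Finset.univ.filter (· ≠ e), EOp (N := N) p e e = ((m : ℂ) - 1) • EOp p e e := by
    rw [Finset.sum_const, Finset.filter_ne', Finset.card_erase_of_mem (Finset.mem_univ e),
      Finset.card_univ, Fintype.card_fin, ← Nat.cast_smul_eq_nsmul ℂ, Nat.cast_sub hm, Nat.cast_one]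
  rw [Finset.sum_sub_distrib, Finset.sum_add_distrib, Finset.sum_add_distrib, h1, sum_filter_EOp,
    dunklCorr, Finset.sum_sub_distrib, Finset.sum_comm, Finset.sum_comm (s := Finset.univ.filter
      (· ≠ e)) (t := Finset.univ.filter (· ≠ p)) (f := fun a r => xOp p 1 * xOp r (-1) * _)]
  simp only [Finset.mul_sum]
  module

/-- On the coinvariants, the conjugation of the Cherednik operator by the translation only
subtracts the scalar `κ / m`. This uses the relation between the level and `κ`. -/
theorem mkQ_zCorr {κ : ℂ} (hF : IsSmooth F) (hC : F (ι ℂ (slC m)) = (κ - m) • 1)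
    (he : ∀ a, a ≠ e → a < e) (p : Fin N) (w : P m N ⊗[ℂ] V) : ∃ K₀ : ℕ, ∀ K, K₀ ≤ K →
      (nSub N F).mkQ (zCorr F κ K e p w) = -(κ / m) • (nSub N F).mkQ w := by
  obtain ⟨K₀, hK₀⟩ := hF.eV_eq_zero w
  refine ⟨K₀ + 1, fun K hK => ?_⟩
  have hm := natCast_ne_zero m
  have h0 : ∀ a b (j : ℤ), (K₀ : ℤ) ≤ j → unitTerm F p a b j w = 0 := fun a b j hj => by
    rw [unitTerm, Module.End.mul_apply, hK₀ j hj, map_zero]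
  have hcV : cV F N w = (κ - m) • w := by
    rw [cV, hC, map_smul, map_one]
    rfl
  have hcurr : (nSub N F).mkQ (currCorr F K e p w) =
      (nSub N F).mkQ (rA V (((m : ℂ) - κ) • EOp p e e - 1 - dunklCorr κ e p) w) := by
    rw [← sum_moved_terms κ p, currCorr, LinearMap.sum_apply, map_sum, map_sum, LinearMap.sum_apply,
      map_sum]
    refine Finset.sum_congr rfl fun a ha => ?_
    have ha' := (Finset.mem_filter.mp ha).2
    rw [LinearMap.add_apply, LinearMap.sub_apply, LinearMap.sub_apply, h0 e a (K - 1) (by omega),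
      h0 a e K (by omega), sub_zero, zero_sub, map_add, map_neg, mkQ_unitTerm_raise ha',
      mkQ_unitTerm_lower (he a ha'), neg_neg, map_sub, LinearMap.sub_apply, map_sub]
    abel
  rw [zCorr, LinearMap.add_apply, LinearMap.add_apply, Module.End.mul_apply, hcV, map_add, map_add,
    hcurr, ← map_add, ← map_add, ← LinearMap.add_apply, ← map_add, map_smul, ← LinearMap.smul_apply,
    ← map_smul, ← LinearMap.add_apply, ← map_add]
  have hsum : dunklCorr κ e p + (((m : ℂ) - κ) • EOp p e e - 1 - dunklCorr κ e p) +
      (κ - m) • (EOp p e e - (m : ℂ)⁻¹ • 1) = -(κ / m) • (1 : Module.End ℂ (P m N)) := by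
    have : (κ - m) * (m : ℂ)⁻¹ = κ / m - 1 := by field_simp
    rw [smul_sub, smul_smul, this]
    module
  rw [hsum, map_smul, map_one, LinearMap.smul_apply, map_smul]
  rfl

end Coinvariants

open UniversalEnvelopingAlgebra (ι)

/-! ### The Zhelobenko operators and the action of the Cherednik algebra -/

section Commutation

variable {m N : ℕ} [m.AtLeastTwo] {c : Fin m}

omit [m.AtLeastTwo] in
theorem commute_diagAct_of_commute {f : Module.End ℂ (P m N)} {X : affineSL m}
    (h : Commute f (loopRep m N X)) : Commute (rA (Ubar m) f) (diagAct N (FUbar m) X) := by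
  rw [diagAct_apply]
  exact (show Commute _ _ by rw [commute_iff_eq, ← map_mul, h.eq, map_mul]).add_right
    (rA_commute_lA _ _)

theorem isCompatible_rA {f : Module.End ℂ (P m N)} (h : ∀ X, Commute f (loopRep m N X))
    (hτ : ∀ w s, affineMapP N w s * f = f * affineMapP N w s) : IsCompatible c (rA (Ubar m) f) where
  exists_lift := ⟨rA (U m) f, fun Y => lTensor_rA f Y⟩
  right _ := rA_commute_lA _ _
  nodeE := commute_diagAct_of_commute (h _)
  nodeF := commute_diagAct_of_commute (h _)
  tau := (affBbar_mul_rA _ _ (hτ _ _)).symm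

omit [m.AtLeastTwo] in
theorem numer_comp_FU (u : U m) :
    (numer m).toLinearMap ∘ₗ FU m u = FUbar m u ∘ₗ (numer m).toLinearMap :=
  LinearMap.ext fun v => map_mul (numer m) u v

omit [m.AtLeastTwo] in
theorem mulRight_comp_FUbar (A : Ubar m) (u : U m) :
    LinearMap.mulRight ℂ A ∘ₗ FUbar m u = FUbar m u ∘ₗ LinearMap.mulRight ℂ A :=
  LinearMap.ext fun v => mul_assoc (numer m u) v A

omit [m.AtLeastTwo] in
theorem vermaMk_comp_FUbar (l : ℂ) (u : U m) :
    vermaMk m l ∘ₗ FUbar m u = FVerma m l u ∘ₗ vermaMk m l := rfl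

theorem isCompatible_zTrunc (hc : c ≠ 0) (κ : ℂ) (K : ℕ) (p : Fin N) :
    IsCompatible c (zTrunc (FUbar m) κ K p) where
  exists_lift := ⟨zTrunc (FU m) κ K p, fun Y => lTensor_zTrunc numer_comp_FU κ K p Y⟩
  right A := LinearMap.ext fun y => (lTensor_zTrunc (mulRight_comp_FUbar A) κ K p y).symm
  nodeE := by
    rw [nodeE, nodeDeg, if_neg hc]
    exact zTrunc_commute_const _ κ K p _ _
  nodeF := by
    rw [nodeF, nodeDeg, if_neg hc, neg_zero]
    exact zTrunc_commute_const _ κ K p _ _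
  tau := by
    have h : tauShift c = 0 := funext fun a => if_neg hc
    rw [tauBbar_eq, h]
    exact (affBbar_commute_zTrunc _ κ K p).symm

omit [m.AtLeastTwo] in
theorem unitVec_swap {d e : Fin m} (h : e ≠ d) (a : Fin m) : unitVec e (Equiv.swap e d a) =
    unitVec e a + ((if a = d then 1 else 0) - if a = e then 1 else 0) := by
  by_cases h1 : a = e
  · subst h1
    simp [unitVec, h, h.symm]
  · by_cases h2 : a = d
    · subst h2
      simp [unitVec, h1]
    · simp [unitVec, h1, h2, Equiv.swap_apply_of_ne_of_ne h1 h2]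

/-- The translation conjugates the action of the constant transposition of the first and the last
basis vectors into the action of `τ_0`. -/
theorem tauBbar_zero_mul : tauBbar N (0 : Fin m) * affBbar N 1 (unitVec (0 - 1)) =
    affBbar N 1 (unitVec (0 - 1)) * affBbar N (tauPerm 0) 0 := by
  rw [tauBbar_eq, affBbar_mul, affBbar_mul, mul_one, one_mul]
  congr 1
  funext a
  refine Eq.trans ?_ (zero_add (unitVec (0 - 1) (tauPerm 0 a))).symm
  rw [tauPerm, unitVec_swap (sub_one_ne (0 : Fin m)), tauShift, if_pos rfl]
  rfl

/-- An operator intertwined with the truncated Cherednik operator by a surjective operator `D`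
commutes with everything that `D` intertwines with an operator commuting with the truncated
Cherednik operator. -/
theorem commute_of_intertwine {M : Type} [AddCommGroup M] [Module ℂ M] {D G Z A A' : Module.End ℂ M}
    (hD : Function.Surjective D) (h : D * Z = G * D) (hA : A * D = D * A') (hZ : Commute A' Z) :
    Commute G A := by
  refine LinearMap.ext fun y => ?_
  obtain ⟨y, rfl⟩ := hD y
  have h1 : G * A * D = A * G * D := by
    rw [mul_assoc, hA, ← mul_assoc, ← h, mul_assoc, ← hZ.eq, ← mul_assoc, ← hA, mul_assoc, h,
      mul_assoc]
  exact LinearMap.congr_fun h1 y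

theorem diagAct_mul_affBbar {X Y : affineSL m} {e : Fin m}
    (h : affineMapSL 1 (unitVec e) X = Y) : diagAct N (FUbar m) Y * affBbar N 1 (unitVec e) =
      affBbar N 1 (unitVec e) * diagAct N (FUbar m) X := by
  subst h
  exact LinearMap.ext fun y => (affBbar_diagAct 1 (unitVec e) X y).symm

theorem affineMapSL_unitVec_nodeE :
    affineMapSL 1 (unitVec (0 - 1)) (slE (0 - 1) 0 0) = nodeE (0 : Fin m) := by
  have h := sub_one_ne (0 : Fin m)
  rw [affineMapSL_slE, nodeE, nodeDeg, if_pos rfl, if_pos rfl, if_neg h, trc, if_neg h, zero_mul,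
    sub_zero, zero_smul, add_zero, unitVec, unitVec, if_pos rfl, if_neg h.symm]
  rfl

theorem affineMapSL_unitVec_nodeF :
    affineMapSL 1 (unitVec (0 - 1)) (slE 0 (0 - 1) 0) = nodeF (0 : Fin m) := by
  have h := (sub_one_ne (0 : Fin m)).symm
  rw [affineMapSL_slE, nodeF, nodeDeg, if_pos rfl, if_pos rfl, if_neg h, trc, if_neg h, zero_mul,
    sub_zero, zero_smul, add_zero, unitVec, unitVec, if_pos rfl, if_neg h]
  rfl

/-- For `c = 0`, the truncated Cherednik operator has to be conjugated by the translation that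
carries constant root vectors to `E_0` and `F_0`. -/
theorem isCompatible_zTrunc_add_zCorr (κ : ℂ) {K : ℕ} (hK : 0 < K) (p : Fin N) :
    IsCompatible (0 : Fin m) (zTrunc (FUbar m) κ K p + zCorr (FUbar m) κ K (0 - 1) p) where
  exists_lift := ⟨zTrunc (FU m) κ K p + zCorr (FU m) κ K (0 - 1) p, fun Y =>
    (map_add _ _ _).trans (congrArg₂ (· + ·) (lTensor_zTrunc numer_comp_FU κ K p Y)
      (lTensor_zCorr numer_comp_FU κ K (0 - 1) p Y))⟩
  right A := LinearMap.ext fun y => ((map_add _ _ _).trans (congrArg₂ (· + ·)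
    (lTensor_zTrunc (mulRight_comp_FUbar A) κ K p y)
    (lTensor_zCorr (mulRight_comp_FUbar A) κ K (0 - 1) p y))).symm
  nodeE := commute_of_intertwine (affBbar_one_surjective _) (affBbar_mul_zTrunc (0 - 1) κ hK p)
    (diagAct_mul_affBbar affineMapSL_unitVec_nodeE) (zTrunc_commute_const _ κ K p _ _).symm
  nodeF := commute_of_intertwine (affBbar_one_surjective _) (affBbar_mul_zTrunc (0 - 1) κ hK p)
    (diagAct_mul_affBbar affineMapSL_unitVec_nodeF) (zTrunc_commute_const _ κ K p _ _).symm
  tau := commute_of_intertwine (affBbar_one_surjective _) (affBbar_mul_zTrunc (0 - 1) κ hK p)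
    tauBbar_zero_mul (affBbar_commute_zTrunc _ κ K p)

variable {κ l : ℂ} (hl : l = κ - m)

theorem actQ_mk_rA {a : Cherednik N κ} {f : Module.End ℂ (P m N)}
    (ha : actW m N κ l a = rA (Verma m l) f) (y : Bbar m N) :
    actQ hl a (Submodule.Quotient.mk y) = Submodule.Quotient.mk (rA (Ubar m) f y) :=
  actQ_mk hl a (by rw [ha]; exact lTensor_rA f y)

/-- On any given vector, the action of `z_p` is induced by the truncated operators. -/
theorem eventually_actQ_mk_z (p : Fin N) (y : Bbar m N) : ∀ᶠ K in atTop,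
    actQ hl (Cherednik.z κ p) (Submodule.Quotient.mk y) =
      Submodule.Quotient.mk (zTrunc (FUbar m) κ K p y) := by
  filter_upwards [currentPart_spec (isSmooth_FVerma l) p (toW m N l y)] with K hK
  refine actQ_mk hl _ ?_
  rw [actW_z, zOp, LinearMap.add_apply, hK]
  refine (lTensor_zTrunc (vermaMk_comp_FUbar l) κ K p y).trans ?_
  rw [zTrunc, LinearMap.add_apply, LinearMap.sum_apply]
  rfl

include hl in
theorem eventually_mk_zCorr (p : Fin N) (y : Bbar m N) : ∀ᶠ K in atTop,
    (Submodule.Quotient.mk (zCorr (FUbar m) κ K (0 - 1) p y) : Q m N l) =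
      -(κ / m) • Submodule.Quotient.mk y := by
  have he : ∀ a : Fin m, a ≠ 0 - 1 → a < 0 - 1 := fun a ha => by
    have h1 : (a : ℕ) ≠ m - 1 := fun h => ha (Fin.ext (h.trans val_zero_sub_one.symm))
    have h2 := a.2
    rw [Fin.lt_def, val_zero_sub_one]
    omega
  obtain ⟨K₀, hK₀⟩ := mkQ_zCorr (isSmooth_FVerma l) (κ := κ) (by rw [FVerma_slC,
    hl]) he p (toW m N l y)
  filter_upwards [eventually_ge_atTop K₀] with K hK
  apply (coinvEquiv m N l).injective
  rw [map_smul, coinvEquiv_mk, coinvEquiv_mk]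
  refine Eq.trans ?_ (hK₀ K hK)
  exact congrArg _ (lTensor_zCorr (vermaMk_comp_FUbar l) κ K (0 - 1) p y)

theorem zhelobenkoQ_commute_rA {a : Cherednik N κ} {f : Module.End ℂ (P m N)}
    (ha : actW m N κ l a = rA (Verma m l) f) (h : ∀ X, Commute f (loopRep m N X))
    (hτ : ∀ w s, affineMapP N w s * f = f * affineMapP N w s) :
    zhelobenkoQ N c l ∘ₗ actQ hl a = actQ hl a ∘ₗ zhelobenkoQ N c l :=
  zhelobenkoQ_commute_of_rep fun y y' => ⟨_, 0, isCompatible_rA h hτ, by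
    rw [zero_smul, add_zero, actQ_mk_rA hl ha], by rw [zero_smul, add_zero, actQ_mk_rA hl ha]⟩

/-- The scalar by which `zCorr` acts on the quotient is compensated by `κ / m`. -/
theorem zhelobenkoQ_commute_z (p : Fin N) : zhelobenkoQ N c l ∘ₗ actQ hl (Cherednik.z κ p) =
    actQ hl (Cherednik.z κ p) ∘ₗ zhelobenkoQ N c l := by
  refine zhelobenkoQ_commute_of_rep fun y y' => ?_
  have hz := fun y => eventually_actQ_mk_z (κ := κ) hl p y
  by_cases hc : c = 0
  · subst hc
    obtain ⟨K, h1, h1', h2, h2', hK⟩ := ((hz y).and ((hz y').and ((eventually_mk_zCorr hl p y).and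
      ((eventually_mk_zCorr hl p y').and (eventually_gt_atTop 0))))).exists
    refine ⟨_, κ / m, isCompatible_zTrunc_add_zCorr κ hK p, ?_, ?_⟩
    · rw [h1, LinearMap.add_apply, Submodule.Quotient.mk_add, h2, neg_smul, neg_add_cancel_right]
    · rw [h1', LinearMap.add_apply, Submodule.Quotient.mk_add, h2', neg_smul, neg_add_cancel_right]
  · obtain ⟨K, h1, h1'⟩ := ((hz y).and (hz y')).exists
    exact ⟨_, 0, isCompatible_zTrunc hc κ K p, by rw [zero_smul, add_zero, h1],
      by rw [zero_smul, add_zero, h1']⟩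

theorem zhelobenkoQ_commute (a : Cherednik N κ) :
    zhelobenkoQ N c l ∘ₗ actQ hl a = actQ hl a ∘ₗ zhelobenkoQ N c l := by
  obtain ⟨hx, hxinv, hs, -⟩ := isCherednikAction_actW (m := m) (N := N) κ l
  let A : Subalgebra ℂ (Cherednik N κ) :=
    (Subalgebra.centralizer ℂ {zhelobenkoQ N c l}).comap (actQ hl)
  have hA : ∀ a, a ∈ A ↔ zhelobenkoQ N c l ∘ₗ actQ hl a = actQ hl a ∘ₗ zhelobenkoQ N c l :=
    fun a => Set.mem_centralizer_iff.trans ⟨fun h => h _ rfl, fun h x hx => by rw [hx]; exact h⟩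
  refine (hA a).mp (cherednik_generators A (fun p => (hA _).mpr ?_) (fun p => (hA _).mpr ?_)
    (fun σ => (hA _).mpr ?_) (fun p => (hA _).mpr (zhelobenkoQ_commute_z hl p)) a)
  · exact zhelobenkoQ_commute_rA hl (hx p) (xOp_commute_loopRep p 1)
      fun w s => affineMapP_mul_xOp w s p 1
  · exact zhelobenkoQ_commute_rA hl (hxinv p) (xOp_commute_loopRep p (-1))
      fun w s => affineMapP_mul_xOp w s p (-1)
  · exact zhelobenkoQ_commute_rA hl (hs σ) (permOp_commute_loopRep σ)
      fun w s => (affineMapP_commute_permOp w s σ).eq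

end Commutation

end Zhel

end

/-- Here `η` is the Zhelobenko operator on `B̄ / J̄`, `T` is the linear map on
`B̄ / (J̄ + J̄' + Ī)` that it determines, `ρW` is the action of the trigonometric Cherednik algebra
on `W = 𝔓_N ⊗ (ℂᵐ)^{⊗N} ⊗ V` with `V` the universal Verma module of level `ℓ`, `Φ` is the
identification of `B̄ / (J̄ + J̄' + Ī)` with the `𝔫̂`-coinvariants of `W`, and `ρ` is the resulting
action on the quotient. -/
theorem theorem3p6 (m N : ℕ) [m.AtLeastTwo] (κ l : ℂ) (hl : l = κ - m) (c : Fin m) :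
    ∃ (η : Module.End ℂ (Bbar m N ⧸ Jbar m N)) (T : Module.End ℂ (Q m N l))
      (ρW : Cherednik N κ →ₐ[ℂ] Module.End ℂ (W m N l)) (Φ : Q m N l ≃ₗ[ℂ] Coinv m N l)
      (ρ : Cherednik N κ →ₐ[ℂ] Module.End ℂ (Q m N l)),
      (IsZhelobenko c η ∧ ∀ η', IsZhelobenko c η' → η' = η) ∧
      (∀ y, T (projQ m N l y) = projQ m N l (η y)) ∧
      (IsCherednikAction κ (FVerma m l) ρW ∧
        ∀ ρ', IsCherednikAction κ (FVerma m l) ρ' → ρ' = ρW) ∧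
      (∀ y : Bbar m N, Φ (Submodule.Quotient.mk y) =
        Submodule.Quotient.mk (LinearMap.lTensor (P m N) (vermaMk m l) y)) ∧
      (∀ a w, Φ (ρ a (Φ.symm (Submodule.Quotient.mk w))) = Submodule.Quotient.mk (ρW a w)) ∧
      ∀ a, T ∘ₗ ρ a = ρ a ∘ₗ T := by
  refine ⟨zhelobenko N c, zhelobenkoQ N c l, actW m N κ l, coinvEquiv m N l, actQ hl,
    ⟨isZhelobenko_zhelobenko c, fun _ h => isZhelobenko_unique c h⟩, zhelobenkoQ_projQ c l,
    ⟨isCherednikAction_actW κ l, fun _ h => (isCherednikAction_actW κ l).unique h⟩,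
    coinvEquiv_mk l, fun a w => ?_, zhelobenkoQ_commute hl⟩
  rw [coinvEquiv_actQ, LinearEquiv.apply_symm_apply]
  rfl
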